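/- **Theorem 5.1.** Notation. For an even lattice $K$ let $K^\vee\subset K\otimes\mathbb Q$ be its dual lattice, $D(K)=K^\vee/K$ its discriminant group, $q_K:D(K)\to\mathbb Q/2\mathbb Z$, $q_K(x+K)=(x,x)\bmod 2\mathbb Z$, its discriminant form, $\mathcal A=O(q_K)$ the group of automorphisms of $D(K)$ preserving $q_K$, and $\mathcal B\le\mathcal A$ the image of the natural homomorphism $O(K)\to O(q_K)$. Let $K^{\mathrm{root}}\subseteq K$ be the sublattice spanned by the vectors of square $-2$, and $\mathcal W=K/K^{\mathrm{root}}$. $H$ is the even unimodular hyperbolic lattice of rank two. $A_n,D_n,E_n$ are the positive definite root lattices, with simple roots numbered as in Bourbaki (in $D_n$, $\alpha_1,\dots,\alpha_{n-2}$ is a chain, and $\alpha_{n-1},\alpha_n$ are both attached to $\alpha_{n-2}$); $+$ is orthogonal sum, $mR$ is the sum of $m$ copies of $R$, and $R(-1)$ is $R$ with the form negated. In the list below, $K$ is the lattice generated by $R(-1)$ and the given vectors $v$ (if any) of $R(-1)\otimes\mathbb Q$. A vector $v$ is given by the string of the coordinates of $2v$ (each $0$ or $1$) in the simple roots of the components of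 $R$, in the order in which the components are written; the first block contains all components $A_1$, if there are any, and each further block, separated by a bar, is one component. For each of the 229 lattices $K$ of the list: 1. $K$ is an even negative definite lattice with $K^{\mathrm{root}}=R(-1)$, and $\mathcal W=K/K^{\mathrm{root}}$ is isomorphic to the group stated, so that $K$ has the frame $(K^{\mathrm{root}},\mathcal W)$; 2. $\mathcal A$ is finite, and $|\mathcal A|/|\mathcal B|$ is the ratio stated; 3. if $|\mathcal A|/|\mathcal B|=1$, then $O(K)\to O(q_K)$ is surjective; the multiplicity $|\mathcal C\backslash\mathcal A/\mathcal B|$ equals $1$ for every subgroup $\mathcal C\le\mathcal A$; and the primitive embedding of $H$ with orthogonal complement $K$ is unique: if $L$ is an even lattice and $j,j':H\hookrightarrow L$ are primitive embeddings whose orthogonal complements in $L$ are isometric to $K$, then $j'=g\circ j$ for some $g\in O(L)$ that acts trivially on $D(L)$. **(I) Frames with $\mathcal W=0$** ($K=R(-1)$). - ratio $1$: $A_{1}$, $2A_{1}$, $A_{2}$, $3A_{1}$, $A_{3}$, $A_{1}+A_{2}$, $D_{4}$, $4A_{1}$, $A_{4}$, $A_{1}+A_{3}$, $2A_{2}$,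 $2A_{1}+A_{2}$, $A_{1}+D_{4}$, $5A_{1}$, $D_{5}$, $A_{5}$, $A_{1}+A_{4}$, $A_{2}+A_{3}$, $2A_{1}+A_{3}$, $A_{1}+2A_{2}$, $D_{6}$, $2A_{1}+D_{4}$, $E_{6}$, $A_{1}+D_{5}$, $A_{2}+D_{4}$, $A_{6}$, $A_{1}+A_{5}$, $A_{2}+A_{4}$, $2A_{3}$, $3A_{2}$, $E_{7}$, $A_{1}+D_{6}$, $A_{1}+E_{6}$, $D_{7}$, $A_{2}+D_{5}$, $A_{3}+D_{4}$, $A_{7}$, $E_{8}$, $D_{8}$, $A_{1}+E_{7}$, $2D_{4}$, $A_{2}+E_{6}$, $A_{1}+E_{8}$, $2A_{1}+E_{7}$, $A_{1}+D_{8}$, $A_{1}+2D_{4}$, $2A_{1}+E_{8}$, $D_{10}$, $D_{4}+D_{6}$, $A_{2}+E_{8}$, $3A_{1}+E_{8}$, $D_{4}+E_{7}$, $A_{3}+E_{8}$, $D_{4}+E_{8}$, $4A_{1}+E_{8}$, $A_{1}+D_{4}+E_{8}$, $D_{6}+E_{8}$, $2E_{7}$, $D_{14}$, $E_{7}+E_{8}$,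 $2E_{8}$, $A_{1}+2E_{8}$, $5A_{1}+E_{8}$, $2A_{1}+D_{4}+E_{8}$, $D_{4}+D_{10}$, $A_{1}+D_{6}+E_{8}$, $A_{1}+2E_{7}$, $D_{8}+E_{7}$, $A_{1}+D_{14}$, $2D_{4}+E_{7}$, $D_{8}+E_{8}$, $D_{16}$, $A_{1}+E_{7}+E_{8}$, $2D_{4}+E_{8}$, $2A_{1}+E_{7}+E_{8}$, $A_{1}+D_{8}+E_{8}$, $D_{10}+E_{7}$, $A_{1}+D_{16}$, $2A_{1}+2E_{8}$, $D_{10}+E_{8}$, $D_{18}$. - ratio $2$: $6A_{1}$, $3A_{1}+D_{4}$, $2A_{1}+D_{6}$, $3A_{1}+E_{7}$, $6A_{1}+E_{8}$, $3A_{1}+D_{4}+E_{8}$, $2A_{1}+D_{6}+E_{8}$, $2A_{1}+2E_{7}$, $2A_{1}+D_{14}$, $D_{6}+D_{10}$. - ratio $3$: $2A_{1}+D_{8}$, $A_{1}+D_{10}$, $D_{12}$, $2D_{6}$, $D_{6}+E_{7}$, $A_{1}+D_{12}$, $2A_{1}+D_{12}$, $D_{6}+D_{8}$. - ratio $4$: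 $A_{1}+D_{4}+E_{7}$, $A_{1}+D_{8}+E_{7}$. - ratio $5$: $4A_{1}+E_{7}$. - ratio $6$: $3A_{1}+D_{6}$, $2A_{1}+D_{10}$, $A_{1}+D_{6}+E_{7}$, $3A_{1}+D_{12}$, $A_{1}+D_{4}+D_{10}$, $D_{4}+D_{12}$. - ratio $8$: $7A_{1}$, $4A_{1}+D_{4}$. - ratio $9$: $2D_{8}$. - ratio $10$: $2A_{1}+2D_{4}$, $3A_{1}+D_{8}$, $A_{1}+D_{4}+D_{6}$, $D_{4}+D_{8}$, $2A_{1}+D_{4}+E_{7}$, $A_{1}+D_{4}+D_{8}$, $2D_{4}+D_{6}$. - ratio $15$: $A_{1}+2D_{6}$. - ratio $16$: $5A_{1}+E_{7}$. - ratio $18$: $A_{1}+D_{6}+D_{8}$. - ratio $30$: $4A_{1}+D_{6}$, $4A_{1}+D_{10}$. - ratio $40$: $3D_{4}$, $4A_{1}+D_{8}$, $A_{1}+3D_{4}$, $3A_{1}+D_{4}+E_{7}$. - ratio $56$: $5A_{1}+D_{4}$. - ratio $60$: $2A_{1}+D_{4}+D_{8}$. - ratio $64$: $8A_{1}$. - ratio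 $72$: $6A_{1}+E_{7}$. - ratio $80$: $2A_{1}+D_{4}+D_{6}$. - ratio $90$: $2A_{1}+2D_{6}$. - ratio $120$: $3A_{1}+2D_{4}$. - ratio $216$: $5A_{1}+D_{6}$, $5A_{1}+D_{8}$. - ratio $672$: $6A_{1}+D_{4}$. - ratio $720$: $3A_{1}+D_{4}+D_{6}$. - ratio $960$: $9A_{1}$. - ratio $1920$: $4A_{1}+2D_{4}$. - ratio $2304$: $6A_{1}+D_{6}$. - ratio $13056$: $7A_{1}+D_{4}$. - ratio $26112$: $10A_{1}$. **(II) Frames with $\mathcal W\cong\mathbb Z/2$** (given as $R$: $2v$; ratio). - $8A_{1}$: $11111111$; $1$. - $9A_{1}$: $111111110$; $1$. - $6A_{1}+D_{4}$: $111111\,|\,1010$; $1$. - $5A_{1}+D_{6}$: $11111\,|\,101001$; $1$. - $5A_{1}+E_{7}$: $11111\,|\,0100101$; $1$. - $4A_{1}+D_{8}$: $1111\,|\,10101010$; $1$. - $3A_{1}+D_{10}$: $111\,|\,1010101001$; $1$. - $2A_{1}+D_{12}$: $11\,|\,101010101010$; $1$. - $A_{1}+D_{14}$: $1\,|\,10101010101001$;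 $1$. - $D_{16}$: $1010101010101010$; $1$. - $D_{10}+E_{7}$: $1010101001\,|\,0100101$; $1$. - $A_{1}+D_{16}$: $0\,|\,1010101010101010$; $1$. - $10A_{1}$: $1111111100$; $36$. - $7A_{1}+D_{4}$: $1111110\,|\,1010$; $36$. - $11A_{1}$: $11111111000$; $1632$. - $6A_{1}+D_{6}$: $111111\,|\,000011$; $36$. - $6A_{1}+D_{6}$: $111110\,|\,101001$; $16$. - $4A_{1}+2D_{4}$: $1111\,|\,1010\,|\,1010$; $10$. - $8A_{1}+D_{4}$: $11111100\,|\,1010$; $1152$. - $6A_{1}+E_{7}$: $111110\,|\,0100101$; $1$. - $5A_{1}+D_{8}$: $11110\,|\,10101010$; $5$. - $3A_{1}+D_{4}+D_{6}$: $111\,|\,1010\,|\,101001$; $10$. - $7A_{1}+D_{6}$: $1111100\,|\,101001$; $216$. - $7A_{1}+D_{6}$: $1111110\,|\,000011$; $36$. - $5A_{1}+2D_{4}$: $11110\,|\,1010\,|\,1010$; $270$. - $3A_{1}+D_{4}+E_{7}$: $111\,|\,1010\,|\,0100101$; $1$. - $4A_{1}+D_{10}$: $1110\,|\,1010101001$;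 $2$. - $2A_{1}+D_{4}+D_{8}$: $11\,|\,1010\,|\,10101010$; $3$. - $2A_{1}+2D_{6}$: $11\,|\,101001\,|\,101001$; $3$. - $7A_{1}+E_{7}$: $1111100\,|\,0100101$; $6$. - $6A_{1}+D_{8}$: $111100\,|\,10101010$; $30$. - $6A_{1}+D_{8}$: $111111\,|\,00000011$; $1$. - $4A_{1}+D_{4}+D_{6}$: $1110\,|\,1010\,|\,101001$; $120$. - $4A_{1}+D_{4}+D_{6}$: $1111\,|\,1010\,|\,000011$; $15$. - $2A_{1}+3D_{4}$: $11\,|\,1010\,|\,1010\,|\,1010$; $15$. - $3A_{1}+D_{12}$: $110\,|\,101010101010$; $1$. - $A_{1}+D_{4}+D_{10}$: $1\,|\,1010\,|\,1010101001$; $1$. - $A_{1}+D_{6}+D_{8}$: $1\,|\,101001\,|\,10101010$; $2$. - $4A_{1}+D_{4}+E_{7}$: $1110\,|\,1010\,|\,0100101$; $6$. - $5A_{1}+D_{10}$: $11100\,|\,1010101001$; $6$. - $3A_{1}+D_{4}+D_{8}$: $110\,|\,1010\,|\,10101010$; $18$. - $3A_{1}+2D_{6}$: $110\,|\,101001\,|\,101001$;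 $18$. - $3A_{1}+2D_{6}$: $111\,|\,101001\,|\,000011$; $6$. - $2A_{1}+2E_{7}$: $11\,|\,0100101\,|\,0100101$; $1$. - $D_{4}+D_{12}$: $1010\,|\,101010101010$; $1$. - $2D_{8}$: $10101010\,|\,10101010$; $2$. - $A_{1}+D_{8}+E_{7}$: $1\,|\,10101010\,|\,0100101$; $1$. - $2A_{1}+D_{14}$: $10\,|\,10101010101001$; $1$. - $D_{6}+D_{10}$: $101001\,|\,1010101001$; $1$. - $2D_{4}+D_{8}$: $1010\,|\,1010\,|\,10101010$; $9$. - $3A_{1}+D_{6}+E_{7}$: $111\,|\,000011\,|\,0100101$; $6$. - $3A_{1}+D_{6}+E_{7}$: $110\,|\,101001\,|\,0100101$; $4$. - $A_{1}+2D_{4}+E_{7}$: $1\,|\,1010\,|\,1010\,|\,0100101$; $1$. - $4A_{1}+D_{12}$: $1100\,|\,101010101010$; $2$. - $2A_{1}+D_{4}+D_{10}$: $10\,|\,1010\,|\,1010101001$; $4$. - $2A_{1}+D_{6}+D_{8}$: $10\,|\,101001\,|\,10101010$; $8$. - $2A_{1}+D_{6}+D_{8}$: $11\,|\,000011\,|\,10101010$;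 $2$. - $D_{4}+2D_{6}$: $1010\,|\,101001\,|\,101001$; $2$. - $3A_{1}+2E_{7}$: $110\,|\,0100101\,|\,0100101$; $1$. - $2A_{1}+D_{8}+E_{7}$: $10\,|\,10101010\,|\,0100101$; $2$. - $D_{4}+D_{6}+E_{7}$: $1010\,|\,101001\,|\,0100101$; $1$. - $A_{1}+D_{4}+D_{12}$: $0\,|\,1010\,|\,101010101010$; $1$. - $A_{1}+D_{6}+D_{10}$: $0\,|\,101001\,|\,1010101001$; $2$. - $A_{1}+D_{6}+D_{10}$: $1\,|\,000011\,|\,1010101001$; $1$. - $A_{1}+2D_{8}$: $0\,|\,10101010\,|\,10101010$; $2$. - $D_{4}+2E_{7}$: $1010\,|\,0100101\,|\,0100101$; $1$. - $A_{1}+D_{10}+E_{7}$: $0\,|\,1010101001\,|\,0100101$; $2$. - $2A_{1}+D_{16}$: $00\,|\,1010101010101010$; $1$. - $D_{6}+D_{12}$: $000011\,|\,101010101010$; $1$. **(III) Frames with $\mathcal W\cong(\mathbb Z/2)^2$** (given as $R$: $2v_1$, $2v_2$; ratio). - $12A_{1}$: $111100001111$, $000011111111$; $40$. - $9A_{1}+D_{4}$: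 $111000111\,|\,1010$, $000111111\,|\,1001$; $40$. - $8A_{1}+D_{6}$: $11100011\,|\,101001$, $00011111\,|\,101010$; $10$. - $6A_{1}+2D_{4}$: $110011\,|\,1010\,|\,1010$, $001111\,|\,1001\,|\,1001$; $15$. - $7A_{1}+D_{8}$: $1110001\,|\,10101010$, $0001111\,|\,10101001$; $1$. - $5A_{1}+D_{4}+D_{6}$: $11001\,|\,1010\,|\,101001$, $00111\,|\,1001\,|\,101010$; $9$. - $3A_{1}+3D_{4}$: $101\,|\,1010\,|\,1010\,|\,1010$, $011\,|\,1001\,|\,1001\,|\,1001$; $2$. - $6A_{1}+D_{10}$: $111000\,|\,1010101001$, $000111\,|\,1010101010$; $1$. - $4A_{1}+2D_{6}$: $1100\,|\,101001\,|\,101001$, $0011\,|\,101010\,|\,101010$; $9$. - $4D_{4}$: $1010\,|\,1010\,|\,1010\,|\,1010$, $1001\,|\,1001\,|\,1001\,|\,1001$; $2$. - $4A_{1}+2D_{6}$: $1101\,|\,101001\,|\,000011$, $0011\,|\,101010\,|\,101010$; $2$. - $4A_{1}+D_{4}+D_{8}$: $1100\,|\,1010\,|\,10101010$, $0011\,|\,1001\,|\,10101001$;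 $1$. - $2A_{1}+2D_{4}+D_{6}$: $10\,|\,1010\,|\,1010\,|\,101001$, $01\,|\,1001\,|\,1001\,|\,101010$; $2$. - $3A_{1}+D_{6}+D_{8}$: $111\,|\,101001\,|\,00000011$, $001\,|\,101010\,|\,10101001$; $1$. - $A_{1}+D_{4}+2D_{6}$: $1\,|\,1010\,|\,101001\,|\,000011$, $0\,|\,1001\,|\,101010\,|\,101010$; $1$. - $2A_{1}+2D_{8}$: $11\,|\,10101010\,|\,00000011$, $00\,|\,10101001\,|\,10101001$; $1$. - $3D_{6}$: $000011\,|\,101001\,|\,101001$, $101010\,|\,000011\,|\,101010$; $1$. -/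

import Mathlib

namespace K3Frames

/-! ### Even lattices and discriminant forms -/

section Lattice

variable {V : Type*} [AddCommGroup V] [Module ℚ V]

/-- `Λ` is a (nondegenerate) even lattice in the rational quadratic space `(V, b)`, with
`V = Λ ⊗ ℚ`. -/
structure IsEvenLattice (b : LinearMap.BilinForm ℚ V) (Λ : Submodule ℤ V) : Prop where
  symm : ∀ x y, b x y = b y x
  nondegenerate : b.Nondegenerate
  fg : Λ.FG
  span_eq_top : Submodule.span ℚ (Λ : Set V) = ⊤
  integral : ∀ x ∈ Λ, ∀ y ∈ Λ, ∃ n : ℤ, b x y = n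
  even : ∀ x ∈ Λ, ∃ n : ℤ, b x x = 2 * n

/-- The dual lattice `Λ^∨ = {x ∈ Λ ⊗ ℚ | b(x, Λ) ⊆ ℤ}`. -/
abbrev dualLattice (b : LinearMap.BilinForm ℚ V) (Λ : Submodule ℤ V) : Submodule ℤ V :=
  b.dualSubmodule Λ

/-- The discriminant group `D(Λ) = Λ^∨ / Λ`. -/
abbrev DiscGroup (b : LinearMap.BilinForm ℚ V) (Λ : Submodule ℤ V) : Type _ :=
  ↥(dualLattice b Λ) ⧸ Λ.submoduleOf (dualLattice b Λ)

lemma exists_int_of_mem_dual {b : LinearMap.BilinForm ℚ V} {Λ : Submodule ℤ V} {x y : V}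
    (hx : x ∈ dualLattice b Λ) (hy : y ∈ Λ) : ∃ n : ℤ, b x y = n := by
  obtain ⟨n, hn⟩ := Submodule.mem_one.mp (hx y hy)
  exact ⟨n, by simpa using hn.symm⟩

lemma form_congr {b : LinearMap.BilinForm ℚ V} {Λ : Submodule ℤ V} (h : IsEvenLattice b Λ)
    {x y : V} (hy : y ∈ dualLattice b Λ) (hxy : x - y ∈ Λ) :
    ((b x x : ℚ) : AddCircle (2 : ℚ)) = ((b y y : ℚ) : AddCircle (2 : ℚ)) := by
  obtain ⟨m, hm⟩ := h.even _ hxy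
  obtain ⟨n, hn⟩ := exists_int_of_mem_dual hy hxy
  have key : b x x - b y y = (m + n) • (2 : ℚ) := by
    have e : b x x = b (x - y) (x - y) + 2 * b y (x - y) + b y y := by
      simp only [map_sub, LinearMap.sub_apply, h.symm x y]
      ring
    rw [e, hm, hn, zsmul_eq_mul]
    push_cast
    ring
  rw [← sub_eq_zero, ← AddCircle.coe_sub, key]
  exact (AddCircle.coe_eq_zero_iff (2 : ℚ)).2 ⟨m + n, rfl⟩

/-- The discriminant form `q_Λ : D(Λ) → ℚ/2ℤ`, `q_Λ(x + Λ) = b(x, x) mod 2ℤ`. -/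
def discForm {b : LinearMap.BilinForm ℚ V} {Λ : Submodule ℤ V} (h : IsEvenLattice b Λ) :
    DiscGroup b Λ → AddCircle (2 : ℚ) :=
  Quotient.lift (s := Submodule.quotientRel _)
    (fun x : dualLattice b Λ => ((b (x : V) (x : V) : ℚ) : AddCircle (2 : ℚ)))
    (fun x y hxy => form_congr h y.2 (by
      have := (Submodule.quotientRel_def _).1 hxy
      simpa [Submodule.submoduleOf] using this))

lemma discForm_mk {b : LinearMap.BilinForm ℚ V} {Λ : Submodule ℤ V} (h : IsEvenLattice b Λ)
    (x : dualLattice b Λ) :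
    discForm h (Submodule.Quotient.mk x) = ((b (x : V) (x : V) : ℚ) : AddCircle (2 : ℚ)) :=
  rfl

/-- The orthogonal group `O(q_Λ)` of the discriminant form: the automorphisms of the group `D(Λ)`
that preserve `q_Λ`. -/
def discO {b : LinearMap.BilinForm ℚ V} {Λ : Submodule ℤ V} (h : IsEvenLattice b Λ) :
    Subgroup (DiscGroup b Λ ≃ₗ[ℤ] DiscGroup b Λ) where
  carrier := {σ | ∀ x, discForm h (σ x) = discForm h x}
  mul_mem' := fun {σ τ} hσ hτ x => (hσ (τ x)).trans (hτ x)
  one_mem' := fun _ => rfl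
  inv_mem' := fun {σ} hσ x => by
    have e : σ (σ⁻¹ x) = x := σ.apply_symm_apply x
    exact (hσ (σ⁻¹ x)).symm.trans (by rw [e])

/-- The orthogonal group `O(Λ)`, realised as the group of isometries of `(Λ ⊗ ℚ, b)` that map `Λ`
onto itself. -/
def latticeO (b : LinearMap.BilinForm ℚ V) (Λ : Submodule ℤ V) : Subgroup (V ≃ₗ[ℚ] V) where
  carrier := {g | (∀ x y, b (g x) (g y) = b x y) ∧ ∀ x, g x ∈ Λ ↔ x ∈ Λ}
  mul_mem' := fun {g k} hg hk =>
    ⟨fun x y => (hg.1 (k x) (k y)).trans (hk.1 x y), fun x => (hg.2 (k x)).trans (hk.2 x)⟩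
  one_mem' := ⟨fun _ _ => rfl, fun _ => Iff.rfl⟩
  inv_mem' := fun {g} hg => by
    have e : ∀ x, g (g⁻¹ x) = x := fun x => g.apply_symm_apply x
    exact ⟨fun x y => by rw [← hg.1 (g⁻¹ x), e, e], fun x => by rw [← hg.2 (g⁻¹ x), e]⟩

lemma mem_dual_iff {b : LinearMap.BilinForm ℚ V} {Λ : Submodule ℤ V} {g : V ≃ₗ[ℚ] V}
    (hg : g ∈ latticeO b Λ) (x : V) : g x ∈ dualLattice b Λ ↔ x ∈ dualLattice b Λ := by
  refine ⟨fun hx y hy => ?_, fun hx y hy => ?_⟩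
  · rw [← hg.1 x y]
    exact hx _ ((hg.2 y).2 hy)
  · have e : g (g.symm y) = y := g.apply_symm_apply y
    rw [← e, hg.1]
    exact hx _ ((hg.2 _).1 (by rwa [e]))

/-- The action of an isometry of `Λ` on the dual lattice. -/
def dualEquiv {b : LinearMap.BilinForm ℚ V} {Λ : Submodule ℤ V} (g : latticeO b Λ) :
    dualLattice b Λ ≃ₗ[ℤ] dualLattice b Λ :=
  ((g : V ≃ₗ[ℚ] V).restrictScalars ℤ).ofSubmodules _ _ (by
    ext x
    constructor
    · rintro ⟨y, hy, rfl⟩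
      exact (mem_dual_iff g.2 y).2 hy
    · intro hx
      refine ⟨(g : V ≃ₗ[ℚ] V).symm x, (mem_dual_iff g.2 _).1 ?_, ?_⟩
      · simpa using hx
      · simp)

@[simp] lemma coe_dualEquiv {b : LinearMap.BilinForm ℚ V} {Λ : Submodule ℤ V}
    (g : latticeO b Λ) (x : dualLattice b Λ) :
    ((dualEquiv g x : dualLattice b Λ) : V) = (g : V ≃ₗ[ℚ] V) x := rfl

/-- The action of an isometry of `Λ` on the discriminant group, `x + Λ ↦ g x + Λ`. -/
def discEquiv {b : LinearMap.BilinForm ℚ V} {Λ : Submodule ℤ V} (g : latticeO b Λ) :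
    DiscGroup b Λ ≃ₗ[ℤ] DiscGroup b Λ :=
  Submodule.Quotient.equiv _ _ (dualEquiv g) (by
    ext x
    constructor
    · rintro ⟨y, hy, rfl⟩
      exact (g.2.2 _).2 hy
    · intro hx
      refine ⟨(dualEquiv g).symm x, ?_, (dualEquiv g).apply_symm_apply x⟩
      have e : (g : V ≃ₗ[ℚ] V) ((dualEquiv g).symm x : dualLattice b Λ) = x := by
        rw [← coe_dualEquiv, LinearEquiv.apply_symm_apply]
      exact (g.2.2 _).1 (e ▸ hx))

lemma discEquiv_mk {b : LinearMap.BilinForm ℚ V} {Λ : Submodule ℤ V} (g : latticeO b Λ)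
    (x : dualLattice b Λ) :
    discEquiv g (Submodule.Quotient.mk x) = Submodule.Quotient.mk (dualEquiv g x) := rfl

/-- The natural homomorphism `O(Λ) → O(q_Λ)`. -/
def discHom {b : LinearMap.BilinForm ℚ V} {Λ : Submodule ℤ V} (h : IsEvenLattice b Λ) :
    latticeO b Λ →* discO h where
  toFun g := ⟨discEquiv g, fun x => by
    induction x using Submodule.Quotient.induction_on with
    | H x => rw [discEquiv_mk, discForm_mk, discForm_mk, coe_dualEquiv, g.2.1]⟩
  map_one' := by
    ext x
    induction x using Submodule.Quotient.induction_on with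
    | H x => rfl
  map_mul' g k := by
    ext x
    induction x using Submodule.Quotient.induction_on with
    | H x => rfl

/-- The sublattice `Λ^root` spanned by the roots, i.e. the vectors of self-intersection `-2`. -/
def rootSublattice (b : LinearMap.BilinForm ℚ V) (Λ : Submodule ℤ V) : Submodule ℤ V :=
  Submodule.span ℤ {x | x ∈ Λ ∧ b x x = -2}

end Lattice

/-! ### Embeddings of the hyperbolic plane -/

section Embedding

variable {V : Type*} [AddCommGroup V] [Module ℚ V] {V' : Type*} [AddCommGroup V'] [Module ℚ V']

/-- Two lattices are isometric. -/
def Isometric (b : LinearMap.BilinForm ℚ V) (Λ : Submodule ℤ V)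
    (b' : LinearMap.BilinForm ℚ V') (Λ' : Submodule ℤ V') : Prop :=
  ∃ e : Λ ≃ₗ[ℤ] Λ', ∀ x y : Λ, b' (e x : V') (e y : V') = b (x : V) (y : V)

/-- A primitive embedding `j : H ↪ L` of the hyperbolic plane: `H = ℤ²` with the form
`(x, y) ↦ x₁ y₂ + x₂ y₁`; `j` is injective, preserves the forms and `L / j(H)` is torsion-free. -/
structure IsPrimitiveHEmbedding (b : LinearMap.BilinForm ℚ V) (L : Submodule ℤ V)
    (j : (ℤ × ℤ) →ₗ[ℤ] L) : Prop where
  injective : Function.Injective j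
  isometric : ∀ x y : ℤ × ℤ, b (j x : V) (j y : V) = ((x.1 * y.2 + x.2 * y.1 : ℤ) : ℚ)
  primitive : ∀ (n : ℤ) (v : L), n ≠ 0 → n • v ∈ LinearMap.range j → v ∈ LinearMap.range j

/-- The orthogonal complement of `j(H)` in `L`. -/
def complementH (b : LinearMap.BilinForm ℚ V) (L : Submodule ℤ V) (j : (ℤ × ℤ) →ₗ[ℤ] L) :
    Submodule ℤ V where
  carrier := {v | v ∈ L ∧ ∀ x, b (j x : V) v = 0}
  add_mem' := fun {v w} hv hw => ⟨L.add_mem hv.1 hw.1, fun x => by simp [hv.2 x, hw.2 x]⟩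
  zero_mem' := ⟨L.zero_mem, fun x => by simp⟩
  smul_mem' := fun n v hv => ⟨L.smul_mem n hv.1, fun x => by simp [hv.2 x]⟩

/-- The primitive embedding `H ↪ L` with orthogonal complement `K` is unique: for every even
lattice `L`, any two primitive embeddings of `H` into `L` whose orthogonal complements are isometric
to `K` differ by an isometry of `L` that acts trivially on the discriminant group `D(L)`. -/
def UniqueHEmbedding (b : LinearMap.BilinForm ℚ V) (K : Submodule ℤ V) : Prop :=
  ∀ (W : Type) [AddCommGroup W] [Module ℚ W] (c : LinearMap.BilinForm ℚ W) (L : Submodule ℤ W),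
    IsEvenLattice c L → ∀ j j' : (ℤ × ℤ) →ₗ[ℤ] L,
      IsPrimitiveHEmbedding c L j → IsPrimitiveHEmbedding c L j' →
      Isometric c (complementH c L j) b K → Isometric c (complementH c L j') b K →
      ∃ g : latticeO c L, discEquiv g = 1 ∧
        ∀ x, (g : W ≃ₗ[ℚ] W) (j x : W) = (j' x : W)

end Embedding

/-! ### Root lattices, overlattices and frames -/

/-- The types of the irreducible root lattices that occur. -/
inductive RootType
  | A (n : ℕ)
  | D (n : ℕ)
  | E6
  | E7
  | E8

/-- The rank of an irreducible root lattice. -/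
def RootType.rank : RootType → ℕ
  | A n => n
  | D n => n
  | E6 => 6
  | E7 => 7
  | E8 => 8

/-- The Cartan matrix, that is the Gram matrix of the positive definite root lattice in a basis of
simple roots (Bourbaki's numbering; in type `D n` the last two simple roots are the fork ends). -/
def RootType.cartan : (t : RootType) → Matrix (Fin t.rank) (Fin t.rank) ℤ
  | A n => CartanMatrix.A n
  | D n => CartanMatrix.D n
  | E6 => CartanMatrix.E₆
  | E7 => CartanMatrix.E₇
  | E8 => CartanMatrix.E₈

/-- The data of a frame `(K^root, W)` together with the tabulated ratio. `roots` is the list of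
the irreducible components of `K^root(-1)`. `K` is spanned by `K^root` and by one vector for
each entry of `glue`; an entry lists the doubled coordinates of that vector in the simple roots of
all components, one component after the other. -/
structure Frame where
  roots : List RootType
  glue : List (List ℕ)
  ratio : ℕ

namespace Frame

variable (F : Frame)

/-- The index set of the simple roots of `K^root`. -/
abbrev Idx : Type := (i : Fin F.roots.length) × Fin (F.roots.get i).rank

/-- The rational quadratic space `K^root ⊗ ℚ`, with coordinates in the simple roots. -/
abbrev Space : Type := F.Idx → ℚ

/-- The negative definite form: minus the block diagonal matrix of Cartan matrices. -/
noncomputable def form : LinearMap.BilinForm ℚ F.Space :=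
  Matrix.toBilin' ((-(Matrix.blockDiagonal' fun i => (F.roots.get i).cartan)).map
    (Int.cast : ℤ → ℚ))

/-- The lattice `K^root`, spanned by the simple roots. -/
def rootLattice : Submodule ℤ F.Space :=
  Submodule.span ℤ (Set.range fun p : F.Idx => (Pi.single p 1 : F.Space))

/-- The vector with doubled coordinates `v`. -/
def glueVector (v : List ℕ) : F.Space := fun p => (v.getD (finSigmaFinEquiv p).val 0 : ℚ) / 2

/-- The lattice `K`, spanned by `K^root` and the glue vectors. -/
def lattice : Submodule ℤ F.Space :=
  F.rootLattice ⊔ Submodule.span ℤ {x | ∃ v ∈ F.glue, x = F.glueVector v}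

/-- `K` has the frame `(K^root, W)`: it is negative definite, its roots span the root lattice of
the given type, and the factor group `W = K / K^root` is `(ℤ/2)^k`, `k` being the number of glue
vectors. -/
def IsFrame : Prop :=
  (∀ x : F.Space, x ≠ 0 → F.form x x < 0) ∧
  rootSublattice F.form F.lattice = F.rootLattice ∧
  Nonempty ((↥F.lattice ⧸ F.rootLattice.submoduleOf F.lattice) ≃+ (Fin F.glue.length → ZMod 2))

end Frame

open RootType

/-- `n` components of type `A 1`. -/
abbrev a (n : ℕ) : List RootType := List.replicate n (A 1)

/-- Frames for finite automorphism group, Picard number at most 10. -/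
def framesFiniteSmall : List Frame :=
  [ -- ρ = 3, |D(K)| = 2, δ = 1
   ⟨a 1, [], 1⟩,
   -- ρ = 4, |D(K)| = 4, δ = 1
   ⟨a 2, [], 1⟩,
   -- ρ = 4, |D(K)| = 3
   ⟨[A 2], [], 1⟩,
   -- ρ = 5, |D(K)| = 8, δ = 1
   ⟨a 3, [], 1⟩,
   -- ρ = 5, |D(K)| = 4
   ⟨[A 3], [], 1⟩,
   -- ρ = 5, |D(K)| = 6
   ⟨a 1 ++ [A 2], [], 1⟩,
   -- ρ = 6, |D(K)| = 4, δ = 0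
   ⟨[D 4], [], 1⟩,
   -- ρ = 6, |D(K)| = 16, δ = 1
   ⟨a 4, [], 1⟩,
   -- ρ = 6, |D(K)| = 5
   ⟨[A 4], [], 1⟩,
   -- ρ = 6, |D(K)| = 8
   ⟨a 1 ++ [A 3], [], 1⟩,
   -- ρ = 6, |D(K)| = 9
   ⟨[A 2, A 2], [], 1⟩,
   -- ρ = 6, |D(K)| = 12
   ⟨a 2 ++ [A 2], [], 1⟩,
   -- ρ = 7, |D(K)| = 8, δ = 1
   ⟨a 1 ++ [D 4], [], 1⟩,
   -- ρ = 7, |D(K)| = 32, δ = 1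
   ⟨a 5, [], 1⟩,
   -- ρ = 7, |D(K)| = 4
   ⟨[D 5], [], 1⟩,
   -- ρ = 7, |D(K)| = 6
   ⟨[A 5], [], 1⟩,
   -- ρ = 7, |D(K)| = 10
   ⟨a 1 ++ [A 4], [], 1⟩,
   -- ρ = 7, |D(K)| = 12
   ⟨[A 2, A 3], [], 1⟩,
   -- ρ = 7, |D(K)| = 16
   ⟨a 2 ++ [A 3], [], 1⟩,
   -- ρ = 7, |D(K)| = 18
   ⟨a 1 ++ [A 2, A 2], [], 1⟩,
   -- ρ = 8, |D(K)| = 4, δ = 1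
   ⟨[D 6], [], 1⟩,
   -- ρ = 8, |D(K)| = 16, δ = 1
   ⟨a 2 ++ [D 4], [], 1⟩,
   -- ρ = 8, |D(K)| = 64, δ = 1
   ⟨a 6, [], 2⟩,
   -- ρ = 8, |D(K)| = 3
   ⟨[E6], [], 1⟩,
   -- ρ = 8, |D(K)| = 8
   ⟨a 1 ++ [D 5], [], 1⟩,
   -- ρ = 8, |D(K)| = 12
   ⟨[A 2, D 4], [], 1⟩,
   -- ρ = 8, |D(K)| = 7
   ⟨[A 6], [], 1⟩,
   -- ρ = 8, |D(K)| = 12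
   ⟨a 1 ++ [A 5], [], 1⟩,
   -- ρ = 8, |D(K)| = 15
   ⟨[A 2, A 4], [], 1⟩,
   -- ρ = 8, |D(K)| = 16
   ⟨[A 3, A 3], [], 1⟩,
   -- ρ = 8, |D(K)| = 27
   ⟨[A 2, A 2, A 2], [], 1⟩,
   -- ρ = 9, |D(K)| = 2, δ = 1
   ⟨[E7], [], 1⟩,
   -- ρ = 9, |D(K)| = 8, δ = 1
   ⟨a 1 ++ [D 6], [], 1⟩,
   -- ρ = 9, |D(K)| = 32, δ = 1
   ⟨a 3 ++ [D 4], [], 2⟩,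
   -- ρ = 9, |D(K)| = 128, δ = 1
   ⟨a 7, [], 8⟩,
   -- ρ = 9, |D(K)| = 6
   ⟨a 1 ++ [E6], [], 1⟩,
   -- ρ = 9, |D(K)| = 4
   ⟨[D 7], [], 1⟩,
   -- ρ = 9, |D(K)| = 12
   ⟨[A 2, D 5], [], 1⟩,
   -- ρ = 9, |D(K)| = 16
   ⟨[A 3, D 4], [], 1⟩,
   -- ρ = 9, |D(K)| = 8
   ⟨[A 7], [], 1⟩,
   -- ρ = 10, |D(K)| = 1, δ = 0
   ⟨[E8], [], 1⟩,
   -- ρ = 10, |D(K)| = 4, δ = 0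
   ⟨[D 8], [], 1⟩,
   -- ρ = 10, |D(K)| = 4, δ = 1
   ⟨a 1 ++ [E7], [], 1⟩,
   -- ρ = 10, |D(K)| = 16, δ = 0
   ⟨[D 4, D 4], [], 1⟩,
   -- ρ = 10, |D(K)| = 16, δ = 1
   ⟨a 2 ++ [D 6], [], 2⟩,
   -- ρ = 10, |D(K)| = 64, δ = 0
   ⟨a 8, [[1, 1, 1, 1, 1, 1, 1, 1]], 1⟩,
   -- ρ = 10, |D(K)| = 64, δ = 1
   ⟨a 4 ++ [D 4], [], 8⟩,
   -- ρ = 10, |D(K)| = 256, δ = 1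
   ⟨a 8, [], 64⟩,
   -- ρ = 10, |D(K)| = 9
   ⟨[A 2, E6], [], 1⟩]

/-- Frames for finite automorphism group, Picard number at least 11. -/
def framesFiniteLarge : List Frame :=
  [ -- ρ = 11, |D(K)| = 2, δ = 1
   ⟨a 1 ++ [E8], [], 1⟩,
   -- ρ = 11, |D(K)| = 8, δ = 1
   ⟨a 2 ++ [E7], [], 1⟩,
   ⟨a 1 ++ [D 8], [], 1⟩,
   -- ρ = 11, |D(K)| = 32, δ = 1
   ⟨a 3 ++ [D 6], [], 6⟩,
   ⟨a 1 ++ [D 4, D 4], [], 1⟩,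
   -- ρ = 11, |D(K)| = 128, δ = 1
   ⟨a 5 ++ [D 4], [], 56⟩,
   ⟨a 9, [[1, 1, 1, 1, 1, 1, 1, 1, 0]], 1⟩,
   -- ρ = 12, |D(K)| = 4, δ = 1
   ⟨a 2 ++ [E8], [], 1⟩,
   ⟨[D 10], [], 1⟩,
   -- ρ = 12, |D(K)| = 16, δ = 1
   ⟨a 3 ++ [E7], [], 2⟩,
   ⟨a 2 ++ [D 8], [], 3⟩,
   ⟨[D 4, D 6], [], 1⟩,
   -- ρ = 12, |D(K)| = 64, δ = 1
   ⟨a 4 ++ [D 6], [], 30⟩,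
   ⟨a 2 ++ [D 4, D 4], [], 10⟩,
   ⟨a 6 ++ [D 4], [[1, 1, 1, 1, 1, 1, 1, 0, 1, 0]], 1⟩,
   -- ρ = 12, |D(K)| = 3
   ⟨[A 2, E8], [], 1⟩,
   -- ρ = 13, |D(K)| = 8, δ = 1
   ⟨a 3 ++ [E8], [], 1⟩,
   ⟨[D 4, E7], [], 1⟩,
   ⟨a 1 ++ [D 10], [], 3⟩,
   -- ρ = 13, |D(K)| = 32, δ = 1
   ⟨a 4 ++ [E7], [], 5⟩,
   ⟨a 3 ++ [D 8], [], 10⟩,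
   ⟨a 1 ++ [D 4, D 6], [], 10⟩,
   ⟨a 5 ++ [D 6], [[1, 1, 1, 1, 1, 1, 0, 1, 0, 0, 1]], 1⟩,
   -- ρ = 13, |D(K)| = 4
   ⟨[A 3, E8], [], 1⟩,
   -- ρ = 14, |D(K)| = 4, δ = 0
   ⟨[D 4, E8], [], 1⟩,
   ⟨[D 12], [], 3⟩,
   -- ρ = 14, |D(K)| = 16, δ = 0
   ⟨[D 4, D 8], [], 10⟩,
   ⟨a 5 ++ [E7], [[1, 1, 1, 1, 1, 0, 1, 0, 0, 1, 0, 1]], 1⟩,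
   -- ρ = 14, |D(K)| = 16, δ = 1
   ⟨a 4 ++ [E8], [], 1⟩,
   ⟨a 1 ++ [D 4, E7], [], 4⟩,
   ⟨a 2 ++ [D 10], [], 6⟩,
   ⟨[D 6, D 6], [], 3⟩,
   ⟨a 4 ++ [D 8], [[1, 1, 1, 1, 1, 0, 1, 0, 1, 0, 1, 0]], 1⟩,
   -- ρ = 15, |D(K)| = 8, δ = 1
   ⟨a 1 ++ [D 4, E8], [], 1⟩,
   ⟨[D 6, E7], [], 3⟩,
   ⟨a 1 ++ [D 12], [], 3⟩,
   ⟨a 3 ++ [D 10], [[1, 1, 1, 1, 0, 1, 0, 1, 0, 1, 0, 0, 1]], 1⟩,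
   -- ρ = 16, |D(K)| = 4, δ = 1
   ⟨[D 6, E8], [], 1⟩,
   ⟨[E7, E7], [], 1⟩,
   ⟨[D 14], [], 1⟩,
   ⟨a 2 ++ [D 12], [[1, 1, 1, 0, 1, 0, 1, 0, 1, 0, 1, 0, 1, 0]], 1⟩,
   -- ρ = 17, |D(K)| = 2, δ = 1
   ⟨[E7, E8], [], 1⟩,
   ⟨a 1 ++ [D 14], [[1, 1, 0, 1, 0, 1, 0, 1, 0, 1, 0, 1, 0, 0, 1]], 1⟩,
   -- ρ = 18, |D(K)| = 1, δ = 0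
   ⟨[E8, E8], [], 1⟩,
   ⟨[D 16], [[1, 0, 1, 0, 1, 0, 1, 0, 1, 0, 1, 0, 1, 0, 1, 0]], 1⟩,
   -- ρ = 19, |D(K)| = 2, δ = 1
   ⟨a 1 ++ [E8, E8], [], 1⟩,
   ⟨[D 10, E7], [[1, 0, 1, 0, 1, 0, 1, 0, 0, 1, 0, 1, 0, 0, 1, 0, 1]], 1⟩,
   ⟨a 1 ++ [D 16], [[0, 1, 0, 1, 0, 1, 0, 1, 0, 1, 0, 1, 0, 1, 0, 1, 0]], 1⟩]

/-- Frames for infinite automorphism group, 2-elementary of Picard number 11 to 16. -/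
def framesInfiniteOne : List Frame :=
  [ -- ρ = 11, |D(K)| = 512, δ = 1
   ⟨a 9, [], 960⟩,
   -- ρ = 12, |D(K)| = 256, δ = 1
   ⟨a 6 ++ [D 4], [], 672⟩,
   ⟨a 10, [[1, 1, 1, 1, 1, 1, 1, 1, 0, 0]], 36⟩,
   -- ρ = 12, |D(K)| = 1024, δ = 1
   ⟨a 10, [], 26112⟩,
   -- ρ = 13, |D(K)| = 128, δ = 1
   ⟨a 5 ++ [D 6], [], 216⟩,
   ⟨a 3 ++ [D 4, D 4], [], 120⟩,
   ⟨a 7 ++ [D 4], [[1, 1, 1, 1, 1, 1, 0, 1, 0, 1, 0]], 36⟩,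
   -- ρ = 13, |D(K)| = 512, δ = 1
   ⟨a 7 ++ [D 4], [], 13056⟩,
   ⟨a 11, [[1, 1, 1, 1, 1, 1, 1, 1, 0, 0, 0]], 1632⟩,
   -- ρ = 14, |D(K)| = 64, δ = 0
   ⟨[D 4, D 4, D 4], [], 40⟩,
   ⟨a 6 ++ [D 6], [[1, 1, 1, 1, 1, 1, 0, 0, 0, 0, 1, 1]], 36⟩,
   -- ρ = 14, |D(K)| = 64, δ = 1
   ⟨a 2 ++ [D 4, D 6], [], 80⟩,
   ⟨a 4 ++ [D 8], [], 40⟩,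
   ⟨a 5 ++ [E7], [], 16⟩,
   ⟨a 6 ++ [D 6], [[1, 1, 1, 1, 1, 0, 1, 0, 1, 0, 0, 1]], 16⟩,
   ⟨a 4 ++ [D 4, D 4], [[1, 1, 1, 1, 1, 0, 1, 0, 1, 0, 1, 0]], 10⟩,
   -- ρ = 14, |D(K)| = 256, δ = 1
   ⟨a 4 ++ [D 4, D 4], [], 1920⟩,
   ⟨a 6 ++ [D 6], [], 2304⟩,
   ⟨a 8 ++ [D 4], [[1, 1, 1, 1, 1, 1, 0, 0, 1, 0, 1, 0]], 1152⟩,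
   ⟨a 12, [[1, 1, 1, 1, 0, 0, 0, 0, 1, 1, 1, 1], [0, 0, 0, 0, 1, 1, 1, 1, 1, 1, 1, 1]], 40⟩,
   -- ρ = 15, |D(K)| = 32, δ = 1
   ⟨a 5 ++ [E8], [], 1⟩,
   ⟨a 2 ++ [D 4, E7], [], 10⟩,
   ⟨a 1 ++ [D 4, D 8], [], 10⟩,
   ⟨a 1 ++ [D 6, D 6], [], 15⟩,
   ⟨a 6 ++ [E7], [[1, 1, 1, 1, 1, 0, 0, 1, 0, 0, 1, 0, 1]], 1⟩,
   ⟨a 5 ++ [D 8], [[1, 1, 1, 1, 0, 1, 0, 1, 0, 1, 0, 1, 0]], 5⟩,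
   ⟨a 3 ++ [D 4, D 6], [[1, 1, 1, 1, 0, 1, 0, 1, 0, 1, 0, 0, 1]], 10⟩,
   -- ρ = 15, |D(K)| = 128, δ = 1
   ⟨a 6 ++ [E7], [], 72⟩,
   ⟨a 5 ++ [D 8], [], 216⟩,
   ⟨a 3 ++ [D 4, D 6], [], 720⟩,
   ⟨a 1 ++ [D 4, D 4, D 4], [], 40⟩,
   ⟨a 7 ++ [D 6], [[1, 1, 1, 1, 1, 0, 0, 1, 0, 1, 0, 0, 1]], 216⟩,
   ⟨a 7 ++ [D 6], [[1, 1, 1, 1, 1, 1, 0, 0, 0, 0, 0, 1, 1]], 36⟩,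
   ⟨a 5 ++ [D 4, D 4], [[1, 1, 1, 1, 0, 1, 0, 1, 0, 1, 0, 1, 0]], 270⟩,
   ⟨a 9 ++ [D 4],
      [[1, 1, 1, 0, 0, 0, 1, 1, 1, 1, 0, 1, 0],
      [0, 0, 0, 1, 1, 1, 1, 1, 1, 1, 0, 0, 1]], 40⟩,
   -- ρ = 16, |D(K)| = 16, δ = 1
   ⟨a 2 ++ [D 4, E8], [], 1⟩,
   ⟨a 1 ++ [D 6, E7], [], 6⟩,
   ⟨a 2 ++ [D 12], [], 3⟩,
   ⟨[D 4, D 10], [], 1⟩,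
   ⟨[D 6, D 8], [], 3⟩,
   ⟨a 3 ++ [D 4, E7], [[1, 1, 1, 1, 0, 1, 0, 0, 1, 0, 0, 1, 0, 1]], 1⟩,
   ⟨a 4 ++ [D 10], [[1, 1, 1, 0, 1, 0, 1, 0, 1, 0, 1, 0, 0, 1]], 2⟩,
   ⟨a 2 ++ [D 4, D 8], [[1, 1, 1, 0, 1, 0, 1, 0, 1, 0, 1, 0, 1, 0]], 3⟩,
   ⟨a 2 ++ [D 6, D 6], [[1, 1, 1, 0, 1, 0, 0, 1, 1, 0, 1, 0, 0, 1]], 3⟩]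

/-- Frames for infinite automorphism group, 2-elementary of Picard number 16 to 18. -/
def framesInfiniteTwo : List Frame :=
  [ -- ρ = 16, |D(K)| = 64, δ = 1
   ⟨a 6 ++ [E8], [], 2⟩,
   ⟨a 3 ++ [D 4, E7], [], 40⟩,
   ⟨a 4 ++ [D 10], [], 30⟩,
   ⟨a 2 ++ [D 4, D 8], [], 60⟩,
   ⟨a 2 ++ [D 6, D 6], [], 90⟩,
   ⟨[D 4, D 4, D 6], [], 10⟩,
   ⟨a 7 ++ [E7], [[1, 1, 1, 1, 1, 0, 0, 0, 1, 0, 0, 1, 0, 1]], 6⟩,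
   ⟨a 6 ++ [D 8], [[1, 1, 1, 1, 0, 0, 1, 0, 1, 0, 1, 0, 1, 0]], 30⟩,
   ⟨a 6 ++ [D 8], [[1, 1, 1, 1, 1, 1, 0, 0, 0, 0, 0, 0, 1, 1]], 1⟩,
   ⟨a 4 ++ [D 4, D 6], [[1, 1, 1, 0, 1, 0, 1, 0, 1, 0, 1, 0, 0, 1]], 120⟩,
   ⟨a 4 ++ [D 4, D 6], [[1, 1, 1, 1, 1, 0, 1, 0, 0, 0, 0, 0, 1, 1]], 15⟩,
   ⟨a 2 ++ [D 4, D 4, D 4], [[1, 1, 1, 0, 1, 0, 1, 0, 1, 0, 1, 0, 1, 0]], 15⟩,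
   ⟨a 8 ++ [D 6],
      [[1, 1, 1, 0, 0, 0, 1, 1, 1, 0, 1, 0, 0, 1],
      [0, 0, 0, 1, 1, 1, 1, 1, 1, 0, 1, 0, 1, 0]], 10⟩,
   ⟨a 6 ++ [D 4, D 4],
      [[1, 1, 0, 0, 1, 1, 1, 0, 1, 0, 1, 0, 1, 0],
      [0, 0, 1, 1, 1, 1, 1, 0, 0, 1, 1, 0, 0, 1]], 15⟩,
   -- ρ = 17, |D(K)| = 8, δ = 1
   ⟨a 1 ++ [D 6, E8], [], 1⟩,
   ⟨a 1 ++ [E7, E7], [], 1⟩,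
   ⟨[D 8, E7], [], 1⟩,
   ⟨a 1 ++ [D 14], [], 1⟩,
   ⟨a 3 ++ [D 12], [[1, 1, 0, 1, 0, 1, 0, 1, 0, 1, 0, 1, 0, 1, 0]], 1⟩,
   ⟨a 1 ++ [D 4, D 10], [[1, 1, 0, 1, 0, 1, 0, 1, 0, 1, 0, 1, 0, 0, 1]], 1⟩,
   ⟨a 1 ++ [D 6, D 8], [[1, 1, 0, 1, 0, 0, 1, 1, 0, 1, 0, 1, 0, 1, 0]], 2⟩,
   -- ρ = 17, |D(K)| = 32, δ = 1
   ⟨a 3 ++ [D 4, E8], [], 2⟩,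
   ⟨[D 4, D 4, E7], [], 1⟩,
   ⟨a 3 ++ [D 12], [], 6⟩,
   ⟨a 1 ++ [D 4, D 10], [], 6⟩,
   ⟨a 1 ++ [D 6, D 8], [], 18⟩,
   ⟨a 4 ++ [D 4, E7], [[1, 1, 1, 0, 1, 0, 1, 0, 0, 1, 0, 0, 1, 0, 1]], 6⟩,
   ⟨a 5 ++ [D 10], [[1, 1, 1, 0, 0, 1, 0, 1, 0, 1, 0, 1, 0, 0, 1]], 6⟩,
   ⟨a 3 ++ [D 4, D 8], [[1, 1, 0, 1, 0, 1, 0, 1, 0, 1, 0, 1, 0, 1, 0]], 18⟩,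
   ⟨a 3 ++ [D 6, D 6], [[1, 1, 0, 1, 0, 1, 0, 0, 1, 1, 0, 1, 0, 0, 1]], 18⟩,
   ⟨a 3 ++ [D 6, D 6], [[1, 1, 1, 1, 0, 1, 0, 0, 1, 0, 0, 0, 0, 1, 1]], 6⟩,
   ⟨a 7 ++ [D 8],
      [[1, 1, 1, 0, 0, 0, 1, 1, 0, 1, 0, 1, 0, 1, 0],
      [0, 0, 0, 1, 1, 1, 1, 1, 0, 1, 0, 1, 0, 0, 1]], 1⟩,
   ⟨a 5 ++ [D 4, D 6],
      [[1, 1, 0, 0, 1, 1, 0, 1, 0, 1, 0, 1, 0, 0, 1],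
      [0, 0, 1, 1, 1, 1, 0, 0, 1, 1, 0, 1, 0, 1, 0]], 9⟩,
   ⟨a 3 ++ [D 4, D 4, D 4],
      [[1, 0, 1, 1, 0, 1, 0, 1, 0, 1, 0, 1, 0, 1, 0],
      [0, 1, 1, 1, 0, 0, 1, 1, 0, 0, 1, 1, 0, 0, 1]], 2⟩,
   -- ρ = 18, |D(K)| = 4, δ = 0
   ⟨[D 8, E8], [], 1⟩,
   ⟨[D 16], [], 1⟩,
   ⟨a 2 ++ [E7, E7], [[1, 1, 0, 1, 0, 0, 1, 0, 1, 0, 1, 0, 0, 1, 0, 1]], 1⟩,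
   ⟨[D 4, D 12], [[1, 0, 1, 0, 1, 0, 1, 0, 1, 0, 1, 0, 1, 0, 1, 0]], 1⟩,
   ⟨[D 8, D 8], [[1, 0, 1, 0, 1, 0, 1, 0, 1, 0, 1, 0, 1, 0, 1, 0]], 2⟩,
   -- ρ = 18, |D(K)| = 4, δ = 1
   ⟨a 1 ++ [E7, E8], [], 1⟩,
   ⟨a 1 ++ [D 8, E7], [[1, 1, 0, 1, 0, 1, 0, 1, 0, 0, 1, 0, 0, 1, 0, 1]], 1⟩,
   ⟨a 2 ++ [D 14], [[1, 0, 1, 0, 1, 0, 1, 0, 1, 0, 1, 0, 1, 0, 0, 1]], 1⟩,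
   ⟨[D 6, D 10], [[1, 0, 1, 0, 0, 1, 1, 0, 1, 0, 1, 0, 1, 0, 0, 1]], 1⟩,
   -- ρ = 18, |D(K)| = 16, δ = 0
   ⟨[D 4, D 4, E8], [], 1⟩,
   ⟨[D 4, D 12], [], 6⟩,
   ⟨[D 8, D 8], [], 9⟩,
   ⟨[D 4, D 4, D 8], [[1, 0, 1, 0, 1, 0, 1, 0, 1, 0, 1, 0, 1, 0, 1, 0]], 9⟩,
   ⟨a 3 ++ [D 6, E7], [[1, 1, 1, 0, 0, 0, 0, 1, 1, 0, 1, 0, 0, 1, 0, 1]], 6⟩,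
   ⟨a 6 ++ [D 10],
      [[1, 1, 1, 0, 0, 0, 1, 0, 1, 0, 1, 0, 1, 0, 0, 1],
      [0, 0, 0, 1, 1, 1, 1, 0, 1, 0, 1, 0, 1, 0, 1, 0]], 1⟩,
   ⟨a 4 ++ [D 6, D 6],
      [[1, 1, 0, 0, 1, 0, 1, 0, 0, 1, 1, 0, 1, 0, 0, 1],
      [0, 0, 1, 1, 1, 0, 1, 0, 1, 0, 1, 0, 1, 0, 1, 0]], 9⟩,
   ⟨[D 4, D 4, D 4, D 4],
      [[1, 0, 1, 0, 1, 0, 1, 0, 1, 0, 1, 0, 1, 0, 1, 0],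
      [1, 0, 0, 1, 1, 0, 0, 1, 1, 0, 0, 1, 1, 0, 0, 1]], 2⟩]

/-- Frames for infinite automorphism group, 2-elementary of Picard number 18 to 20. -/
def framesInfiniteThree : List Frame :=
  [ -- ρ = 18, |D(K)| = 16, δ = 1
   ⟨a 2 ++ [D 6, E8], [], 2⟩,
   ⟨a 2 ++ [E7, E7], [], 2⟩,
   ⟨a 1 ++ [D 8, E7], [], 4⟩,
   ⟨a 2 ++ [D 14], [], 2⟩,
   ⟨[D 6, D 10], [], 2⟩,
   ⟨a 3 ++ [D 6, E7], [[1, 1, 0, 1, 0, 1, 0, 0, 1, 0, 1, 0, 0, 1, 0, 1]], 4⟩,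
   ⟨a 1 ++ [D 4, D 4, E7], [[1, 1, 0, 1, 0, 1, 0, 1, 0, 0, 1, 0, 0, 1, 0, 1]], 1⟩,
   ⟨a 4 ++ [D 12], [[1, 1, 0, 0, 1, 0, 1, 0, 1, 0, 1, 0, 1, 0, 1, 0]], 2⟩,
   ⟨a 2 ++ [D 4, D 10], [[1, 0, 1, 0, 1, 0, 1, 0, 1, 0, 1, 0, 1, 0, 0, 1]], 4⟩,
   ⟨a 2 ++ [D 6, D 8], [[1, 0, 1, 0, 1, 0, 0, 1, 1, 0, 1, 0, 1, 0, 1, 0]], 8⟩,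
   ⟨a 2 ++ [D 6, D 8], [[1, 1, 0, 0, 0, 0, 1, 1, 1, 0, 1, 0, 1, 0, 1, 0]], 2⟩,
   ⟨[D 4, D 6, D 6], [[1, 0, 1, 0, 1, 0, 1, 0, 0, 1, 1, 0, 1, 0, 0, 1]], 2⟩,
   ⟨a 4 ++ [D 6, D 6],
      [[1, 1, 0, 1, 1, 0, 1, 0, 0, 1, 0, 0, 0, 0, 1, 1],
      [0, 0, 1, 1, 1, 0, 1, 0, 1, 0, 1, 0, 1, 0, 1, 0]], 2⟩,
   ⟨a 4 ++ [D 4, D 8],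
      [[1, 1, 0, 0, 1, 0, 1, 0, 1, 0, 1, 0, 1, 0, 1, 0],
      [0, 0, 1, 1, 1, 0, 0, 1, 1, 0, 1, 0, 1, 0, 0, 1]], 1⟩,
   ⟨a 2 ++ [D 4, D 4, D 6],
      [[1, 0, 1, 0, 1, 0, 1, 0, 1, 0, 1, 0, 1, 0, 0, 1],
      [0, 1, 1, 0, 0, 1, 1, 0, 0, 1, 1, 0, 1, 0, 1, 0]], 2⟩,
   -- ρ = 19, |D(K)| = 8, δ = 1
   ⟨a 2 ++ [E7, E8], [], 1⟩,
   ⟨a 1 ++ [D 8, E8], [], 1⟩,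
   ⟨[D 10, E7], [], 1⟩,
   ⟨a 1 ++ [D 16], [], 1⟩,
   ⟨a 3 ++ [E7, E7], [[1, 1, 0, 0, 1, 0, 0, 1, 0, 1, 0, 1, 0, 0, 1, 0, 1]], 1⟩,
   ⟨a 2 ++ [D 8, E7], [[1, 0, 1, 0, 1, 0, 1, 0, 1, 0, 0, 1, 0, 0, 1, 0, 1]], 2⟩,
   ⟨[D 4, D 6, E7], [[1, 0, 1, 0, 1, 0, 1, 0, 0, 1, 0, 1, 0, 0, 1, 0, 1]], 1⟩,
   ⟨a 1 ++ [D 4, D 12], [[0, 1, 0, 1, 0, 1, 0, 1, 0, 1, 0, 1, 0, 1, 0, 1, 0]], 1⟩,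
   ⟨a 1 ++ [D 6, D 10], [[0, 1, 0, 1, 0, 0, 1, 1, 0, 1, 0, 1, 0, 1, 0, 0, 1]], 2⟩,
   ⟨a 1 ++ [D 6, D 10], [[1, 0, 0, 0, 0, 1, 1, 1, 0, 1, 0, 1, 0, 1, 0, 0, 1]], 1⟩,
   ⟨a 1 ++ [D 8, D 8], [[0, 1, 0, 1, 0, 1, 0, 1, 0, 1, 0, 1, 0, 1, 0, 1, 0]], 2⟩,
   ⟨a 3 ++ [D 6, D 8],
      [[1, 1, 1, 1, 0, 1, 0, 0, 1, 0, 0, 0, 0, 0, 0, 1, 1],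
      [0, 0, 1, 1, 0, 1, 0, 1, 0, 1, 0, 1, 0, 1, 0, 0, 1]], 1⟩,
   ⟨a 1 ++ [D 4, D 6, D 6],
      [[1, 1, 0, 1, 0, 1, 0, 1, 0, 0, 1, 0, 0, 0, 0, 1, 1],
      [0, 1, 0, 0, 1, 1, 0, 1, 0, 1, 0, 1, 0, 1, 0, 1, 0]], 1⟩,
   -- ρ = 20, |D(K)| = 4, δ = 1
   ⟨a 2 ++ [E8, E8], [], 1⟩,
   ⟨[D 10, E8], [], 1⟩,
   ⟨[D 18], [], 1⟩,
   ⟨[D 4, E7, E7], [[1, 0, 1, 0, 0, 1, 0, 0, 1, 0, 1, 0, 1, 0, 0, 1, 0, 1]], 1⟩,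
   ⟨a 1 ++ [D 10, E7], [[0, 1, 0, 1, 0, 1, 0, 1, 0, 0, 1, 0, 1, 0, 0, 1, 0, 1]], 2⟩,
   ⟨a 2 ++ [D 16], [[0, 0, 1, 0, 1, 0, 1, 0, 1, 0, 1, 0, 1, 0, 1, 0, 1, 0]], 1⟩,
   ⟨[D 6, D 12], [[0, 0, 0, 0, 1, 1, 1, 0, 1, 0, 1, 0, 1, 0, 1, 0, 1, 0]], 1⟩,
   ⟨a 2 ++ [D 8, D 8],
      [[1, 1, 1, 0, 1, 0, 1, 0, 1, 0, 0, 0, 0, 0, 0, 0, 1, 1],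
      [0, 0, 1, 0, 1, 0, 1, 0, 0, 1, 1, 0, 1, 0, 1, 0, 0, 1]], 1⟩,
   ⟨[D 6, D 6, D 6],
      [[0, 0, 0, 0, 1, 1, 1, 0, 1, 0, 0, 1, 1, 0, 1, 0, 0, 1],
      [1, 0, 1, 0, 1, 0, 0, 0, 0, 0, 1, 1, 1, 0, 1, 0, 1, 0]], 1⟩]

/-- All tabulated frames. -/
def frames : List Frame :=
  framesFiniteSmall ++ framesFiniteLarge ++ framesInfiniteOne ++ framesInfiniteTwo ++ framesInfiniteThree

end K3Frames

namespace K3Frames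

/-! ### Unimodular splitting and uniqueness of the embedding of the hyperbolic plane -/

section UniqueEmbedding

variable {V : Type*} [AddCommGroup V] [Module ℚ V] {W : Type*} [AddCommGroup W] [Module ℚ W]

/-! Everything reduces to two group orders. Since H is unimodular, an embedding of H into L with
complement K splits L as H ⊕ K and identifies D(L) with D(K). Two such embeddings differ on D(K) by
an isometry of q_K. If that isometry lifts to O(K), the lift and the identification of the two
hyperbolic planes glue to an isometry of L that is the identity on D(L)
(`uniqueHEmbedding_of_surjective`). So surjectivity of O(K) → O(q_K) gives uniqueness, and
surjectivity follows from equality of |O(q_K)| with the order of the image (`consequences_of_card`).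

The image. A reflection in a root moves dual vectors by integral multiples of the root, hence acts
trivially on D(K). Modulo such reflections every isometry permutes the simple roots
(`exists_permutation_of_isometry`). The image is therefore that of the diagram automorphisms that
preserve the glue. Its order is the product of the orbit lengths in a stabilizer chain along a basis
of D(K) (`OrbitChain.rel_card`). An orbit is bounded from above by a numerical invariant of diagram
automorphisms (`classWeight_moves`) and from below by listed automorphisms; the bounds coincide in
every case (`MaskCode.orbitChain`, `MaskCode.card_range`).

The order of O(q_K). If the components are of types A₁, D₂ₘ, E₇, E₈, then D(K) is an elementary
abelian 2-group, and each class is represented by half the sum of a set of mutually orthogonal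
simple roots. Classes become binary words, q_K is minus half the number of bits, and membership
questions become linear algebra over the field with two elements. If q_K has an orthogonal basis of
vectors with odd values, isometries correspond to the orthogonal sequences with the same values.
These are chosen one vector at a time: the number of admissible vectors depends only on the
remaining values, and only the characteristic vector has to be excluded (`card_orthSeq`,
`card_isom_eq`). A form with even values is first enlarged by a rank one form, which does not change
the isometry group (`card_isom_stabilize`).

The frame. No root lies outside the root lattice, because every vector of a nonzero glue coset has
norm greater than 2, by a bound that is added over the components
(`RootType.IsTwoElementary.normBound_le`, `maskCode_of_glue`).

The lattices with other components have no glue and ratio 1. There surjectivity is proved directly: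
D(K) is generated by a few fundamental weights, all systems of images with the correct products are
enumerated, and each is realized by a symmetry of the Dynkin diagram
(`InvCode.surjective_of_extends`).

What remains for each lattice is a finite decidable condition on an explicit certificate
(`FrameCert.Valid.holds`, `WeightCert.Valid.holds`). -/

lemma exists_nsmul_mem_of_span_eq_top {Λ : Submodule ℤ V}
    (h : Submodule.span ℚ (Λ : Set V) = ⊤) (v : V) : ∃ n : ℕ, n ≠ 0 ∧ (n : ℤ) • v ∈ Λ := by
  have hv : v ∈ Submodule.span ℚ (Λ : Set V) := h ▸ Submodule.mem_top
  induction hv using Submodule.span_induction with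
  | mem x hx => exact ⟨1, one_ne_zero, by simpa using hx⟩
  | zero => exact ⟨1, one_ne_zero, by simp⟩
  | add x y _ _ hx hy =>
    obtain ⟨n, hn, hx⟩ := hx
    obtain ⟨m, hm, hy⟩ := hy
    refine ⟨n * m, mul_ne_zero hn hm, ?_⟩
    have := Λ.add_mem (Λ.smul_mem (m : ℤ) hx) (Λ.smul_mem (n : ℤ) hy)
    rw [smul_smul, smul_smul] at this
    rw [smul_add]
    push_cast
    rwa [mul_comm (n : ℤ) m, show ((m : ℤ) * n) • y = ((n : ℤ) * m) • y by rw [mul_comm]]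
  | smul a x _ hx =>
    obtain ⟨n, hn, hx⟩ := hx
    refine ⟨a.den * n, mul_ne_zero a.den_ne_zero hn, ?_⟩
    have e : ((a.den * n : ℕ) : ℤ) • a • x = a.num • (n : ℤ) • x := by
      rw [← Int.cast_smul_eq_zsmul ℚ, ← Int.cast_smul_eq_zsmul ℚ a.num,
        ← Int.cast_smul_eq_zsmul ℚ (n : ℤ), smul_smul, smul_smul]
      congr 1
      push_cast
      rw [mul_assoc, mul_comm (n : ℚ) a, ← mul_assoc, Rat.den_mul_eq_num]
    rw [e]
    exact Λ.smul_mem _ hx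

lemma isUnit_algebraMap_end {U : Type*} [AddCommGroup U] [Module ℚ U] (n : nonZeroDivisors ℤ) :
    IsUnit (algebraMap ℤ (Module.End ℤ U) n) := by
  have hn : ((n : ℤ) : ℚ) ≠ 0 := by exact_mod_cast nonZeroDivisors.ne_zero n.2
  rw [Module.End.isUnit_iff]
  refine ⟨fun x y hxy => ?_, fun x => ⟨((n : ℤ) : ℚ)⁻¹ • x, ?_⟩⟩
  · simp only [Module.algebraMap_end_apply, ← Int.cast_smul_eq_zsmul ℚ] at hxy
    exact smul_right_injective _ hn hxy
  · simp only [Module.algebraMap_end_apply, ← Int.cast_smul_eq_zsmul ℚ]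
    rw [smul_smul, mul_inv_cancel₀ hn, one_smul]

/-- V is the localization of Λ at the nonzero integers, and these act invertibly on the rational
space W, so the universal property applies. -/
lemma exists_linearMap_extend {Λ : Submodule ℤ V} (h : Submodule.span ℚ (Λ : Set V) = ⊤)
    (f : Λ →ₗ[ℤ] W) : ∃ F : V →ₗ[ℚ] W, ∀ x : Λ, F x = f x := by
  have : IsLocalizedModule (nonZeroDivisors ℤ) Λ.subtype :=
    { map_units := isUnit_algebraMap_end (U := V)
      surj := fun v => by
        obtain ⟨n, hn, hv⟩ := exists_nsmul_mem_of_span_eq_top h v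
        exact ⟨(⟨_, hv⟩, ⟨n, by simpa using hn⟩), rfl⟩
      exists_of_eq := fun {x y} hxy => ⟨1, by rw [Subtype.ext hxy]⟩ }
  refine ⟨(IsLocalizedModule.lift (nonZeroDivisors ℤ) Λ.subtype f
    (isUnit_algebraMap_end (U := W))).toAddMonoidHom.toRatLinearMap, fun x => ?_⟩
  exact IsLocalizedModule.lift_apply (nonZeroDivisors ℤ) Λ.subtype f (isUnit_algebraMap_end (U := W)) x

/-- The orthogonal decomposition of a lattice `L` containing a hyperbolic plane with basis `u`, `w`
and orthogonal complement `K`: `embed` embeds `K ⊗ ℚ`, and `proj` is the orthogonal projection. -/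
structure HyperbolicSplitting (c : LinearMap.BilinForm ℚ W) (L : Submodule ℤ W)
    (b : LinearMap.BilinForm ℚ V) (K : Submodule ℤ V) (u w : W) where
  embed : V →ₗ[ℚ] W
  proj : W →ₗ[ℚ] V
  u_mem : u ∈ L
  w_mem : w ∈ L
  u_u : c u u = 0
  w_w : c w w = 0
  u_w : c u w = 1
  proj_u : proj u = 0
  proj_w : proj w = 0
  proj_embed : ∀ v, proj (embed v) = v
  decomp : ∀ x, x = c x w • u + c x u • w + embed (proj x)
  embed_u : ∀ v, c (embed v) u = 0
  embed_w : ∀ v, c (embed v) w = 0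
  embed_embed : ∀ v v', c (embed v) (embed v') = b v v'
  proj_mem : ∀ x ∈ L, proj x ∈ K
  embed_mem : ∀ v ∈ K, embed v ∈ L

/-- Products with u and w are integral on L, so the orthogonal projection along the hyperbolic plane
maps L into the complement of the plane. It is composed with the isometry to K over the integers,
and both this composite and the inverse isometry are extended to rational maps. Every identity is
then checked on a lattice. -/
lemma exists_hyperbolicSplitting {c : LinearMap.BilinForm ℚ W} {L : Submodule ℤ W}
    {b : LinearMap.BilinForm ℚ V} {K : Submodule ℤ V} (hL : IsEvenLattice c L)
    (hK : IsEvenLattice b K) {j : (ℤ × ℤ) →ₗ[ℤ] L} (hj : IsPrimitiveHEmbedding c L j)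
    (hi : Isometric c (complementH c L j) b K) :
    Nonempty (HyperbolicSplitting c L b K (j (1, 0)) (j (0, 1))) := by
  obtain ⟨e, he⟩ := hi
  set u : L := j (1, 0) with hu
  set w : L := j (0, 1) with hw
  have huu : c u u = 0 := by rw [hu, hj.isometric]; norm_num
  have hww : c w w = 0 := by rw [hw, hj.isometric]; norm_num
  have huw : c u w = 1 := by rw [hu, hw, hj.isometric]; norm_num
  have hwu : c w u = 1 := by rw [hL.symm, huw]
  have hjx : ∀ x, (j x : W) = (x.1 : ℚ) • (u : W) + (x.2 : ℚ) • (w : W) := by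
    intro x
    have : x = x.1 • ((1 : ℤ), (0 : ℤ)) + x.2 • ((0 : ℤ), (1 : ℤ)) := by ext <;> simp
    conv_lhs => rw [this, map_add, map_smul, map_smul]
    rw [Int.cast_smul_eq_zsmul, Int.cast_smul_eq_zsmul]
    rfl
  have hcompl : ∀ v : W, v ∈ L → c v u = 0 → c v w = 0 → v ∈ complementH c L j := by
    intro v hv h1 h2
    refine ⟨hv, fun x => ?_⟩
    rw [hjx, map_add, map_smul, map_smul, LinearMap.add_apply, LinearMap.smul_apply,
      LinearMap.smul_apply, hL.symm (u : W), hL.symm (w : W), h1, h2]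
    simp
  -- The basis of the plane dual to u, w is w, u, so the coefficient of u is the product with w and
  -- conversely.
  let π : W →ₗ[ℚ] W := LinearMap.id - (c.flip (w : W)).smulRight (u : W)
    - (c.flip (u : W)).smulRight (w : W)
  have hπ : ∀ x, π x = x - c x w • (u : W) - c x u • (w : W) := fun x => rfl
  have hπM : ∀ x ∈ L, π x ∈ complementH c L j := by
    intro x hx
    obtain ⟨m, hm⟩ := hL.integral x hx w w.2
    obtain ⟨n, hn⟩ := hL.integral x hx u u.2
    apply hcompl
    · rw [hπ, hm, hn, Int.cast_smul_eq_zsmul, Int.cast_smul_eq_zsmul]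
      exact L.sub_mem (L.sub_mem hx (L.smul_mem _ u.2)) (L.smul_mem _ w.2)
    · rw [hπ]; simp [huu, hwu]
    · rw [hπ]; simp [huw, hww]
  let πL : L →ₗ[ℤ] complementH c L j :=
    ((π.restrictScalars ℤ).comp L.subtype).codRestrict _ (fun x => hπM x x.2)
  obtain ⟨P, hP⟩ := exists_linearMap_extend hL.span_eq_top
    (K.subtype.comp (e.toLinearMap.comp πL))
  obtain ⟨E, hE⟩ := exists_linearMap_extend hK.span_eq_top
    ((complementH c L j).subtype.comp e.symm.toLinearMap)
  have hP' : ∀ x : L, P x = e (πL x) := hP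
  have hE' : ∀ v : K, E v = e.symm v := hE
  have hK' : ∀ v ∈ K, ∃ y : complementH c L j, (e y : V) = v ∧ E v = y := by
    intro v hv
    exact ⟨e.symm ⟨v, hv⟩, by simp, hE' ⟨v, hv⟩⟩
  have extV : ∀ (f g : V →ₗ[ℚ] ℚ), (∀ v ∈ K, f v = g v) → f = g := fun f g h =>
    LinearMap.ext_on hK.span_eq_top h
  have hEu : ∀ y : complementH c L j, c (y : W) u = 0 := fun y => by
    rw [hL.symm]; exact y.2.2 _
  have hEw : ∀ y : complementH c L j, c (y : W) w = 0 := fun y => by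
    rw [hL.symm]; exact y.2.2 _
  have hπy : ∀ y : complementH c L j, ∀ hy : (y : W) ∈ L, πL ⟨y, hy⟩ = y := by
    intro y hy
    apply Subtype.ext
    change π y = y
    rw [hπ, hEu, hEw]
    simp
  refine ⟨⟨E, P, u.2, w.2, huu, hww, huw, ?_, ?_, ?_, ?_, ?_, ?_, ?_, ?_, ?_⟩⟩
  · rw [hP']
    have : πL u = 0 := by
      apply Subtype.ext
      change π u = 0
      rw [hπ, huw, huu]; simp
    simp [this]
  · rw [hP']
    have : πL w = 0 := by
      apply Subtype.ext
      change π w = 0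
      rw [hπ, hwu, hww]; simp
    simp [this]
  · suffices P.comp E = LinearMap.id from fun v => LinearMap.congr_fun this v
    refine LinearMap.ext_on hK.span_eq_top fun v hv => ?_
    obtain ⟨y, hy, hEy⟩ := hK' v hv
    have := hP' ⟨y, y.2.1⟩
    rw [hπy] at this
    rw [LinearMap.comp_apply, hEy, LinearMap.id_apply, ← hy]
    exact this
  · suffices E.comp P = π by
      intro x
      have h := LinearMap.congr_fun this x
      rw [LinearMap.comp_apply, hπ] at h
      rw [h]; abel
    refine LinearMap.ext_on hL.span_eq_top fun x hx => ?_
    rw [LinearMap.comp_apply, hP' ⟨x, hx⟩, hE', LinearEquiv.symm_apply_apply]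
    rfl
  · suffices (c.flip (u : W)).comp E = 0 from fun v => LinearMap.congr_fun this v
    refine extV _ _ fun v hv => ?_
    obtain ⟨y, hy, hEy⟩ := hK' v hv
    simpa [hEy] using hEu y
  · suffices (c.flip (w : W)).comp E = 0 from fun v => LinearMap.congr_fun this v
    refine extV _ _ fun v hv => ?_
    obtain ⟨y, hy, hEy⟩ := hK' v hv
    simpa [hEy] using hEw y
  · suffices c.compl₁₂ E E = b by
      intro v v'
      rw [← this, LinearMap.compl₁₂_apply]
    refine LinearMap.ext_on hK.span_eq_top fun v hv => ?_
    refine LinearMap.ext_on hK.span_eq_top fun v' hv' => ?_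
    obtain ⟨y, hy, hEy⟩ := hK' v hv
    obtain ⟨y', hy', hEy'⟩ := hK' v' hv'
    rw [LinearMap.compl₁₂_apply, hEy, hEy', ← hy, ← hy', he]
  · intro x hx
    rw [hP' ⟨x, hx⟩]
    exact (e _).2
  · intro v hv
    obtain ⟨y, hy, hEy⟩ := hK' v hv
    rw [hEy]
    exact y.2.1

namespace HyperbolicSplitting

variable {c : LinearMap.BilinForm ℚ W} {L : Submodule ℤ W}
  {b : LinearMap.BilinForm ℚ V} {K : Submodule ℤ V} {u w u' w' : W}

lemma proj_mem_dual (S : HyperbolicSplitting c L b K u w) (hL : IsEvenLattice c L) {x : W}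
    (hx : x ∈ dualLattice c L) : S.proj x ∈ dualLattice b K := by
  intro k hk
  have h := hx _ (S.embed_mem k hk)
  rw [S.decomp x] at h
  simp only [map_add, map_smul, LinearMap.add_apply, LinearMap.smul_apply,
    hL.symm u, hL.symm w, S.embed_u, S.embed_w, S.embed_embed] at h
  simpa using h

lemma embed_mem_dual (S : HyperbolicSplitting c L b K u w) {y : V}
    (hy : y ∈ dualLattice b K) : S.embed y ∈ dualLattice c L := by
  intro l hl
  have h := hy _ (S.proj_mem l hl)
  rw [S.decomp l]
  simpa only [map_add, map_smul, S.embed_u, S.embed_w, S.embed_embed, smul_zero, zero_add]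

lemma exists_proj_sub (S : HyperbolicSplitting c L b K u w) {x : W} (hx : x ∈ dualLattice c L) :
    ∃ m n : ℤ, x = m • u + n • w + S.embed (S.proj x) := by
  obtain ⟨m, hm⟩ := exists_int_of_mem_dual hx S.w_mem
  obtain ⟨n, hn⟩ := exists_int_of_mem_dual hx S.u_mem
  refine ⟨m, n, ?_⟩
  conv_lhs => rw [S.decomp x]
  rw [hm, hn, Int.cast_smul_eq_zsmul, Int.cast_smul_eq_zsmul]

lemma form_eq (S : HyperbolicSplitting c L b K u w) (hL : IsEvenLattice c L) (x y : W) :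
    c x y = c x w * c y u + c x u * c y w + b (S.proj x) (S.proj y) := by
  have hwu : c w u = 1 := by rw [hL.symm, S.u_w]
  conv_lhs => rw [S.decomp x, S.decomp y]
  simp only [map_add, map_smul, LinearMap.add_apply, LinearMap.smul_apply, smul_eq_mul,
    S.u_u, S.w_w, S.u_w, hwu, hL.symm u (S.embed _), hL.symm w (S.embed _), S.embed_u, S.embed_w,
    S.embed_embed]
  ring

/-- Two splittings induce an additive map between the dual lattices of the complements. -/
def transfer (S : HyperbolicSplitting c L b K u w) (S' : HyperbolicSplitting c L b K u' w')
    (hL : IsEvenLattice c L) : dualLattice b K →ₗ[ℤ] dualLattice b K :=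
  (((S'.proj.comp S.embed).restrictScalars ℤ).comp (dualLattice b K).subtype).codRestrict _
    (fun y => S'.proj_mem_dual hL (S.embed_mem_dual y.2))

@[simp] lemma coe_transfer (S : HyperbolicSplitting c L b K u w)
    (S' : HyperbolicSplitting c L b K u' w') (hL : IsEvenLattice c L) (y : dualLattice b K) :
    (S.transfer S' hL y : V) = S'.proj (S.embed y) := rfl

/-- The map of discriminant groups induced by `transfer`. -/
def discTransfer (S : HyperbolicSplitting c L b K u w) (S' : HyperbolicSplitting c L b K u' w')
    (hL : IsEvenLattice c L) : DiscGroup b K →ₗ[ℤ] DiscGroup b K :=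
  Submodule.mapQ _ _ (S.transfer S' hL) (fun _ hy => S'.proj_mem _ (S.embed_mem _ hy))

/-- Passing through the second splitting changes a dual vector by an integral combination of u' and
w' only, and the first projection maps this combination into K. -/
lemma discTransfer_discTransfer (S : HyperbolicSplitting c L b K u w)
    (S' : HyperbolicSplitting c L b K u' w') (hL : IsEvenLattice c L) :
    (S'.discTransfer S hL).comp (S.discTransfer S' hL) = LinearMap.id := by
  ext y
  refine (Submodule.Quotient.eq _).2 ?_
  change S.proj (S'.embed (S'.proj (S.embed y))) - (y : V) ∈ K
  obtain ⟨m, n, h⟩ := S'.exists_proj_sub (S.embed_mem_dual y.2)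
  have h2 : S'.embed (S'.proj (S.embed y)) = S.embed y - m • u' - n • w' := by
    rw [eq_sub_iff_add_eq, eq_sub_iff_add_eq]
    conv_rhs => rw [h]
    abel
  rw [h2, map_sub, map_sub, S.proj_embed, map_zsmul, map_zsmul]
  have : (y : V) - m • S.proj u' - n • S.proj w' - y = -(m • S.proj u' + n • S.proj w') := by abel
  rw [this]
  exact K.neg_mem (K.add_mem (K.smul_mem _ (S.proj_mem _ S'.u_mem))
    (K.smul_mem _ (S.proj_mem _ S'.w_mem)))

/-- The part discarded by the projection is m u' + n w', up to the order of the coefficients. Its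
square is 2mn, which vanishes modulo 2. -/
lemma discForm_discTransfer (S : HyperbolicSplitting c L b K u w)
    (S' : HyperbolicSplitting c L b K u' w') (hL : IsEvenLattice c L) (hK : IsEvenLattice b K)
    (x : DiscGroup b K) : discForm hK (S.discTransfer S' hL x) = discForm hK x := by
  induction x using Submodule.Quotient.induction_on with
  | H y =>
    change discForm hK (Submodule.Quotient.mk (S.transfer S' hL y)) = _
    rw [discForm_mk, discForm_mk, coe_transfer]
    have h := S'.form_eq hL (S.embed y) (S.embed y)
    have hx := S.embed_mem_dual y.2
    obtain ⟨m, hm⟩ := exists_int_of_mem_dual hx S'.w_mem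
    obtain ⟨n, hn⟩ := exists_int_of_mem_dual hx S'.u_mem
    rw [S.embed_embed, hm, hn] at h
    rw [h, eq_comm, ← sub_eq_zero, ← AddCircle.coe_sub]
    refine (AddCircle.coe_eq_zero_iff (2 : ℚ)).2 ⟨m * n, ?_⟩
    rw [zsmul_eq_mul]
    push_cast
    ring

/-- The isometry of `W` glued from an isometry `k` of the complement. -/
def glue (S : HyperbolicSplitting c L b K u w) (S' : HyperbolicSplitting c L b K u' w')
    (k : V →ₗ[ℚ] V) : W →ₗ[ℚ] W :=
  (c.flip w).smulRight u' + (c.flip u).smulRight w' + S'.embed.comp (k.comp S.proj)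

lemma glue_apply (S : HyperbolicSplitting c L b K u w) (S' : HyperbolicSplitting c L b K u' w')
    (k : V →ₗ[ℚ] V) (x : W) :
    S.glue S' k x = c x w • u' + c x u • w' + S'.embed (k (S.proj x)) := rfl

lemma proj_glue (S : HyperbolicSplitting c L b K u w) (S' : HyperbolicSplitting c L b K u' w')
    (k : V →ₗ[ℚ] V) (x : W) : S'.proj (S.glue S' k x) = k (S.proj x) := by
  rw [glue_apply, map_add, map_add, map_smul, map_smul, S'.proj_u, S'.proj_w, S'.proj_embed]
  simp

lemma glue_u (S : HyperbolicSplitting c L b K u w) (S' : HyperbolicSplitting c L b K u' w')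
    (hL : IsEvenLattice c L) (k : V →ₗ[ℚ] V) (x : W) : c (S.glue S' k x) u' = c x u := by
  rw [glue_apply]
  simp [S'.u_u, S'.embed_u, hL.symm w' u', S'.u_w]

lemma glue_w (S : HyperbolicSplitting c L b K u w) (S' : HyperbolicSplitting c L b K u' w')
    (k : V →ₗ[ℚ] V) (x : W) : c (S.glue S' k x) w' = c x w := by
  rw [glue_apply]
  simp [S'.w_w, S'.embed_w, S'.u_w]

lemma glue_glue (S : HyperbolicSplitting c L b K u w) (S' : HyperbolicSplitting c L b K u' w')
    (hL : IsEvenLattice c L) (k k' : V →ₗ[ℚ] V) (h : ∀ v, k' (k v) = v) (x : W) :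
    S'.glue S k' (S.glue S' k x) = x := by
  rw [S'.glue_apply, S.proj_glue, h, S.glue_u _ hL, S.glue_w, ← S.decomp x]

lemma glue_mem (S : HyperbolicSplitting c L b K u w) (S' : HyperbolicSplitting c L b K u' w')
    (hL : IsEvenLattice c L) {k : V →ₗ[ℚ] V} (h : ∀ v ∈ K, k v ∈ K) {x : W} (hx : x ∈ L) :
    S.glue S' k x ∈ L := by
  obtain ⟨m, hm⟩ := hL.integral _ hx _ S.w_mem
  obtain ⟨n, hn⟩ := hL.integral _ hx _ S.u_mem
  rw [glue_apply, hm, hn, Int.cast_smul_eq_zsmul, Int.cast_smul_eq_zsmul]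
  exact L.add_mem (L.add_mem (L.smul_mem _ S'.u_mem) (L.smul_mem _ S'.w_mem))
    (S'.embed_mem _ (h _ (S.proj_mem _ hx)))

end HyperbolicSplitting

/-- Both splittings identify D(K) with D(L), and their comparison is an isometry of q_K. A lift k of
it to O(K), together with u ↦ u' and w ↦ w', defines the isometry of L. It is trivial on D(L)
because k agrees with the comparison modulo K. -/
theorem uniqueHEmbedding_of_surjective {b : LinearMap.BilinForm ℚ V} {K : Submodule ℤ V}
    (hK : IsEvenLattice b K) (hsurj : Function.Surjective (discHom hK)) :
    UniqueHEmbedding b K := by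
  intro W _ _ c L hL j j' hj hj' hi hi'
  obtain ⟨S⟩ := exists_hyperbolicSplitting hL hK hj hi
  obtain ⟨S'⟩ := exists_hyperbolicSplitting hL hK hj' hi'
  have e1 := S.discTransfer_discTransfer S' hL
  have e2 := S'.discTransfer_discTransfer S hL
  obtain ⟨k, hk⟩ := hsurj ⟨LinearEquiv.ofLinearMap (S.discTransfer S' hL) (S'.discTransfer S hL) e2 e1,
    fun x => S.discForm_discTransfer S' hL hK x⟩
  have hk' : ∀ y ∈ dualLattice b K, (k : V ≃ₗ[ℚ] V) y - S'.proj (S.embed y) ∈ K := by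
    intro y hy
    have h := congrArg (fun τ : discO hK => (τ : DiscGroup b K ≃ₗ[ℤ] DiscGroup b K)
      (Submodule.Quotient.mk ⟨y, hy⟩)) hk
    exact (Submodule.Quotient.eq (K.submoduleOf (dualLattice b K)) (x := dualEquiv k ⟨y, hy⟩)
      (y := S.transfer S' hL ⟨y, hy⟩)).1 h
  set κ : V ≃ₗ[ℚ] V := (k : V ≃ₗ[ℚ] V) with hκ
  have hκs : ∀ v ∈ K, κ.symm v ∈ K := fun v hv => (k.2.2 _).1 (by
    change κ (κ.symm v) ∈ K
    rwa [κ.apply_symm_apply])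
  have i1 := S.glue_glue S' hL κ.toLinearMap κ.symm.toLinearMap (fun v => κ.symm_apply_apply v)
  have i2 := S'.glue_glue S hL κ.symm.toLinearMap κ.toLinearMap (fun v => κ.apply_symm_apply v)
  let g : W ≃ₗ[ℚ] W := LinearEquiv.ofLinearMap (S.glue S' κ.toLinearMap)
    (S'.glue S κ.symm.toLinearMap) (LinearMap.ext i2) (LinearMap.ext i1)
  have hg : g ∈ latticeO c L := by
    refine ⟨fun x y => ?_, fun x => ⟨fun hx => ?_, fun hx => ?_⟩⟩
    · change c (S.glue S' κ.toLinearMap x) (S.glue S' κ.toLinearMap y) = c x y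
      rw [S'.form_eq hL, S.glue_u _ hL, S.glue_u _ hL, S.glue_w, S.glue_w, S.proj_glue,
        S.proj_glue, S.form_eq hL x y]
      congr 1
      exact k.2.1 _ _
    · have := S'.glue_mem S hL (k := κ.symm.toLinearMap) hκs hx
      change S'.glue S κ.symm.toLinearMap (S.glue S' κ.toLinearMap x) ∈ L at this
      rwa [i1] at this
    · exact S.glue_mem S' hL (k := κ.toLinearMap) (fun v hv => (k.2.2 v).2 hv) hx
  refine ⟨⟨g, hg⟩, ?_, fun x => ?_⟩
  · ext x
    induction x using Submodule.Quotient.induction_on with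
    | H x =>
      rw [discEquiv_mk]
      refine (Submodule.Quotient.eq _).2 ?_
      change S.glue S' κ.toLinearMap x - (x : W) ∈ L
      obtain ⟨m, hm⟩ := exists_int_of_mem_dual x.2 S.w_mem
      obtain ⟨n, hn⟩ := exists_int_of_mem_dual x.2 S.u_mem
      obtain ⟨m', n', h'⟩ := S'.exists_proj_sub x.2
      have hx := S.decomp x
      rw [hm, hn] at hx
      have h1 := hk' _ (S.proj_mem_dual hL x.2)
      have h2 : S.embed (S.proj (x : W)) = x - m • (j (1, 0) : W) - n • (j (0, 1) : W) := by
        rw [eq_sub_iff_add_eq, eq_sub_iff_add_eq]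
        conv_rhs => rw [hx, Int.cast_smul_eq_zsmul, Int.cast_smul_eq_zsmul]
        abel
      rw [h2, map_sub, map_sub, map_zsmul, map_zsmul] at h1
      have h3 := S'.embed_mem _ h1
      rw [map_sub, map_sub, map_sub, map_zsmul, map_zsmul] at h3
      rw [S.glue_apply, hm, hn, Int.cast_smul_eq_zsmul, Int.cast_smul_eq_zsmul]
      have h4 : S'.embed (S'.proj (x : W)) = x - m' • (j' (1, 0) : W) - n' • (j' (0, 1) : W) := by
        rw [eq_sub_iff_add_eq, eq_sub_iff_add_eq]
        conv_rhs => rw [h']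
        abel
      rw [h4] at h3
      have hmem : ∀ (a : ℤ) {y : W}, y ∈ L → a • y ∈ L := fun a y hy => L.smul_mem a hy
      have e3 := S'.embed_mem _ (S'.proj_mem _ S.u_mem)
      have e4 := S'.embed_mem _ (S'.proj_mem _ S.w_mem)
      -- The vector in `h3` differs from g x - x only by integral multiples of u', w' and of the
      -- components of u and w orthogonal to the second plane, all of which lie in L.
      have := L.add_mem (L.add_mem (L.add_mem (L.sub_mem (L.sub_mem h3 (hmem m e3)) (hmem n e4))
        (hmem m S'.u_mem)) (hmem n S'.w_mem)) (L.neg_mem (L.add_mem (hmem m' S'.u_mem)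
        (hmem n' S'.w_mem)))
      convert this using 1
      change _ + S'.embed (κ (S.proj (x : W))) - _ = _
      abel
  · have hjx : ∀ j : (ℤ × ℤ) →ₗ[ℤ] L,
        (j x : W) = (x.1 : ℤ) • (j (1, 0) : W) + (x.2 : ℤ) • (j (0, 1) : W) := by
      intro j
      have : x = x.1 • ((1 : ℤ), (0 : ℤ)) + x.2 • ((0 : ℤ), (1 : ℤ)) := by ext <;> simp
      conv_lhs => rw [this, map_add, map_smul, map_smul]
      rfl
    change S.glue S' κ.toLinearMap (j x) = j' x
    rw [S.glue_apply, hjx j, hjx j']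
    simp [S.u_u, S.w_w, S.u_w, hL.symm (j (0, 1) : W) (j (1, 0)), S.proj_u, S.proj_w,
      Int.cast_smul_eq_zsmul]

end UniqueEmbedding

/-! ### Isometries modulo reflections permute the simple roots -/

section SimpleRoots

variable {ι : Type*} [Fintype ι] [DecidableEq ι]

/-- The form with Gram matrix `-C`. -/
noncomputable def negForm (C : Matrix ι ι ℤ) : LinearMap.BilinForm ℚ (ι → ℚ) :=
  Matrix.toBilin' ((-C).map (Int.cast : ℤ → ℚ))

variable (ι) in
/-- The lattice `ℤ^ι`. -/
def intLattice : Submodule ℤ (ι → ℚ) :=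
  Submodule.span ℤ (Set.range fun p : ι => (Pi.single p 1 : ι → ℚ))

lemma negForm_apply (C : Matrix ι ι ℤ) (x y : ι → ℚ) :
    negForm C x y = -∑ p, ∑ q, x p * C p q * y q := by
  rw [negForm, Matrix.toBilin'_apply, ← Finset.sum_neg_distrib]
  refine Finset.sum_congr rfl fun p _ => ?_
  rw [← Finset.sum_neg_distrib]
  refine Finset.sum_congr rfl fun q _ => ?_
  simp

lemma negForm_single_single (C : Matrix ι ι ℤ) (p q : ι) :
    negForm C (Pi.single p 1) (Pi.single q 1) = -(C p q : ℚ) := by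
  rw [negForm, Matrix.toBilin'_single]
  simp

lemma negForm_single_left (C : Matrix ι ι ℤ) (p : ι) (y : ι → ℚ) :
    negForm C (Pi.single p 1) y = -∑ q, (C p q : ℚ) * y q := by
  rw [negForm_apply, Finset.sum_eq_single p]
  · simp
  · intro q _ hq
    simp [Pi.single_eq_of_ne hq]
  · simp

lemma negForm_symm {C : Matrix ι ι ℤ} (hC : C.IsSymm) (x y : ι → ℚ) :
    negForm C x y = negForm C y x := by
  rw [negForm_apply, negForm_apply, Finset.sum_comm]
  congr 1
  refine Finset.sum_congr rfl fun p _ => Finset.sum_congr rfl fun q _ => ?_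
  rw [hC.apply p q]
  ring

lemma mem_intLattice {x : ι → ℚ} : x ∈ intLattice ι ↔ ∀ p, ∃ n : ℤ, x p = n := by
  constructor
  · intro hx p
    induction hx using Submodule.span_induction with
    | mem x hx =>
      obtain ⟨q, rfl⟩ := hx
      by_cases h : p = q
      · subst h; exact ⟨1, by simp⟩
      · exact ⟨0, by simp [Pi.single_eq_of_ne h]⟩
    | zero => exact ⟨0, by simp⟩
    | add x y _ _ hx hy =>
      obtain ⟨m, hm⟩ := hx
      obtain ⟨n, hn⟩ := hy
      exact ⟨m + n, by simp [hm, hn]⟩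
    | smul a x _ hx =>
      obtain ⟨m, hm⟩ := hx
      exact ⟨a * m, by simp [hm]⟩
  · intro h
    choose n hn using h
    have : x = ∑ p, n p • (Pi.single p 1 : ι → ℚ) := by
      ext q
      rw [Finset.sum_apply, Finset.sum_eq_single q]
      · simp [hn]
      · intro p _ hp
        simp [Pi.single_eq_of_ne hp.symm]
      · simp
    rw [this]
    exact Submodule.sum_mem _ fun p _ => Submodule.smul_mem _ _
      (Submodule.subset_span ⟨p, rfl⟩)

omit [Fintype ι] in
lemma single_mem_intLattice (p : ι) : (Pi.single p 1 : ι → ℚ) ∈ intLattice ι :=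
  Submodule.subset_span ⟨p, rfl⟩

/-- The reflection in a vector `β` of square `-2`. -/
noncomputable def rootReflection {V : Type*} [AddCommGroup V] [Module ℚ V]
    (b : LinearMap.BilinForm ℚ V) (β : V) (hβ : b β β = -2) : V ≃ₗ[ℚ] V :=
  LinearEquiv.ofInvolutive (LinearMap.id + (b.flip β).smulRight β) (fun x => by
    change x + b x β • β + b (x + b x β • β) β • β = x
    rw [map_add, map_smul, LinearMap.add_apply, LinearMap.smul_apply, hβ, smul_eq_mul]
    module)

lemma rootReflection_apply {V : Type*} [AddCommGroup V] [Module ℚ V]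
    (b : LinearMap.BilinForm ℚ V) (β : V) (hβ : b β β = -2) (x : V) :
    rootReflection b β hβ x = x + b x β • β := rfl

lemma rootReflection_mem {V : Type*} [AddCommGroup V] [Module ℚ V]
    {b : LinearMap.BilinForm ℚ V} {K : Submodule ℤ V} (hK : IsEvenLattice b K) {β : V}
    (hβK : β ∈ K) (hβ : b β β = -2) : rootReflection b β hβ ∈ latticeO b K := by
  have h1 : ∀ x ∈ K, rootReflection b β hβ x ∈ K := by
    intro x hx
    obtain ⟨n, hn⟩ := hK.integral x hx β hβK
    rw [rootReflection_apply, hn, Int.cast_smul_eq_zsmul]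
    exact K.add_mem hx (K.smul_mem _ hβK)
  refine ⟨fun x y => ?_, fun x => ⟨fun hx => ?_, h1 x⟩⟩
  · simp only [rootReflection_apply, map_add, LinearMap.add_apply, map_smul, LinearMap.smul_apply,
      smul_eq_mul, hβ, hK.symm β y]
    ring
  · have := h1 _ hx
    have e : rootReflection b β hβ (rootReflection b β hβ x) = x :=
      (rootReflection b β hβ).left_inv x
    rwa [e] at this

variable {C : Matrix ι ι ℤ} {K : Submodule ℤ (ι → ℚ)}

/-- Split β into its positive and negative parts x and y. Their supports are disjoint and the
off-diagonal entries of C are nonpositive, so the product of x and y in the negative form is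
nonnegative. If both parts were nonzero, each would have square at most -2 and β would have square
at most -4. -/
lemma coord_nonneg_or_nonpos (hK : IsEvenLattice (negForm C) K)
    (hpos : ∀ x : ι → ℚ, x ≠ 0 → negForm C x x < 0) (hoff : ∀ p q, p ≠ q → C p q ≤ 0)
    (hR : intLattice ι ≤ K) {β : ι → ℚ} (hβ : β ∈ intLattice ι) (hβ2 : negForm C β β = -2) :
    (∀ p, 0 ≤ β p) ∨ (∀ p, β p ≤ 0) := by
  set x : ι → ℚ := fun p => max (β p) 0 with hx
  set y : ι → ℚ := fun p => max (-β p) 0 with hy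
  have hxy : β = x - y := by
    ext p
    simp only [hx, hy, Pi.sub_apply]
    rcases le_total (β p) 0 with h | h
    · rw [max_eq_right h, max_eq_left (by linarith)]; ring
    · rw [max_eq_left h, max_eq_right (by linarith)]; ring
  have hxR : x ∈ intLattice ι := mem_intLattice.2 fun p => by
    obtain ⟨n, hn⟩ := mem_intLattice.1 hβ p
    exact ⟨max n 0, by simp [hx, hn]⟩
  have hyR : y ∈ intLattice ι := mem_intLattice.2 fun p => by
    obtain ⟨n, hn⟩ := mem_intLattice.1 hβ p
    exact ⟨max (-n) 0, by simp [hy, hn]⟩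
  have hcross : 0 ≤ negForm C x y := by
    rw [negForm_apply, ← Finset.sum_neg_distrib]
    refine Finset.sum_nonneg fun p _ => ?_
    rw [← Finset.sum_neg_distrib]
    refine Finset.sum_nonneg fun q _ => ?_
    by_cases h : p = q
    · subst h
      have : x p * y p = 0 := by
        simp only [hx, hy]
        rcases le_total (β p) 0 with h | h
        · rw [max_eq_right h]; ring
        · rw [max_eq_right (a := -β p) (by linarith)]; ring
      have : x p * C p p * y p = 0 := by linear_combination (C p p : ℚ) * this
      rw [this]; simp
    · have h1 : (C p q : ℚ) ≤ 0 := by exact_mod_cast hoff p q h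
      have h2 : 0 ≤ x p := le_max_right _ _
      have h3 : 0 ≤ y q := le_max_right _ _
      have : 0 ≤ x p * (-(C p q : ℚ)) * y q := by
        apply mul_nonneg (mul_nonneg h2 (by linarith)) h3
      linarith
  have heven : ∀ z ∈ intLattice ι, z ≠ 0 → negForm C z z ≤ -2 := by
    intro z hz hz0
    obtain ⟨n, hn⟩ := hK.even z (hR hz)
    have h := hpos z hz0
    rw [hn] at h ⊢
    have : (n : ℚ) < 0 := by linarith
    have : n < 0 := by exact_mod_cast this
    have : (n : ℚ) ≤ -1 := by exact_mod_cast Int.le_sub_one_of_lt this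
    linarith
  have hsum : negForm C β β = negForm C x x + negForm C y y - 2 * negForm C x y := by
    rw [hxy]
    simp only [map_sub, LinearMap.sub_apply, hK.symm y x]
    ring
  by_cases hx0 : x = 0
  · right
    intro p
    have := congrFun hx0 p
    simp only [hx, Pi.zero_apply] at this
    exact max_eq_right_iff.1 this
  · by_cases hy0 : y = 0
    · left
      intro p
      have := congrFun hy0 p
      simp only [hy, Pi.zero_apply] at this
      linarith [max_eq_right_iff.1 this]
    · have := heven x hxR hx0
      have := heven y hyR hy0
      linarith

/-- Definiteness makes C invertible, and h is |det C| times the solution of C z = (1, …, 1),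
integral because it comes from the adjugate. It is a positive multiple of the Weyl vector, so the
product with h measures the sum of the coordinates, i.e. the height. -/
lemma exists_dominant_vector (hpos : ∀ x : ι → ℚ, x ≠ 0 → negForm C x x < 0) :
    ∃ h ∈ intLattice ι, ∃ m : ℚ, 0 < m ∧ ∀ p, negForm C (Pi.single p 1) h = -m := by
  have hdet : C.det ≠ 0 := by
    intro h
    obtain ⟨v, hv, hv0⟩ := Matrix.exists_mulVec_eq_zero_iff.2 h
    have hne : (fun p => (v p : ℚ)) ≠ 0 := by
      intro h0
      exact hv (funext fun p => by simpa using congrFun h0 p)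
    have h1 := hpos _ hne
    have h2 : negForm C (fun p => (v p : ℚ)) (fun p => (v p : ℚ)) = 0 := by
      rw [negForm_apply, neg_eq_zero]
      refine Finset.sum_eq_zero fun p _ => ?_
      have h3 := congrFun hv0 p
      simp only [Matrix.mulVec, dotProduct, Pi.zero_apply] at h3
      have h4 : ∑ q, (C p q : ℚ) * v q = 0 := by exact_mod_cast h3
      simp only [mul_assoc, ← Finset.mul_sum, h4, mul_zero]
    linarith
  set z : ι → ℤ := C.det.sign • (C.adjugate.mulVec 1) with hz
  refine ⟨fun p => (z p : ℚ), mem_intLattice.2 fun p => ⟨z p, rfl⟩, |(C.det : ℚ)|,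
    abs_pos.2 (by exact_mod_cast hdet), fun p => ?_⟩
  rw [negForm_single_left]
  have h1 : C.mulVec z = fun _ => |C.det| := by
    rw [hz, Matrix.mulVec_smul, Matrix.mulVec_mulVec, Matrix.mul_adjugate]
    ext p
    simp
  have h2 := congrFun h1 p
  simp only [Matrix.mulVec, dotProduct] at h2
  congr 1
  exact_mod_cast h2

/-- Every isometry of `K` acts on the discriminant group as an isometry that permutes
the simple roots. -/
theorem exists_permutation_of_isometry (hK : IsEvenLattice (negForm C) K)
    (hpos : ∀ x : ι → ℚ, x ≠ 0 → negForm C x x < 0) (hdiag : ∀ p, C p p = 2)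
    (hoff : ∀ p q, p ≠ q → C p q ≤ 0) (hroot : rootSublattice (negForm C) K = intLattice ι)
    (g : latticeO (negForm C) K) :
    ∃ g' : latticeO (negForm C) K, ∃ σ : Equiv.Perm ι,
      (∀ p, (g' : (ι → ℚ) ≃ₗ[ℚ] (ι → ℚ)) (Pi.single p 1) = Pi.single (σ p) 1) ∧
      discHom hK g' = discHom hK g := by
  have hR : intLattice ι ≤ K := by
    rw [← hroot]
    exact Submodule.span_le.2 fun x hx => hx.1
  obtain ⟨h, hhR, m, hm, hhm⟩ := exists_dominant_vector hpos
  have hb : ∀ x : ι → ℚ, negForm C x h = -m * ∑ p, x p := by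
    intro x
    have hx : x = ∑ p, x p • (Pi.single p 1 : ι → ℚ) := by
      ext q
      rw [Finset.sum_apply, Finset.sum_eq_single q]
      · simp
      · intro p _ hp
        simp [Pi.single_eq_of_ne hp.symm]
      · simp
    conv_lhs => rw [hx]
    rw [map_sum, LinearMap.sum_apply, Finset.mul_sum]
    refine Finset.sum_congr rfl fun p _ => ?_
    rw [map_smul, LinearMap.smul_apply, hhm, smul_eq_mul, mul_comm]
  have hsimple : ∀ p, negForm C (Pi.single p 1) (Pi.single p 1) = -2 := fun p => by
    rw [negForm_single_single, hdiag]; norm_num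
  have hgR : ∀ k : latticeO (negForm C) K, ∀ x ∈ intLattice ι,
      (k : (ι → ℚ) ≃ₗ[ℚ] (ι → ℚ)) x ∈ intLattice ι := by
    intro k x hx
    rw [← hroot] at hx ⊢
    induction hx using Submodule.span_induction with
    | mem x hx =>
      exact Submodule.subset_span ⟨(k.2.2 x).2 hx.1, by rw [k.2.1]; exact hx.2⟩
    | zero => rw [map_zero]; exact Submodule.zero_mem _
    | add x y _ _ hx hy => rw [map_add]; exact Submodule.add_mem _ hx hy
    | smul a x _ hx => rw [map_zsmul]; exact Submodule.smul_mem _ a hx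
  -- choose the representative modulo reflections that maximizes the pairing with `h`
  let S : Set (latticeO (negForm C) K) := {k | discHom hK k = discHom hK g}
  have hval : ∀ k : latticeO (negForm C) K, ∃ n : ℤ,
      negForm C ((k : (ι → ℚ) ≃ₗ[ℚ] (ι → ℚ)) h) h = n := fun k =>
    hK.integral _ (hR (hgR k h hhR)) _ (hR hhR)
  choose val hval using hval
  -- The vectors k h and h have the same square, and the square of their difference is nonpositive.
  have hbdd : ∀ k, negForm C h h ≤ val k := by
    intro k
    rw [← hval]
    set y := (k : (ι → ℚ) ≃ₗ[ℚ] (ι → ℚ)) h with hy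
    have h1 : negForm C y y = negForm C h h := k.2.1 h h
    have h2 : negForm C (y - h) (y - h) ≤ 0 := by
      by_cases h0 : y - h = 0
      · rw [h0]; simp
      · exact (hpos _ h0).le
    simp only [map_sub, LinearMap.sub_apply, hK.symm h y, h1] at h2
    linarith
  obtain ⟨k, hkS, hkmin⟩ : ∃ k ∈ S, ∀ k' ∈ S, val k ≤ val k' := by
    obtain ⟨n, hn⟩ : ∃ n : ℤ, negForm C h h = n := hK.integral _ (hR hhR) _ (hR hhR)
    obtain ⟨k, hk, hmin⟩ := WellFounded.has_min
      (measure fun k : latticeO (negForm C) K => (val k - n).toNat).wf S ⟨g, rfl⟩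
    refine ⟨k, hk, fun k' hk' => ?_⟩
    have h1 : ¬ (val k' - n).toNat < (val k - n).toNat := hmin k' hk'
    have h2 : n ≤ val k' := by have := hbdd k'; rw [hn] at this; exact_mod_cast this
    omega
  -- Reflections in simple roots act trivially on D(K), so the chosen representative may be composed
  -- with them.
  have hrefl : ∀ p, discHom hK ⟨rootReflection (negForm C) (Pi.single p 1) (hsimple p),
      rootReflection_mem hK (hR (single_mem_intLattice p)) _⟩ = 1 := by
    intro p
    ext x
    induction x using Submodule.Quotient.induction_on with
    | H x =>
      refine (Submodule.Quotient.eq _).2 ?_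
      change (x : ι → ℚ) + negForm C x (Pi.single p 1) • Pi.single p 1 - (x : ι → ℚ) ∈ K
      obtain ⟨n, hn⟩ := exists_int_of_mem_dual x.2 (hR (single_mem_intLattice p))
      rw [add_sub_cancel_left, hn, Int.cast_smul_eq_zsmul]
      exact K.smul_mem _ (hR (single_mem_intLattice p))
  set κ : (ι → ℚ) ≃ₗ[ℚ] (ι → ℚ) := (k : (ι → ℚ) ≃ₗ[ℚ] (ι → ℚ)) with hκ
  have hκb : ∀ x y, negForm C (κ x) (κ y) = negForm C x y := k.2.1
  have hks : ∀ x ∈ intLattice ι, κ.symm x ∈ intLattice ι := hgR k⁻¹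
  have hksb : ∀ x y, negForm C (κ.symm x) (κ.symm y) = negForm C x y := fun x y => by
    rw [← hκb, κ.apply_symm_apply, κ.apply_symm_apply]
  -- Minimality against the composite with the p-th simple reflection says that the preimage of the
  -- p-th simple root has nonnegative height.
  have hsum : ∀ p, 0 ≤ ∑ q, κ.symm (Pi.single p 1) q := by
    intro p
    set ρ : latticeO (negForm C) K := ⟨rootReflection (negForm C) (Pi.single p 1) (hsimple p),
      rootReflection_mem hK (hR (single_mem_intLattice p)) _⟩ with hρ
    have h1 := hkmin (ρ * k)
      (by change discHom hK (ρ * k) = _; rw [map_mul, hrefl, one_mul]; exact hkS)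
    have h2 : (val k : ℚ) ≤ val (ρ * k) := by exact_mod_cast h1
    have hρk : ((ρ * k : latticeO (negForm C) K) : (ι → ℚ) ≃ₗ[ℚ] (ι → ℚ)) h =
        κ h + negForm C (κ h) (Pi.single p 1) • Pi.single p 1 := by
      rw [← rootReflection_apply (negForm C) (Pi.single p 1) (hsimple p)]
      rfl
    rw [← hval, ← hval, hρk, ← hκ] at h2
    rw [map_add, map_smul, LinearMap.add_apply, LinearMap.smul_apply, hhm, smul_eq_mul] at h2
    have h3 : negForm C (κ h) (Pi.single p 1) = negForm C (κ.symm (Pi.single p 1)) h := by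
      rw [hK.symm, ← hksb, κ.symm_apply_apply]
    rw [h3, hb (κ.symm (Pi.single p 1))] at h2
    by_contra hneg
    push Not at hneg
    have := mul_pos hm (mul_pos hm (neg_pos.2 hneg))
    linarith
  have hne : ∀ p, κ.symm (Pi.single p 1) ≠ 0 := fun p h0 => by
    have : (Pi.single p 1 : ι → ℚ) = 0 := by
      rw [← κ.apply_symm_apply (Pi.single p 1), h0, map_zero]
    have := congrFun this p
    simp at this
  have hnn : ∀ p q, 0 ≤ κ.symm (Pi.single p 1) q := by
    intro p
    rcases coord_nonneg_or_nonpos hK hpos hoff hR (hks _ (single_mem_intLattice p))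
      (by rw [hksb, hsimple]) with h1 | h1
    · exact h1
    · exfalso
      apply hne p
      have h2 : ∑ q, κ.symm (Pi.single p 1) q = 0 :=
        le_antisymm (Finset.sum_nonpos fun q _ => h1 q) (hsum p)
      ext q
      exact (Finset.sum_eq_zero_iff_of_nonpos fun q _ => h1 q).1 h2 q (Finset.mem_univ q)
  have hht : ∀ p, 1 ≤ ∑ q, κ.symm (Pi.single p 1) q := by
    intro p
    obtain ⟨q, hq⟩ : ∃ q, κ.symm (Pi.single p 1) q ≠ 0 := by
      by_contra hcon
      push Not at hcon
      exact hne p (funext hcon)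
    obtain ⟨n, hn⟩ := mem_intLattice.1 (hks _ (single_mem_intLattice p)) q
    have h0 := hnn p q
    have h1 : 1 ≤ κ.symm (Pi.single p 1) q := by
      rw [hn] at h0 hq ⊢
      have h2 : (0 : ℤ) ≤ n := by exact_mod_cast h0
      have h3 : n ≠ 0 := by exact_mod_cast hq
      exact_mod_cast (by omega : (1 : ℤ) ≤ n)
    exact h1.trans (Finset.single_le_sum (fun q _ => hnn p q) (Finset.mem_univ q))
  have hcomb : ∀ q, (Pi.single q 1 : ι → ℚ) =
      ∑ p, κ (Pi.single q 1) p • κ.symm (Pi.single p 1) := by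
    intro q
    have hx : κ (Pi.single q 1) = ∑ p, κ (Pi.single q 1) p • (Pi.single p 1 : ι → ℚ) := by
      ext r
      rw [Finset.sum_apply, Finset.sum_eq_single r]
      · simp
      · intro p _ hp
        simp [Pi.single_eq_of_ne hp.symm]
      · simp
    conv_lhs => rw [← κ.symm_apply_apply (Pi.single q 1), hx, map_sum]
    exact Finset.sum_congr rfl fun p _ => by rw [map_smul]
  -- The image of a simple root is again a root. If it were negative, `hcomb` would express the
  -- simple root as a nonpositive combination of nonnegative vectors, although its own coordinate is
  -- 1.
  have hcnn : ∀ q p, 0 ≤ κ (Pi.single q 1) p := by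
    intro q
    rcases coord_nonneg_or_nonpos hK hpos hoff hR (hgR k _ (single_mem_intLattice q))
      (by rw [hκb, hsimple]) with h1 | h1
    · exact h1
    · exfalso
      have h2 := congrFun (hcomb q) q
      rw [Finset.sum_apply, Pi.single_eq_same] at h2
      have h3 : ∑ p, (κ (Pi.single q 1) p • κ.symm (Pi.single p 1)) q ≤ 0 :=
        Finset.sum_nonpos fun p _ => mul_nonpos_of_nonpos_of_nonneg (h1 p) (hnn p q)
      linarith
  -- Take heights in `hcomb`: 1 is a sum of nonnegative integral coefficients times heights that are
  -- at least 1. Hence one coefficient is 1 and the others vanish.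
  have hsimp : ∀ q, ∃ p, κ (Pi.single q 1) = Pi.single p 1 := by
    intro q
    have h1 : ∑ p, κ (Pi.single q 1) p * ∑ r, κ.symm (Pi.single p 1) r = 1 := by
      have h2 : ∑ r, (Pi.single q 1 : ι → ℚ) r = 1 := by simp
      rw [hcomb q] at h2
      simp only [Finset.sum_apply, Pi.smul_apply, smul_eq_mul] at h2
      rw [Finset.sum_comm] at h2
      simpa only [Finset.mul_sum] using h2
    have h2 : ∑ p, κ (Pi.single q 1) p ≤ 1 := by
      exact (Finset.sum_le_sum fun p _ => le_mul_of_one_le_right (hcnn q p) (hht p)).trans h1.le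
    have hint := mem_intLattice.1 (hgR k _ (single_mem_intLattice q))
    obtain ⟨p, hp⟩ : ∃ p, κ (Pi.single q 1) p ≠ 0 := by
      by_contra hcon
      push Not at hcon
      simp [hcon] at h1
    have h3 : 1 ≤ κ (Pi.single q 1) p := by
      obtain ⟨n, hn⟩ := hint p
      have h0 := hcnn q p
      change κ (Pi.single q 1) p = n at hn
      rw [hn] at h0 hp ⊢
      have h2 : (0 : ℤ) ≤ n := by exact_mod_cast h0
      have h3 : n ≠ 0 := by exact_mod_cast hp
      exact_mod_cast (by omega : (1 : ℤ) ≤ n)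
    refine ⟨p, ?_⟩
    rw [← Finset.add_sum_erase _ _ (Finset.mem_univ p)] at h2
    have h4 : 0 ≤ ∑ r ∈ Finset.univ.erase p, κ (Pi.single q 1) r :=
      Finset.sum_nonneg fun r _ => hcnn q r
    have h5 : ∑ r ∈ Finset.univ.erase p, κ (Pi.single q 1) r = 0 := by linarith
    ext r
    by_cases hr : r = p
    · subst hr
      rw [Pi.single_eq_same]
      linarith
    · rw [Pi.single_eq_of_ne hr]
      exact (Finset.sum_eq_zero_iff_of_nonneg fun r _ => hcnn q r).1 h5 r
        (Finset.mem_erase.2 ⟨hr, Finset.mem_univ r⟩)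
  choose σ hσ using hsimp
  have hinj : Function.Injective σ := by
    intro p q hpq
    have h1 : κ (Pi.single p 1) = κ (Pi.single q 1) := by rw [hσ, hσ, hpq]
    have h2 := congrFun (κ.injective h1) p
    by_contra hne'
    rw [Pi.single_eq_same, Pi.single_eq_of_ne hne'] at h2
    exact one_ne_zero h2
  exact ⟨k, Equiv.ofBijective σ (Finite.injective_iff_bijective.1 hinj), hσ, hkS⟩

end SimpleRoots

/-! ### Counting isometries of quadratic functions with values in ℤ/4 -/

section Counting

/-- The number of subsequences of a list with a given sum. -/
def subsumCount : List (ZMod 4) → ZMod 4 → ℕ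
  | [], k => if k = 0 then 1 else 0
  | c :: ε, k => subsumCount ε k + subsumCount ε (k - c)

/-- The order of the isometry group of the orthogonal sum of the rank one forms with odd values
`ε` on an elementary abelian `2`-group. -/
def isometryCount : List (ZMod 4) → ℕ
  | [] => 1
  | [_] => 1
  -- The first vector has value c and differs from the characteristic vector. The latter has value
  -- the sum of the list, and its complement contains no odd values, so it cannot be continued by
  -- c'.
  | c :: c' :: ε => (subsumCount (c :: c' :: ε) c -
      (if (c :: c' :: ε).sum = c then 1 else 0)) * isometryCount (c' :: ε)

/-- A quadratic function with values in `ℤ/4` on an elementary abelian `2`-group. -/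
structure IsQuadratic {D : Type*} [AddCommGroup D] (q : D → ZMod 4) : Prop where
  two_torsion : ∀ x : D, x + x = 0
  zero : q 0 = 0
  cube : ∀ x y z, q (x + y + z) = q (x + y) + q (x + z) + q (y + z) - q x - q y - q z

/-- The polar form of a quadratic function. -/
def polar {D : Type*} [AddCommGroup D] (q : D → ZMod 4) (x y : D) : ZMod 4 :=
  q (x + y) - q x - q y

variable {D : Type*} [AddCommGroup D] {q : D → ZMod 4}

lemma polar_comm (x y : D) : polar q x y = polar q y x := by
  rw [polar, polar, add_comm]; ring

lemma apply_add_eq (q : D → ZMod 4) (x y : D) : q (x + y) = q x + q y + polar q x y := by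
  rw [polar]; ring

namespace IsQuadratic

variable (hq : IsQuadratic q)
include hq

lemma polar_add_left (x y z : D) : polar q (x + y) z = polar q x z + polar q y z := by
  simp only [polar, hq.cube]; ring

lemma polar_add_right (x y z : D) : polar q x (y + z) = polar q x y + polar q x z := by
  rw [polar_comm, hq.polar_add_left, polar_comm y, polar_comm z]

lemma polar_zero_left (x : D) : polar q 0 x = 0 := by simp [polar, hq.zero]

lemma polar_zero_right (x : D) : polar q x 0 = 0 := by simp [polar, hq.zero]

lemma polar_self (x : D) : polar q x x = 2 * q x := by
  rw [polar, hq.two_torsion, hq.zero]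
  have : (4 : ZMod 4) = 0 := rfl
  linear_combination (-q x) * this

lemma polar_eq (x y : D) : polar q x y = 0 ∨ polar q x y = 2 := by
  have h : polar q x y + polar q x y = 0 := by
    rw [← hq.polar_add_left, hq.two_torsion, hq.polar_zero_left]
  generalize polar q x y = t at h
  revert h
  revert t
  decide

lemma two_mul_add (x y : D) : 2 * q (x + y) = 2 * q x + 2 * q y := by
  rw [apply_add_eq q]
  rcases hq.polar_eq x y with h | h <;> rw [h]
  · ring
  · have : (4 : ZMod 4) = 0 := rfl
    linear_combination this

/-- The elements of `W` orthogonal to `y`. -/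
def orth (W : AddSubgroup D) (y : D) : AddSubgroup D where
  carrier := {x | x ∈ W ∧ polar q x y = 0}
  add_mem' := fun hx hy => ⟨W.add_mem hx.1 hy.1, by rw [hq.polar_add_left, hx.2, hy.2, add_zero]⟩
  zero_mem' := ⟨W.zero_mem, hq.polar_zero_left y⟩
  neg_mem' := fun {x} hx => by
    have : -x = x := neg_eq_of_add_eq_zero_left (hq.two_torsion x)
    rwa [this]

lemma mem_orth {W : AddSubgroup D} {x y : D} : x ∈ hq.orth W y ↔ x ∈ W ∧ polar q x y = 0 := Iff.rfl

end IsQuadratic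

/-- The number of elements of `W` on which `q` takes the value `k`. -/
noncomputable def valueCount (q : D → ZMod 4) (W : AddSubgroup D) (k : ZMod 4) : ℕ :=
  Nat.card {x : D // x ∈ W ∧ q x = k}

/-- Sequences of mutually orthogonal elements of `W` with prescribed values. -/
def OrthSeq (q : D → ZMod 4) (W : AddSubgroup D) (ε : List (ZMod 4)) : Type _ :=
  {l : List D // List.Forall₂ (fun y c => y ∈ W ∧ q y = c) l ε ∧
    l.Pairwise fun x y => polar q x y = 0}

/-- `W` has the same invariants as an orthogonal sum of rank one forms with values `ε`. -/
structure HasType (q : D → ZMod 4) (W : AddSubgroup D) (ε : List (ZMod 4)) : Prop where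
  nondeg : ∀ x ∈ W, (∀ y ∈ W, polar q x y = 0) → x = 0
  count : ∀ k, valueCount q W k = subsumCount ε k
  char : ∃ w ∈ W, q w = ε.sum ∧ ∀ x ∈ W, polar q x w = 2 * q x

variable [Finite D]

omit [Finite D] in
lemma orthSeq_nil (W : AddSubgroup D) : Nat.card (OrthSeq q W []) = 1 := by
  rw [Nat.card_eq_one_iff_unique]
  refine ⟨⟨fun x y => ?_⟩, ⟨⟨[], List.Forall₂.nil, List.Pairwise.nil⟩⟩⟩
  obtain ⟨l, h, _⟩ := x
  obtain ⟨l', h', _⟩ := y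
  cases h
  cases h'
  rfl

omit [Finite D] in
lemma forall₂_mem_orth (hq : IsQuadratic q) {W : AddSubgroup D} {y : D} {l : List D}
    {ε : List (ZMod 4)} : List.Forall₂ (fun x c => x ∈ hq.orth W y ∧ q x = c) l ε ↔
      List.Forall₂ (fun x c => x ∈ W ∧ q x = c) l ε ∧ ∀ x ∈ l, polar q y x = 0 := by
  induction l generalizing ε with
  | nil => simp
  | cons a l ih =>
    cases ε with
    | nil => simp
    | cons c ε =>
      rw [List.forall₂_cons, List.forall₂_cons, ih, hq.mem_orth, List.forall_mem_cons,
        polar_comm y a]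
      tauto

/-- Splitting off the first element of an orthogonal sequence. -/
def orthSeqCons (hq : IsQuadratic q) (W : AddSubgroup D) (c : ZMod 4) (ε : List (ZMod 4)) :
    OrthSeq q W (c :: ε) ≃ Σ y : {x : D // x ∈ W ∧ q x = c}, OrthSeq q (hq.orth W y) ε where
  toFun l := match l with
    | ⟨y :: l, h⟩ => ⟨⟨y, (List.forall₂_cons.1 h.1).1⟩, ⟨l, (forall₂_mem_orth hq).2
        ⟨(List.forall₂_cons.1 h.1).2, (List.pairwise_cons.1 h.2).1⟩, (List.pairwise_cons.1 h.2).2⟩⟩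
  invFun p := ⟨p.1.1 :: p.2.1, List.Forall₂.cons p.1.2 ((forall₂_mem_orth hq).1 p.2.2.1).1,
    List.pairwise_cons.2 ⟨((forall₂_mem_orth hq).1 p.2.2.1).2, p.2.2.2⟩⟩
  left_inv l := by
    obtain ⟨l, h⟩ := l
    cases l with
    | nil => cases h.1
    | cons y l => rfl
  right_inv p := rfl

lemma finite_orthSeq (hq : IsQuadratic q) (ε : List (ZMod 4)) (W : AddSubgroup D) :
    Finite (OrthSeq q W ε) := by
  induction ε generalizing W with
  | nil => exact Nat.finite_of_card_ne_zero (by rw [orthSeq_nil]; exact one_ne_zero)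
  | cons c ε ih =>
    have : ∀ y : {x : D // x ∈ W ∧ q x = c}, Finite (OrthSeq q (hq.orth W y) ε) :=
      fun y => ih _
    exact Finite.of_equiv _ (orthSeqCons hq W c ε).symm

lemma mul_two_eq_two_iff {c : ZMod 4} : 2 * c = 2 ↔ c = 1 ∨ c = 3 := by revert c; decide

lemma two_ne_zero_zmod : (2 : ZMod 4) ≠ 0 := by decide

omit [AddCommGroup D] in
lemma card_or {P Q : D → Prop} (h : ∀ x, P x → ¬ Q x) :
    Nat.card {x // P x ∨ Q x} = Nat.card {x // P x} + Nat.card {x // Q x} := by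
  classical
  have := Fintype.ofFinite D
  simp only [Nat.card_eq_fintype_card]
  exact Fintype.card_subtype_or_disjoint _ _ (by
    rw [Pi.disjoint_iff]
    intro x
    rw [Prop.disjoint_iff]
    exact fun hx => h x hx.1 hx.2)

/-- As q(y) is odd, W is the orthogonal sum of the complement of y and the group generated by y.
Translation by y matches the elements not orthogonal to y with elements of the complement whose
value is smaller by q(y). -/
lemma valueCount_split (hq : IsQuadratic q) {W : AddSubgroup D} {y : D} (hy : y ∈ W)
    (hodd : 2 * q y = 2) (k : ZMod 4) :
    valueCount q W k = valueCount q (hq.orth W y) k + valueCount q (hq.orth W y) (k - q y) := by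
  have hyy : polar q y y = 2 := by rw [hq.polar_self, hodd]
  have h4 : (4 : ZMod 4) = 0 := rfl
  have e : Nat.card {x // (x ∈ hq.orth W y ∧ q x = k)} +
      Nat.card {x // (x ∈ W ∧ q x = k) ∧ polar q x y = 2} = valueCount q W k := by
    rw [← card_or (fun x hx hx' => two_ne_zero_zmod (hx'.2.symm.trans hx.1.2))]
    refine Nat.card_congr (Equiv.subtypeEquivRight fun x => ?_)
    rw [hq.mem_orth]
    rcases hq.polar_eq x y with h | h <;> simp [h, two_ne_zero_zmod, two_ne_zero_zmod.symm]
  rw [← e, valueCount, valueCount]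
  congr 1
  refine Nat.card_congr
    { toFun := fun x => ⟨x + y, ⟨W.add_mem x.2.1.1 hy, ?_⟩, ?_⟩
      invFun := fun x => ⟨x + y, ⟨W.add_mem x.2.1.1 hy, ?_⟩, ?_⟩
      left_inv := fun x => Subtype.ext ?_
      right_inv := fun x => Subtype.ext ?_ }
  · rw [hq.polar_add_left, x.2.2, hyy]; rfl
  · rw [apply_add_eq q, x.2.1.2, x.2.2]
    linear_combination hodd + h4
  · rw [apply_add_eq q, x.2.2, x.2.1.2]; ring
  · rw [hq.polar_add_left, x.2.1.2, hyy]; ring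
  · change (x : D) + y + y = x
    rw [add_assoc, hq.two_torsion, add_zero]
  · change (x : D) + y + y = x
    rw [add_assoc, hq.two_torsion, add_zero]

/-- Translation by an odd element exchanges even and odd values. -/
lemma valueCount_balanced (hq : IsQuadratic q) {W : AddSubgroup D} {y : D} (hy : y ∈ W)
    (hodd : 2 * q y = 2) : valueCount q W 0 + valueCount q W 2 =
      valueCount q W 1 + valueCount q W 3 := by
  have e : ∀ a b c : ZMod 4, a ≠ b → (∀ t : ZMod 4, 2 * t = c ↔ t = a ∨ t = b) →
      valueCount q W a + valueCount q W b = Nat.card {x // x ∈ W ∧ 2 * q x = c} := by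
    intro a b c hab h
    rw [valueCount, valueCount, ← card_or (fun x hx hx' => hab (hx.2.symm.trans hx'.2))]
    refine Nat.card_congr (Equiv.subtypeEquivRight fun x => ?_)
    rw [h, and_or_left]
  rw [e 0 2 0 (by decide) (by decide), e 1 3 2 (by decide) (by decide)]
  refine Nat.card_congr
    { toFun := fun x => ⟨x + y, W.add_mem x.2.1 hy, ?_⟩
      invFun := fun x => ⟨x + y, W.add_mem x.2.1 hy, ?_⟩
      left_inv := fun x => Subtype.ext ?_
      right_inv := fun x => Subtype.ext ?_ }
  · rw [hq.two_mul_add, x.2.2, hodd]; rfl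
  · rw [hq.two_mul_add, x.2.2, hodd]; rfl
  · change (x : D) + y + y = x
    rw [add_assoc, hq.two_torsion, add_zero]
  · change (x : D) + y + y = x
    rw [add_assoc, hq.two_torsion, add_zero]

lemma subsumCount_balanced {c : ZMod 4} (hc : 2 * c = 2) (ε : List (ZMod 4)) :
    subsumCount (c :: ε) 0 + subsumCount (c :: ε) 2 =
      subsumCount (c :: ε) 1 + subsumCount (c :: ε) 3 := by
  rcases mul_two_eq_two_iff.1 hc with rfl | rfl
  · simp only [subsumCount, show (0 : ZMod 4) - 1 = 3 by decide, show (2 : ZMod 4) - 1 = 1 by decide,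
      show (1 : ZMod 4) - 1 = 0 by decide, show (3 : ZMod 4) - 1 = 2 by decide]
    omega
  · simp only [subsumCount, show (0 : ZMod 4) - 3 = 1 by decide, show (2 : ZMod 4) - 3 = 3 by decide,
      show (1 : ZMod 4) - 3 = 2 by decide, show (3 : ZMod 4) - 3 = 0 by decide]
    omega

/-- The difference d of f and g satisfies d(k) = -d(k - c) with c odd, so it alternates in sign
around ℤ/4. Balance of even and odd positions then forces d = 0. -/
lemma eq_of_split {f g : ZMod 4 → ℕ} {c : ZMod 4} (hc : 2 * c = 2)
    (hf : f 0 + f 2 = f 1 + f 3) (hg : g 0 + g 2 = g 1 + g 3)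
    (h : ∀ k, f k + f (k - c) = g k + g (k - c)) (k : ZMod 4) : f k = g k := by
  have h0 := h 0
  have h1 := h 1
  have h2 := h 2
  have h3 := h 3
  have key : f 0 = g 0 ∧ f 1 = g 1 ∧ f 2 = g 2 ∧ f 3 = g 3 := by
    rcases mul_two_eq_two_iff.1 hc with rfl | rfl
    · simp only [show (0 : ZMod 4) - 1 = 3 by decide, show (2 : ZMod 4) - 1 = 1 by decide,
        show (1 : ZMod 4) - 1 = 0 by decide, show (3 : ZMod 4) - 1 = 2 by decide] at h0 h1 h2 h3
      omega
    · simp only [show (0 : ZMod 4) - 3 = 1 by decide, show (2 : ZMod 4) - 3 = 3 by decide,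
        show (1 : ZMod 4) - 3 = 2 by decide, show (3 : ZMod 4) - 3 = 0 by decide] at h0 h1 h2 h3
      omega
  have hk : k = 0 ∨ k = 1 ∨ k = 2 ∨ k = 3 := by revert k; decide
  rcases hk with rfl | rfl | rfl | rfl
  exacts [key.1, key.2.1, key.2.2.1, key.2.2.2]

/-- The new characteristic vector is w + y. The value counts of the complement are recovered from
those of W through `valueCount_split` and `eq_of_split`. This needs an odd element in the
complement: without one, w + y would be orthogonal to the whole complement, hence zero, contrary to
y ≠ w. -/
lemma HasType.orth (hq : IsQuadratic q) {W : AddSubgroup D} {c c' : ZMod 4} {ε : List (ZMod 4)}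
    (h : HasType q W (c :: c' :: ε)) (hc : 2 * c = 2) (hc' : 2 * c' = 2) {y : D} (hy : y ∈ W)
    (hyc : q y = c) {w : D} (hw : w ∈ W) (hws : q w = (c :: c' :: ε).sum)
    (hwx : ∀ x ∈ W, polar q x w = 2 * q x) (hne : y ≠ w) :
    HasType q (hq.orth W y) (c' :: ε) := by
  have h4 : (4 : ZMod 4) = 0 := rfl
  have hyy : polar q y y = 2 := by rw [hq.polar_self, hyc, hc]
  have hnd : ∀ x ∈ hq.orth W y, (∀ z ∈ hq.orth W y, polar q x z = 0) → x = 0 := by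
    intro x hx hz
    refine h.nondeg x hx.1 fun z hzW => ?_
    rcases hq.polar_eq z y with h0 | h2
    · exact hz z ⟨hzW, h0⟩
    -- An element not orthogonal to y is moved into the complement by adding y, which does not
    -- change its pairing with x.
    · have : z + y ∈ hq.orth W y := ⟨W.add_mem hzW hy, by rw [hq.polar_add_left, h2, hyy]; rfl⟩
      have := hz _ this
      rwa [hq.polar_add_right, hx.2, add_zero] at this
  have hw'W : w + y ∈ W := W.add_mem hw hy
  have hw' : w + y ∈ hq.orth W y := ⟨hw'W, by
    rw [hq.polar_add_left, polar_comm, hwx y hy, hyy, hyc, hc]; rfl⟩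
  have hchar : ∀ x ∈ hq.orth W y, polar q x (w + y) = 2 * q x := fun x hx => by
    rw [hq.polar_add_right, hwx x hx.1, hx.2, add_zero]
  refine ⟨hnd, ?_, w + y, hw', ?_, hchar⟩
  · have hne' : w + y ≠ 0 := by
      intro h0
      apply hne
      rw [← add_left_inj y, hq.two_torsion, h0]
    obtain ⟨z, hz, hzodd⟩ : ∃ z ∈ hq.orth W y, 2 * q z = 2 := by
      by_contra hcon
      push Not at hcon
      apply hne'
      refine hnd _ hw' fun z hz => ?_
      rw [polar_comm]
      rcases hq.polar_eq z (w + y) with h0 | h2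
      · exact h0
      · exact absurd ((hchar z hz).symm.trans h2) (hcon z hz)
    refine eq_of_split hc (valueCount_balanced hq hz hzodd) (subsumCount_balanced hc' ε) fun k => ?_
    have := valueCount_split hq hy (hyc ▸ hc) k
    rw [h.count, hyc] at this
    rw [← this]
    rfl
  · rw [apply_add_eq q, polar_comm, hwx y hy, hws, hyc, List.sum_cons]
    linear_combination c * h4

/-- Induction on the list of values. By `HasType.orth`, the number of continuations of a first
vector y does not depend on y, apart from the characteristic vector, which has none. No
classification of forms is needed, since the type records only value counts and the characteristic
vector. -/
theorem card_orthSeq (hq : IsQuadratic q) (ε : List (ZMod 4)) (hodd : ∀ c ∈ ε, 2 * c = 2)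
    (W : AddSubgroup D) (h : HasType q W ε) : Nat.card (OrthSeq q W ε) = isometryCount ε := by
  classical
  induction ε generalizing W with
  | nil => rw [orthSeq_nil]; rfl
  | cons c ε ih =>
    have hfin : ∀ y : {x : D // x ∈ W ∧ q x = c}, Finite (OrthSeq q (hq.orth W y) ε) :=
      fun y => finite_orthSeq hq _ _
    have : Fintype {x : D // x ∈ W ∧ q x = c} := Fintype.ofFinite _
    rw [Nat.card_congr (orthSeqCons hq W c ε), Nat.card_sigma]
    have hc := hodd c List.mem_cons_self
    cases ε with
    | nil =>
      simp only [orthSeq_nil, Finset.sum_const, Finset.card_univ, smul_eq_mul, mul_one]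
      rw [← Nat.card_eq_fintype_card]
      have := h.count c
      rw [valueCount] at this
      rw [this]
      rcases mul_two_eq_two_iff.1 hc with rfl | rfl <;> rfl
    | cons c' ε =>
      obtain ⟨w, hw, hws, hwx⟩ := h.char
      have hc' := hodd c' (by simp)
      have key : ∀ y : {x : D // x ∈ W ∧ q x = c}, Nat.card (OrthSeq q (hq.orth W y) (c' :: ε)) =
          if (y : D) = w then 0 else isometryCount (c' :: ε) := by
        intro y
        -- On the complement of the characteristic vector 2q vanishes, so the odd value c' is not
        -- attained there.
        split_ifs with hyw
        · rw [Nat.card_eq_zero]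
          left
          refine ⟨fun l => ?_⟩
          obtain ⟨l, hl, _⟩ := l
          cases hl with
          | cons ha _ =>
            have h1 := hwx _ ha.1.1
            rw [← hyw, ha.1.2, ha.2, hc'] at h1
            exact two_ne_zero_zmod h1.symm
        · exact ih (fun d hd => hodd d (List.mem_cons_of_mem _ hd)) _
            (h.orth hq hc hc' y.2.1 y.2.2 hw hws hwx hyw)
      rw [Finset.sum_congr rfl fun y _ => key y, Finset.sum_ite, Finset.sum_const_zero, zero_add,
        Finset.sum_const, smul_eq_mul]
      change _ = (_ - _) * _
      congr 1
      rw [← h.count c, valueCount, Nat.card_eq_fintype_card, ← Finset.card_univ,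
        ← Finset.card_filter_add_card_filter_not (s := Finset.univ)
          (fun y : {x : D // x ∈ W ∧ q x = c} => (y : D) = w)]
      have : (Finset.univ.filter fun y : {x : D // x ∈ W ∧ q x = c} => (y : D) = w).card =
          if (c :: c' :: ε).sum = c then 1 else 0 := by
        split_ifs with hs
        · rw [Finset.card_eq_one]
          refine ⟨⟨w, hw, hws.trans hs⟩, ?_⟩
          ext y
          simp [Subtype.ext_iff]
        · rw [Finset.card_eq_zero, Finset.filter_eq_empty_iff]
          intro y _ hy
          exact hs (hws.symm.trans (hy ▸ y.2.2))
      rw [this, Nat.add_sub_cancel_left]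

/-- Splitting off one vector of Y at a time reproduces the recursion of `subsumCount`. The
characteristic vector is the sum of Y. -/
lemma hasType_of_orthogonal (hq : IsQuadratic q) (Y : List D) (W : AddSubgroup D)
    (hYW : ∀ y ∈ Y, y ∈ W) (hodd : ∀ y ∈ Y, 2 * q y = 2)
    (horth : Y.Pairwise fun x y => polar q x y = 0)
    (hsep : ∀ x ∈ W, (∀ y ∈ Y, polar q x y = 0) → x = 0) : HasType q W (Y.map q) := by
  induction Y generalizing W with
  | nil =>
    have h0 : ∀ x ∈ W, x = 0 := fun x hx => hsep x hx (by simp)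
    refine ⟨fun x hx _ => h0 x hx, fun k => ?_, 0, W.zero_mem, by simp [hq.zero], fun x hx => ?_⟩
    · by_cases hk : k = 0
      · subst hk
        simp only [List.map_nil, subsumCount, if_true]
        rw [valueCount, Nat.card_eq_one_iff_unique]
        exact ⟨⟨fun x y => Subtype.ext ((h0 _ x.2.1).trans (h0 _ y.2.1).symm)⟩,
          ⟨⟨0, W.zero_mem, hq.zero⟩⟩⟩
      · simp only [List.map_nil, subsumCount, if_neg hk]
        rw [valueCount, Nat.card_eq_zero]
        left
        exact ⟨fun x => hk (by rw [← x.2.2, h0 _ x.2.1, hq.zero])⟩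
    · rw [h0 x hx, hq.zero, hq.polar_zero_left, mul_zero]
  | cons y Y ih =>
    have hy := hYW y List.mem_cons_self
    have hyo := hodd y List.mem_cons_self
    have hyy : polar q y y = 2 := by rw [hq.polar_self, hyo]
    obtain ⟨h1, h2⟩ := List.pairwise_cons.1 horth
    obtain ⟨_, hcount, w, hw, hws, hwx⟩ := ih (hq.orth W y)
      (fun z hz => ⟨hYW z (List.mem_cons_of_mem _ hz), by rw [polar_comm]; exact h1 z hz⟩)
      (fun z hz => hodd z (List.mem_cons_of_mem _ hz)) h2
      (fun x hx hxY => hsep x hx.1 fun z hz => by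
        rcases List.mem_cons.1 hz with rfl | hz
        · exact hx.2
        · exact hxY z hz)
    refine ⟨fun x hx hxW => hsep x hx fun z hz => hxW z (hYW z hz), fun k => ?_,
      y + w, W.add_mem hy hw.1, ?_, fun x hx => ?_⟩
    · rw [valueCount_split hq hy hyo, hcount, hcount]
      rfl
    · rw [apply_add_eq q, polar_comm, hw.2, hws, List.map_cons, List.sum_cons, add_zero]
    · rcases hq.polar_eq x y with h0 | h2'
      · rw [hq.polar_add_right, h0, zero_add, hwx x ⟨hx, h0⟩]
      · have hxy : x + y ∈ hq.orth W y := ⟨W.add_mem hx hy, by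
          rw [hq.polar_add_left, h2', hyy]; rfl⟩
        have h3 := hwx _ hxy
        rw [hq.polar_add_left, polar_comm y, hw.2, add_zero, hq.two_mul_add, hyo] at h3
        rw [hq.polar_add_right, h3, h2']
        have h4 : (4 : ZMod 4) = 0 := rfl
        linear_combination h4

/-- The isometries of a quadratic function. -/
abbrev Isom (q : D → ZMod 4) : Type _ := {σ : D ≃ₗ[ℤ] D // ∀ x, q (σ x) = q x}

omit [Finite D] in
lemma Isom.polar (σ : Isom q) (x y : D) : polar q (σ.1 x) (σ.1 y) = polar q x y := by
  rw [K3Frames.polar, K3Frames.polar, ← map_add, σ.2, σ.2, σ.2]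

omit [Finite D] in
lemma apply_sum_of_orthogonal (hq : IsQuadratic q) {n : Type*} (z : n → D)
    (h : ∀ i j, i ≠ j → polar q (z i) (z j) = 0) (s : Finset n) :
    q (∑ i ∈ s, z i) = ∑ i ∈ s, q (z i) := by
  classical
  induction s using Finset.induction_on with
  | empty => simp [hq.zero]
  | insert i s hi ih =>
    rw [Finset.sum_insert hi, Finset.sum_insert hi, apply_add_eq q, ih]
    have : ∀ t : Finset n, i ∉ t → polar q (z i) (∑ j ∈ t, z j) = 0 := by
      intro t
      induction t using Finset.induction_on with
      | empty => intro; simp [hq.polar_zero_right]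
      | insert j t hj iht =>
        intro hit
        rw [Finset.sum_insert hj, hq.polar_add_right, iht (fun h => hit (Finset.mem_insert_of_mem h)),
          h i j (fun h => hit (h ▸ Finset.mem_insert_self _ _)), add_zero]
    rw [this s hi, add_zero]

/-- The additive map that sends an orthogonal basis `y` to the family `z`. -/
noncomputable def orthMap (hq : IsQuadratic q) {n : Type*} [Fintype n] (y z : n → D) : D →+ D where
  toFun x := by
    classical
    exact ∑ i, if polar q x (y i) = 0 then 0 else z i
  map_zero' := by
    simp [hq.polar_zero_left]
  map_add' a b := by
    classical
    rw [← Finset.sum_add_distrib]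
    refine Finset.sum_congr rfl fun i _ => ?_
    rw [hq.polar_add_left]
    rcases hq.polar_eq a (y i) with h | h <;> rcases hq.polar_eq b (y i) with h' | h' <;>
      simp [h, h', two_ne_zero_zmod, hq.two_torsion, show (2 : ZMod 4) + 2 = 0 by decide]

omit [Finite D] in
lemma orthMap_apply (hq : IsQuadratic q) {n : Type*} [Fintype n] [DecidableEq n] (y z : n → D)
    (x : D) : orthMap hq y z x = ∑ i ∈ Finset.univ.filter (fun i => polar q x (y i) ≠ 0), z i := by
  classical
  rw [Finset.sum_filter]
  exact Finset.sum_congr rfl fun i _ => by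
    by_cases h : polar q x (y i) = 0 <;> simp [h]

omit [Finite D] in
lemma orthMap_self (hq : IsQuadratic q) {n : Type*} [Fintype n] [DecidableEq n] {y : n → D}
    (z : n → D) (hodd : ∀ i, 2 * q (y i) = 2) (horth : ∀ i j, i ≠ j → polar q (y i) (y j) = 0)
    (i : n) : orthMap hq y z (y i) = z i := by
  rw [orthMap_apply]
  have : Finset.univ.filter (fun j => polar q (y i) (y j) ≠ 0) = {i} := by
    ext j
    simp only [Finset.mem_filter, Finset.mem_univ, true_and, Finset.mem_singleton]
    constructor
    · intro h
      by_contra hne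
      exact h (horth i j (Ne.symm hne))
    · rintro rfl
      rw [hq.polar_self, hodd]
      exact two_ne_zero_zmod
  rw [this, Finset.sum_singleton]

omit [Finite D] in
lemma polar_orthMap (hq : IsQuadratic q) {n : Type*} [Fintype n] [DecidableEq n] {y z : n → D}
    (hodd : ∀ i, 2 * q (z i) = 2) (horth : ∀ i j, i ≠ j → polar q (z i) (z j) = 0)
    (x : D) (i : n) : polar q (orthMap hq y z x) (z i) = polar q x (y i) := by
  let φ : D →+ ZMod 4 := ⟨⟨fun t => polar q t (z i), hq.polar_zero_left _⟩,
    fun a b => hq.polar_add_left a b _⟩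
  have h1 : polar q (orthMap hq y z x) (z i) = φ (orthMap hq y z x) := rfl
  rw [h1, orthMap_apply, map_sum, Finset.sum_filter, Finset.sum_eq_single i]
  · change (if polar q x (y i) ≠ 0 then polar q (z i) (z i) else 0) = _
    rw [hq.polar_self, hodd]
    rcases hq.polar_eq x (y i) with h | h <;> simp [h, two_ne_zero_zmod]
  · intro j _ hj
    change (if polar q x (y j) ≠ 0 then polar q (z j) (z i) else 0) = 0
    rw [horth j i hj, ite_self]
  · simp

omit [Finite D] in
lemma orthMap_eq_self (hq : IsQuadratic q) {n : Type*} [Fintype n] [DecidableEq n] {y : n → D}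
    (hodd : ∀ i, 2 * q (y i) = 2) (horth : ∀ i j, i ≠ j → polar q (y i) (y j) = 0)
    (hsep : ∀ x, (∀ i, polar q x (y i) = 0) → x = 0) (x : D) : orthMap hq y y x = x := by
  have : orthMap hq y y x + x = 0 := hsep _ fun i => by
    rw [hq.polar_add_left, polar_orthMap hq hodd horth]
    rcases hq.polar_eq x (y i) with h | h <;> rw [h] <;> rfl
  rw [← add_left_inj x, this, hq.two_torsion]

/-- An isometry is determined by the image of the orthogonal basis Y, and this image is an
orthogonal sequence with the same values. Conversely, pairing with such a sequence recovers the
coordinates with respect to Y. So the additive map defined by it is injective, hence bijective on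
the finite group. -/
theorem card_isom_eq (hq : IsQuadratic q) (Y : List D) (hodd : ∀ y ∈ Y, 2 * q y = 2)
    (horth : Y.Pairwise fun x y => polar q x y = 0)
    (hsep : ∀ x, (∀ y ∈ Y, polar q x y = 0) → x = 0) :
    Nat.card (Isom q) = isometryCount (Y.map q) := by
  classical
  rw [← card_orthSeq hq (Y.map q) (by simpa using hodd) ⊤
    (hasType_of_orthogonal hq Y ⊤ (fun _ _ => AddSubgroup.mem_top _) hodd horth
      fun x _ => hsep x)]
  set y : Fin Y.length → D := Y.get with hy
  have hyodd : ∀ i, 2 * q (y i) = 2 := fun i => hodd _ (List.get_mem _ _)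
  have hyorth : ∀ i j, i ≠ j → polar q (y i) (y j) = 0 := by
    intro i j hij
    rcases lt_or_gt_of_ne hij with h | h
    · exact List.pairwise_iff_get.1 horth i j h
    · rw [polar_comm]; exact List.pairwise_iff_get.1 horth j i h
  have hysep : ∀ x, (∀ i, polar q x (y i) = 0) → x = 0 := fun x hx => hsep x fun z hz => by
    obtain ⟨i, rfl⟩ := List.get_of_mem hz
    exact hx i
  have hself := orthMap_eq_self hq hyodd hyorth hysep
  refine Nat.card_congr (Equiv.ofBijective (fun σ => ⟨Y.map σ.1, ?_, ?_⟩) ⟨?_, ?_⟩)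
  · rw [List.forall₂_map_left_iff, List.forall₂_map_right_iff, List.forall₂_same]
    exact fun x _ => ⟨AddSubgroup.mem_top _, σ.2 x⟩
  · rw [List.pairwise_map]
    exact horth.imp fun h => by rw [σ.polar]; exact h
  · intro σ τ h
    have h1 : Y.map σ.1 = Y.map τ.1 := congrArg Subtype.val h
    have h2 : ∀ z ∈ Y, σ.1 z = τ.1 z := fun z hz => List.map_inj_left.1 h1 z hz
    apply Subtype.ext
    ext x
    rw [← hself x, orthMap_apply, map_sum, map_sum]
    exact Finset.sum_congr rfl fun i _ => h2 _ (List.get_mem _ _)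
  · rintro ⟨l, hl, hlorth⟩
    have hlen : l.length = Y.length := by simpa using hl.length_eq
    set z : Fin Y.length → D := fun i => l.get (i.cast hlen.symm) with hz
    have hzq : ∀ i, q (z i) = q (y i) := by
      intro i
      have := (List.forall₂_iff_get.1 hl).2 i (by rw [hlen]; exact i.2) (by simp)
      simpa [hz, hy] using this.2
    have hzodd : ∀ i, 2 * q (z i) = 2 := fun i => by rw [hzq, hyodd]
    have hzorth : ∀ i j, i ≠ j → polar q (z i) (z j) = 0 := by
      intro i j hij
      rcases lt_or_gt_of_ne hij with h | h
      · exact List.pairwise_iff_get.1 hlorth _ _ h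
      · rw [polar_comm]; exact List.pairwise_iff_get.1 hlorth _ _ h
    have hinj : Function.Injective (orthMap hq y z) := by
      rw [injective_iff_map_eq_zero]
      intro x hx
      refine hysep x fun i => ?_
      rw [← polar_orthMap hq (y := y) hzodd hzorth, hx, hq.polar_zero_left]
    let σ : D ≃+ D := AddEquiv.ofBijective (orthMap hq y z) (Finite.injective_iff_bijective.1 hinj)
    refine ⟨⟨σ.toIntLinearEquiv, fun x => ?_⟩, Subtype.ext ?_⟩
    · change q (orthMap hq y z x) = q x
      conv_rhs => rw [← hself x]
      rw [orthMap_apply, orthMap_apply, apply_sum_of_orthogonal hq z hzorth,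
        apply_sum_of_orthogonal hq y hyorth]
      exact Finset.sum_congr rfl fun i _ => hzq i
    · change Y.map (orthMap hq y z) = l
      refine List.ext_get (by simp [hlen]) fun i h1 h2 => ?_
      have h3 : i < Y.length := by simpa using h1
      have := orthMap_self hq z hyodd hyorth ⟨i, h3⟩
      simpa [hz, hy] using this

/-- The sum of a quadratic function and the rank one form with value `1`. -/
def stabilize (q : D → ZMod 4) (x : D × ZMod 2) : ZMod 4 := q x.1 + if x.2 = 0 then 0 else 1

omit [Finite D] in
lemma isQuadratic_stabilize (hq : IsQuadratic q) : IsQuadratic (stabilize q) := by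
  refine ⟨fun x => Prod.ext (hq.two_torsion _) (by
    change x.2 + x.2 = 0
    generalize x.2 = t
    revert t
    decide), by simp [stabilize, hq.zero], fun x y z => ?_⟩
  have key : ∀ a b c : ZMod 2, (if a + b + c = 0 then (0 : ZMod 4) else 1) =
      (if a + b = 0 then 0 else 1) + (if a + c = 0 then 0 else 1) + (if b + c = 0 then 0 else 1) -
      (if a = 0 then 0 else 1) - (if b = 0 then 0 else 1) - (if c = 0 then 0 else 1) := by decide
  simp only [stabilize, Prod.fst_add, Prod.snd_add, hq.cube x.1 y.1 z.1, key x.2 y.2 z.2]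
  ring

omit [Finite D] in
lemma polar_stabilize (x y : D × ZMod 2) :
    polar (stabilize q) x y = polar q x.1 y.1 + if x.2 = 0 ∨ y.2 = 0 then 0 else 2 := by
  have key : ∀ a b : ZMod 2, (if a + b = 0 then (0 : ZMod 4) else 1) -
      (if a = 0 then 0 else 1) - (if b = 0 then 0 else 1) = if a = 0 ∨ b = 0 then 0 else 2 := by
    decide
  rw [← key]
  simp only [polar, stabilize, Prod.fst_add, Prod.snd_add]
  ring

omit [Finite D] in
-- If q has even values, then (0, 1) represents twice the stabilized function under the polar form,
-- so by nondegeneracy it is the unique characteristic vector and every isometry fixes it. The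
-- second coordinate is the parity of the value, so it is preserved as well. Hence an isometry is
-- the product of one of q with the identity.
theorem card_isom_stabilize (hq : IsQuadratic q) (heven : ∀ x, 2 * q x = 0)
    (hsep : ∀ z : D × ZMod 2, (∀ y, polar (stabilize q) z y = 0) → z = 0) :
    Nat.card (Isom (stabilize q)) = Nat.card (Isom q) := by
  have hs := isQuadratic_stabilize hq
  have h01 : (1 : ZMod 2) ≠ 0 := by decide
  have hchar : ∀ z, polar (stabilize q) z (0, 1) = 2 * stabilize q z := by
    intro z
    rw [polar_stabilize, hq.polar_zero_right, stabilize, mul_add, heven]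
    by_cases h : z.2 = 0 <;> simp [h]
  have hfix : ∀ τ : Isom (stabilize q), τ.1 (0, 1) = (0, 1) := by
    intro τ
    have : τ.1 (0, 1) + (0, 1) = 0 := by
      refine hsep _ fun y => ?_
      obtain ⟨x, rfl⟩ := τ.1.surjective y
      rw [hs.polar_add_left, τ.polar, polar_comm, hchar, polar_comm, hchar, τ.2, ← hs.polar_self,
        ← hs.polar_add_left, hs.two_torsion, hs.polar_zero_left]
    rw [← add_left_inj ((0 : D), (1 : ZMod 2)), this, hs.two_torsion]
  have hsnd : ∀ (τ : Isom (stabilize q)) z, (τ.1 z).2 = z.2 := by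
    intro τ z
    have h : 2 * stabilize q (τ.1 z) = 2 * stabilize q z := by rw [τ.2]
    simp only [stabilize, mul_add, heven, zero_add] at h
    have key : ∀ a b : ZMod 2, 2 * (if a = 0 then (0 : ZMod 4) else 1) =
        2 * (if b = 0 then 0 else 1) → a = b := by decide
    exact key _ _ h
  have hfst : ∀ (τ : Isom (stabilize q)) (x : D), τ.1 (x, 0) = ((τ.1 (x, 0)).1, 0) :=
    fun τ x => Prod.ext rfl (hsnd τ (x, 0))
  have hinv : ∀ τ : Isom (stabilize q), ∀ x, stabilize q (τ.1.symm x) = stabilize q x :=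
    fun τ x => by rw [← τ.2, LinearEquiv.apply_symm_apply]
  refine Nat.card_congr
    { toFun := fun τ => ⟨LinearEquiv.ofLinearMap
        ((LinearMap.fst ℤ D (ZMod 2)).comp (τ.1.toLinearMap.comp (LinearMap.inl ℤ D (ZMod 2))))
        ((LinearMap.fst ℤ D (ZMod 2)).comp (τ.1.symm.toLinearMap.comp (LinearMap.inl ℤ D (ZMod 2))))
        (LinearMap.ext fun x => ?_) (LinearMap.ext fun x => ?_), fun x => ?_⟩
      invFun := fun σ => ⟨σ.1.prodCongr (LinearEquiv.refl ℤ (ZMod 2)), fun x => ?_⟩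
      left_inv := fun τ => ?_
      right_inv := fun σ => ?_ }
  · have h := hfst ⟨τ.1.symm, hinv τ⟩ x
    change (τ.1 ((τ.1.symm (x, 0)).1, 0)).1 = x
    rw [← h, LinearEquiv.apply_symm_apply]
  · have h := hfst τ x
    change (τ.1.symm ((τ.1 (x, 0)).1, 0)).1 = x
    rw [← h, LinearEquiv.symm_apply_apply]
  · have h := τ.2 (x, 0)
    rw [hfst] at h
    simpa [stabilize] using h
  · change q (σ.1 x.1) + _ = _
    rw [σ.2]
    rfl
  · apply Subtype.ext
    apply LinearEquiv.ext
    intro z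
    have h2 : ∀ t : ZMod 2, τ.1 (0, t) = (0, t) := by
      intro t
      have : t = 0 ∨ t = 1 := by revert t; decide
      rcases this with rfl | rfl
      · exact map_zero τ.1
      · exact hfix τ
    have h3 : z = (z.1, 0) + (0, z.2) := by ext <;> simp
    conv_rhs => rw [h3, map_add, h2, hfst]
    change ((τ.1 (z.1, 0)).1, z.2) = _
    simp
  · apply Subtype.ext
    apply LinearEquiv.ext
    intro z
    rfl

end Counting

/-! ### Group orders from orbit lengths along a base -/

section Chain

variable {Γ X : Type*} [Group Γ] [MulAction Γ X]

variable (Γ) in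
/-- The pointwise stabilizer of a list of points. -/
def listStabilizer (pre : List X) : Subgroup Γ where
  carrier := {g | ∀ x ∈ pre, g • x = x}
  mul_mem' := fun {g k} hg hk x hx => by rw [mul_smul, hk x hx, hg x hx]
  one_mem' := fun x _ => one_smul _ x
  inv_mem' := fun {g} hg x hx => by rw [inv_smul_eq_iff, hg x hx]

variable (Γ) in
/-- The sizes of the successive orbits along a base are related to given numbers. -/
def OrbitChain (r : ℕ → ℕ → Prop) : List X → List (X × ℕ) → Prop
  | pre, [] => listStabilizer Γ pre = ⊥
  | pre, (x, t) :: xs => r (MulAction.orbit (listStabilizer Γ pre) x).ncard t ∧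
      OrbitChain r (x :: pre) xs

/-- Orbit-stabilizer, repeated along the base: the stabilizer of the next point in the current
pointwise stabilizer is the next pointwise stabilizer, and the last one is trivial. -/
lemma OrbitChain.rel_card [Finite Γ] {r : ℕ → ℕ → Prop} (h1 : r 1 1)
    (hmul : ∀ a b c d, r a b → r c d → r (a * c) (b * d)) {pre : List X} {xs : List (X × ℕ)}
    (h : OrbitChain Γ r pre xs) : r (Nat.card (listStabilizer Γ pre)) (xs.map Prod.snd).prod := by
  induction xs generalizing pre with
  | nil =>
    change listStabilizer Γ pre = ⊥ at h
    rw [h]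
    simpa using h1
  | cons x xs ih =>
    obtain ⟨x, t⟩ := x
    obtain ⟨ho, hc⟩ := h
    have e : Nat.card (MulAction.stabilizer (listStabilizer Γ pre) x) =
        Nat.card (listStabilizer Γ (x :: pre)) := by
      refine Nat.card_congr
        { toFun := fun g => ⟨g.1.1, fun y hy => ?_⟩
          invFun := fun g => ⟨⟨g.1, fun y hy => g.2 y (List.mem_cons_of_mem _ hy)⟩,
            g.2 x List.mem_cons_self⟩
          left_inv := fun g => rfl
          right_inv := fun g => rfl }
      rcases List.mem_cons.1 hy with rfl | hy
      · exact g.2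
      · exact g.1.2 y hy
    rw [← (MulAction.stabilizer (listStabilizer Γ pre) x).card_mul_index, MulAction.index_stabilizer,
      e, mul_comm, List.map_cons, List.prod_cons]
    exact hmul _ _ _ _ ho (ih hc)

lemma OrbitChain.rel_card_group [Finite Γ] {r : ℕ → ℕ → Prop} (h1 : r 1 1)
    (hmul : ∀ a b c d, r a b → r c d → r (a * c) (b * d)) {xs : List (X × ℕ)}
    (h : OrbitChain Γ r [] xs) : r (Nat.card Γ) (xs.map Prod.snd).prod := by
  have e : listStabilizer Γ ([] : List X) = ⊤ := by
    ext g
    simp [listStabilizer]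
  have := h.rel_card h1 hmul
  rwa [e, Subgroup.card_top] at this

end Chain

/-! ### Binary words as natural numbers and linear algebra over the field with two elements -/

section Masks

/-- The sum of the weights of the bits of `w`. -/
def bitSum (cs : List ℕ) : ℕ → ℕ :=
  -- Explicit recursors and binary operations on numerals keep this function, and those below, cheap
  -- to evaluate in the kernel.
  List.rec (fun _ => 0) (fun c _ ih w => Nat.add (Nat.mul (Nat.mod w 2) c) (ih (Nat.div w 2))) cs

/-- The number of bits of `w` below position `r`. -/
def bitCount : ℕ → ℕ → ℕ
  | 0, _ => 0
  | r + 1, w => w % 2 + bitCount r (w / 2)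

/-- All sums modulo two of sublists. -/
def xorSpan : List ℕ → List ℕ
  | [] => [0]
  | x :: xs => xorSpan xs ++ (xorSpan xs).map (Nat.xor x)

/-- The mask of a list of binary digits. -/
def toMask : List ℕ → ℕ
  | [] => 0
  | b :: v => b + 2 * toMask v

/-- Reduction of a mask by an echelon basis. -/
def xorReduce (ech : List ℕ) : ℕ → ℕ :=
  List.rec (fun w => w)
    -- For b ≠ 0, adding b decreases w exactly when the leading bit of b occurs in w.
    (fun b _ ih w => ih (cond (Nat.ble (Nat.xor w b) w) (Nat.xor w b) w)) ech

/-- An echelon basis of the span of `B` that extends `ech`. -/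
def echelon : List ℕ → List ℕ → List ℕ
  | ech, [] => ech
  | ech, b :: B => echelon (ech ++ [xorReduce ech b]) B

/-- The action of a sequence of transpositions of positions on a position. -/
def moveIndex : List (ℕ × ℕ) → ℕ → ℕ
  | [], i => i
  | p :: g, i => moveIndex g (cond (Nat.beq i p.1) p.2 (cond (Nat.beq i p.2) p.1 i))

/-- The action of a sequence of transpositions of positions on a mask. -/
def moveMask (g : List (ℕ × ℕ)) : ℕ → ℕ :=
  List.rec (fun w => w) (fun p _ ih w => ih (cond (Nat.beq (Nat.mod (Nat.shiftRight w p.1) 2)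
    (Nat.mod (Nat.shiftRight w p.2) 2)) w (Nat.xor w (Nat.add (Nat.pow 2 p.1) (Nat.pow 2 p.2))))) g

/-- Membership in a list of natural numbers. -/
def memNat (n : ℕ) (l : List ℕ) : Bool :=
  List.rec false (fun m _ ih => cond (Nat.beq n m) true ih) l

/-- The sum of the values of a function on a list. -/
def sumMap (f : ℕ → ℕ) (l : List ℕ) : ℕ :=
  List.rec 0 (fun m _ ih => Nat.add (f m) ih) l

/-- The closure of `seen` and `front` under `f`. -/
def closeUp (f : ℕ → List ℕ) : ℕ → List ℕ → List ℕ → List ℕ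
  | 0, _, seen => seen
  | _, [], seen => seen
  | n + 1, w :: front, seen =>
    let new := (f w).filter fun v => !memNat v seen
    closeUp f n (front ++ new) (seen ++ new)

/-- A set of masks closed under addition modulo two. -/
structure XorClosed (S : ℕ → Prop) : Prop where
  zero : S 0
  xor : ∀ {a b}, S a → S b → S (a ^^^ b)

lemma mem_xorSpan_cons {x w : ℕ} {B : List ℕ} :
    w ∈ xorSpan (x :: B) ↔ w ∈ xorSpan B ∨ x ^^^ w ∈ xorSpan B := by
  change w ∈ xorSpan B ++ (xorSpan B).map (Nat.xor x) ↔ _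
  rw [List.mem_append, List.mem_map]
  refine or_congr_right ⟨?_, fun h => ⟨_, h, ?_⟩⟩
  · rintro ⟨a, ha, rfl⟩
    change x ^^^ (x ^^^ a) ∈ _
    rwa [← Nat.xor_assoc, Nat.xor_self, Nat.zero_xor]
  · change x ^^^ (x ^^^ w) = w
    rw [← Nat.xor_assoc, Nat.xor_self, Nat.zero_xor]

lemma xorSpan_closed (B : List ℕ) : XorClosed (· ∈ xorSpan B) := by
  induction B with
  | nil => exact ⟨by simp [xorSpan], by simp [xorSpan]⟩
  | cons x B ih =>
    refine ⟨mem_xorSpan_cons.2 (Or.inl ih.zero), fun {a b} ha hb => ?_⟩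
    rw [mem_xorSpan_cons] at ha hb ⊢
    rcases ha with ha | ha <;> rcases hb with hb | hb
    · exact Or.inl (ih.xor ha hb)
    · right
      have := ih.xor ha hb
      rwa [← Nat.xor_assoc, Nat.xor_comm a x, Nat.xor_assoc] at this
    · right
      have := ih.xor ha hb
      rwa [Nat.xor_assoc] at this
    · left
      have := ih.xor ha hb
      rwa [Nat.xor_comm x a, Nat.xor_assoc, ← Nat.xor_assoc x x, Nat.xor_self,
        Nat.zero_xor] at this

lemma subset_xorSpan {B : List ℕ} {x : ℕ} (h : x ∈ B) : x ∈ xorSpan B := by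
  induction B with
  | nil => simp at h
  | cons y B ih =>
    rw [mem_xorSpan_cons]
    rcases List.mem_cons.1 h with rfl | h
    · right
      rw [Nat.xor_self]
      exact (xorSpan_closed B).zero
    · exact Or.inl (ih h)

lemma xorSpan_le {B : List ℕ} {S : ℕ → Prop} (hS : XorClosed S) (h : ∀ x ∈ B, S x) :
    ∀ w ∈ xorSpan B, S w := by
  induction B with
  | nil =>
    intro w hw
    simp only [xorSpan, List.mem_singleton] at hw
    exact hw ▸ hS.zero
  | cons y B ih =>
    intro w hw
    have ih' := ih fun x hx => h x (List.mem_cons_of_mem _ hx)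
    rcases mem_xorSpan_cons.1 hw with hw | hw
    · exact ih' w hw
    · have := hS.xor (h y List.mem_cons_self) (ih' _ hw)
      rwa [← Nat.xor_assoc, Nat.xor_self, Nat.zero_xor] at this

lemma length_xorSpan (B : List ℕ) : (xorSpan B).length = 2 ^ B.length := by
  induction B with
  | nil => rfl
  | cons x B ih =>
    rw [xorSpan, List.length_append, List.length_map, ih, List.length_cons, pow_succ, mul_two]

lemma xorReduce_xor {S : ℕ → Prop} (hS : XorClosed S) {ech : List ℕ} (h : ∀ b ∈ ech, S b)
    (w : ℕ) : S (xorReduce ech w ^^^ w) := by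
  induction ech generalizing w with
  | nil =>
    change S (w ^^^ w)
    rw [Nat.xor_self]
    exact hS.zero
  | cons b ech ih =>
    change S (xorReduce ech (cond (Nat.ble (Nat.xor w b) w) (Nat.xor w b) w) ^^^ w)
    have ih' := ih fun x hx => h x (List.mem_cons_of_mem _ hx)
    cases Nat.ble (Nat.xor w b) w
    · exact ih' w
    · have := hS.xor (ih' (w ^^^ b)) (h b List.mem_cons_self)
      rw [Nat.xor_assoc, Nat.xor_assoc w, Nat.xor_self, Nat.xor_zero] at this
      exact this

lemma of_xorReduce_eq_zero {S : ℕ → Prop} (hS : XorClosed S) {ech : List ℕ} (h : ∀ b ∈ ech, S b)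
    {w : ℕ} (hw : xorReduce ech w = 0) : S w := by
  have := xorReduce_xor hS h w
  rwa [hw, Nat.zero_xor] at this

lemma echelon_mem {S : ℕ → Prop} (hS : XorClosed S) {B : List ℕ} (h : ∀ b ∈ B, S b)
    {ech : List ℕ} (hech : ∀ b ∈ ech, S b) : ∀ b ∈ echelon ech B, S b := by
  induction B generalizing ech with
  | nil => exact hech
  | cons b B ih =>
    refine ih (fun x hx => h x (List.mem_cons_of_mem _ hx)) fun x hx => ?_
    rcases List.mem_append.1 hx with hx | hx
    · exact hech x hx
    · rw [List.mem_singleton.1 hx]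
      have := hS.xor (xorReduce_xor hS hech b) (h b List.mem_cons_self)
      rwa [Nat.xor_assoc, Nat.xor_self, Nat.xor_zero] at this

/-- A criterion for `w` to lie in the span of `B`. -/
def inSpan (B : List ℕ) (w : ℕ) : Bool := Nat.beq (xorReduce (echelon [] B) w) 0

/-- Each reduction step adds an element of the span, so reduction to zero proves membership. The
converse, and the echelon shape itself, play no role. -/
lemma mem_xorSpan_of_inSpan {B : List ℕ} {w : ℕ} (h : inSpan B w = true) : w ∈ xorSpan B :=
  of_xorReduce_eq_zero (xorSpan_closed B) (echelon_mem (xorSpan_closed B)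
    (fun _ => subset_xorSpan) (by simp)) (Nat.eq_of_beq_eq_true h)

lemma bitSum_eq (cs : List ℕ) (w : ℕ) : bitSum cs w =
    ∑ i ∈ Finset.range cs.length, if w.testBit i then cs.getD i 0 else 0 := by
  induction cs generalizing w with
  | nil => rfl
  | cons c cs ih =>
    change w % 2 * c + bitSum cs (w / 2) = _
    rw [ih, List.length_cons, Finset.sum_range_succ', add_comm]
    congr 1
    · refine Finset.sum_congr rfl fun i _ => ?_
      rw [Nat.testBit_add_one, List.getD_cons_succ]
    · rw [List.getD_cons_zero, Nat.testBit_zero]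
      rcases Nat.mod_two_eq_zero_or_one w with h | h <;> simp [h]

lemma bitCount_eq (r w : ℕ) : bitCount r w =
    ∑ i ∈ Finset.range r, if w.testBit i then 1 else 0 := by
  induction r generalizing w with
  | zero => rfl
  | succ r ih =>
    change w % 2 + bitCount r (w / 2) = _
    rw [ih, Finset.sum_range_succ', add_comm]
    congr 1
    · exact Finset.sum_congr rfl fun i _ => by rw [Nat.testBit_add_one]
    · rw [Nat.testBit_zero]
      rcases Nat.mod_two_eq_zero_or_one w with h | h <;> simp [h]

lemma bitCount_xor (r a b : ℕ) :
    bitCount r (a ^^^ b) + 2 * bitCount r (a &&& b) = bitCount r a + bitCount r b := by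
  simp only [bitCount_eq, Finset.mul_sum, ← Finset.sum_add_distrib]
  refine Finset.sum_congr rfl fun i _ => ?_
  rw [Nat.testBit_xor, Nat.testBit_and]
  cases a.testBit i <;> cases b.testBit i <;> rfl

lemma sumMap_eq (f : ℕ → ℕ) (l : List ℕ) : sumMap f l = (l.map f).sum := by
  induction l with
  | nil => rfl
  | cons a l ih =>
    change f a + sumMap f l = _
    rw [ih, List.map_cons, List.sum_cons]

lemma memNat_iff {n : ℕ} {l : List ℕ} : memNat n l = true ↔ n ∈ l := by
  induction l with
  | nil => simp [memNat]
  | cons a l ih =>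
    change cond (Nat.beq n a) true (memNat n l) = true ↔ _
    rw [List.mem_cons, ← ih]
    by_cases h : n = a
    · subst h
      simp
    · have : Nat.beq n a = false := by
        rw [← Bool.not_eq_true]
        exact fun h' => h (Nat.eq_of_beq_eq_true h')
      simp [this, h]

/-- Only this invariance is used: whatever the search finds is reachable. Completeness is not
claimed, since the bounded number of steps may stop the search early. -/
lemma closeUp_induction {f : ℕ → List ℕ} {Q : ℕ → Prop} (hf : ∀ w, Q w → ∀ v ∈ f w, Q v) (n : ℕ)
    {front seen : List ℕ} (h1 : ∀ w ∈ front, Q w) (h2 : ∀ w ∈ seen, Q w) :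
    ∀ w ∈ closeUp f n front seen, Q w := by
  induction n generalizing front seen with
  | zero => simpa [closeUp] using h2
  | succ n ih =>
    cases front with
    | nil => simpa [closeUp] using h2
    | cons w front =>
      have hnew : ∀ v ∈ (f w).filter fun v => !memNat v seen, Q v := fun v hv =>
        hf w (h1 w List.mem_cons_self) v (List.mem_filter.1 hv).1
      refine ih (fun v hv => ?_) fun v hv => ?_
      · rcases List.mem_append.1 hv with hv | hv
        · exact h1 v (List.mem_cons_of_mem _ hv)
        · exact hnew v hv
      · rcases List.mem_append.1 hv with hv | hv
        · exact h2 v hv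
        · exact hnew v hv

lemma moveIndex_cons (p : ℕ × ℕ) (g : List (ℕ × ℕ)) (i : ℕ) :
    moveIndex (p :: g) i = moveIndex g (Equiv.swap p.1 p.2 i) := by
  have : ∀ a b : ℕ, Nat.beq a b = decide (a = b) := fun a b => by
    by_cases h : a = b
    · simp [h]
    · rw [decide_eq_false h, ← Bool.not_eq_true]
      exact fun h' => h (Nat.eq_of_beq_eq_true h')
  rw [moveIndex, Equiv.swap_apply_def, this, this]
  congr 1
  by_cases h : i = p.1 <;> by_cases h' : i = p.2 <;> simp [h, h']

lemma moveIndex_injective (g : List (ℕ × ℕ)) : Function.Injective (moveIndex g) := by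
  induction g with
  | nil => exact fun _ _ h => h
  | cons p g ih =>
    intro i j h
    rw [moveIndex_cons, moveIndex_cons] at h
    exact (Equiv.swap p.1 p.2).injective (ih h)

lemma moveIndex_lt {r : ℕ} {g : List (ℕ × ℕ)} (hg : ∀ p ∈ g, p.1 < r ∧ p.2 < r) {i : ℕ}
    (hi : i < r) : moveIndex g i < r := by
  induction g generalizing i with
  | nil => exact hi
  | cons p g ih =>
    rw [moveIndex_cons]
    refine ih (fun x hx => hg x (List.mem_cons_of_mem _ hx)) ?_
    have := hg p List.mem_cons_self
    rw [Equiv.swap_apply_def]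
    split_ifs
    exacts [this.2, this.1, hi]

lemma testBit_two_pow_add {a b : ℕ} (h : a ≠ b) (i : ℕ) :
    (2 ^ a + 2 ^ b).testBit i = (decide (i = a) || decide (i = b)) := by
  have e : 2 ^ a + 2 ^ b = 2 ^ a ||| 2 ^ b := by
    have key : ∀ a b : ℕ, b < a → 2 ^ a + 2 ^ b = 2 ^ a ||| 2 ^ b := fun a b hab => by
      have := Nat.two_pow_add_eq_or_of_lt (Nat.pow_lt_pow_right one_lt_two hab) 1
      rwa [mul_one] at this
    rcases lt_or_gt_of_ne h with h | h
    · rw [add_comm, key b a h, Nat.or_comm]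
    · exact key a b h
  rw [e, Nat.testBit_or, Nat.testBit_two_pow, Nat.testBit_two_pow]
  simp [eq_comm]

/-- A transposition changes a word only if its two bits differ, and then it flips both. The addition
2^a + 2^b in the definition is the word with these two bits. -/
lemma testBit_moveMask (g : List (ℕ × ℕ)) (w i : ℕ) :
    (moveMask g w).testBit (moveIndex g i) = w.testBit i := by
  induction g generalizing w i with
  | nil => rfl
  | cons p g ih =>
    rw [moveIndex_cons]
    change (moveMask g (cond (Nat.beq (w >>> p.1 % 2) (w >>> p.2 % 2)) w
      (w ^^^ (2 ^ p.1 + 2 ^ p.2)))).testBit _ = _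
    rw [ih]
    have hb : ∀ k, w.testBit k = decide (w >>> k % 2 = 1) := fun k => by
      rw [← Nat.testBit_zero, Nat.testBit_shiftRight, add_zero]
    by_cases h : w >>> p.1 % 2 = w >>> p.2 % 2
    · rw [h, show ∀ a : ℕ, Nat.beq a a = true from fun a => Nat.beq_refl a, cond_true]
      have h' : w.testBit p.1 = w.testBit p.2 := by rw [hb, hb, h]
      rw [Equiv.swap_apply_def]
      split_ifs with h1 h2
      · rw [h1, h']
      · rw [h2, h']
      · rfl
    · have h0 : Nat.beq (w >>> p.1 % 2) (w >>> p.2 % 2) = false := by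
        rw [← Bool.not_eq_true]
        exact fun h' => h (Nat.eq_of_beq_eq_true h')
      have hne : p.1 ≠ p.2 := fun h' => h (by rw [h'])
      have h' : w.testBit p.1 = !w.testBit p.2 := by
        rw [hb, hb]
        rcases Nat.mod_two_eq_zero_or_one (w >>> p.1) with h1 | h1 <;>
          rcases Nat.mod_two_eq_zero_or_one (w >>> p.2) with h2 | h2 <;> simp_all
      rw [h0, cond_false, Nat.testBit_xor, testBit_two_pow_add hne, Equiv.swap_apply_def]
      split_ifs with h1 h2
      · simp [h1, h']
      · simp [h2, h']
      · simp [h1, h2]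

end Masks


/-! ### Dynkin diagrams as adjacency words, and invariants of their automorphisms -/

namespace RootType

/-- The neighbours of a node of the Dynkin diagram. -/
def adj : RootType → ℕ → ℕ
  | A n, i => (if i = 0 then 0 else 2 ^ (i - 1)) + (if i + 1 < n then 2 ^ (i + 1) else 0)
  | D n, i => (if i = 0 ∨ i + 1 = n then 0 else 2 ^ (i - 1)) + (if i + 2 < n then 2 ^ (i + 1) else 0)
      + (if i + 3 = n then 2 ^ (n - 1) else 0) + (if i + 1 = n then 2 ^ (n - 3) else 0)
  | E6, i => [4, 8, 9, 22, 40, 16].getD i 0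
  | E7, i => [4, 8, 9, 22, 40, 80, 32].getD i 0
  | E8, i => [4, 8, 9, 22, 40, 80, 160, 64].getD i 0

/-- The sum of the bits at the even positions below `n`. -/
def evenBits (n : ℕ) : ℕ := (4 ^ (n / 2) - 1) / 3

/-- Doubled representatives of generators of the discriminant group, with a position that occurs
in this word only. -/
def words : RootType → List (ℕ × ℕ)
  | A _ => [(0, 1)]
  -- For even n these are the two half-spin classes: half of every second node of the chain,
  -- together with one of the two fork ends.
  | D n => [(n - 2, evenBits (n - 2) + 2 ^ (n - 2)), (n - 1, evenBits (n - 2) + 2 ^ (n - 1))]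
  | E7 => [(6, 82)]
  | _ => []

end RootType

/-- The components with their offsets. -/
def blocks : List RootType → ℕ → List (RootType × ℕ)
  | [], _ => []
  | t :: L, o => (t, o) :: blocks L (o + t.rank)

def rankSum (L : List RootType) : ℕ := (L.map RootType.rank).sum

def adjMasks (L : List RootType) : List ℕ :=
  (blocks L 0).flatMap fun p => (List.range p.1.rank).map fun i => p.1.adj i * 2 ^ p.2

def wordMasks (L : List RootType) : List ℕ :=
  (blocks L 0).flatMap fun p => p.1.words.map fun e => e.2 * 2 ^ p.2

/-- Twice the weight of a node plus the weights of its neighbours. -/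
def weightStep (adjs cs : List ℕ) : List ℕ :=
  List.zipWith (fun c m => 2 * c + bitSum cs m) cs adjs

/-- With A the adjacency matrix, the n-th list is (2 + A)^n applied to the all-one vector. It is
invariant under diagram automorphisms and serves to tell apart nodes in different positions. -/
def weights (adjs : List ℕ) : ℕ → List ℕ
  | 0 => adjs.map fun _ => 1
  | n + 1 => weightStep adjs (weights adjs n)

/-- An invariant of a pair of masks under permutations that preserve the weights. -/
def pairWeight (cs : List ℕ) (a b : ℕ) : ℕ :=
  Nat.mul (Nat.mul (Nat.succ (bitSum cs a)) (Nat.pow (Nat.add (bitSum cs b) 2) 2))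
    (Nat.add (Nat.pow (bitSum cs (Nat.xor a b)) 2) 3)

/-- An invariant of a pair of classes of masks modulo `Gs`. -/
def classWeight (fine : Bool) (cs Gs : List ℕ) (x y : ℕ) : ℕ :=
  cond fine (sumMap (fun c => sumMap (fun d => pairWeight cs (Nat.xor x c) (Nat.xor y d)) Gs) Gs)
    (sumMap (fun c => Nat.pow (Nat.succ (bitSum cs (Nat.xor (Nat.xor x y) c))) 5) Gs)

/-- An upper bound for the orbit of x under the stabilizer of `prev`: only classes whose invariant
relative to every fixed class is that of x can occur. -/
def orbitBound (fine : Bool) (cs Gs Ds prev : List ℕ) (x : ℕ) : List ℕ :=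
  Ds.filter fun t => prev.all fun y => Nat.beq (classWeight fine cs Gs y t) (classWeight fine cs Gs y x)

/-- A lower bound for the same orbit, obtained from those generators that visibly fix all of `prev`.
Words are reduced modulo the glue; 1000 limits the number of search steps. -/
def orbitList (ech : List ℕ) (gens : List (List (ℕ × ℕ))) (prev : List ℕ) (x : ℕ) : List ℕ :=
  closeUp (fun w => (gens.filter fun g => prev.all fun y => Nat.beq (xorReduce ech (moveMask g y)) y).map
    fun g => xorReduce ech (moveMask g w)) 1000 [x] [x]

/-- An entry is an orbit length when the upper bound is contained in the lower bound, and 0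
otherwise. A nonzero product therefore certifies all entries at once. -/
def chainSizes (fine : Bool) (cs Gs Ds ech : List ℕ) (gens : List (List (ℕ × ℕ))) : List ℕ → List ℕ → List ℕ
  | _, [] => []
  | prev, x :: xs =>
    (if (orbitBound fine cs Gs Ds prev x).all (fun t => memNat t (orbitList ech gens prev x)) then
      (orbitBound fine cs Gs Ds prev x).length else 0) :: chainSizes fine cs Gs Ds ech gens (x :: prev) xs


/-! ### Lattices generated by simple roots and half sums of simple roots -/

section MaskLattice

variable {ι : Type*} [Fintype ι] [DecidableEq ι] {r : ℕ}

/-- The vector with coordinates `1/2` at the bits of `w`. -/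
def halfVec (e : ι ≃ Fin r) (w : ℕ) : ι → ℚ := fun p => if w.testBit (e p) then 1 / 2 else 0

/-- The lattice generated by `ℤ^ι` and the vectors `halfVec e g`. -/
def maskLattice (e : ι ≃ Fin r) (G : List ℕ) : Submodule ℤ (ι → ℚ) :=
  intLattice ι ⊔ Submodule.span ℤ {x | ∃ g ∈ G, x = halfVec e g}

variable {e : ι ≃ Fin r}

omit [DecidableEq ι] [Fintype ι] in
lemma halfVec_zero : halfVec e 0 = 0 := by ext p; simp [halfVec]

lemma halfVec_xor (a b : ℕ) :
    halfVec e (a ^^^ b) - (halfVec e a + halfVec e b) ∈ intLattice ι := by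
  refine mem_intLattice.2 fun p => ?_
  simp only [Pi.sub_apply, Pi.add_apply, halfVec, Nat.testBit_xor]
  cases a.testBit (e p) <;> cases b.testBit (e p)
  · exact ⟨0, by norm_num⟩
  · exact ⟨0, by norm_num⟩
  · exact ⟨0, by norm_num⟩
  · exact ⟨-1, by norm_num⟩

lemma two_smul_halfVec (a : ℕ) : (2 : ℤ) • halfVec e a ∈ intLattice ι := by
  refine mem_intLattice.2 fun p => ?_
  simp only [Pi.smul_apply, halfVec]
  cases a.testBit (e p)
  · exact ⟨0, by norm_num⟩
  · exact ⟨1, by norm_num⟩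

lemma testBit_eq_of_sub_mem {a b : ℕ} (h : halfVec e a - halfVec e b ∈ intLattice ι) (p : ι) :
    a.testBit (e p) = b.testBit (e p) := by
  obtain ⟨n, hn⟩ := mem_intLattice.1 h p
  simp only [Pi.sub_apply, halfVec] at hn
  have key : ∀ q : ℚ, (q = 1 / 2 ∨ q = -(1 / 2)) → q ≠ n := by
    rintro q hq rfl
    have h2 : (2 * n : ℚ) = 1 ∨ (2 * n : ℚ) = -1 := by
      rcases hq with hq | hq
      · left; rw [hq]; norm_num
      · right; rw [hq]; norm_num
    rcases h2 with h2 | h2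
    · have : 2 * n = 1 := by exact_mod_cast h2
      omega
    · have : 2 * n = -1 := by exact_mod_cast h2
      omega
  revert hn
  cases a.testBit (e p) <;> cases b.testBit (e p) <;> intro hn
  · rfl
  · exact absurd hn (key _ (by norm_num))
  · exact absurd hn (key _ (by norm_num))
  · rfl

omit [DecidableEq ι] [Fintype ι] in
lemma eq_of_testBit {a b : ℕ} (ha : a < 2 ^ r) (hb : b < 2 ^ r)
    (h : ∀ p, a.testBit (e p) = b.testBit (e p)) : a = b := by
  refine Nat.eq_of_testBit_eq fun i => ?_
  by_cases hi : i < r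
  · have := h (e.symm ⟨i, hi⟩)
    rwa [e.apply_symm_apply] at this
  · have hi' : 2 ^ r ≤ 2 ^ i := Nat.pow_le_pow_right two_pos (not_lt.1 hi)
    rw [Nat.testBit_lt_two_pow (ha.trans_le hi'), Nat.testBit_lt_two_pow (hb.trans_le hi')]

lemma xorClosed_lt : XorClosed (· < 2 ^ r) := ⟨by positivity, Nat.xor_lt_two_pow⟩

omit [Fintype ι] in
lemma intLattice_le_maskLattice (G : List ℕ) : intLattice ι ≤ maskLattice e G := le_sup_left

lemma xorClosed_halfVec_mem {Λ : Submodule ℤ (ι → ℚ)} (h : intLattice ι ≤ Λ) :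
    XorClosed fun w => halfVec e w ∈ Λ := by
  refine ⟨by rw [halfVec_zero]; exact Λ.zero_mem, fun {a b} ha hb => ?_⟩
  have := Λ.add_mem (h (halfVec_xor (e := e) a b)) (Λ.add_mem ha hb)
  rwa [sub_add_cancel] at this

lemma halfVec_mem_maskLattice {G : List ℕ} {c : ℕ} (hc : c ∈ xorSpan G) :
    halfVec e c ∈ maskLattice e G :=
  xorSpan_le (xorClosed_halfVec_mem (intLattice_le_maskLattice G)) (fun g hg =>
    (le_sup_right : _ ≤ maskLattice e G) (Submodule.subset_span ⟨g, hg, rfl⟩)) c hc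

/-- Twice a glue vector is integral, so coefficients matter only modulo 2, and addition of glue
vectors modulo ℤ^ι is addition of words without carry. -/
lemma exists_mask_of_mem {G : List ℕ} {x : ι → ℚ} (hx : x ∈ maskLattice e G) :
    ∃ c ∈ xorSpan G, x - halfVec e c ∈ intLattice ι := by
  obtain ⟨y, hy, z, hz, rfl⟩ := Submodule.mem_sup.1 hx
  suffices ∃ c ∈ xorSpan G, z - halfVec e c ∈ intLattice ι by
    obtain ⟨c, hc, h⟩ := this
    exact ⟨c, hc, by rw [add_sub_assoc]; exact Submodule.add_mem _ hy h⟩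
  clear hx hy
  induction hz using Submodule.span_induction with
  | mem x hx =>
    obtain ⟨g, hg, rfl⟩ := hx
    exact ⟨g, subset_xorSpan hg, by rw [sub_self]; exact Submodule.zero_mem _⟩
  | zero => exact ⟨0, (xorSpan_closed G).zero, by rw [halfVec_zero, sub_self]; exact Submodule.zero_mem _⟩
  | add x y _ _ hx hy =>
    obtain ⟨c, hc, h⟩ := hx
    obtain ⟨d, hd, h'⟩ := hy
    refine ⟨c ^^^ d, (xorSpan_closed G).xor hc hd, ?_⟩
    have := Submodule.sub_mem _ (Submodule.add_mem _ h h') (halfVec_xor (e := e) c d)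
    convert this using 1
    abel
  | smul n x _ hx =>
    obtain ⟨c, hc, h⟩ := hx
    have hn := Submodule.smul_mem _ n h
    rcases Int.even_or_odd' n with ⟨m, hm | hm⟩
    · refine ⟨0, (xorSpan_closed G).zero, ?_⟩
      have h2 := Submodule.smul_mem _ m (two_smul_halfVec (e := e) c)
      rw [smul_smul, mul_comm, ← hm] at h2
      have := Submodule.add_mem _ hn h2
      rw [smul_sub, sub_add_cancel] at this
      rwa [halfVec_zero, sub_zero]
    · refine ⟨c, hc, ?_⟩
      have h2 := Submodule.smul_mem _ m (two_smul_halfVec (e := e) c)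
      rw [smul_smul, mul_comm] at h2
      have := Submodule.add_mem _ hn h2
      convert this using 1
      rw [hm]
      module

lemma mem_xorSpan_of_halfVec_mem {G : List ℕ} (hG : ∀ g ∈ G, g < 2 ^ r) {m : ℕ} (hm : m < 2 ^ r)
    (h : halfVec e m ∈ maskLattice e G) : m ∈ xorSpan G := by
  obtain ⟨c, hc, h'⟩ := exists_mask_of_mem h
  have := eq_of_testBit (e := e) hm (xorSpan_le xorClosed_lt hG c hc) (testBit_eq_of_sub_mem h')
  exact this ▸ hc

omit [Fintype ι] in
lemma span_intLattice [Finite ι] {Λ : Submodule ℤ (ι → ℚ)} (h : intLattice ι ≤ Λ) :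
    Submodule.span ℚ (Λ : Set (ι → ℚ)) = ⊤ := by
  have := Fintype.ofFinite ι
  rw [eq_top_iff, ← (Pi.basisFun ℚ ι).span_eq, Submodule.span_le]
  rintro x ⟨p, rfl⟩
  rw [Pi.basisFun_apply]
  exact Submodule.subset_span (h (single_mem_intLattice p))

lemma nondegenerate_of_neg {C : Matrix ι ι ℤ} (hpos : ∀ x : ι → ℚ, x ≠ 0 → negForm C x x < 0) :
    (negForm C).Nondegenerate := by
  refine ⟨fun x hx => ?_, fun x hx => ?_⟩
  all_goals
    by_contra h0
    have := hpos x h0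
    rw [hx x] at this
    exact lt_irrefl _ this

/-- A lattice spanned by vectors with integral products and even squares is even. -/
lemma isEvenLattice_of_span {C : Matrix ι ι ℤ} (hC : C.IsSymm)
    (hpos : ∀ x : ι → ℚ, x ≠ 0 → negForm C x x < 0) {Λ : Submodule ℤ (ι → ℚ)}
    (hR : intLattice ι ≤ Λ) {S : Set (ι → ℚ)} (hS : S.Finite) (hΛ : Λ = Submodule.span ℤ S)
    (hint : ∀ x ∈ S, ∀ y ∈ S, ∃ n : ℤ, negForm C x y = n)
    (heven : ∀ x ∈ S, ∃ n : ℤ, negForm C x x = 2 * n) : IsEvenLattice (negForm C) Λ := by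
  have h1 : ∀ x ∈ S, ∀ y ∈ Λ, ∃ n : ℤ, negForm C x y = n := by
    intro x hx y hy
    rw [hΛ] at hy
    induction hy using Submodule.span_induction with
    | mem y hy => exact hint x hx y hy
    | zero => exact ⟨0, by simp⟩
    | add y z _ _ hy hz =>
      obtain ⟨m, hm⟩ := hy
      obtain ⟨n, hn⟩ := hz
      exact ⟨m + n, by rw [map_add, hm, hn]; push_cast; rfl⟩
    | smul a y _ hy =>
      obtain ⟨m, hm⟩ := hy
      exact ⟨a * m, by rw [map_zsmul, hm, zsmul_eq_mul]; push_cast; rfl⟩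
  have h2 : ∀ x ∈ Λ, ∀ y ∈ Λ, ∃ n : ℤ, negForm C x y = n := by
    intro x hx y hy
    rw [hΛ] at hx
    induction hx using Submodule.span_induction with
    | mem x hx => exact h1 x hx y hy
    | zero => exact ⟨0, by simp⟩
    | add x z _ _ hx hz =>
      obtain ⟨m, hm⟩ := hx
      obtain ⟨n, hn⟩ := hz
      exact ⟨m + n, by rw [map_add, LinearMap.add_apply, hm, hn]; push_cast; rfl⟩
    | smul a x _ hx =>
      obtain ⟨m, hm⟩ := hx
      exact ⟨a * m, by rw [map_zsmul, LinearMap.smul_apply, hm, zsmul_eq_mul]; push_cast; rfl⟩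
  refine ⟨negForm_symm hC, nondegenerate_of_neg hpos, ?_, span_intLattice hR, h2, ?_⟩
  · exact ⟨hS.toFinset, by rw [hS.coe_toFinset, hΛ]⟩
  · intro x hx
    rw [hΛ] at hx
    induction hx using Submodule.span_induction with
    | mem x hx => exact heven x hx
    | zero => exact ⟨0, by simp⟩
    | add x y hx hy ihx ihy =>
      rw [← hΛ] at hx hy
      obtain ⟨m, hm⟩ := ihx
      obtain ⟨n, hn⟩ := ihy
      obtain ⟨k, hk⟩ := h2 x hx y hy
      refine ⟨m + n + k, ?_⟩
      simp only [map_add, LinearMap.add_apply, hm, hn, hk, negForm_symm hC y x]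
      push_cast
      ring
    | smul a x hx ihx =>
      rw [← hΛ] at hx
      obtain ⟨m, hm⟩ := ihx
      refine ⟨a * a * m, ?_⟩
      rw [map_zsmul, map_zsmul, LinearMap.smul_apply, hm, zsmul_eq_mul, zsmul_eq_mul]
      push_cast
      ring

lemma intLattice_le_dual (C : Matrix ι ι ℤ) :
    intLattice ι ≤ dualLattice (negForm C) (intLattice ι) := by
  rw [intLattice, Submodule.span_le]
  rintro x ⟨p, rfl⟩ y hy
  rw [negForm_single_left]
  have hy' := mem_intLattice.1 hy
  choose n hn using hy'
  have : ∑ q, (C p q : ℚ) * y q = ((∑ q, C p q * n q : ℤ) : ℚ) := by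
    push_cast
    exact Finset.sum_congr rfl fun q _ => by rw [hn q]
  exact Submodule.mem_one.2 ⟨-∑ q, C p q * n q, by rw [this]; simp⟩

/-- The combinatorial description of a `2`-elementary lattice: `E` are words that represent
the dual of the root lattice, `G` are the glue words. -/
structure MaskCode (C : Matrix ι ι ℤ) (e : ι ≃ Fin r) (E G : List ℕ) : Prop where
  symm : C.IsSymm
  diag : ∀ p, C p p = 2
  off_diag : ∀ p q, p ≠ q → C p q ≤ 0
  neg : ∀ x : ι → ℚ, x ≠ 0 → negForm C x x < 0
  -- Distinct nodes that occur in any of the words are orthogonal, so products of half vectors only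
  -- count common bits.
  indep : ∀ w ∈ E, ∀ w' ∈ E, ∀ p q, p ≠ q → w.testBit (e p) → w'.testBit (e q) → C p q = 0
  lt : ∀ w ∈ E, w < 2 ^ r
  dual : ∀ w ∈ E, halfVec e w ∈ dualLattice (negForm C) (intLattice ι)
  gen : ∀ y ∈ dualLattice (negForm C) (intLattice ι), ∃ w ∈ xorSpan E,
    y - halfVec e w ∈ intLattice ι
  glue_mem : ∀ g ∈ G, g ∈ xorSpan E
  -- The square of a half vector is minus half its number of bits: evenness of the lattice requires
  -- divisibility by 4, integrality of products even intersections.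
  glue_four : ∀ g ∈ G, bitCount r g % 4 = 0
  glue_two : ∀ g ∈ G, ∀ g' ∈ G, bitCount r (g &&& g') % 2 = 0
  nodup : (xorSpan G).Nodup
  -- Nontrivial glue cosets contain no roots, which makes the root sublattice equal to ℤ^ι.
  long : ∀ c ∈ xorSpan G, c ≠ 0 → ∀ x, x - halfVec e c ∈ intLattice ι → negForm C x x < -2

namespace MaskCode

variable {C : Matrix ι ι ℤ} {E G : List ℕ} (H : MaskCode C e E G)
include H

/-- Nodes of the supports are mutually orthogonal, so each common node contributes a quarter of -2
and nothing else contributes. -/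
lemma form_halfVec {w w' : ℕ} (hw : w ∈ xorSpan E) (hw' : w' ∈ xorSpan E) :
    negForm C (halfVec e w) (halfVec e w') = -(bitCount r (w &&& w') : ℚ) / 2 := by
  have hbit : ∀ w ∈ xorSpan E, ∀ p, w.testBit (e p) → ∃ x ∈ E, x.testBit (e p) := by
    refine xorSpan_le (S := fun w => ∀ p, w.testBit (e p) → ∃ x ∈ E, x.testBit (e p))
      ⟨by simp, fun {a b} ha hb p hp => ?_⟩ fun w hw p hp => ⟨w, hw, hp⟩
    rw [Nat.testBit_xor] at hp
    by_cases h : a.testBit (e p) = true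
    · exact ha p h
    · rw [Bool.not_eq_true] at h
      rw [h, Bool.false_xor] at hp
      exact hb p hp
  rw [negForm_apply, bitCount_eq, neg_div]
  congr 1
  have : ∀ p, ∑ q, halfVec e w p * C p q * halfVec e w' q =
      if (w &&& w').testBit (e p) then 1 / 2 else 0 := by
    intro p
    rw [Finset.sum_eq_single p]
    · rw [H.diag, Nat.testBit_and]
      simp only [halfVec]
      cases w.testBit (e p) <;> cases w'.testBit (e p) <;> norm_num
    · intro q _ hq
      by_cases h1 : w.testBit (e p) = true
      · by_cases h2 : w'.testBit (e q) = true
        · obtain ⟨x, hx, hxp⟩ := hbit w hw p h1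
          obtain ⟨y, hy, hyq⟩ := hbit w' hw' q h2
          rw [H.indep x hx y hy p q hq.symm hxp hyq]
          simp
        · simp [halfVec, h2]
      · simp [halfVec, h1]
    · simp
  rw [Finset.sum_congr rfl fun p _ => this p, Finset.sum_range, ← e.sum_comp]
  push_cast
  rw [Finset.sum_div]
  exact Finset.sum_congr rfl fun p _ => by split_ifs <;> norm_num

lemma xorSpan_lt {w : ℕ} (hw : w ∈ xorSpan E) : w < 2 ^ r := xorSpan_le xorClosed_lt H.lt w hw

lemma glue_lt : ∀ g ∈ G, g < 2 ^ r := fun g hg => H.xorSpan_lt (H.glue_mem g hg)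

lemma xorSpan_glue {c : ℕ} (hc : c ∈ xorSpan G) : c ∈ xorSpan E :=
  xorSpan_le (xorSpan_closed E) H.glue_mem c hc

lemma dual_span {w : ℕ} (hw : w ∈ xorSpan E) :
    halfVec e w ∈ dualLattice (negForm C) (intLattice ι) :=
  xorSpan_le (xorClosed_halfVec_mem (intLattice_le_dual C)) H.dual w hw

lemma isEvenLattice : IsEvenLattice (negForm C) (maskLattice e G) := by
  refine isEvenLattice_of_span H.symm H.neg (intLattice_le_maskLattice G)
    (S := (Set.range fun p : ι => (Pi.single p 1 : ι → ℚ)) ∪ {x | ∃ g ∈ G, x = halfVec e g}) ?_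
    ?_ ?_ ?_
  · refine (Set.finite_range _).union ?_
    refine ((List.finite_toSet G).image (halfVec e)).subset ?_
    rintro x ⟨g, hg, rfl⟩
    exact ⟨g, hg, rfl⟩
  · rw [Submodule.span_union]
    rfl
  · have hmix : ∀ p, ∀ g ∈ G, ∃ n : ℤ, negForm C (halfVec e g) (Pi.single p 1) = n :=
      fun p g hg => exists_int_of_mem_dual (H.dual_span (H.glue_mem g hg)) (single_mem_intLattice p)
    rintro x (⟨p, rfl⟩ | ⟨g, hg, rfl⟩) y (⟨q, rfl⟩ | ⟨g', hg', rfl⟩)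
    · exact ⟨-C p q, by simp [negForm_single_single]⟩
    · rw [negForm_symm H.symm]; exact hmix p g' hg'
    · exact hmix q g hg
    · obtain ⟨n, hn⟩ := Nat.dvd_of_mod_eq_zero (H.glue_two g hg g' hg')
      refine ⟨-n, ?_⟩
      rw [H.form_halfVec (H.glue_mem g hg) (H.glue_mem g' hg'), hn]
      push_cast
      ring
  · rintro x (⟨p, rfl⟩ | ⟨g, hg, rfl⟩)
    · exact ⟨-1, by simp [negForm_single_single, H.diag]⟩
    · obtain ⟨n, hn⟩ := Nat.dvd_of_mod_eq_zero (H.glue_four g hg)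
      refine ⟨-n, ?_⟩
      rw [H.form_halfVec (H.glue_mem g hg) (H.glue_mem g hg), Nat.and_self, hn]
      push_cast
      ring

lemma rootSublattice_eq : rootSublattice (negForm C) (maskLattice e G) = intLattice ι := by
  apply le_antisymm
  · refine Submodule.span_le.2 fun x hx => ?_
    obtain ⟨c, hc, h⟩ := exists_mask_of_mem hx.1
    by_cases hc0 : c = 0
    · subst hc0
      rwa [halfVec_zero, sub_zero] at h
    · exact absurd hx.2 (H.long c hc hc0 x h).ne
  · refine Submodule.span_le.2 ?_
    rintro x ⟨p, rfl⟩
    refine Submodule.subset_span ⟨intLattice_le_maskLattice G (single_mem_intLattice p), ?_⟩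
    rw [negForm_single_single, H.diag]
    norm_num

lemma mem_dual_iff {w : ℕ} (hw : w ∈ xorSpan E) :
    halfVec e w ∈ dualLattice (negForm C) (maskLattice e G) ↔
      ∀ g ∈ G, bitCount r (w &&& g) % 2 = 0 := by
  constructor
  · intro h g hg
    obtain ⟨n, hn⟩ := exists_int_of_mem_dual h (halfVec_mem_maskLattice (subset_xorSpan hg))
    rw [H.form_halfVec hw (H.glue_mem g hg)] at hn
    have : (bitCount r (w &&& g) : ℚ) = ((-2 * n : ℤ) : ℚ) := by
      push_cast
      linarith
    have : (bitCount r (w &&& g) : ℤ) = -2 * n := by exact_mod_cast this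
    omega
  · intro h y hy
    obtain ⟨c, hc, hy'⟩ := exists_mask_of_mem hy
    have h1 : ∀ c ∈ xorSpan G, bitCount r (w &&& c) % 2 = 0 := by
      refine xorSpan_le ⟨?_, fun {a b} ha hb => ?_⟩ h
      · simp [bitCount_eq]
      · have := bitCount_xor r (w &&& a) (w &&& b)
        rw [← Nat.and_xor_distrib_left] at this
        omega
    obtain ⟨n, hn⟩ := Nat.dvd_of_mod_eq_zero (h1 c hc)
    obtain ⟨m, hm⟩ := exists_int_of_mem_dual (H.dual_span hw) hy'
    refine Submodule.mem_one.2 ⟨m - n, ?_⟩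
    have e1 : negForm C (halfVec e w) y = negForm C (halfVec e w) (y - halfVec e c) +
        negForm C (halfVec e w) (halfVec e c) := by rw [map_sub, sub_add_cancel]
    rw [e1, hm, H.form_halfVec hw (H.xorSpan_glue hc), hn]
    push_cast
    simp only [eq_intCast]
    ring

/-- The dual of K lies in the dual of the root lattice, whose classes are words. As ℤ^ι is contained
in the dual of K, the word found there represents an element of the dual of K. -/
lemma exists_mask_of_dual {y : ι → ℚ} (hy : y ∈ dualLattice (negForm C) (maskLattice e G)) :
    ∃ w ∈ xorSpan E, y - halfVec e w ∈ intLattice ι ∧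
      halfVec e w ∈ dualLattice (negForm C) (maskLattice e G) := by
  obtain ⟨w, hw, h⟩ := H.gen y fun z hz => hy z (intLattice_le_maskLattice G hz)
  refine ⟨w, hw, h, ?_⟩
  have h1 : intLattice ι ≤ dualLattice (negForm C) (maskLattice e G) := fun x hx z hz => by
    obtain ⟨n, hn⟩ := H.isEvenLattice.integral x (intLattice_le_maskLattice G hx) z hz
    exact Submodule.mem_one.2 ⟨n, by rw [hn]; rfl⟩
  have := Submodule.sub_mem _ hy (h1 h)
  rwa [sub_sub_cancel] at this

/-- The quotient is in bijection with the glue code, which has 2^k distinct words, and it is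
annihilated by 2. Vector spaces over ℤ/2 of equal dimension are isomorphic. -/
lemma card_quotient : Nonempty ((↥(maskLattice e G) ⧸
    (intLattice ι).submoduleOf (maskLattice e G)) ≃+ (Fin G.length → ZMod 2)) := by
  set Q := ↥(maskLattice e G) ⧸ (intLattice ι).submoduleOf (maskLattice e G)
  let f : {c // c ∈ xorSpan G} → Q := fun c =>
    Submodule.Quotient.mk ⟨halfVec e c, halfVec_mem_maskLattice c.2⟩
  have hf : Function.Bijective f := by
    constructor
    · intro c d h
      have h' : halfVec e c - halfVec e d ∈ intLattice ι :=
        (Submodule.Quotient.eq ((intLattice ι).submoduleOf (maskLattice e G))).1 h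
      exact Subtype.ext (eq_of_testBit (e := e) (H.xorSpan_lt (H.xorSpan_glue c.2))
        (H.xorSpan_lt (H.xorSpan_glue d.2)) (testBit_eq_of_sub_mem h'))
    · intro z
      induction z using Submodule.Quotient.induction_on with
      | H x =>
        obtain ⟨c, hc, h⟩ := exists_mask_of_mem x.2
        refine ⟨⟨c, hc⟩, (Submodule.Quotient.eq _).2 ?_⟩
        change halfVec e c - (x : ι → ℚ) ∈ intLattice ι
        rw [← neg_sub]
        exact Submodule.neg_mem _ h
  have hcard : Nat.card Q = 2 ^ G.length := by
    rw [← Nat.card_congr (Equiv.ofBijective f hf), ← length_xorSpan,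
      ← List.toFinset_card_of_nodup H.nodup,
      Nat.card_congr (Equiv.subtypeEquivRight fun c => List.mem_toFinset.symm),
      Nat.card_eq_fintype_card, Fintype.card_coe]
  have htwo : ∀ z : Q, 2 • z = 0 := by
    intro z
    induction z using Submodule.Quotient.induction_on with
    | H x =>
      refine (Submodule.Quotient.mk_eq_zero _).2 ?_
      change (2 : ℕ) • (x : ι → ℚ) ∈ intLattice ι
      obtain ⟨c, hc, h⟩ := exists_mask_of_mem x.2
      have := Submodule.add_mem _ (Submodule.smul_mem _ 2 h) (two_smul_halfVec (e := e) c)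
      convert this using 1
      module
  have : Finite Q := Nat.finite_of_card_ne_zero (by rw [hcard]; positivity)
  let _ : Module (ZMod 2) Q := AddCommGroup.zmodModule htwo
  have hrank : Module.finrank (ZMod 2) Q = Module.finrank (ZMod 2) (Fin G.length → ZMod 2) := by
    rw [Module.finrank_fin_fun]
    have := Module.natCard_eq_pow_finrank (K := ZMod 2) (V := Q)
    rw [hcard, Nat.card_zmod] at this
    exact (Nat.pow_right_injective le_rfl this).symm
  exact ⟨(LinearEquiv.ofFinrankEq Q _ hrank).toAddEquiv⟩

end MaskCode

end MaskLattice

/-! ### Orthogonal bases given by words -/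

section OrthogonalMasks

/-- The sum of the masks in `Y` that have odd pairing with `x`. -/
def orthCombo (s : ℕ) (Y : List ℕ) (x : ℕ) : ℕ :=
  List.rec 0 (fun y _ ih => cond (Nat.beq (Nat.mod (bitCount s (Nat.land x y)) 2) 0) ih
    (Nat.xor y ih)) Y

lemma orthCombo_cons (s y : ℕ) (Y : List ℕ) (x : ℕ) : orthCombo s (y :: Y) x =
    if bitCount s (x &&& y) % 2 = 0 then orthCombo s Y x else y ^^^ orthCombo s Y x := by
  change cond (Nat.beq (bitCount s (x &&& y) % 2) 0) (orthCombo s Y x) (y ^^^ orthCombo s Y x) = _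
  rcases Nat.mod_two_eq_zero_or_one (bitCount s (x &&& y)) with h | h <;> rw [h] <;> rfl

lemma bitCount_and_xor (s a b y : ℕ) : bitCount s ((a ^^^ b) &&& y) % 2 =
    (bitCount s (a &&& y) + bitCount s (b &&& y)) % 2 := by
  rw [Nat.and_xor_distrib_right]
  have := bitCount_xor s (a &&& y) (b &&& y)
  omega

lemma orthCombo_xor (s : ℕ) (Y : List ℕ) (a b : ℕ) :
    orthCombo s Y (a ^^^ b) = orthCombo s Y a ^^^ orthCombo s Y b := by
  induction Y with
  | nil => exact (Nat.xor_self 0).symm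
  | cons y Y ih =>
    rw [orthCombo_cons, orthCombo_cons, orthCombo_cons, bitCount_and_xor, ih]
    by_cases h : bitCount s (a &&& y) % 2 = 0 <;> by_cases h' : bitCount s (b &&& y) % 2 = 0
    · rw [if_pos (by omega), if_pos h, if_pos h']
    · rw [if_neg (by omega), if_pos h, if_neg h', ← Nat.xor_assoc, Nat.xor_comm y, Nat.xor_assoc]
    · rw [if_neg (by omega), if_neg h, if_pos h', Nat.xor_assoc]
    · rw [if_pos (by omega), if_neg h, if_neg h', Nat.xor_assoc,
        ← Nat.xor_assoc (orthCombo s Y a), Nat.xor_comm (orthCombo s Y a) y,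
        Nat.xor_assoc y, ← Nat.xor_assoc y y, Nat.xor_self, Nat.zero_xor]

lemma orthCombo_mem {S : ℕ → Prop} (hS : XorClosed S) (s : ℕ) {Y : List ℕ} (hY : ∀ y ∈ Y, S y)
    (x : ℕ) : S (orthCombo s Y x) := by
  induction Y with
  | nil => exact hS.zero
  | cons y Y ih =>
    rw [orthCombo_cons]
    have ih' := ih fun z hz => hY z (List.mem_cons_of_mem _ hz)
    split_ifs
    · exact ih'
    · exact hS.xor (hY y List.mem_cons_self) ih'

lemma orthCombo_eq_zero (s : ℕ) {Y : List ℕ} {x : ℕ}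
    (h : ∀ y ∈ Y, bitCount s (x &&& y) % 2 = 0) : orthCombo s Y x = 0 := by
  induction Y with
  | nil => rfl
  | cons y Y ih =>
    rw [orthCombo_cons, if_pos (h y List.mem_cons_self),
      ih fun z hz => h z (List.mem_cons_of_mem _ hz)]

lemma sum_subsumCount (ε : List (ZMod 4)) : ∑ k, subsumCount ε k = 2 ^ ε.length := by
  induction ε with
  | nil => rfl
  | cons c ε ih =>
    simp only [subsumCount, Finset.sum_add_distrib]
    have h : ∑ k, subsumCount ε (k - c) = ∑ k, subsumCount ε k :=
      Equiv.sum_comp (Equiv.subRight c) (subsumCount ε)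
    rw [h, ih, List.length_cons, pow_succ, mul_two]

variable {D : Type*} [AddCommGroup D] [Finite D] {q : D → ZMod 4}

/-- Sum the value counts over the four values: subsequences of the list of values number 2 to its
length. -/
lemma card_eq_two_pow (hq : IsQuadratic q) (Y : List D) (hodd : ∀ y ∈ Y, 2 * q y = 2)
    (horth : Y.Pairwise fun x y => polar q x y = 0)
    (hsep : ∀ x, (∀ y ∈ Y, polar q x y = 0) → x = 0) : Nat.card D = 2 ^ Y.length := by
  have h := hasType_of_orthogonal hq Y ⊤ (fun _ _ => AddSubgroup.mem_top _) hodd horth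
    fun x _ => hsep x
  have := Fintype.ofFinite D
  rw [← Nat.card_congr (Equiv.sigmaFiberEquiv q), Nat.card_sigma, ← List.length_map (f := q),
    ← sum_subsumCount]
  refine Finset.sum_congr rfl fun k _ => ?_
  rw [← h.count, valueCount]
  exact Nat.card_congr (Equiv.subtypeEquivRight fun x => by simp)

lemma two_mul_natCast_eq_zero {n : ℕ} : (2 * n : ZMod 4) = 0 ↔ n % 2 = 0 := by
  have : (2 * n : ZMod 4) = ((2 * n : ℕ) : ZMod 4) := by push_cast; rfl
  rw [this, ZMod.natCast_eq_zero_iff]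
  omega

lemma two_mul_natCast_eq_two {n : ℕ} (h : n % 2 = 1) : (2 * n : ZMod 4) = 2 := by
  obtain ⟨m, hm⟩ : ∃ m, n = 2 * m + 1 := ⟨n / 2, by omega⟩
  have h4 : (4 : ZMod 4) = 0 := rfl
  rw [hm]
  push_cast
  linear_combination (m : ZMod 4) * h4

/-- A parametrization of an elementary abelian `2`-group by masks for which the quadratic function
counts bits. -/
structure MaskModel (q : D → ZMod 4) (elt : ℕ → D) (S : ℕ → Prop) (s : ℕ) (X : List ℕ) :
    Prop where
  closed : XorClosed S
  add : ∀ a b, S a → S b → elt (a ^^^ b) = elt a + elt b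
  value : ∀ a, S a → q (elt a) = bitCount s a
  base : ∀ x ∈ X, S x
  surj : ∀ z, ∃ w ∈ xorSpan X, elt w = z

omit [Finite D] in
lemma MaskModel.polar_elt {elt : ℕ → D} {S : ℕ → Prop} {s : ℕ} {X : List ℕ}
    (M : MaskModel q elt S s X) {a b : ℕ} (ha : S a) (hb : S b) :
    polar q (elt a) (elt b) = 2 * (bitCount s (a &&& b) : ZMod 4) := by
  rw [polar, ← M.add a b ha hb, M.value _ (M.closed.xor ha hb), M.value a ha, M.value b hb]
  have h := congrArg (Nat.cast : ℕ → ZMod 4) (bitCount_xor s a b)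
  push_cast at h
  have h4 : (4 : ZMod 4) = 0 := rfl
  linear_combination h - (bitCount s (a &&& b) : ZMod 4) * h4

/-- Nondegeneracy with respect to Y is verified on the generators X alone. The map x ↦ x +
`orthCombo` x is additive, so if it vanishes on X, every class equals its expansion in Y, and a
class orthogonal to Y is zero. -/
lemma MaskModel.card_isom (hq : IsQuadratic q) {elt : ℕ → D} {S : ℕ → Prop} {s : ℕ} {X : List ℕ}
    (M : MaskModel q elt S s X) {Y : List ℕ} (hY : ∀ y ∈ Y, S y)
    (hodd : ∀ y ∈ Y, bitCount s y % 2 = 1)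
    (horth : Y.Pairwise fun y y' => bitCount s (y &&& y') % 2 = 0)
    (hsep : ∀ x ∈ X, elt (x ^^^ orthCombo s Y x) = 0) :
    Nat.card (Isom q) = isometryCount (Y.map fun y => (bitCount s y : ZMod 4)) ∧
      Nat.card D = 2 ^ Y.length ∧ ∀ z : D, (∀ y, polar q z y = 0) → z = 0 := by
  have h1 : ∀ y ∈ Y.map elt, 2 * q y = 2 := by
    intro z hz
    obtain ⟨y, hy, rfl⟩ := List.mem_map.1 hz
    rw [M.value y (hY y hy), two_mul_natCast_eq_two (hodd y hy)]
  have h2 : (Y.map elt).Pairwise fun x y => polar q x y = 0 := by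
    rw [List.pairwise_map]
    refine horth.imp_of_mem fun {a b} ha hb h => ?_
    rw [M.polar_elt (hY a ha) (hY b hb), two_mul_natCast_eq_zero]
    exact h
  have hS : ∀ w ∈ xorSpan X, S w := xorSpan_le M.closed M.base
  have h3 : ∀ w ∈ xorSpan X, S w ∧ elt (w ^^^ orthCombo s Y w) = 0 := by
    refine xorSpan_le (S := fun w => S w ∧ elt (w ^^^ orthCombo s Y w) = 0) ⟨⟨M.closed.zero, ?_⟩,
      fun {a b} ha hb => ⟨M.closed.xor ha.1 hb.1, ?_⟩⟩ fun x hx => ⟨M.base x hx, hsep x hx⟩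
    · rw [orthCombo_eq_zero s (fun y _ => by simp [bitCount_eq]), Nat.xor_self]
      have := M.add 0 0 M.closed.zero M.closed.zero
      rw [Nat.xor_self] at this
      exact left_eq_add.1 this
    · have hc : ∀ x, S x → S (x ^^^ orthCombo s Y x) := fun x hx =>
        M.closed.xor hx (orthCombo_mem M.closed s hY x)
      have := M.add _ _ (hc a ha.1) (hc b hb.1)
      rw [ha.2, hb.2, add_zero] at this
      rw [← this, orthCombo_xor]
      congr 1
      rw [Nat.xor_assoc, Nat.xor_assoc, ← Nat.xor_assoc b, Nat.xor_comm b, Nat.xor_assoc]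
  have h4 : ∀ z, (∀ y ∈ Y.map elt, polar q z y = 0) → z = 0 := by
    intro z hz
    obtain ⟨w, hw, rfl⟩ := M.surj z
    have h := (h3 w hw).2
    rwa [orthCombo_eq_zero s, Nat.xor_zero] at h
    intro y hy
    rw [← two_mul_natCast_eq_zero, ← M.polar_elt (hS w hw) (hY y hy)]
    exact hz _ (List.mem_map_of_mem hy)
  refine ⟨?_, ?_, fun z hz => h4 z fun y _ => hz y⟩
  · rw [card_isom_eq hq _ h1 h2 h4, List.map_map]
    congr 1
    exact List.map_congr_left fun y hy => M.value y (hY y hy)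
  · rw [card_eq_two_pow hq _ h1 h2 h4, List.length_map]

end OrthogonalMasks

/-! ### The discriminant form on words and the order of its isometry group -/

section DiscriminantMasks

/-- The map `n ↦ -n/2` from `ℤ/4` to `ℚ/2ℤ`. -/
noncomputable def negHalf : ZMod 4 →+ AddCircle (2 : ℚ) :=
  ZMod.lift 4 ⟨zmultiplesHom (AddCircle (2 : ℚ)) ((-(1 / 2) : ℚ) : AddCircle (2 : ℚ)), by
    change (4 : ℤ) • ((-(1 / 2) : ℚ) : AddCircle (2 : ℚ)) = 0
    rw [← AddCircle.coe_zsmul]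
    exact (AddCircle.coe_eq_zero_iff (2 : ℚ)).2 ⟨-1, by norm_num⟩⟩

lemma negHalf_natCast (n : ℕ) : negHalf n = ((-(n : ℚ) / 2 : ℚ) : AddCircle (2 : ℚ)) := by
  have : ((n : ℕ) : ZMod 4) = ((n : ℤ) : ZMod 4) := by push_cast; rfl
  rw [this, negHalf, ZMod.lift_coe]
  change (n : ℤ) • ((-(1 / 2) : ℚ) : AddCircle (2 : ℚ)) = _
  rw [← AddCircle.coe_zsmul]
  congr 1
  rw [zsmul_eq_mul]
  push_cast
  ring

/-- This allows the discriminant form of a 2-elementary lattice to be replaced by a function with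
values in ℤ/4. -/
lemma negHalf_injective : Function.Injective negHalf := by
  rw [negHalf, ZMod.lift_injective]
  intro m hm
  change (m : ℤ) • ((-(1 / 2) : ℚ) : AddCircle (2 : ℚ)) = 0 at hm
  rw [← AddCircle.coe_zsmul] at hm
  obtain ⟨n, hn⟩ := (AddCircle.coe_eq_zero_iff (2 : ℚ)).1 hm
  rw [zsmul_eq_mul, zsmul_eq_mul] at hn
  have : ((m : ℤ) : ℚ) = ((-4 * n : ℤ) : ℚ) := by
    push_cast
    linarith
  have h : m = -4 * n := by exact_mod_cast this
  rw [h, ZMod.intCast_zmod_eq_zero_iff_dvd]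
  exact ⟨-n, by push_cast; ring⟩

namespace MaskCode

variable {ι : Type*} [Fintype ι] [DecidableEq ι] {r : ℕ} {e : ι ≃ Fin r}
  {C : Matrix ι ι ℤ} {E G : List ℕ} (H : MaskCode C e E G)

/-- The masks that represent elements of the discriminant group. -/
def Good (r : ℕ) (E G : List ℕ) (w : ℕ) : Prop :=
  w ∈ xorSpan E ∧ ∀ g ∈ G, bitCount r (w &&& g) % 2 = 0

lemma good_closed (r : ℕ) (E G : List ℕ) : XorClosed (Good r E G) := by
  refine ⟨⟨(xorSpan_closed E).zero, fun g _ => by simp [bitCount_eq]⟩, fun {a b} ha hb =>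
    ⟨(xorSpan_closed E).xor ha.1 hb.1, fun g hg => ?_⟩⟩
  rw [bitCount_and_xor, Nat.add_mod, ha.2 g hg, hb.2 g hg]

open Classical in
/-- The class of `halfVec e w` in the discriminant group. -/
noncomputable def maskClass (C : Matrix ι ι ℤ) (e : ι ≃ Fin r) (G : List ℕ) (w : ℕ) : DiscGroup (negForm C) (maskLattice e G) :=
  if h : halfVec e w ∈ dualLattice (negForm C) (maskLattice e G) then
    Submodule.Quotient.mk ⟨halfVec e w, h⟩ else 0

lemma maskClass_eq {w : ℕ} (h : halfVec e w ∈ dualLattice (negForm C) (maskLattice e G)) :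
    maskClass C e G w = Submodule.Quotient.mk ⟨halfVec e w, h⟩ := dif_pos h

include H

lemma good_dual {w : ℕ} (h : Good r E G w) :
    halfVec e w ∈ dualLattice (negForm C) (maskLattice e G) := (H.mem_dual_iff h.1).2 h.2

lemma good_glue {c : ℕ} (hc : c ∈ xorSpan G) : Good r E G c := by
  refine xorSpan_le (good_closed r E G) (fun g hg => ⟨H.glue_mem g hg, fun g' hg' =>
    H.glue_two g hg g' hg'⟩) c hc

/-- Sum and difference of two half vectors agree modulo ℤ^ι, and a half vector lies in K exactly
when its word is in the glue code. -/
lemma maskClass_eq_iff {a b : ℕ} (ha : Good r E G a) (hb : Good r E G b) :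
    maskClass C e G a = maskClass C e G b ↔ a ^^^ b ∈ xorSpan G := by
  have hab := (good_closed r E G).xor ha hb
  rw [maskClass_eq (H.good_dual ha), maskClass_eq (H.good_dual hb), Submodule.Quotient.eq]
  change halfVec e a - halfVec e b ∈ maskLattice e G ↔ _
  have h1 : halfVec e (a ^^^ b) - (halfVec e a - halfVec e b) ∈ intLattice ι := by
    have := Submodule.add_mem _ (halfVec_xor (e := e) a b) (two_smul_halfVec (e := e) b)
    convert this using 1
    module
  have h2 := intLattice_le_maskLattice (e := e) G h1
  constructor
  · intro h
    have := Submodule.add_mem _ h2 h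
    rw [sub_add_cancel] at this
    exact mem_xorSpan_of_halfVec_mem H.glue_lt (H.xorSpan_lt hab.1) this
  · intro h
    have := Submodule.sub_mem _ (halfVec_mem_maskLattice (e := e) h) h2
    rwa [sub_sub_cancel] at this

lemma maskClass_xor {a b : ℕ} (ha : Good r E G a) (hb : Good r E G b) :
    maskClass C e G (a ^^^ b) = maskClass C e G a + maskClass C e G b := by
  rw [maskClass_eq (H.good_dual ha), maskClass_eq (H.good_dual hb),
    maskClass_eq (H.good_dual ((good_closed r E G).xor ha hb))]
  exact (Submodule.Quotient.eq _).2 (intLattice_le_maskLattice G (halfVec_xor (e := e) a b))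

lemma exists_good (z : DiscGroup (negForm C) (maskLattice e G)) :
    ∃ w, Good r E G w ∧ maskClass C e G w = z := by
  induction z using Submodule.Quotient.induction_on with
  | H y =>
    obtain ⟨w, hw, h, hd⟩ := H.exists_mask_of_dual y.2
    refine ⟨w, ⟨hw, (H.mem_dual_iff hw).1 hd⟩, ?_⟩
    rw [maskClass_eq hd, eq_comm]
    exact (Submodule.Quotient.eq _).2 (intLattice_le_maskLattice G h)

lemma discForm_maskClass (h : IsEvenLattice (negForm C) (maskLattice e G)) {w : ℕ}
    (hw : Good r E G w) : discForm h (maskClass C e G w) = negHalf (bitCount r w) := by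
  rw [maskClass_eq (H.good_dual hw), discForm_mk, negHalf_natCast, H.form_halfVec hw.1 hw.1,
    Nat.and_self]

omit H in
lemma discForm_cube {V : Type*} [AddCommGroup V] [Module ℚ V] {b : LinearMap.BilinForm ℚ V}
    {Λ : Submodule ℤ V} (h : IsEvenLattice b Λ) (x y z : DiscGroup b Λ) :
    discForm h (x + y + z) = discForm h (x + y) + discForm h (x + z) + discForm h (y + z) -
      discForm h x - discForm h y - discForm h z := by
  induction x using Submodule.Quotient.induction_on with
  | H x =>
    induction y using Submodule.Quotient.induction_on with
    | H y =>
      induction z using Submodule.Quotient.induction_on with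
      | H z =>
        rw [← Submodule.Quotient.mk_add, ← Submodule.Quotient.mk_add, ← Submodule.Quotient.mk_add,
          ← Submodule.Quotient.mk_add]
        simp only [discForm_mk, ← AddCircle.coe_add, ← AddCircle.coe_sub]
        congr 1
        simp only [Submodule.coe_add, map_add, LinearMap.add_apply]
        ring

/-- Every class has a word, so every value of the form is the image of a bit count. Injectivity of
`negHalf` pulls the identity for sums of three elements, valid for the form, back to ℤ/4. -/
lemma exists_discValue (h : IsEvenLattice (negForm C) (maskLattice e G)) :
    ∃ q : DiscGroup (negForm C) (maskLattice e G) → ZMod 4, IsQuadratic q ∧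
      (∀ z, discForm h z = negHalf (q z)) ∧
      ∀ w, Good r E G w → q (maskClass C e G w) = bitCount r w := by
  have hex : ∀ z, ∃ n, discForm h z = negHalf n := fun z => by
    obtain ⟨w, hw, rfl⟩ := H.exists_good z
    exact ⟨_, H.discForm_maskClass h hw⟩
  choose q hq using hex
  have hv : ∀ w, Good r E G w → q (maskClass C e G w) = bitCount r w := fun w hw =>
    negHalf_injective ((hq _).symm.trans (H.discForm_maskClass h hw))
  have h0 : maskClass C e G 0 = 0 := by
    have := H.maskClass_xor (good_closed r E G).zero (good_closed r E G).zero
    rw [Nat.xor_self] at this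
    exact left_eq_add.1 this
  refine ⟨q, ⟨fun z => ?_, ?_, fun x y z => ?_⟩, hq, hv⟩
  · obtain ⟨w, hw, rfl⟩ := H.exists_good z
    rw [← H.maskClass_xor hw hw, Nat.xor_self, h0]
  · rw [← h0, hv 0 (good_closed r E G).zero]
    simp [bitCount_eq]
  · apply negHalf_injective
    simp only [map_add, map_sub, ← hq]
    exact discForm_cube h x y z

lemma finite_discGroup : Finite (DiscGroup (negForm C) (maskLattice e G)) := by
  have : Finite {w // w ∈ xorSpan E} := (List.finite_toSet (xorSpan E)).to_subtype
  refine Finite.of_surjective (fun w : {w // w ∈ xorSpan E} => maskClass C e G w) fun z => ?_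
  obtain ⟨w, hw, rfl⟩ := H.exists_good z
  exact ⟨⟨w, hw.1⟩, rfl⟩

/-- Every word orthogonal to the glue words is a combination of the base and the glue words. -/
lemma exists_base {X : List ℕ} (hX : ∀ w, Good r E G w → w ∈ xorSpan (X ++ G))
    (hXG : ∀ x ∈ X, Good r E G x) (z : DiscGroup (negForm C) (maskLattice e G)) :
    ∃ w ∈ xorSpan X, maskClass C e G w = z := by
  obtain ⟨w, hw, rfl⟩ := H.exists_good z
  have hgood := xorSpan_le (good_closed r E G) hXG
  have : ∀ w ∈ xorSpan (X ++ G), ∃ x ∈ xorSpan X, w ^^^ x ∈ xorSpan G := by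
    refine xorSpan_le (S := fun w => ∃ x ∈ xorSpan X, w ^^^ x ∈ xorSpan G) ⟨⟨0, (xorSpan_closed X).zero, ?_⟩, ?_⟩ fun x hx => ?_
    · rw [Nat.xor_self]
      exact (xorSpan_closed G).zero
    · rintro a b ⟨x, hx, hax⟩ ⟨y, hy, hby⟩
      refine ⟨x ^^^ y, (xorSpan_closed X).xor hx hy, ?_⟩
      have := (xorSpan_closed G).xor hax hby
      rwa [Nat.xor_assoc, ← Nat.xor_assoc x, Nat.xor_comm x, Nat.xor_assoc b, ← Nat.xor_assoc] at this
    · rcases List.mem_append.1 hx with hx | hx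
      · exact ⟨x, subset_xorSpan hx, by rw [Nat.xor_self]; exact (xorSpan_closed G).zero⟩
      · exact ⟨0, (xorSpan_closed X).zero, by rw [Nat.xor_zero]; exact subset_xorSpan hx⟩
  obtain ⟨x, hx, hwx⟩ := this w (hX w hw)
  exact ⟨x, hx, ((H.maskClass_eq_iff hw (hgood x hx)).2 hwx).symm⟩

omit H in
lemma bitCount_mod_two_pow (r y : ℕ) :
    bitCount (r + 1) y = bitCount r (y % 2 ^ r) + if y.testBit r then 1 else 0 := by
  rw [bitCount_eq, bitCount_eq, Finset.sum_range_succ]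
  congr 1
  refine Finset.sum_congr rfl fun i hi => ?_
  rw [Nat.testBit_mod_two_pow, decide_eq_true (Finset.mem_range.1 hi), Bool.true_and]

omit H in
lemma card_discO_eq {h : IsEvenLattice (negForm C) (maskLattice e G)}
    {q : DiscGroup (negForm C) (maskLattice e G) → ZMod 4}
    (hq : ∀ z, discForm h z = negHalf (q z)) : Nat.card (discO h) = Nat.card (Isom q) := by
  refine Nat.card_congr (Equiv.subtypeEquivRight fun σ => ?_)
  refine forall_congr' fun x => ?_
  rw [hq, hq, negHalf_injective.eq_iff]

/-- Here the discriminant form itself has an orthogonal basis Y with odd values. -/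
theorem card_discO_odd (h : IsEvenLattice (negForm C) (maskLattice e G)) {X Y : List ℕ}
    (hX : ∀ w, Good r E G w → w ∈ xorSpan (X ++ G)) (hXG : ∀ x ∈ X, Good r E G x)
    (hY : ∀ y ∈ Y, Good r E G y) (hodd : ∀ y ∈ Y, bitCount r y % 2 = 1)
    (horth : Y.Pairwise fun y y' => bitCount r (y &&& y') % 2 = 0)
    (hsep : ∀ x ∈ X, x ^^^ orthCombo r Y x ∈ xorSpan G) :
    Nat.card (discO h) = isometryCount (Y.map fun y => (bitCount r y : ZMod 4)) ∧
      Nat.card (DiscGroup (negForm C) (maskLattice e G)) = 2 ^ Y.length := by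
  obtain ⟨q, hq, hqf, hqv⟩ := H.exists_discValue h
  have := H.finite_discGroup
  have M : MaskModel q (maskClass C e G) (Good r E G) r X := ⟨good_closed r E G,
    fun a b => H.maskClass_xor, hqv, hXG, H.exists_base hX hXG⟩
  obtain ⟨h1, h2, -⟩ := M.card_isom hq hY hodd horth fun x hx => by
    have hg := M.closed.xor (hXG x hx) (orthCombo_mem M.closed r hY x)
    have h0 : maskClass C e G 0 = 0 := by
      have := M.add 0 0 M.closed.zero M.closed.zero
      rw [Nat.xor_self] at this
      exact left_eq_add.1 this
    rw [← h0, H.maskClass_eq_iff hg M.closed.zero, Nat.xor_zero]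
    exact hsep x hx
  exact ⟨(card_discO_eq hqf).trans h1, h2⟩

/-- A form with even values has no orthogonal basis of odd vectors, so the stabilized form is used.
Its extra generator is the bit at position r, one beyond the positions of the simple roots; this
explains r + 1 positions, the additional base word 2^r and the factor 2 in the order. -/
theorem card_discO_even (h : IsEvenLattice (negForm C) (maskLattice e G)) {X Y : List ℕ}
    (hX : ∀ w, Good r E G w → w ∈ xorSpan (X ++ G)) (hXG : ∀ x ∈ X, Good r E G x)
    (hXe : ∀ x ∈ X, bitCount r x % 2 = 0)
    (hY : ∀ y ∈ Y, Good r E G (y % 2 ^ r)) (hodd : ∀ y ∈ Y, bitCount (r + 1) y % 2 = 1)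
    (horth : Y.Pairwise fun y y' => bitCount (r + 1) (y &&& y') % 2 = 0)
    (hsep : ∀ x ∈ 2 ^ r :: X, x ^^^ orthCombo (r + 1) Y x ∈ xorSpan G) :
    Nat.card (discO h) = isometryCount (Y.map fun y => (bitCount (r + 1) y : ZMod 4)) ∧
      Nat.card (DiscGroup (negForm C) (maskLattice e G)) * 2 = 2 ^ Y.length := by
  obtain ⟨q, hq, hqf, hqv⟩ := H.exists_discValue h
  have := H.finite_discGroup
  have hgc := good_closed r E G
  have h0 : maskClass C e G 0 = 0 := by
    have := H.maskClass_xor hgc.zero hgc.zero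
    rw [Nat.xor_self] at this
    exact left_eq_add.1 this
  let elt : ℕ → DiscGroup (negForm C) (maskLattice e G) × ZMod 2 := fun y =>
    (maskClass C e G (y % 2 ^ r), if y.testBit r then 1 else 0)
  have hmod : ∀ w, Good r E G w → w % 2 ^ r = w := fun w hw =>
    Nat.mod_eq_of_lt (H.xorSpan_lt hw.1)
  have hbit : ∀ w, Good r E G w → w.testBit r = false := fun w hw =>
    Nat.testBit_lt_two_pow (H.xorSpan_lt hw.1)
  have helt : ∀ w, Good r E G w → elt w = (maskClass C e G w, 0) := fun w hw => by
    simp only [elt, hmod w hw, hbit w hw]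
    rfl
  have hSc : XorClosed fun y => Good r E G (y % 2 ^ r) :=
    ⟨by rw [Nat.zero_mod]; exact hgc.zero, fun {a b} ha hb => by
      rw [Nat.xor_mod_two_pow]; exact hgc.xor ha hb⟩
  have hXS : ∀ x ∈ 2 ^ r :: X, Good r E G (x % 2 ^ r) := by
    intro x hx
    rcases List.mem_cons.1 hx with rfl | hx
    · rw [Nat.mod_self]; exact hgc.zero
    · rw [hmod x (hXG x hx)]; exact hXG x hx
  have hgood := xorSpan_le hgc hXG
  have M : MaskModel (stabilize q) elt (fun y => Good r E G (y % 2 ^ r)) (r + 1) (2 ^ r :: X) := by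
    refine ⟨hSc, fun a b ha hb => ?_, fun a ha => ?_, hXS, fun z => ?_⟩
    · refine Prod.ext ?_ ?_
      · change maskClass C e G ((a ^^^ b) % 2 ^ r) = _
        rw [Nat.xor_mod_two_pow, H.maskClass_xor ha hb]
        rfl
      · change (if (a ^^^ b).testBit r then (1 : ZMod 2) else 0) =
          (if a.testBit r then 1 else 0) + if b.testBit r then 1 else 0
        rw [Nat.testBit_xor]
        cases a.testBit r <;> cases b.testBit r <;> rfl
    · rw [bitCount_mod_two_pow, stabilize]
      change q (maskClass C e G (a % 2 ^ r)) + _ = _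
      rw [hqv _ ha]
      push_cast
      congr 1
      change (if (if a.testBit r then (1 : ZMod 2) else 0) = 0 then (0 : ZMod 4) else 1) = _
      cases a.testBit r <;> rfl
    · obtain ⟨w, hw, hwz⟩ := H.exists_base hX hXG z.1
      have hz2 : z.2 = 0 ∨ z.2 = 1 := by
        generalize z.2 = t
        revert t
        decide
      have hg := hgood w hw
      rcases hz2 with h2 | h2
      · refine ⟨w, mem_xorSpan_cons.2 (Or.inl hw), ?_⟩
        rw [helt w hg, hwz, ← h2]
      · refine ⟨2 ^ r ^^^ w, mem_xorSpan_cons.2 (Or.inr ?_), Prod.ext ?_ ?_⟩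
        · rwa [← Nat.xor_assoc, Nat.xor_self, Nat.zero_xor]
        · change maskClass C e G ((2 ^ r ^^^ w) % 2 ^ r) = _
          rw [Nat.xor_mod_two_pow, Nat.mod_self, Nat.zero_xor, hmod w hg, hwz]
        · change (if (2 ^ r ^^^ w).testBit r then (1 : ZMod 2) else 0) = _
          rw [Nat.testBit_xor, Nat.testBit_two_pow_self, hbit w hg, h2]
          rfl
  obtain ⟨h1, h2, h3⟩ := M.card_isom (isQuadratic_stabilize hq) hY hodd horth fun x hx => by
    have hg := hsep x hx
    rw [helt _ (H.good_glue hg)]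
    refine Prod.ext ?_ rfl
    change maskClass C e G _ = 0
    rw [← h0, H.maskClass_eq_iff (H.good_glue hg) hgc.zero, Nat.xor_zero]
    exact hg
  have heven : ∀ x, 2 * q x = 0 := by
    intro z
    obtain ⟨w, hw, rfl⟩ := H.exists_base hX hXG z
    have : Good r E G w ∧ bitCount r w % 2 = 0 := by
      refine xorSpan_le (S := fun w => Good r E G w ∧ bitCount r w % 2 = 0)
        ⟨⟨hgc.zero, by simp [bitCount_eq]⟩, fun {a b} ha hb => ⟨hgc.xor ha.1 hb.1, ?_⟩⟩
        (fun x hx => ⟨hXG x hx, hXe x hx⟩) w hw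
      have h1 := bitCount_xor r a b
      have h2 := ha.2
      have h3 := hb.2
      omega
    rw [hqv w this.1, two_mul_natCast_eq_zero]
    exact this.2
  refine ⟨?_, ?_⟩
  · rw [card_discO_eq hqf, ← card_isom_stabilize hq heven h3, h1]
  · rw [← h2, Nat.card_prod, Nat.card_zmod]

end MaskCode

end DiscriminantMasks

/-! ### Permutations of the nodes acting on words -/

section Moves

variable {ι : Type*} [Fintype ι] [DecidableEq ι] {r : ℕ} {e : ι ≃ Fin r}

/-- `m` moves the bits of masks by the permutation `σ`. -/
def Moves (e : ι ≃ Fin r) (σ : Equiv.Perm ι) (m : ℕ → ℕ) : Prop :=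
  ∀ w, w < 2 ^ r → m w < 2 ^ r ∧ ∀ p, (m w).testBit (e (σ p)) = w.testBit (e p)

omit [Fintype ι] [DecidableEq ι] in
lemma exists_moves (e : ι ≃ Fin r) (σ : Equiv.Perm ι) : ∃ m, Moves e σ m := by
  refine ⟨fun w => Nat.ofBits fun i : Fin r => w.testBit (e (σ.symm (e.symm i))), fun w _ =>
    ⟨Nat.ofBits_lt_two_pow _, fun p => ?_⟩⟩
  rw [Nat.testBit_ofBits_lt _ _ (e (σ p)).2]
  simp

omit [Fintype ι] [DecidableEq ι] in
lemma exists_perm_of_moveIndex (e : ι ≃ Fin r) {g : List (ℕ × ℕ)}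
    (hg : ∀ p ∈ g, p.1 < r ∧ p.2 < r) :
    ∃ σ : Equiv.Perm ι, (∀ p, (e (σ p) : ℕ) = moveIndex g (e p)) ∧ Moves e σ (moveMask g) := by
  let f : Fin r → Fin r := fun i => ⟨moveIndex g i, moveIndex_lt hg i.2⟩
  have hf : Function.Injective f := fun i j h => Fin.ext (moveIndex_injective g (Fin.ext_iff.1 h))
  let s : Equiv.Perm (Fin r) := Equiv.ofBijective f (Finite.injective_iff_bijective.1 hf)
  let σ : Equiv.Perm ι := (e.trans s).trans e.symm
  have hσ : ∀ p, (e (σ p) : ℕ) = moveIndex g (e p) := fun p => by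
    change (e (e.symm (s (e p))) : ℕ) = _
    rw [Equiv.apply_symm_apply]
    rfl
  refine ⟨σ, hσ, fun w hw => ⟨Nat.lt_pow_two_of_testBit _ fun i hi => ?_, fun p => ?_⟩⟩
  -- All transpositions involve positions below r, so higher positions are fixed and remain empty.
  · have : moveIndex g i = i := by
      clear hσ σ s hf f
      induction g with
      | nil => rfl
      | cons p g ih =>
        have h := hg p List.mem_cons_self
        rw [moveIndex_cons, Equiv.swap_apply_of_ne_of_ne (by omega) (by omega)]
        exact ih fun q hq => hg q (List.mem_cons_of_mem _ hq)
    rw [← this, testBit_moveMask]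
    exact Nat.testBit_lt_two_pow (hw.trans_le (Nat.pow_le_pow_right two_pos hi))
  · rw [hσ, testBit_moveMask]

omit [Fintype ι] [DecidableEq ι] in
lemma Moves.xor {σ : Equiv.Perm ι} {m : ℕ → ℕ} (hm : Moves e σ m) {a b : ℕ} (ha : a < 2 ^ r)
    (hb : b < 2 ^ r) : m (a ^^^ b) = m a ^^^ m b := by
  have hab := Nat.xor_lt_two_pow ha hb
  refine eq_of_testBit (e := e) (hm _ hab).1 (Nat.xor_lt_two_pow (hm a ha).1 (hm b hb).1)
    fun p => ?_
  obtain ⟨p, rfl⟩ := σ.surjective p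
  rw [(hm _ hab).2, Nat.testBit_xor, Nat.testBit_xor, (hm a ha).2, (hm b hb).2]

omit [Fintype ι] [DecidableEq ι] in
lemma Moves.injOn {σ : Equiv.Perm ι} {m : ℕ → ℕ} (hm : Moves e σ m) {a b : ℕ} (ha : a < 2 ^ r)
    (hb : b < 2 ^ r) (h : m a = m b) : a = b :=
  eq_of_testBit (e := e) ha hb fun p => by rw [← (hm a ha).2, ← (hm b hb).2, h]

omit [Fintype ι] in
lemma apply_of_map_single [Finite ι] {σ : Equiv.Perm ι} {g : (ι → ℚ) ≃ₗ[ℚ] (ι → ℚ)}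
    (hg : ∀ p, g (Pi.single p 1) = Pi.single (σ p) 1) (x : ι → ℚ) (p : ι) : g x (σ p) = x p := by
  have h : (g : (ι → ℚ) →ₗ[ℚ] (ι → ℚ)) =
      ((LinearEquiv.funCongrLeft ℚ ℚ σ.symm : (ι → ℚ) ≃ₗ[ℚ] (ι → ℚ)) : (ι → ℚ) →ₗ[ℚ] (ι → ℚ)) := by
    refine LinearMap.pi_ext' fun p => LinearMap.ext_ring ?_
    change g (Pi.single p 1) = fun q => (Pi.single p (1 : ℚ) : ι → ℚ) (σ.symm q)
    rw [hg]
    ext q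
    simp only [Pi.single_apply, Equiv.symm_apply_eq]
  have h' := LinearMap.congr_fun h x
  change g _ = fun q => x (σ.symm q) at h'
  rw [h']
  exact congrArg x (σ.symm_apply_apply p)

omit [Fintype ι] in
lemma Moves.map_halfVec [Finite ι] {σ : Equiv.Perm ι} {m : ℕ → ℕ} (hm : Moves e σ m)
    {g : (ι → ℚ) ≃ₗ[ℚ] (ι → ℚ)} (hg : ∀ p, g (Pi.single p 1) = Pi.single (σ p) 1) {w : ℕ}
    (hw : w < 2 ^ r) : g (halfVec e w) = halfVec e (m w) := by
  ext q
  obtain ⟨p, rfl⟩ := σ.surjective q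
  rw [apply_of_map_single hg, halfVec, halfVec, (hm w hw).2]

/-- The isometry defined by a permutation of the simple roots. -/
lemma exists_isometry_intLattice {C : Matrix ι ι ℤ} {σ : Equiv.Perm ι}
    (hC : ∀ p q, C (σ p) (σ q) = C p q) : ∃ g : latticeO (negForm C) (intLattice ι),
      ∀ p, (g : (ι → ℚ) ≃ₗ[ℚ] (ι → ℚ)) (Pi.single p 1) = Pi.single (σ p) 1 := by
  let P : (ι → ℚ) ≃ₗ[ℚ] (ι → ℚ) := LinearEquiv.funCongrLeft ℚ ℚ σ.symm
  have hP : ∀ x p, P x (σ p) = x p := fun x p => congrArg x (σ.symm_apply_apply p)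
  refine ⟨⟨P, fun x y => ?_, fun x => ?_⟩, fun p => ?_⟩
  · rw [negForm_apply, negForm_apply, ← Equiv.sum_comp σ]
    congr 1
    refine Finset.sum_congr rfl fun p _ => ?_
    rw [← Equiv.sum_comp σ]
    exact Finset.sum_congr rfl fun q _ => by rw [hP, hP, hC]
  · rw [mem_intLattice, mem_intLattice, ← σ.forall_congr_right]
    simp only [hP]
  · change P (Pi.single p 1) = Pi.single (σ p) 1
    ext q
    obtain ⟨q, rfl⟩ := σ.surjective q
    rw [hP, Pi.single_apply, Pi.single_apply]
    simp only [σ.injective.eq_iff]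

/-- The masks `adjs` list the neighbours of the nodes of the diagram of `C`. -/
structure AdjCode (C : Matrix ι ι ℤ) (e : ι ≃ Fin r) (adjs : List ℕ) : Prop where
  length : adjs.length = r
  diag : ∀ p, C p p = 2
  off_diag : ∀ p q, p ≠ q → C p q = if (adjs.getD (e p) 0).testBit (e q) then -1 else 0
  loopless : ∀ p, (adjs.getD (e p) 0).testBit (e p) = false

omit [DecidableEq ι] in
lemma bitSum_eq_sum (e : ι ≃ Fin r) {cs : List ℕ} (h : cs.length = r) (w : ℕ) :
    bitSum cs w = ∑ p, if w.testBit (e p) then cs.getD (e p) 0 else 0 := by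
  rw [bitSum_eq, h, Finset.sum_range, ← e.sum_comp]

omit [DecidableEq ι] in
lemma bitSum_moves {cs : List ℕ} (h : cs.length = r) {σ : Equiv.Perm ι}
    (hcs : ∀ p, cs.getD (e (σ p)) 0 = cs.getD (e p) 0) {w w' : ℕ}
    (hw : ∀ p, w'.testBit (e (σ p)) = w.testBit (e p)) : bitSum cs w' = bitSum cs w := by
  rw [bitSum_eq_sum e h, bitSum_eq_sum e h, ← Equiv.sum_comp σ]
  exact Finset.sum_congr rfl fun p _ => by rw [hw, hcs]

namespace AdjCode

variable {C : Matrix ι ι ℤ} {adjs : List ℕ} (A : AdjCode C e adjs)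
include A

omit [Fintype ι] [DecidableEq ι] in
lemma length_weights (n : ℕ) : (weights adjs n).length = r := by
  induction n with
  | zero => rw [weights, List.length_map, A.length]
  | succ n ih => rw [weights, weightStep, List.length_zipWith, ih, A.length, min_self]

omit [Fintype ι] [DecidableEq ι] in
lemma testBit_comp {σ : Equiv.Perm ι} (hσ : ∀ p q, C (σ p) (σ q) = C p q) (p q : ι) :
    (adjs.getD (e (σ p)) 0).testBit (e (σ q)) = (adjs.getD (e p) 0).testBit (e q) := by
  by_cases h : p = q
  · rw [h, A.loopless, A.loopless]
  · have := hσ p q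
    rw [A.off_diag _ _ h, A.off_diag _ _ fun h' => h (σ.injective h')] at this
    revert this
    cases (adjs.getD (e p) 0).testBit (e q) <;>
      cases (adjs.getD (e (σ p)) 0).testBit (e (σ q)) <;> simp

omit [Fintype ι] [DecidableEq ι] in
lemma getD_weights_succ (n : ℕ) (p : ι) : (weights adjs (n + 1)).getD (e p) 0 =
    2 * (weights adjs n).getD (e p) 0 + bitSum (weights adjs n) (adjs.getD (e p) 0) := by
  have h1 : (e p : ℕ) < (weights adjs n).length := by rw [A.length_weights]; exact (e p).2
  have h2 : (e p : ℕ) < adjs.length := by rw [A.length]; exact (e p).2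
  have h3 : (e p : ℕ) < (weights adjs (n + 1)).length := by rw [A.length_weights]; exact (e p).2
  rw [List.getD_eq_getElem _ _ h1, List.getD_eq_getElem _ _ h2, List.getD_eq_getElem _ _ h3]
  simp only [weights, weightStep, List.getElem_zipWith]

omit [DecidableEq ι] in
-- The refinement step uses only the old weight and the sum of the old weights of the neighbours,
-- both of which a diagram automorphism preserves.
lemma weights_comp {σ : Equiv.Perm ι} (hσ : ∀ p q, C (σ p) (σ q) = C p q) (n : ℕ) (p : ι) :
    (weights adjs n).getD (e (σ p)) 0 = (weights adjs n).getD (e p) 0 := by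
  induction n generalizing p with
  | zero =>
    have h : ∀ p, (weights adjs 0).getD (e p) 0 = 1 := fun p => by
      have h2 : (e p : ℕ) < (weights adjs 0).length := by rw [A.length_weights]; exact (e p).2
      rw [List.getD_eq_getElem _ _ h2]
      simp [weights]
    rw [h, h]
  | succ n ih =>
    rw [A.getD_weights_succ, A.getD_weights_succ, ih,
      bitSum_moves (A.length_weights n) ih fun q => A.testBit_comp hσ p q]

omit [Fintype ι] [DecidableEq ι] in
lemma comp_of_moveMask {g : List (ℕ × ℕ)} {σ : Equiv.Perm ι}
    (hσ : ∀ p, (e (σ p) : ℕ) = moveIndex g (e p))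
    (hg : ∀ i < r, moveMask g (adjs.getD i 0) = adjs.getD (moveIndex g i) 0) (p q : ι) :
    C (σ p) (σ q) = C p q := by
  by_cases h : p = q
  · rw [h, A.diag, A.diag]
  · rw [A.off_diag _ _ h, A.off_diag _ _ fun h' => h (σ.injective h'), hσ, hσ, ← hg _ (e p).2,
      testBit_moveMask]

end AdjCode

lemma sumMap_comp {l : List ℕ} (hl : l.Nodup) {φ : ℕ → ℕ} (hφ : ∀ x ∈ l, φ x ∈ l)
    (hinj : ∀ x ∈ l, ∀ y ∈ l, φ x = φ y → x = y) {f g : ℕ → ℕ} (h : ∀ x ∈ l, f (φ x) = g x) :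
    sumMap f l = sumMap g l := by
  have himg : l.toFinset.image φ = l.toFinset := by
    refine Finset.eq_of_subset_of_card_le (fun y hy => ?_) ?_
    · obtain ⟨x, hx, rfl⟩ := Finset.mem_image.1 hy
      exact List.mem_toFinset.2 (hφ x (List.mem_toFinset.1 hx))
    · rw [Finset.card_image_of_injOn]
      intro x hx y hy
      exact hinj x (List.mem_toFinset.1 hx) y (List.mem_toFinset.1 hy)
  rw [sumMap_eq, sumMap_eq, ← List.sum_toFinset _ hl, ← List.sum_toFinset _ hl]
  conv_lhs => rw [← himg]
  rw [Finset.sum_image fun x hx y hy => hinj x (List.mem_toFinset.1 hx) y (List.mem_toFinset.1 hy)]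
  exact Finset.sum_congr rfl fun x hx => h x (List.mem_toFinset.1 hx)

omit [DecidableEq ι] in
-- The representative x' is known only modulo the glue code. Since the automorphism permutes that
-- code, c ↦ (x' + m x) + m c permutes it as well. After this substitution x' plus the new glue word
-- is the image of x + c, whose weight is that of x + c.
lemma classWeight_moves {cs G : List ℕ} (hcs : cs.length = r) (hG : (xorSpan G).Nodup)
    (hlt : ∀ c ∈ xorSpan G, c < 2 ^ r) {σ : Equiv.Perm ι} {m : ℕ → ℕ} (hm : Moves e σ m)
    (hσ : ∀ p, cs.getD (e (σ p)) 0 = cs.getD (e p) 0) (hmG : ∀ c ∈ xorSpan G, m c ∈ xorSpan G)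
    (fine : Bool) {x y x' y' : ℕ} (hx : x < 2 ^ r) (hy : y < 2 ^ r)
    (hx' : x' ^^^ m x ∈ xorSpan G) (hy' : y' ^^^ m y ∈ xorSpan G) :
    classWeight fine cs (xorSpan G) x' y' = classWeight fine cs (xorSpan G) x y := by
  have hsum : ∀ w, w < 2 ^ r → bitSum cs (m w) = bitSum cs w := fun w hw =>
    bitSum_moves hcs hσ (hm w hw).2
  have hc := xorSpan_closed G
  have hφ : ∀ c0 ∈ xorSpan G, ∀ c ∈ xorSpan G, c0 ^^^ m c ∈ xorSpan G := fun c0 h0 c h =>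
    hc.xor h0 (hmG c h)
  have hinj : ∀ c0, ∀ c ∈ xorSpan G, ∀ d ∈ xorSpan G, c0 ^^^ m c = c0 ^^^ m d → c = d :=
    fun c0 c hc d hd h => hm.injOn (hlt c hc) (hlt d hd) (Nat.xor_right_injective h)
  have hshift : ∀ x x', x < 2 ^ r → ∀ c ∈ xorSpan G, x' ^^^ ((x' ^^^ m x) ^^^ m c) = m (x ^^^ c) :=
    fun x x' hx c hc => by
      rw [hm.xor hx (hlt c hc), ← Nat.xor_assoc, ← Nat.xor_assoc, Nat.xor_self, Nat.zero_xor]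
  cases fine with
  | false =>
    refine sumMap_comp hG (hφ _ (hc.xor hx' hy')) (hinj _) fun c hcG => ?_
    change (bitSum cs ((x' ^^^ y') ^^^ (((x' ^^^ m x) ^^^ (y' ^^^ m y)) ^^^ m c)) + 1) ^ 5 =
      (bitSum cs ((x ^^^ y) ^^^ c) + 1) ^ 5
    have h1 : (x' ^^^ m x) ^^^ (y' ^^^ m y) = (x' ^^^ y') ^^^ m (x ^^^ y) := by
      rw [hm.xor hx hy]
      simp only [Nat.xor_assoc, Nat.xor_left_comm]
    have hxy := Nat.xor_lt_two_pow hx hy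
    rw [h1, hshift _ _ hxy c hcG, hsum _ (Nat.xor_lt_two_pow hxy (hlt c hcG))]
  | true =>
    refine sumMap_comp hG (hφ _ hx') (hinj _) fun c hcG => ?_
    refine sumMap_comp hG (hφ _ hy') (hinj _) fun d hdG => ?_
    have h1 := Nat.xor_lt_two_pow hx (hlt c hcG)
    have h2 := Nat.xor_lt_two_pow hy (hlt d hdG)
    change pairWeight cs (x' ^^^ ((x' ^^^ m x) ^^^ m c)) (y' ^^^ ((y' ^^^ m y) ^^^ m d)) =
      pairWeight cs (x ^^^ c) (y ^^^ d)
    rw [hshift _ _ hx c hcG, hshift _ _ hy d hdG]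
    change (bitSum cs (m (x ^^^ c)) + 1) * (bitSum cs (m (y ^^^ d)) + 2) ^ 2 *
        (bitSum cs (m (x ^^^ c) ^^^ m (y ^^^ d)) ^ 2 + 3) =
      (bitSum cs (x ^^^ c) + 1) * (bitSum cs (y ^^^ d) + 2) ^ 2 *
        (bitSum cs ((x ^^^ c) ^^^ (y ^^^ d)) ^ 2 + 3)
    rw [← hm.xor h1 h2, hsum _ h1, hsum _ h2, hsum _ (Nat.xor_lt_two_pow h1 h2)]

end Moves

lemma length_chainSizes (fine : Bool) (cs Gs Ds ech : List ℕ) (gens : List (List (ℕ × ℕ)))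
    (prev xs : List ℕ) : (chainSizes fine cs Gs Ds ech gens prev xs).length = xs.length := by
  induction xs generalizing prev with
  | nil => rfl
  | cons x xs ih => rw [chainSizes, List.length_cons, ih, List.length_cons]

/-! ### The image of O(K) in O(q_K), computed along a stabilizer chain -/

section Chain

open MaskCode

variable {ι : Type*} [Fintype ι] [DecidableEq ι] {r : ℕ} {e : ι ≃ Fin r}
  {C : Matrix ι ι ℤ} {E G : List ℕ} (H : MaskCode C e E G)
include H

lemma MaskCode.maskClass_zero : maskClass C e G 0 = 0 := by
  have := H.maskClass_xor (good_closed r E G).zero (good_closed r E G).zero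
  rw [Nat.xor_self] at this
  exact left_eq_add.1 this

/-- The words of the span of X represent all classes, and there are as many words as classes.
Counting words therefore counts classes. -/
lemma MaskCode.nodup_base {X : List ℕ}
    (hX : ∀ z : DiscGroup (negForm C) (maskLattice e G), ∃ w ∈ xorSpan X, maskClass C e G w = z)
    (hcard : Nat.card (DiscGroup (negForm C) (maskLattice e G)) = 2 ^ X.length) :
    ((xorSpan X).map (maskClass C e G)).Nodup := by
  classical
  have := H.finite_discGroup
  have := Fintype.ofFinite (DiscGroup (negForm C) (maskLattice e G))
  have h : ((xorSpan X).map (maskClass C e G)).toFinset = Finset.univ := by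
    refine Finset.eq_univ_of_forall fun z => List.mem_toFinset.2 ?_
    obtain ⟨w, hw, rfl⟩ := hX z
    exact List.mem_map_of_mem hw
  refine Multiset.coe_nodup.1 (Multiset.toFinset_card_eq_card_iff_nodup.1 ?_)
  change ((xorSpan X).map (maskClass C e G)).toFinset.card = ((xorSpan X).map (maskClass C e G)).length
  rw [h, Finset.card_univ, ← Nat.card_eq_fintype_card, hcard, List.length_map, length_xorSpan]

variable {g : latticeO (negForm C) (maskLattice e G)} {σ : Equiv.Perm ι}
  (hg : ∀ p, (g : (ι → ℚ) ≃ₗ[ℚ] (ι → ℚ)) (Pi.single p 1) = Pi.single (σ p) 1)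
include hg

omit H in
lemma comp_of_isometry (p q : ι) : C (σ p) (σ q) = C p q := by
  have h := g.2.1 (Pi.single p 1) (Pi.single q 1)
  rw [hg, hg, negForm_single_single, negForm_single_single] at h
  exact_mod_cast neg_injective h

variable {m : ℕ → ℕ} (hm : Moves e σ m)
include hm

lemma MaskCode.moves_glue {c : ℕ} (hc : c ∈ xorSpan G) : m c ∈ xorSpan G := by
  have hlt := H.xorSpan_lt (H.xorSpan_glue hc)
  refine mem_xorSpan_of_halfVec_mem (e := e) H.glue_lt (hm c hlt).1 ?_
  rw [← hm.map_halfVec hg hlt]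
  exact (g.2.2 _).2 (halfVec_mem_maskLattice hc)

lemma MaskCode.moves_good {w : ℕ} (hw : Good r E G w) : Good r E G (m w) ∧
    discEquiv g (maskClass C e G w) = maskClass C e G (m w) := by
  have hlt := H.xorSpan_lt hw.1
  have h1 : halfVec e (m w) ∈ dualLattice (negForm C) (maskLattice e G) := by
    rw [← hm.map_halfVec hg hlt]
    exact (K3Frames.mem_dual_iff g.2 _).2 (H.good_dual hw)
  obtain ⟨w', hw', h, -⟩ := H.exists_mask_of_dual h1
  have h2 := eq_of_testBit (e := e) (hm w hlt).1 (H.xorSpan_lt hw') (testBit_eq_of_sub_mem h)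
  have h3 : Good r E G (m w) := ⟨h2 ▸ hw', (H.mem_dual_iff (h2 ▸ hw')).1 h1⟩
  refine ⟨h3, ?_⟩
  rw [maskClass_eq (H.good_dual hw), maskClass_eq h1, discEquiv_mk]
  congr 1
  exact Subtype.ext (hm.map_halfVec hg hlt)

omit hg hm

/-- A permutation of the nodes that preserves the diagram and the glue words is an isometry. -/
lemma MaskCode.exists_isometry (hC : ∀ p q, C (σ p) (σ q) = C p q) (hm : Moves e σ m)
    (hG : ∀ c ∈ G, m c ∈ xorSpan G) : ∃ g : latticeO (negForm C) (maskLattice e G),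
      ∀ p, (g : (ι → ℚ) ≃ₗ[ℚ] (ι → ℚ)) (Pi.single p 1) = Pi.single (σ p) 1 := by
  obtain ⟨⟨P, hP⟩, hs⟩ := exists_isometry_intLattice hC
  replace hs : ∀ p, P (Pi.single p 1) = Pi.single (σ p) 1 := hs
  have hlt : ∀ c ∈ xorSpan G, c < 2 ^ r := fun c hc => H.xorSpan_lt (H.xorSpan_glue hc)
  have hG' : ∀ c ∈ xorSpan G, m c ∈ xorSpan G := by
    have : XorClosed fun c => c < 2 ^ r ∧ m c ∈ xorSpan G := by
      refine ⟨⟨by positivity, ?_⟩, fun {a b} ha hb => ⟨Nat.xor_lt_two_pow ha.1 hb.1, ?_⟩⟩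
      · have h0 := hm.xor (a := 0) (b := 0) (by positivity) (by positivity)
        rw [Nat.xor_self, Nat.xor_self] at h0
        rw [h0]
        exact (xorSpan_closed G).zero
      · rw [hm.xor ha.1 hb.1]
        exact (xorSpan_closed G).xor ha.2 hb.2
    exact fun c hc => (xorSpan_le this (fun c hc => ⟨H.glue_lt c hc, hG c hc⟩) c hc).2
  have hsurj : ∀ c ∈ xorSpan G, ∃ d ∈ xorSpan G, m d = c := by
    intro c hc
    -- An injective map of the finite glue code into itself is surjective, so the inverse isometry
    -- preserves the lattice too.
    have h := Finset.surj_on_of_inj_on_of_card_le (s := (xorSpan G).toFinset)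
      (t := (xorSpan G).toFinset) (fun c _ => m c)
      (fun c hc => List.mem_toFinset.2 (hG' c (List.mem_toFinset.1 hc)))
      (fun c d hc hd h => hm.injOn (hlt c (List.mem_toFinset.1 hc))
        (hlt d (List.mem_toFinset.1 hd)) h) le_rfl c (List.mem_toFinset.2 hc)
    obtain ⟨d, hd, h⟩ := h
    exact ⟨d, List.mem_toFinset.1 hd, h.symm⟩
  have hle := intLattice_le_maskLattice (e := e) G
  have hmem : ∀ x, P x ∈ maskLattice e G ↔ x ∈ maskLattice e G := fun x => by
    constructor
    · intro h
      obtain ⟨c, hc, h⟩ := exists_mask_of_mem h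
      obtain ⟨d, hd, rfl⟩ := hsurj c hc
      rw [← hm.map_halfVec hs (hlt d hd), ← map_sub, hP.2] at h
      have := Submodule.add_mem _ (hle h) (halfVec_mem_maskLattice (e := e) hd)
      rwa [sub_add_cancel] at this
    · intro h
      obtain ⟨c, hc, h⟩ := exists_mask_of_mem h
      rw [← hP.2, map_sub, hm.map_halfVec hs (hlt c hc)] at h
      have := Submodule.add_mem _ (hle h) (halfVec_mem_maskLattice (e := e) (hG' c hc))
      rwa [sub_add_cancel] at this
  exact ⟨⟨P, hP.1, hmem⟩, hs⟩

variable {adjs : List ℕ} (A : AdjCode C e adjs)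
include A

/-- The condition on a sequence of transpositions to define an isometry. -/
def IsSymmetry (r : ℕ) (adjs G : List ℕ) (s : List (ℕ × ℕ)) : Prop :=
  (∀ p ∈ s, p.1 < r ∧ p.2 < r) ∧
  (∀ i < r, moveMask s (adjs.getD i 0) = adjs.getD (moveIndex s i) 0) ∧
  ∀ c ∈ G, moveMask s c ∈ xorSpan G

lemma MaskCode.exists_range (h : IsEvenLattice (negForm C) (maskLattice e G))
    {s : List (ℕ × ℕ)} (hs : IsSymmetry r adjs G s) : ∃ γ : (discHom h).range,
      ∀ w, Good r E G w → Good r E G (moveMask s w) ∧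
        γ • maskClass C e G w = maskClass C e G (moveMask s w) := by
  obtain ⟨σ, hσ, hm⟩ := exists_perm_of_moveIndex e hs.1
  obtain ⟨g, hg⟩ := H.exists_isometry (A.comp_of_moveMask hσ hs.2.1) hm hs.2.2
  exact ⟨⟨discHom h g, g, rfl⟩, fun w hw => H.moves_good hg hm hw⟩

/-- An element of the image is induced by an isometry that permutes the simple roots, even if it was
given by another isometry. For a permutation the class invariant is preserved, also relative to the
fixed classes. -/
lemma MaskCode.orbit_subset (h : IsEvenLattice (negForm C) (maskLattice e G)) {X : List ℕ}
    (hX : ∀ z : DiscGroup (negForm C) (maskLattice e G), ∃ w ∈ xorSpan X, maskClass C e G w = z)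
    (hXG : ∀ x ∈ X, Good r E G x) (fine : Bool) (n : ℕ) {prev : List ℕ}
    (hprev : ∀ y ∈ prev, Good r E G y) {x : ℕ} (hx : Good r E G x) (γ : (discHom h).range)
    (hγ : ∀ y ∈ prev, γ • maskClass C e G y = maskClass C e G y) :
    ∃ t ∈ orbitBound fine (weights adjs n) (xorSpan G) (xorSpan X) prev x,
      maskClass C e G t = γ • maskClass C e G x := by
  obtain ⟨γ', g, hg'⟩ := γ
  subst hg'
  obtain ⟨g', σ, hg, hgg⟩ := exists_permutation_of_isometry h H.neg H.diag H.off_diag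
    H.rootSublattice_eq g
  obtain ⟨m, hm⟩ := exists_moves e σ
  have hact : ∀ w, Good r E G w → (⟨discHom h g, g, rfl⟩ : (discHom h).range) • maskClass C e G w =
      maskClass C e G (m w) := fun w hw => by
    rw [← (H.moves_good hg hm hw).2]
    change (discHom h g).1 _ = (discHom h g').1 _
    rw [hgg]
  have hgood : ∀ w, Good r E G w → Good r E G (m w) := fun w hw => (H.moves_good hg hm hw).1
  obtain ⟨t, ht, hte⟩ := hX ((⟨discHom h g, g, rfl⟩ : (discHom h).range) • maskClass C e G x)
  refine ⟨t, List.mem_filter.2 ⟨ht, List.all_eq_true.2 fun y hy => ?_⟩, hte⟩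
  have htG := xorSpan_le (good_closed r E G) hXG t ht
  have h1 := hγ y (hy)
  rw [hact y (hprev y hy), eq_comm, H.maskClass_eq_iff (hprev y hy) (hgood y (hprev y hy))] at h1
  rw [hact x hx, H.maskClass_eq_iff htG (hgood x hx)] at hte
  rw [classWeight_moves (A.length_weights n) H.nodup (fun c hc => H.xorSpan_lt (H.xorSpan_glue hc))
    hm (A.weights_comp (comp_of_isometry hg) n) (fun c hc => H.moves_glue hg hm hc) fine
    (H.xorSpan_lt (hprev y hy).1) (H.xorSpan_lt hx.1) h1 hte]
  exact Nat.beq_refl _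

/-- Each generator used in the search is an isometry that fixes the classes in `prev`, and reduction
by the echelon basis does not change classes. The found words are thus images of x under products of
elements of the stabilizer. -/
lemma MaskCode.orbitList_subset (h : IsEvenLattice (negForm C) (maskLattice e G))
    {gens : List (List (ℕ × ℕ))} (hgens : ∀ s ∈ gens, IsSymmetry r adjs G s) {prev : List ℕ}
    (hprev : ∀ y ∈ prev, Good r E G y) {x : ℕ} (hx : Good r E G x) {t : ℕ}
    (ht : t ∈ orbitList (echelon [] G) gens prev x) : ∃ γ : (discHom h).range,
      (∀ y ∈ prev, γ • maskClass C e G y = maskClass C e G y) ∧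
      maskClass C e G t = γ • maskClass C e G x := by
  have hech := echelon_mem (xorSpan_closed G) (fun _ => subset_xorSpan) (ech := []) (by simp)
  have hred : ∀ w, Good r E G w → Good r E G (xorReduce (echelon [] G) w) ∧
      maskClass C e G (xorReduce (echelon [] G) w) = maskClass C e G w := fun w hw => by
    have h1 := xorReduce_xor (xorSpan_closed G) hech w
    have h2 : Good r E G (xorReduce (echelon [] G) w) := by
      have := (good_closed r E G).xor (H.good_glue h1) hw
      rwa [Nat.xor_assoc, Nat.xor_self, Nat.xor_zero] at this
    exact ⟨h2, (H.maskClass_eq_iff h2 hw).2 h1⟩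
  refine (closeUp_induction (Q := fun t => Good r E G t ∧ ∃ γ : (discHom h).range,
      (∀ y ∈ prev, γ • maskClass C e G y = maskClass C e G y) ∧
      maskClass C e G t = γ • maskClass C e G x) ?_ 1000 (front := [x]) (seen := [x]) ?_ ?_ t ht).2
  · rintro w ⟨hw, γ, hγ, hwγ⟩ v hv
    obtain ⟨s, hs, rfl⟩ := List.mem_map.1 hv
    obtain ⟨hs, hfix⟩ := List.mem_filter.1 hs
    obtain ⟨δ, hδ⟩ := H.exists_range A h (hgens s hs)
    have h1 := hred _ (hδ w hw).1
    refine ⟨h1.1, δ * γ, fun y hy => ?_, ?_⟩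
    · rw [mul_smul, hγ y hy, (hδ y (hprev y hy)).2, ← (hred _ (hδ y (hprev y hy)).1).2,
        Nat.eq_of_beq_eq_true (List.all_eq_true.1 hfix y hy)]
    · rw [h1.2, mul_smul, ← hwγ, (hδ w hw).2]
  all_goals
    intro w hw
    rw [List.mem_singleton.1 hw]
    exact ⟨hx, 1, fun y _ => one_smul _ _, (one_smul _ _).symm⟩

/-- The base is X: an element that fixes the generating classes is the identity, so the chain ends
in the trivial group. -/
lemma MaskCode.orbitChain (h : IsEvenLattice (negForm C) (maskLattice e G)) {X : List ℕ}
    (hX : ∀ z : DiscGroup (negForm C) (maskLattice e G), ∃ w ∈ xorSpan X, maskClass C e G w = z)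
    (hXG : ∀ x ∈ X, Good r E G x)
    (hcard : Nat.card (DiscGroup (negForm C) (maskLattice e G)) = 2 ^ X.length)
    {gens : List (List (ℕ × ℕ))} (hgens : ∀ s ∈ gens, IsSymmetry r adjs G s) (fine : Bool) (n : ℕ)
    {prev xs : List ℕ} (hprev : ∀ y ∈ prev, Good r E G y) (hxs : ∀ x ∈ xs, x ∈ X)
    (hall : ∀ x ∈ X, x ∈ prev ∨ x ∈ xs)
    {pre : List (DiscGroup (negForm C) (maskLattice e G))}
    (hpre : ∀ γ : (discHom h).range, γ ∈ listStabilizer (discHom h).range pre ↔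
      ∀ y ∈ prev, γ • maskClass C e G y = maskClass C e G y)
    (hne : ∀ t ∈ chainSizes fine (weights adjs n) (xorSpan G) (xorSpan X) (echelon [] G) gens
      prev xs, t ≠ 0) :
    OrbitChain (discHom h).range (· = ·) pre ((xs.map (maskClass C e G)).zip
      (chainSizes fine (weights adjs n) (xorSpan G) (xorSpan X) (echelon [] G) gens prev xs)) := by
  induction xs generalizing prev pre with
  | nil =>
    change listStabilizer _ _ = ⊥
    refine (Subgroup.eq_bot_iff_forall _).2 fun γ hγ => ?_
    rw [hpre] at hγ
    have hfix : ∀ w ∈ xorSpan X, Good r E G w ∧ γ • maskClass C e G w = maskClass C e G w := by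
      refine xorSpan_le (S := fun w => Good r E G w ∧ γ • maskClass C e G w = maskClass C e G w)
        ⟨⟨(good_closed r E G).zero, ?_⟩, fun {a b} ha hb => ⟨(good_closed r E G).xor ha.1 hb.1, ?_⟩⟩
        fun x hx => ⟨hXG x hx, hγ x ((hall x hx).resolve_right (by simp))⟩
      · rw [H.maskClass_zero]
        exact map_zero γ.1.1
      · rw [H.maskClass_xor ha.1 hb.1]
        refine (map_add γ.1.1 _ _).trans ?_
        exact congrArg₂ _ ha.2 hb.2
    refine Subtype.ext (Subtype.ext (LinearEquiv.ext fun z => ?_))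
    obtain ⟨w, hw, rfl⟩ := hX z
    exact (hfix w hw).2
  | cons x xs ih =>
    have hx := hXG x (hxs x List.mem_cons_self)
    rw [chainSizes] at hne ⊢
    have h0 := hne _ List.mem_cons_self
    have hsub : ∀ t ∈ orbitBound fine (weights adjs n) (xorSpan G) (xorSpan X) prev x,
        t ∈ orbitList (echelon [] G) gens prev x := by
      by_contra hcon
      -- A failed comparison would have made the entry zero.
      refine h0 (if_neg fun h' => hcon fun t ht => ?_)
      exact memNat_iff.1 (List.all_eq_true.1 h' t ht)
    rw [if_pos (List.all_eq_true.2 fun t ht => memNat_iff.2 (hsub t ht))]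
    refine ⟨?_, ih (fun y hy => ?_) (fun y hy => hxs y (List.mem_cons_of_mem _ hy))
      (fun y hy => ?_) (fun γ => ?_) fun t ht => hne t (List.mem_cons_of_mem _ ht)⟩
    · classical
      have hnd := H.nodup_base hX hcard
      -- The two bounds enclose the orbit and agree, so the orbit is the set of classes of
      -- `orbitBound`.
      have horb : MulAction.orbit (listStabilizer (discHom h).range pre) (maskClass C e G x) =
          ↑((orbitBound fine (weights adjs n) (xorSpan G) (xorSpan X) prev x).map
            (maskClass C e G)).toFinset := by
        ext z
        simp only [List.coe_toFinset, List.mem_map, Set.mem_ofPred_eq]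
        constructor
        · rintro ⟨γ, rfl⟩
          exact H.orbit_subset A h hX hXG fine n hprev hx γ.1 ((hpre _).1 γ.2)
        · rintro ⟨t, ht, rfl⟩
          obtain ⟨γ, hγ, htγ⟩ := H.orbitList_subset A h hgens hprev hx (hsub t ht)
          exact ⟨⟨γ, (hpre _).2 hγ⟩, htγ.symm⟩
      rw [horb, Set.ncard_coe_finset, List.toFinset_card_of_nodup, List.length_map]
      exact hnd.sublist (List.filter_sublist.map _)
    · rcases List.mem_cons.1 hy with rfl | hy
      exacts [hx, hprev y hy]
    · rcases hall y hy with hy | hy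
      · exact Or.inl (List.mem_cons_of_mem _ hy)
      · rcases List.mem_cons.1 hy with rfl | hy
        exacts [Or.inl List.mem_cons_self, Or.inr hy]
    · have : γ ∈ listStabilizer (discHom h).range (maskClass C e G x :: pre) ↔
          γ • maskClass C e G x = maskClass C e G x ∧ γ ∈ listStabilizer (discHom h).range pre :=
        List.forall_mem_cons
      rw [this, hpre, List.forall_mem_cons]

/-- The order of the image of `O(K)` in `O(q_K)`. -/
theorem MaskCode.card_range (h : IsEvenLattice (negForm C) (maskLattice e G)) {X : List ℕ}
    (hX : ∀ w, Good r E G w → w ∈ xorSpan (X ++ G)) (hXG : ∀ x ∈ X, Good r E G x)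
    (hcard : Nat.card (DiscGroup (negForm C) (maskLattice e G)) = 2 ^ X.length)
    {gens : List (List (ℕ × ℕ))} (hgens : ∀ s ∈ gens, IsSymmetry r adjs G s) (fine : Bool) (n : ℕ)
    (hne : (chainSizes fine (weights adjs n) (xorSpan G) (xorSpan X) (echelon [] G) gens [0]
      X).prod ≠ 0) :
    Nat.card (discHom h).range = (chainSizes fine (weights adjs n) (xorSpan G) (xorSpan X)
      (echelon [] G) gens [0] X).prod := by
  have := H.finite_discGroup
  have : Finite (DiscGroup (negForm C) (maskLattice e G) ≃ₗ[ℤ]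
      DiscGroup (negForm C) (maskLattice e G)) := DFunLike.finite _
  -- The zero class is fixed by everything. Starting with it makes the first bound compare the
  -- weights of the classes themselves.
  have hch := H.orbitChain A h (H.exists_base hX hXG) hXG hcard hgens fine n (prev := [0]) (xs := X)
    (by simpa using (good_closed r E G).zero) (fun _ h => h) (fun _ h => Or.inr h) (pre := [])
    (fun γ => by
      simp only [List.mem_singleton, forall_eq, H.maskClass_zero]
      exact ⟨fun _ => map_zero γ.1.1, fun _ x hx => by simp at hx⟩)
    (fun t ht h0 => hne (List.prod_eq_zero (h0 ▸ ht)))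
  rw [hch.rel_card_group rfl fun _ _ _ _ => by rintro rfl rfl; rfl, List.map_snd_zip]
  rw [length_chainSizes, List.length_map]

end Chain

/-! ### Definiteness from sums of squares -/

section Definite

variable {ι κ : Type*} [Fintype ι] [DecidableEq ι] [Fintype κ] {C : Matrix ι ι ℤ} {B : κ → ι → ℤ}
  {s : ℤ}

lemma mul_negForm_of_rows (hB : ∀ p q, ∑ k, B k p * B k q = s * C p q) (x y : ι → ℚ) :
    s * negForm C x y = -∑ k, (∑ p, B k p * x p) * ∑ q, B k q * y q := by
  have h : ∀ p q, (s * C p q : ℚ) = ∑ k, (B k p * B k q : ℚ) := fun p q => by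
    have := congrArg (Int.cast : ℤ → ℚ) (hB p q)
    push_cast at this
    exact this.symm
  simp only [negForm_apply, mul_neg, Finset.mul_sum, Finset.sum_mul]
  congr 1
  rw [Finset.sum_comm]
  conv_rhs => rw [Finset.sum_comm]
  refine Finset.sum_congr rfl fun q _ => ?_
  conv_rhs => rw [Finset.sum_comm]
  refine Finset.sum_congr rfl fun p _ => ?_
  have := h p q
  calc (s : ℚ) * (x p * C p q * y q) = x p * (s * C p q) * y q := by ring
    _ = _ := by
      rw [this, Finset.mul_sum, Finset.sum_mul]
      exact Finset.sum_congr rfl fun k _ => by ring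

/-- The matrix sC is a Gram matrix of the rows, so the form is negative semidefinite. A vector of
square zero is annihilated by all rows, hence by C, hence it is zero because MC is a positive
multiple of the identity. -/
lemma negForm_neg_of_rows (hs : 0 < s) (hB : ∀ p q, ∑ k, B k p * B k q = s * C p q)
    {M : ι → ι → ℤ} {m : ℤ} (hm : 0 < m)
    (hM : ∀ p q, ∑ k, M p k * C k q = if p = q then m else 0) (x : ι → ℚ) (hx : x ≠ 0) :
    negForm C x x < 0 := by
  have hs' : (0 : ℚ) < s := by exact_mod_cast hs
  have h := mul_negForm_of_rows hB x x
  by_contra hcon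
  have h0 : ∑ k, (∑ p, B k p * x p) * ∑ q, B k q * x q = 0 :=
    le_antisymm (by nlinarith [mul_nonneg hs'.le (not_lt.1 hcon)])
      (Finset.sum_nonneg fun k _ => mul_self_nonneg _)
  have h1 : ∀ k, ∑ p, B k p * x p = 0 := fun k => mul_self_eq_zero.1
    ((Finset.sum_eq_zero_iff_of_nonneg fun k _ => mul_self_nonneg _).1 h0 k (Finset.mem_univ k))
  have h2 : ∀ p, ∑ q, (C p q : ℚ) * x q = 0 := fun p => by
    have h3 := mul_negForm_of_rows hB (Pi.single p 1) x
    simp only [h1, mul_zero, Finset.sum_const_zero, neg_zero] at h3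
    rw [negForm_single_left] at h3
    have := (mul_eq_zero.1 h3).resolve_left hs'.ne'
    linarith
  refine hx (funext fun p => ?_)
  have h3 : ∑ k, (M p k : ℚ) * ∑ q, (C k q : ℚ) * x q = m * x p := by
    simp only [Finset.mul_sum]
    rw [Finset.sum_comm, Finset.sum_eq_single p]
    · have := congrArg (Int.cast : ℤ → ℚ) (hM p p)
      rw [if_pos rfl] at this
      push_cast at this
      rw [← this, Finset.sum_mul]
      exact Finset.sum_congr rfl fun k _ => by ring
    · intro q _ hq
      have := congrArg (Int.cast : ℤ → ℚ) (hM p q)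
      rw [if_neg hq.symm] at this
      push_cast at this
      rw [← zero_mul (x q), ← this, Finset.sum_mul]
      exact Finset.sum_congr rfl fun k _ => by ring
    · simp
  simp only [h2, mul_zero, Finset.sum_const_zero] at h3
  have hm' : (m : ℚ) ≠ 0 := by exact_mod_cast hm.ne'
  exact (mul_eq_zero.1 h3.symm).resolve_left hm'

/-- The coordinates of the vectors of the dual lattice in terms of their products with the
simple roots. -/
lemma exists_int_of_dual {M : ι → ι → ℤ} {m : ℤ}
    (hC : C.IsSymm) (hM : ∀ p q, ∑ k, M p k * C k q = if p = q then m else 0) {y : ι → ℚ}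
    (hy : y ∈ dualLattice (negForm C) (intLattice ι)) :
    ∃ z : ι → ℤ, ∀ p, m * y p = ∑ k, (M p k * z k : ℚ) := by
  have h : ∀ p, ∃ z : ℤ, ∑ q, (C p q : ℚ) * y q = z := fun p => by
    obtain ⟨n, hn⟩ := exists_int_of_mem_dual hy (single_mem_intLattice p)
    rw [negForm_symm hC, negForm_single_left] at hn
    exact ⟨-n, by push_cast; linarith⟩
  choose z hz using h
  refine ⟨z, fun p => ?_⟩
  simp only [← hz, Finset.mul_sum]
  rw [Finset.sum_comm, Finset.sum_eq_single p]
  · have := congrArg (Int.cast : ℤ → ℚ) (hM p p)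
    rw [if_pos rfl] at this
    push_cast at this
    rw [← this, Finset.sum_mul]
    exact Finset.sum_congr rfl fun k _ => by ring
  · intro q _ hq
    have := congrArg (Int.cast : ℤ → ℚ) (hM p q)
    rw [if_neg hq.symm] at this
    push_cast at this
    rw [← zero_mul (y q), ← this, Finset.sum_mul]
    exact Finset.sum_congr rfl fun k _ => by ring
  · simp

end Definite

/-! ### Numerical data of the irreducible root lattices -/

namespace RootType

/-- The number of linear forms given by `row`. -/
def numRows : RootType → ℕ
  | A n => n + 1
  | D n => n
  | _ => 8

/-- The sum of the squares of the linear forms `row` is `scale` times the norm. -/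
def scale : RootType → ℤ
  | A _ => 1
  | D _ => 1
  | _ => 2

/-- Linear forms on the root lattice the sum of whose squares is a multiple of the norm. -/
def row : RootType → ℕ → ℕ → ℤ
  -- For types A and D the rows are the standard Euclidean coordinates of the simple roots.
  | A _, k, i => if k = i then 1 else if k = i + 1 then -1 else 0
  | D n, k, i => if i + 1 = n then (if n ≤ k + 2 then 1 else 0) else
      if k = i then 1 else if k = i + 1 then -1 else 0
  -- Eight linear forms for E₈ whose squares add up to twice the norm. Their restrictions to the
  -- first six or seven simple roots serve E₆ and E₇.
  | _, k, i => ([[0, 0, 0, 0, 0, 0, -1, 2], [0, 0, 0, 0, -1, 2, -1, 0], [0, -1, -1, 2, -1, 0, 0, 0], [2, 0, -1, 0, 0, 0, 0, 0], [0, 1, 0, 0, 0, 0, -1, 0], [0, 1, 0, 0, -1, 0, 1, 0], [0, 0, -1, 0, 1, 0, 0, 0], [0, -1, 1, 0, 0, 0, 0, 0]].getD k []).getD i 0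

/-- A multiple of the exponent of the discriminant group. -/
def den : RootType → ℤ
  | A n => n + 1
  | D n => if n % 2 = 0 then 2 else 4
  | E6 => 3
  | E7 => 2
  | E8 => 2

/-- The inverse of the Cartan matrix, multiplied by `den`. -/
def inv : RootType → ℕ → ℕ → ℤ
  | A n, i, j => (min i j + 1) * (n - max i j)
  | D n, i, j => (if i + 2 < n ∧ j + 2 < n then 4 * (min i j + 1) else if i + 2 < n then 2 * (i + 1)
      else if j + 2 < n then 2 * (j + 1) else if i = j then n else n - 2) /
      (if n % 2 = 0 then 2 else 1)
  | E6, i, j => ([[4, 3, 5, 6, 4, 2], [3, 6, 6, 9, 6, 3], [5, 6, 10, 12, 8, 4], [6, 9, 12, 18, 12, 6], [4, 6, 8, 12, 10, 5], [2, 3, 4, 6, 5, 4]].getD i []).getD j 0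
  | E7, i, j => ([[4, 4, 6, 8, 6, 4, 2], [4, 7, 8, 12, 9, 6, 3], [6, 8, 12, 16, 12, 8, 4], [8, 12, 16, 24, 18, 12, 6], [6, 9, 12, 18, 15, 10, 5], [4, 6, 8, 12, 10, 8, 4], [2, 3, 4, 6, 5, 4, 3]].getD i []).getD j 0
  | E8, i, j => ([[8, 10, 14, 20, 16, 12, 8, 4], [10, 16, 20, 30, 24, 18, 12, 6], [14, 20, 28, 40, 32, 24, 16, 8], [20, 30, 40, 60, 48, 36, 24, 12], [16, 24, 32, 48, 40, 30, 20, 10], [12, 18, 24, 36, 30, 24, 16, 8], [8, 12, 16, 24, 20, 16, 12, 6], [4, 6, 8, 12, 10, 8, 6, 4]].getD i []).getD j 0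

/-- The entries of the Cartan matrix in terms of `adj`. -/
def gram (t : RootType) (i j : ℕ) : ℤ :=
  if i = j then 2 else cond ((t.adj i).testBit j) (-1) 0

/-- The numerical data of a root lattice are correct. -/
structure IsCorrect (t : RootType) : Prop where
  cartan_sub : ∀ p q : Fin t.rank, t.gram p q - t.cartan p q = 0
  symm : ∀ p q : Fin t.rank, t.gram p q = t.gram q p
  loopless : ∀ p : Fin t.rank, (t.adj p).testBit p = false
  adj_lt : ∀ p : Fin t.rank, t.adj p < 2 ^ t.rank
  rows : ∀ p q : Fin t.rank,
    ∑ k : Fin t.numRows, t.row k p * t.row k q = t.scale * t.gram p q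
  inv_mul : ∀ p q : Fin t.rank, ∑ k : Fin t.rank, t.inv p k * t.gram k q = if p = q then t.den else 0

/-- The root lattice has a `2`-elementary discriminant group represented by `words`. -/
structure IsTwoElementary (t : RootType) : Prop extends IsCorrect t where
  den_eq : t.den = 2
  lt : ∀ u ∈ t.words, u.2 < 2 ^ t.rank ∧ u.1 < t.rank
  indep : ∀ u ∈ t.words, ∀ v ∈ t.words, ∀ p q : Fin t.rank, p ≠ q → u.2.testBit p →
    v.2.testBit q → t.gram p q = 0
  dual : ∀ u ∈ t.words, ∀ p : Fin t.rank,
    (∑ q : Fin t.rank, if u.2.testBit q then t.gram p q else 0) % 2 = 0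
  -- Row p of the doubled inverse is, modulo 2, the sum of the marked rows of the words that contain
  -- p. So the parities of a dual vector at the marked positions determine it modulo integral
  -- vectors.
  marker : ∀ p q : Fin t.rank, (t.inv p q -
    (t.words.map fun u => if u.2.testBit p then t.inv u.1 q else 0).sum) % 2 = 0

variable {t : RootType}

lemma IsCorrect.cartan_eq (h : t.IsCorrect) (p q : Fin t.rank) : t.cartan p q = t.gram p q :=
  (sub_eq_zero.1 (h.cartan_sub p q)).symm

lemma IsCorrect.isSymm (h : t.IsCorrect) : t.cartan.IsSymm := by
  ext p q
  rw [Matrix.transpose_apply, h.cartan_eq, h.cartan_eq, h.symm]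

lemma den_pos : 0 < t.den := by
  cases t <;> simp only [den] <;> try split_ifs
  all_goals omega

lemma scale_pos : 0 < t.scale := by
  cases t <;> simp [scale]

lemma IsCorrect.neg (h : t.IsCorrect) : ∀ x : Fin t.rank → ℚ, x ≠ 0 → negForm t.cartan x x < 0 :=
  negForm_neg_of_rows (B := fun (k : Fin t.numRows) p => t.row k p) scale_pos
    (fun p q => by rw [h.cartan_eq]; exact h.rows p q) (M := fun p k => t.inv p k) den_pos
    fun p q => by simp only [h.cartan_eq]; exact h.inv_mul p q

lemma gram_self (i : ℕ) : t.gram i i = 2 := if_pos rfl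

lemma gram_nonpos {i j : ℕ} (h : i ≠ j) : t.gram i j ≤ 0 := by
  rw [gram, if_neg h]
  cases (t.adj i).testBit j <;> simp

/-- Add those words u for which f u is odd. -/
lemma exists_xorSpan_of_parity (W : List (ℕ × ℕ)) (f : ℕ × ℕ → ℤ) :
    ∃ w ∈ xorSpan (W.map Prod.snd), ∀ p, ∃ n : ℤ,
      (W.map fun u => if u.2.testBit p then f u else 0).sum = (if w.testBit p then 1 else 0) + 2 * n := by
  induction W with
  | nil => exact ⟨0, (xorSpan_closed _).zero, fun p => ⟨0, by simp⟩⟩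
  | cons u W ih =>
    obtain ⟨w, hw, h⟩ := ih
    rcases Int.even_or_odd' (f u) with ⟨m, hm | hm⟩
    · refine ⟨w, mem_xorSpan_cons.2 (Or.inl hw), fun p => ?_⟩
      obtain ⟨n, hn⟩ := h p
      rw [List.map_cons, List.sum_cons, hn, hm]
      exact ⟨(if u.2.testBit p then m else 0) + n, by split_ifs <;> ring⟩
    · refine ⟨u.2 ^^^ w, mem_xorSpan_cons.2 (Or.inr ?_), fun p => ?_⟩
      · rwa [← Nat.xor_assoc, Nat.xor_self, Nat.zero_xor]
      · obtain ⟨n, hn⟩ := h p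
        rw [List.map_cons, List.sum_cons, hn, hm, Nat.testBit_xor]
        cases u.2.testBit p <;> cases w.testBit p
        · exact ⟨n, by simp⟩
        · exact ⟨n, by simp⟩
        · exact ⟨m + n, by simp; ring⟩
        · exact ⟨m + n + 1, by simp; ring⟩

lemma IsTwoElementary.maskCode (h : t.IsTwoElementary) :
    MaskCode t.cartan (Equiv.refl (Fin t.rank)) (t.words.map Prod.snd) [] where
  symm := h.isSymm
  diag p := by rw [h.cartan_eq, gram_self]
  off_diag p q hpq := by
    rw [h.cartan_eq]
    exact gram_nonpos fun h' => hpq (Fin.ext h')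
  neg := h.neg
  indep := by
    intro w hw w' hw' p q hpq hp hq
    obtain ⟨u, hu, rfl⟩ := List.mem_map.1 hw
    obtain ⟨v, hv, rfl⟩ := List.mem_map.1 hw'
    rw [h.cartan_eq]
    exact h.indep u hu v hv p q hpq hp hq
  lt := by
    intro w hw
    obtain ⟨u, hu, rfl⟩ := List.mem_map.1 hw
    exact (h.lt u hu).1
  dual := by
    intro w hw
    obtain ⟨u, hu, rfl⟩ := List.mem_map.1 hw
    have hs : ∀ p, ∃ n : ℤ, negForm t.cartan (Pi.single p 1) (halfVec (Equiv.refl _) u.2) = n := by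
      intro p
      obtain ⟨n, hn⟩ := Int.dvd_of_emod_eq_zero (h.dual u hu p)
      refine ⟨-n, ?_⟩
      have := congrArg (Int.cast : ℤ → ℚ) hn
      push_cast at this
      rw [negForm_single_left]
      have e : ∑ q, (t.cartan p q : ℚ) * halfVec (Equiv.refl _) u.2 q = n := by
        rw [← mul_right_inj' (two_ne_zero (α := ℚ)), ← this, Finset.mul_sum]
        refine Finset.sum_congr rfl fun q _ => ?_
        rw [h.cartan_eq, halfVec, Equiv.refl_apply]
        split_ifs <;> ring
      rw [e]
      push_cast
      rfl
    intro y hy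
    refine Submodule.mem_one.2 ?_
    rw [intLattice] at hy
    induction hy using Submodule.span_induction with
    | mem y hy =>
      obtain ⟨p, rfl⟩ := hy
      obtain ⟨n, hn⟩ := hs p
      exact ⟨n, by rw [negForm_symm h.isSymm, hn]; rfl⟩
    | zero => exact ⟨0, by simp⟩
    | add y z _ _ hy hz =>
      obtain ⟨m, hm⟩ := hy
      obtain ⟨n, hn⟩ := hz
      exact ⟨m + n, by rw [map_add, map_add, hm, hn]⟩
    | smul a y _ hy =>
      obtain ⟨m, hm⟩ := hy
      exact ⟨a * m, by rw [map_zsmul, ← hm]; simp⟩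
  gen := by
    intro y hy
    have hM : ∀ p q : Fin t.rank, ∑ k : Fin t.rank, t.inv p k * t.cartan k q = if p = q then (2 : ℤ) else 0 := fun p q => by
      simp only [h.cartan_eq]
      rw [← h.den_eq]
      exact h.inv_mul p q
    obtain ⟨z, hz⟩ := exists_int_of_dual h.isSymm (M := fun p k : Fin t.rank => t.inv p k) hM hy
    obtain ⟨w, hw, hf⟩ := exists_xorSpan_of_parity t.words fun u => ∑ k : Fin t.rank, t.inv u.1 k * z k
    refine ⟨w, hw, mem_intLattice.2 fun p => ?_⟩
    obtain ⟨n, hn⟩ := hf p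
    have hmark : ∀ k : Fin t.rank, ∃ a : ℤ, t.inv p k = (t.words.map fun u =>
        if u.2.testBit p then t.inv u.1 k else 0).sum + 2 * a := fun k => by
      obtain ⟨a, ha⟩ := Int.dvd_of_emod_eq_zero (h.marker p k)
      exact ⟨a, by linarith⟩
    choose a ha using hmark
    have e1 : ∑ k : Fin t.rank, t.inv p k * z k = (t.words.map fun u =>
        if u.2.testBit p then ∑ k : Fin t.rank, t.inv u.1 k * z k else 0).sum +
          2 * ∑ k, a k * z k := by
      rw [Finset.mul_sum]
      simp only [ha]
      clear ha hn hf hw hz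
      induction t.words with
      | nil => simp [mul_assoc]
      | cons u W ih =>
        simp only [List.map_cons, List.sum_cons]
        rw [add_assoc, ← ih]
        split_ifs
        · rw [← Finset.sum_add_distrib]
          exact Finset.sum_congr rfl fun k _ => by ring
        · simp
    rw [hn] at e1
    have e2 := congrArg (Int.cast : ℤ → ℚ) e1
    push_cast at e2
    have e3 := hz p
    rw [e2] at e3
    push_cast at e3
    refine ⟨n + ∑ k, a k * z k, ?_⟩
    rw [Pi.sub_apply, halfVec, Equiv.refl_apply]
    push_cast
    split_ifs at e3 ⊢ <;> linarith
  glue_mem := by simp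
  glue_four := by simp
  glue_two := by simp
  nodup := by simp [xorSpan]
  long := by
    intro c hc h0
    simp only [xorSpan, List.mem_singleton] at hc
    exact absurd hc h0

/-- All linear forms `row` take odd values on `u`. -/
def rowsOdd (t : RootType) (u : ℕ) : Prop := t.scale = 1 ∧
  ∀ k : Fin t.numRows, (∑ i : Fin t.rank, if u.testBit i then t.row k i else 0) % 2 = 1

instance (t : RootType) (u : ℕ) : Decidable (t.rowsOdd u) := by
  unfold rowsOdd
  infer_instance

/-- A lower bound for four times the norms of the vectors of the coset given by `u`. -/
def normBound (t : RootType) (u : ℕ) : ℕ :=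
  if u = 0 then 0 else max (if t.rowsOdd u then t.numRows else 0)
    (if bitCount t.rank u % 4 = 0 then 8 else 2 * (bitCount t.rank u % 4))

/-- Two bounds for four times the norm. If all linear forms are half-integral on the coset, each
square is at least 1/4, which gives the number of forms. Moreover four times the norm is congruent
to twice the number of bits modulo 8 and positive, which gives the least positive residue. -/
lemma IsTwoElementary.normBound_le (h : t.IsTwoElementary) {u : ℕ}
    (hu : u ∈ xorSpan (t.words.map Prod.snd)) {x : Fin t.rank → ℚ}
    (hx : x - halfVec (Equiv.refl _) u ∈ intLattice (Fin t.rank)) :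
    (t.normBound u : ℚ) ≤ -4 * negForm t.cartan x x := by
  have H := h.maskCode
  rw [normBound]
  have hnonneg : 0 ≤ -4 * negForm t.cartan x x := by
    rcases eq_or_ne x 0 with rfl | h0
    · simp
    · linarith [h.neg x h0]
  by_cases hu0 : u = 0
  · rw [if_pos hu0]
    exact_mod_cast hnonneg
  rw [if_neg hu0, Nat.cast_max]
  refine max_le ?_ ?_
  · split_ifs with hr
    · have h1 := mul_negForm_of_rows (C := t.cartan) (B := fun (k : Fin t.numRows) (p : Fin t.rank) => t.row k p) (s := t.scale)
        (fun p q => by rw [h.cartan_eq]; exact h.rows p q) x x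
      rw [hr.1, Int.cast_one, one_mul] at h1
      have h2 : ∀ k : Fin t.numRows, (1 / 4 : ℚ) ≤ (∑ p : Fin t.rank, t.row k p * x p) *
          ∑ q : Fin t.rank, t.row k q * x q := by
        intro k
        obtain ⟨z, hz⟩ : ∃ z : Fin t.rank → ℤ, ∀ p, x p = halfVec (Equiv.refl _) u p + z p := by
          choose z hz using mem_intLattice.1 hx
          exact ⟨z, fun p => by rw [← hz p, Pi.sub_apply]; ring⟩
        obtain ⟨n, hn⟩ : ∃ n : ℤ, (∑ p : Fin t.rank, t.row k p * x p) = n + 1 / 2 := by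
          have hodd := hr.2 k
          obtain ⟨m, hm⟩ : ∃ m, (∑ i : Fin t.rank, if u.testBit i then t.row k i else 0) = 2 * m + 1 :=
            ⟨_, by rw [← hodd]; exact (Int.mul_ediv_add_emod _ 2).symm⟩
          refine ⟨m + ∑ p : Fin t.rank, t.row k p * z p, ?_⟩
          have hm' := congrArg (Int.cast : ℤ → ℚ) hm
          push_cast at hm' ⊢
          have : (m : ℚ) + 1 / 2 = ∑ p : Fin t.rank, t.row k p * halfVec (Equiv.refl _) u p := by
            rw [← mul_right_inj' (two_ne_zero (α := ℚ)), Finset.mul_sum]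
            have : (2 : ℚ) * (m + 1 / 2) = 2 * m + 1 := by ring
            rw [this, ← hm']
            refine Finset.sum_congr rfl fun p _ => ?_
            rw [halfVec, Equiv.refl_apply]
            split_ifs <;> ring
          rw [add_right_comm, this, ← Finset.sum_add_distrib]
          exact Finset.sum_congr rfl fun p _ => by rw [hz p]; ring
        rw [hn]
        -- Equivalent to (n + 1/2)² ≥ 1/4.
        have h3 : (0 : ℤ) ≤ n * (n + 1) := by
          rcases le_or_gt 0 n with h | h
          · exact mul_nonneg h (by omega)
          · nlinarith
        have h4 : (0 : ℚ) ≤ n * (n + 1) := by exact_mod_cast h3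
        nlinarith
      have h5 := Finset.sum_le_sum fun (k : Fin t.numRows) (_ : k ∈ Finset.univ) => h2 k
      rw [Finset.sum_const, Finset.card_univ, Fintype.card_fin, nsmul_eq_mul] at h5
      linarith
    · exact_mod_cast hnonneg
  · set v := halfVec (Equiv.refl (Fin t.rank)) u with hv
    -- The coset of a nonzero word consists of nonintegral vectors.
    have hx0 : x ≠ 0 := by
      rintro rfl
      refine hu0 (eq_of_testBit (e := Equiv.refl (Fin t.rank)) (H.xorSpan_lt hu) (by positivity)
        fun p => (testBit_eq_of_sub_mem (e := Equiv.refl (Fin t.rank)) (b := u) (a := 0) ?_ p).symm)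
      rwa [halfVec_zero]
    have hpos := h.neg x hx0
    obtain ⟨n, hn⟩ := exists_int_of_mem_dual (H.dual_span hu) hx
    have hE := H.isEvenLattice
    obtain ⟨m, hm⟩ := hE.even (x - v) (intLattice_le_maskLattice [] hx)
    have hvv := H.form_halfVec hu hu
    rw [Nat.and_self, ← hv] at hvv
    have e : negForm t.cartan x x = negForm t.cartan (x - v) (x - v) +
        2 * negForm t.cartan v (x - v) + negForm t.cartan v v := by
      simp only [map_sub, LinearMap.sub_apply, negForm_symm h.isSymm x v]
      ring
    rw [hn, hm, hvv] at e
    have e' : -4 * negForm t.cartan x x =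
        ((2 * (bitCount t.rank u : ℤ) - 8 * (m + n) : ℤ) : ℚ) := by
      rw [e]
      push_cast
      ring
    have h0 : (0 : ℤ) < 2 * (bitCount t.rank u : ℤ) - 8 * (m + n) := by
      have : (0 : ℚ) < -4 * negForm t.cartan x x := by linarith
      rw [e'] at this
      exact_mod_cast this
    rw [e']
    have : ((if bitCount t.rank u % 4 = 0 then 8 else 2 * (bitCount t.rank u % 4) : ℕ) : ℤ) ≤
        2 * (bitCount t.rank u : ℤ) - 8 * (m + n) := by
      split_ifs with h4 <;> omega
    have := Int.cast_le (R := ℚ).2 this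
    rwa [Int.cast_natCast] at this

end RootType

/-! ### Orthogonal sums -/

section BlockSum

variable {o : Type*} [Fintype o] [DecidableEq o] {n : o → Type*} [∀ i, Fintype (n i)]
  [∀ i, DecidableEq (n i)]

lemma negForm_blockDiagonal (C : ∀ i, Matrix (n i) (n i) ℤ) (x y : (Σ i, n i) → ℚ) :
    negForm (Matrix.blockDiagonal' C) x y =
      ∑ i, negForm (C i) (fun p => x ⟨i, p⟩) fun p => y ⟨i, p⟩ := by
  simp only [negForm_apply, Fintype.sum_sigma, Finset.sum_neg_distrib]
  congr 1
  refine Finset.sum_congr rfl fun i _ => Finset.sum_congr rfl fun p _ => ?_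
  rw [Finset.sum_eq_single i]
  · exact Finset.sum_congr rfl fun q _ => by rw [Matrix.blockDiagonal'_apply_eq]
  · intro j _ hj
    refine Finset.sum_eq_zero fun q _ => ?_
    rw [Matrix.blockDiagonal'_apply_ne _ _ _ hj.symm]
    simp
  · simp

lemma negForm_blockDiagonal_neg {C : ∀ i, Matrix (n i) (n i) ℤ}
    (h : ∀ i (x : n i → ℚ), x ≠ 0 → negForm (C i) x x < 0) (x : (Σ i, n i) → ℚ) (hx : x ≠ 0) :
    negForm (Matrix.blockDiagonal' C) x x < 0 := by
  rw [negForm_blockDiagonal]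
  have hle : ∀ i (x : n i → ℚ), negForm (C i) x x ≤ 0 := fun i x => by
    rcases eq_or_ne x 0 with rfl | h0
    · simp
    · exact (h i x h0).le
  obtain ⟨⟨i, p⟩, hp⟩ := Function.ne_iff.1 hx
  exact Finset.sum_neg' (fun i _ => hle i _) ⟨i, Finset.mem_univ i, h i _ fun h0 => hp (congrFun h0 p)⟩

omit [Fintype o] [∀ i, Fintype (n i)] [∀ i, DecidableEq (n i)] in
lemma blockDiagonal_isSymm {C : ∀ i, Matrix (n i) (n i) ℤ} (h : ∀ i, (C i).IsSymm) :
    (Matrix.blockDiagonal' C).IsSymm := by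
  rw [Matrix.IsSymm, Matrix.blockDiagonal'_transpose]
  congr 1
  exact funext fun i => h i

lemma mem_dual_blockDiagonal {C : ∀ i, Matrix (n i) (n i) ℤ} {y : (Σ i, n i) → ℚ} :
    y ∈ dualLattice (negForm (Matrix.blockDiagonal' C)) (intLattice (Σ i, n i)) ↔
      ∀ i, (fun p => y ⟨i, p⟩) ∈ dualLattice (negForm (C i)) (intLattice (n i)) := by
  constructor
  · intro h i z hz
    -- Extension by zero to the other components.
    have hz' : (fun p : Σ i, n i => if hp : p.1 = i then z (hp ▸ p.2) else 0) ∈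
        intLattice (Σ i, n i) := mem_intLattice.2 fun p => by
      by_cases hp : p.1 = i
      · rw [dif_pos hp]; exact mem_intLattice.1 hz _
      · rw [dif_neg hp]; exact ⟨0, by simp⟩
    have := h _ hz'
    rw [negForm_blockDiagonal, Finset.sum_eq_single i] at this
    · simpa using this
    · intro j _ hj
      simp only [dif_neg hj]
      exact map_zero _
    · simp
  · intro h z hz
    rw [negForm_blockDiagonal]
    exact Submodule.sum_mem _ fun i _ => h i _ (mem_intLattice.2 fun p => mem_intLattice.1 hz ⟨i, p⟩)

end BlockSum

/-! ### Words of an orthogonal sum and their parts in the components -/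

section Blocks

/-- The index set of the simple roots. -/
abbrev Nodes (L : List RootType) : Type := (i : Fin L.length) × Fin (L.get i).rank

/-- The Gram matrix of the simple roots. -/
abbrev cartanSum (L : List RootType) : Matrix (Nodes L) (Nodes L) ℤ :=
  Matrix.blockDiagonal' fun i => (L.get i).cartan

lemma cartanSum_same {L : List RootType} (i : Fin L.length) (p q : Fin (L.get i).rank) :
    cartanSum L ⟨i, p⟩ ⟨i, q⟩ = (L.get i).cartan p q := Matrix.blockDiagonal'_apply_eq _ _ _ _

lemma cartanSum_ne {L : List RootType} {i j : Fin L.length} (h : i ≠ j) (p : Fin (L.get i).rank)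
    (q : Fin (L.get j).rank) : cartanSum L ⟨i, p⟩ ⟨j, q⟩ = 0 :=
  Matrix.blockDiagonal'_apply_ne _ _ _ h

/-- The position of the first simple root of a component. -/
def offset (L : List RootType) (i : ℕ) : ℕ := ((L.take i).map RootType.rank).sum

variable {L : List RootType}

lemma offset_succ {i : ℕ} (hi : i < L.length) : offset L (i + 1) = offset L i + L[i].rank := by
  rw [offset, List.take_succ_eq_append_getElem hi, List.map_append, List.sum_append]
  simp [offset]

lemma offset_mono {i j : ℕ} (h : i ≤ j) : offset L i ≤ offset L j := by
  obtain ⟨k, rfl⟩ := Nat.exists_eq_add_of_le h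
  rw [offset, offset, List.take_add, List.map_append, List.sum_append]
  exact Nat.le_add_right _ _

lemma rank_sum_eq (L : List RootType) : ∑ i, (L.get i).rank = rankSum L := by
  rw [rankSum, ← List.sum_ofFn]
  congr 1
  exact List.ext_getElem (by simp) fun i _ _ => by simp

/-- The positions of the simple roots. -/
def flatEquiv (L : List RootType) : Nodes L ≃ Fin (rankSum L) :=
  finSigmaFinEquiv.trans (finCongr (rank_sum_eq L))

lemma coe_flatEquiv (p : Nodes L) : (flatEquiv L p : ℕ) = offset L p.1 + p.2 := by
  change (finSigmaFinEquiv p : ℕ) = _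
  rw [finSigmaFinEquiv_apply, offset, ← List.sum_ofFn]
  congr 2
  refine List.ext_getElem ?_ fun i _ _ => by simp
  simp [p.1.2.le]

lemma blocks_eq (L : List RootType) (o : ℕ) :
    blocks L o = List.ofFn fun i : Fin L.length => (L.get i, o + offset L i) := by
  induction L generalizing o with
  | nil => rfl
  | cons t L ih =>
    change _ = List.ofFn (n := L.length + 1) fun i => ((t :: L).get i, o + offset (t :: L) i)
    rw [blocks, ih, List.ofFn_succ]
    congr 1
    congr 1
    funext i
    simp [offset, Nat.add_assoc]

lemma mem_blocks {p : RootType × ℕ} : p ∈ blocks L 0 ↔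
    ∃ i : Fin L.length, p = (L.get i, offset L i) := by
  rw [blocks_eq, List.mem_ofFn]
  simp [eq_comm]

lemma getD_adjMasks (p : Nodes L) : (adjMasks L).getD (flatEquiv L p) 0 =
    (L.get p.1).adj p.2 * 2 ^ offset L p.1 := by
  have key : ∀ (L : List RootType) (o i q : ℕ) (hi : i < L.length), q < L[i].rank →
      ((blocks L o).flatMap fun p => (List.range p.1.rank).map fun i => p.1.adj i * 2 ^ p.2).getD
        (offset L i + q) 0 = L[i].adj q * 2 ^ (o + offset L i) := by
    intro L
    induction L with
    | nil => intro o i q hi; simp at hi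
    | cons t L ih =>
      intro o i q hi hq
      rw [blocks, List.flatMap_cons]
      cases i with
      | zero =>
        have hq' : q < t.rank := hq
        simp only [offset, List.take_zero, List.map_nil, List.sum_nil, Nat.zero_add, Nat.add_zero,
          List.getElem_cons_zero]
        rw [List.getD_append _ _ _ _ (by simpa using hq'), List.getD_eq_getElem _ _ (by simpa using hq')]
        simp
      | succ i =>
        have ho : offset (t :: L) (i + 1) = t.rank + offset L i := by simp [offset]
        rw [ho, List.getD_append_right _ _ _ _ (by simp; omega)]
        have := ih (o + t.rank) i q (by simpa using hi) hq
        rw [List.length_map, List.length_range, show t.rank + offset L i + q - t.rank =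
          offset L i + q by omega, this, List.getElem_cons_succ, Nat.add_assoc]
  rw [coe_flatEquiv, adjMasks, key L 0 p.1 p.2 p.1.2 p.2.2, Nat.zero_add]
  rfl

lemma length_adjMasks (L : List RootType) : (adjMasks L).length = rankSum L := by
  have key : ∀ (L : List RootType) (o : ℕ), ((blocks L o).flatMap fun p =>
      (List.range p.1.rank).map fun i => p.1.adj i * 2 ^ p.2).length = rankSum L := by
    intro L
    induction L with
    | nil => intro o; rfl
    | cons t L ih =>
      intro o
      rw [blocks, List.flatMap_cons, List.length_append, ih]
      simp [rankSum]
  exact key L 0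

lemma testBit_shift {i : Fin L.length} {u : ℕ} (hu : u < 2 ^ (L.get i).rank) (p : Nodes L) :
    (u * 2 ^ offset L i).testBit (flatEquiv L p) = (decide (i = p.1) && u.testBit p.2) := by
  obtain ⟨j, q⟩ := p
  rw [Nat.testBit_mul_two_pow, coe_flatEquiv]
  have hi := offset_succ (L := L) i.2
  have hj := offset_succ (L := L) j.2
  have hq : (q : ℕ) < L[(j : ℕ)].rank := q.2
  rw [List.get_eq_getElem] at hu
  rcases lt_trichotomy (i : ℕ) j with h | h | h
  · have hm := offset_mono (L := L) (i := i + 1) (j := j) h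
    have hne : i ≠ j := fun h' => h.ne (congrArg _ h')
    rw [decide_eq_false hne, Bool.false_and, Bool.and_eq_false_iff]
    right
    exact Nat.testBit_lt_two_pow (hu.trans_le (Nat.pow_le_pow_right two_pos (by simp only; omega)))
  · have hne : i = j := Fin.ext h
    subst hne
    simp
  · have hm := offset_mono (L := L) (i := j + 1) (j := i) h
    have hne : i ≠ j := fun h' => h.ne' (congrArg _ h')
    rw [decide_eq_false hne, Bool.false_and, Bool.and_eq_false_iff]
    left
    exact decide_eq_false (by simp only; omega)

lemma adjCode (hL : ∀ t ∈ L, t.IsCorrect) : AdjCode (cartanSum L) (flatEquiv L) (adjMasks L) where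
  length := length_adjMasks L
  diag := by
    rintro ⟨i, p⟩
    rw [cartanSum_same, (hL _ (L.get_mem i)).cartan_eq, RootType.gram_self]
  off_diag := by
    rintro ⟨i, p⟩ ⟨j, q⟩ hpq
    rw [getD_adjMasks, testBit_shift ((hL _ (L.get_mem i)).adj_lt p)]
    by_cases h : i = j
    · subst h
      rw [cartanSum_same, (hL _ (L.get_mem i)).cartan_eq, RootType.gram, if_neg]
      · simp only [decide_true, Bool.true_and]
        cases ((L.get i).adj p).testBit q <;> rfl
      · rintro h
        exact hpq (by rw [Fin.ext h])
    · rw [cartanSum_ne h]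
      simp [h]
  loopless := by
    rintro ⟨i, p⟩
    rw [getD_adjMasks, testBit_shift ((hL _ (L.get_mem i)).adj_lt p)]
    exact Bool.and_eq_false_iff.2 (Or.inr ((hL _ (L.get_mem i)).loopless p))

/-- The part of a mask that belongs to a component. -/
def window (L : List RootType) (c : ℕ) (i : Fin L.length) : ℕ :=
  (c >>> offset L i) % 2 ^ (L.get i).rank

lemma testBit_window (c : ℕ) (p : Nodes L) :
    (window L c p.1).testBit p.2 = c.testBit (flatEquiv L p) := by
  rw [window, Nat.testBit_mod_two_pow, Nat.testBit_shiftRight, coe_flatEquiv,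
    decide_eq_true p.2.2, Bool.true_and]

lemma window_lt (c : ℕ) (i : Fin L.length) : window L c i < 2 ^ (L.get i).rank :=
  Nat.mod_lt _ (by positivity)

lemma window_xor (a b : ℕ) (i : Fin L.length) :
    window L (a ^^^ b) i = window L a i ^^^ window L b i := by
  rw [window, Nat.shiftRight_xor_distrib, Nat.xor_mod_two_pow]
  rfl

lemma window_zero (i : Fin L.length) : window L 0 i = 0 := by simp [window]

lemma window_shift {i : Fin L.length} {u : ℕ} (hu : u < 2 ^ (L.get i).rank) (j : Fin L.length) :
    window L (u * 2 ^ offset L i) j = if i = j then u else 0 := by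
  have hlt : (if i = j then u else 0) < 2 ^ (L.get j).rank := by
    split_ifs with h
    · exact h ▸ hu
    · positivity
  refine eq_of_testBit (e := Equiv.refl (Fin (L.get j).rank)) (window_lt _ j) hlt fun q => ?_
  rw [Equiv.refl_apply, testBit_window (L := L) _ ⟨j, q⟩, testBit_shift hu]
  by_cases h : i = j <;> simp [h]

lemma halfVec_window (c : ℕ) (i : Fin L.length) : (fun q => halfVec (flatEquiv L) c ⟨i, q⟩) =
    halfVec (Equiv.refl _) (window L c i) := by
  funext q
  rw [halfVec, halfVec, Equiv.refl_apply, testBit_window (L := L) c ⟨i, q⟩]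

lemma mem_wordMasks {w : ℕ} : w ∈ wordMasks L ↔
    ∃ i : Fin L.length, ∃ u ∈ (L.get i).words, w = u.2 * 2 ^ offset L i := by
  simp only [wordMasks, List.mem_flatMap, mem_blocks, List.mem_map]
  constructor
  · rintro ⟨_, ⟨i, rfl⟩, u, hu, rfl⟩
    exact ⟨i, u, hu, rfl⟩
  · rintro ⟨i, u, hu, rfl⟩
    exact ⟨_, ⟨i, rfl⟩, u, hu, rfl⟩

section TwoElementary

variable (hL : ∀ t ∈ L, t.IsTwoElementary)
include hL

lemma window_mem {c : ℕ} (hc : c ∈ xorSpan (wordMasks L)) (i : Fin L.length) :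
    window L c i ∈ xorSpan ((L.get i).words.map Prod.snd) := by
  refine xorSpan_le (S := fun c => window L c i ∈ xorSpan ((L.get i).words.map Prod.snd))
    ⟨?_, fun {a b} ha hb => ?_⟩ (fun w hw => ?_) c hc
  · rw [window_zero]; exact (xorSpan_closed _).zero
  · rw [window_xor]; exact (xorSpan_closed _).xor ha hb
  · obtain ⟨j, u, hu, rfl⟩ := mem_wordMasks.1 hw
    rw [window_shift ((hL _ (L.get_mem j)).lt u hu).1]
    split_ifs with h
    · subst h
      exact subset_xorSpan (List.mem_map_of_mem hu)
    · exact (xorSpan_closed _).zero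

/-- Words of different components occupy disjoint ranges of positions, so prescribed parts are
shifted to their ranges and added one after the other. -/
lemma exists_of_windows (u : Fin L.length → ℕ)
    (hu : ∀ i, u i ∈ xorSpan ((L.get i).words.map Prod.snd)) :
    ∃ w ∈ xorSpan (wordMasks L), ∀ i, window L w i = u i := by
  have hshift : ∀ i, u i * 2 ^ offset L i ∈ xorSpan (wordMasks L) := fun i => by
    refine xorSpan_le (S := fun v => v * 2 ^ offset L i ∈ xorSpan (wordMasks L))
      ⟨?_, fun {a b} ha hb => ?_⟩ (fun w hw => ?_) _ (hu i)
    · rw [Nat.zero_mul]; exact (xorSpan_closed _).zero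
    · have := (xorSpan_closed _).xor ha hb
      rwa [← Nat.shiftLeft_eq, ← Nat.shiftLeft_eq, ← Nat.shiftLeft_xor_distrib,
        Nat.shiftLeft_eq] at this
    · obtain ⟨v, hv, rfl⟩ := List.mem_map.1 hw
      exact subset_xorSpan (mem_wordMasks.2 ⟨i, v, hv, rfl⟩)
  suffices ∀ s : Finset (Fin L.length), ∃ w ∈ xorSpan (wordMasks L), ∀ i,
      window L w i = if i ∈ s then u i else 0 by
    obtain ⟨w, hw, h⟩ := this Finset.univ
    exact ⟨w, hw, fun i => by rw [h, if_pos (Finset.mem_univ i)]⟩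
  intro s
  induction s using Finset.induction_on with
  | empty => exact ⟨0, (xorSpan_closed _).zero, fun i => by rw [window_zero]; rfl⟩
  | insert i s hi ih =>
    obtain ⟨w, hw, h⟩ := ih
    refine ⟨w ^^^ (u i * 2 ^ offset L i), (xorSpan_closed _).xor hw (hshift i), fun j => ?_⟩
    rw [window_xor, h, window_shift ((hL _ (L.get_mem i)).maskCode.xorSpan_lt (hu i))]
    by_cases hj : i = j
    · subst hj
      simp [hi]
    · simp [hj, Ne.symm hj]

/-- The description of an orthogonal sum of root lattices with glue words `G`. -/
theorem maskCode_of_glue {G : List ℕ} (glue_mem : ∀ g ∈ G, g ∈ xorSpan (wordMasks L))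
    (glue_four : ∀ g ∈ G, bitCount (rankSum L) g % 4 = 0)
    (glue_two : ∀ g ∈ G, ∀ g' ∈ G, bitCount (rankSum L) (g &&& g') % 2 = 0)
    (nodup : (xorSpan G).Nodup)
    (long : ∀ c ∈ xorSpan G, c ≠ 0 →
      8 < ((blocks L 0).map fun p => p.1.normBound ((c >>> p.2) % 2 ^ p.1.rank)).sum) :
    MaskCode (cartanSum L) (flatEquiv L) (wordMasks L) G where
  symm := blockDiagonal_isSymm fun i => (hL _ (L.get_mem i)).isSymm
  diag := (adjCode fun t ht => (hL t ht).toIsCorrect).diag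
  off_diag p q h := by
    rw [(adjCode fun t ht => (hL t ht).toIsCorrect).off_diag p q h]
    split_ifs <;> simp
  neg := negForm_blockDiagonal_neg fun i => (hL _ (L.get_mem i)).neg
  indep := by
    intro w hw w' hw' p q hpq hp hq
    obtain ⟨i, p⟩ := p
    obtain ⟨j, q⟩ := q
    by_cases hij : i = j
    · subst hij
      rw [cartanSum_same]
      obtain ⟨k, u, hu, rfl⟩ := mem_wordMasks.1 hw
      obtain ⟨l, v, hv, rfl⟩ := mem_wordMasks.1 hw'
      rw [testBit_shift ((hL _ (L.get_mem k)).lt u hu).1, Bool.and_eq_true,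
        decide_eq_true_iff] at hp
      rw [testBit_shift ((hL _ (L.get_mem l)).lt v hv).1, Bool.and_eq_true,
        decide_eq_true_iff] at hq
      obtain ⟨rfl, hp⟩ := hp
      obtain ⟨rfl, hq⟩ := hq
      exact (hL _ (L.get_mem _)).maskCode.indep _ (List.mem_map_of_mem hu) _
        (List.mem_map_of_mem hv) p q (fun h => hpq (by rw [h])) hp hq
    · exact cartanSum_ne hij p q
  lt := by
    intro w hw
    refine Nat.lt_pow_two_of_testBit _ fun n hn => ?_
    obtain ⟨k, u, hu, rfl⟩ := mem_wordMasks.1 hw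
    have hlt := ((hL _ (L.get_mem k)).lt u hu).1
    have h1 := offset_succ (L := L) k.2
    have h2 := offset_mono (L := L) (i := k + 1) (j := L.length) k.2
    have h3 : offset L L.length = rankSum L := by rw [offset, List.take_length]; rfl
    rw [List.get_eq_getElem] at hlt
    rw [Nat.testBit_mul_two_pow, Bool.and_eq_false_iff]
    right
    exact Nat.testBit_lt_two_pow (hlt.trans_le (Nat.pow_le_pow_right two_pos (by omega)))
  dual := by
    intro w hw
    refine mem_dual_blockDiagonal.2 fun i => ?_
    rw [halfVec_window]
    exact (hL _ (L.get_mem i)).maskCode.dual_span (window_mem hL (subset_xorSpan hw) i)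
  gen := by
    intro y hy
    have h := fun i => (hL _ (L.get_mem i)).maskCode.gen _ (mem_dual_blockDiagonal.1 hy i)
    choose u hu hy' using h
    obtain ⟨w, hw, hwu⟩ := exists_of_windows hL u hu
    refine ⟨w, hw, mem_intLattice.2 fun p => ?_⟩
    have := mem_intLattice.1 (hy' p.1) p.2
    rw [← hwu, ← halfVec_window] at this
    exact this
  glue_mem := glue_mem
  glue_four := glue_four
  glue_two := glue_two
  nodup := nodup
  long := by
    intro c hc h0 x hx
    have hcE : c ∈ xorSpan (wordMasks L) := xorSpan_le (xorSpan_closed _) glue_mem c hc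
    -- The bounds refer to four times the norm, so exceeding 8 means norm greater than 2, and no
    -- root lies in the coset.
    have h1 := long c hc h0
    rw [blocks_eq, List.map_ofFn, List.sum_ofFn] at h1
    have h2 : ∀ i, ((L.get i).normBound (window L c i) : ℚ) ≤
        -4 * negForm (L.get i).cartan (fun q => x ⟨i, q⟩) fun q => x ⟨i, q⟩ := fun i => by
      refine (hL _ (L.get_mem i)).normBound_le (window_mem hL hcE i) (mem_intLattice.2 fun q => ?_)
      rw [← halfVec_window]
      exact mem_intLattice.1 hx ⟨i, q⟩
    have h3 := Finset.sum_le_sum fun i (_ : i ∈ Finset.univ) => h2 i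
    rw [← Finset.mul_sum, ← negForm_blockDiagonal] at h3
    have h4 : (8 : ℚ) < ∑ i, ((L.get i).normBound (window L c i) : ℚ) := by
      rw [← Nat.cast_sum]
      simp only [Function.comp_def, Nat.zero_add] at h1
      exact_mod_cast h1
    linarith

end TwoElementary

end Blocks

/-! ### Consequences of the two orders -/

section Surjective

variable {V : Type*} [AddCommGroup V] [Module ℚ V] {b : LinearMap.BilinForm ℚ V}
  {K : Submodule ℤ V}

/-- If the ratio is 1, the image is the whole finite group, and a single double coset remains for
any subgroup on the left. -/
lemma consequences_of_card (h : IsEvenLattice b K) [Finite (discO h)] {ratio : ℕ}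
    (hr : Nat.card (discHom h).range * ratio = Nat.card (discO h)) :
    (Nat.card (discO h) : ℚ) / Nat.card (discHom h).range = ratio ∧
    (ratio = 1 → Function.Surjective (discHom h) ∧
      (∀ C : Subgroup (discO h), Nat.card (DoubleCoset.Quotient (C : Set (discO h))
        ((discHom h).range : Set (discO h))) = 1) ∧ UniqueHEmbedding b K) := by
  constructor
  · have : (Nat.card (discHom h).range : ℚ) ≠ 0 := by exact_mod_cast Nat.card_pos.ne'
    rw [← hr]
    push_cast
    field_simp
  · rintro rfl
    rw [mul_one] at hr
    have htop : (discHom h).range = ⊤ := Subgroup.eq_top_of_card_eq _ hr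
    have hs : Function.Surjective (discHom h) := MonoidHom.range_eq_top.1 htop
    refine ⟨hs, fun C => ?_, uniqueHEmbedding_of_surjective h hs⟩
    rw [Nat.card_eq_one_iff_unique]
    refine ⟨⟨fun x y => ?_⟩, ⟨Quotient.mk _ 1⟩⟩
    induction x using Quotient.inductionOn with
    | h x =>
      induction y using Quotient.inductionOn with
      | h y =>
        refine Quotient.sound (DoubleCoset.rel_iff.2 ⟨1, C.one_mem, x⁻¹ * y, ?_, by group⟩)
        rw [htop]
        exact Subgroup.mem_top _

end Surjective

/-! ### Efficient evaluation of the order formula -/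

section FastCount

/-- The values of `subsumCount`. -/
def countTuple : List ℕ → ℕ × ℕ × ℕ × ℕ
  | [] => (1, 0, 0, 0)
  | c :: ε => match countTuple ε, c % 4 with
    | (a, b, c, d), 0 => (a + a, b + b, c + c, d + d)
    | (a, b, c, d), 1 => (a + d, b + a, c + b, d + c)
    | (a, b, c, d), 2 => (a + c, b + d, c + a, d + b)
    | (a, b, c, d), _ => (a + b, b + c, c + d, d + a)

/-- The component of a tuple that belongs to a residue modulo `4`. -/
def pick : ℕ × ℕ × ℕ × ℕ → ℕ → ℕ
  | (a, _, _, _), 0 => a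
  | (_, b, _, _), 1 => b
  | (_, _, c, _), 2 => c
  | (_, _, _, d), _ => d

/-- A fast version of `isometryCount`. -/
def fastCount : List ℕ → ℕ
  | [] => 1
  | [_] => 1
  | c :: c' :: ε => (pick (countTuple (c :: c' :: ε)) (c % 4) -
      (if (c :: c' :: ε).sum % 4 = c % 4 then 1 else 0)) * fastCount (c' :: ε)

lemma natCast_mod_four (n : ℕ) : ((n % 4 : ℕ) : ZMod 4) = n := ZMod.natCast_mod n 4

/-- The recursion of `subsumCount` branches twice for each entry; carrying the counts of all four
residues together makes one pass sufficient. -/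
lemma countTuple_eq (l : List ℕ) : countTuple l =
    (subsumCount (l.map Nat.cast) 0, subsumCount (l.map Nat.cast) 1,
      subsumCount (l.map Nat.cast) 2, subsumCount (l.map Nat.cast) 3) := by
  induction l with
  | nil => rfl
  | cons c l ih =>
    have h : ∀ k, subsumCount ((c :: l).map Nat.cast) k =
        subsumCount (l.map Nat.cast) k + subsumCount (l.map Nat.cast) (k - (c % 4 : ℕ)) := fun k => by
      rw [natCast_mod_four]
      rfl
    rw [countTuple, ih, h, h, h, h]
    have h4 := Nat.mod_lt c (show 0 < 4 by norm_num)
    generalize c % 4 = m at h4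
    interval_cases m <;> rfl

lemma pick_eq (l : List ℕ) (c : ℕ) :
    pick (countTuple l) (c % 4) = subsumCount (l.map Nat.cast) (c : ZMod 4) := by
  rw [countTuple_eq, ← natCast_mod_four c]
  have h4 := Nat.mod_lt c (show 0 < 4 by norm_num)
  generalize c % 4 = m at h4
  interval_cases m <;> rfl

lemma fastCount_eq (l : List ℕ) : fastCount l = isometryCount (l.map Nat.cast) := by
  induction l with
  | nil => rfl
  | cons c l ih =>
    cases l with
    | nil => rfl
    | cons c' ε =>
      rw [fastCount, ih, pick_eq]
      simp only [List.map_cons, isometryCount]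
      congr 2
      refine if_congr ?_ rfl rfl
      have h : ∀ l : List ℕ, (l.map (Nat.cast : ℕ → ZMod 4)).sum = (l.sum : ℕ) := fun l => by
        rw [Nat.cast_list_sum]
      have := h (c :: c' :: ε)
      rw [List.map_cons, List.map_cons] at this
      rw [this, ZMod.natCast_eq_natCast_iff']

end FastCount

/-! ### Certificates for 2-elementary lattices -/

section Certificate

/-- The root lattices with `2`-elementary discriminant group that occur. -/
def RootType.isListed : RootType → Bool
  | .A n => Nat.beq n 1
  | .D n => memNat n [4, 6, 8, 10, 12, 14, 16, 18]
  | .E6 => false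
  | .E7 => true
  | .E8 => true

set_option maxRecDepth 100000 in
lemma RootType.isTwoElementary_D {n : ℕ} (h : n ∈ [4, 6, 8, 10, 12, 14, 16, 18]) :
    (D n).IsTwoElementary := by
  fin_cases h <;> (constructor; constructor; all_goals decide +kernel)

set_option maxRecDepth 100000 in
lemma RootType.isTwoElementary_of_isListed {t : RootType} (h : t.isListed = true) :
    t.IsTwoElementary := by
  cases t with
  | A n =>
    rw [Nat.eq_of_beq_eq_true h]
    constructor; constructor
    all_goals decide +kernel
  | D n => exact isTwoElementary_D (memNat_iff.1 h)
  | E6 => exact absurd h (by decide)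
  | E7 =>
    constructor; constructor
    all_goals decide +kernel
  | E8 =>
    constructor; constructor
    all_goals decide +kernel

/-- Each word of `G` is separated by the corresponding word of `d` from the later words. -/
def Separates (r : ℕ) (rest : List ℕ) : List ℕ → List ℕ → Prop
  | [], _ => True
  | d :: ds, g :: gs => (bitCount r (d &&& g) % 2 = 1 ∧
      ∀ x ∈ ds ++ rest, bitCount r (x &&& g) % 2 = 0) ∧ Separates r rest ds gs
  | _ :: _, [] => False

instance decidableSeparates (r : ℕ) (rest : List ℕ) :
    ∀ ds gs, Decidable (Separates r rest ds gs)
  | [], _ => instDecidableTrue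
  | _ :: ds, _ :: gs => @instDecidableAnd _ _ _ (decidableSeparates r rest ds gs)
  | _ :: _, [] => instDecidableFalse

/-- The first glue word pairs oddly with the first separating word and evenly with everything after
it. A word orthogonal to the glue can therefore not involve the first separating word, and induction
removes the others. -/
lemma mem_of_separates {r : ℕ} {rest : List ℕ} {ds gs : List ℕ} (h : Separates r rest ds gs)
    {w : ℕ} (hw : w ∈ xorSpan (ds ++ rest)) (hg : ∀ g ∈ gs, bitCount r (w &&& g) % 2 = 0) :
    w ∈ xorSpan rest := by
  induction ds generalizing gs with
  | nil => exact hw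
  | cons d ds ih =>
    cases gs with
    | nil => exact h.elim
    | cons g gs =>
      obtain ⟨⟨h1, h2⟩, h3⟩ := h
      refine ih h3 ?_ fun g' hg' => hg g' (List.mem_cons_of_mem _ hg')
      refine (mem_xorSpan_cons.1 hw).resolve_right fun hd => ?_
      have h4 := xorSpan_le (S := fun x => bitCount r (x &&& g) % 2 = 0)
        ⟨by simp [bitCount_eq], fun {a b} ha hb => by
          rw [bitCount_and_xor, Nat.add_mod, ha, hb]⟩ h2 _ hd
      rw [bitCount_and_xor] at h4
      have := hg g List.mem_cons_self
      omega

/-- A basis of the discriminant group, generators of the image of the group of isometries, an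
orthogonal basis of the discriminant group (of its sum with a group of order two, if `even`), and
words that separate the glue words. -/
structure FrameCert where
  base : List ℕ
  gens : List (List (ℕ × ℕ))
  orth : List ℕ
  dual : List ℕ
  even : Bool
  fine : Bool

/-- `w` represents an element of the discriminant group. -/
def IsGood (r : ℕ) (E G : List ℕ) (w : ℕ) : Prop :=
  inSpan E w = true ∧ ∀ g ∈ G, bitCount r (w &&& g) % 2 = 0

instance (r : ℕ) (E G : List ℕ) (w : ℕ) : Decidable (IsGood r E G w) := by
  unfold IsGood
  infer_instance

lemma IsGood.good {r : ℕ} {E G : List ℕ} {w : ℕ} (h : IsGood r E G w) : MaskCode.Good r E G w :=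
  ⟨mem_xorSpan_of_inSpan h.1, h.2⟩

/-- The conditions on the glue words. -/
def GlueValid (L : List RootType) (E G : List ℕ) : Prop :=
  (∀ t ∈ L, t.isListed = true) ∧ (∀ g ∈ G, inSpan E g = true) ∧
  (∀ g ∈ G, bitCount (rankSum L) g % 4 = 0) ∧
  (∀ g ∈ G, ∀ g' ∈ G, bitCount (rankSum L) (g &&& g') % 2 = 0) ∧ (xorSpan G).Nodup ∧
  ∀ c ∈ xorSpan G, c ≠ 0 →
    8 < ((blocks L 0).map fun p => p.1.normBound ((c >>> p.2) % 2 ^ p.1.rank)).sum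

instance (L : List RootType) (E G : List ℕ) : Decidable (GlueValid L E G) := by
  unfold GlueValid
  infer_instance

/-- The conditions on the generators of the image of the group of isometries. -/
def GensValid (r : ℕ) (adjs G : List ℕ) (gens : List (List (ℕ × ℕ))) : Prop :=
  ∀ s ∈ gens, (∀ p ∈ s, p.1 < r ∧ p.2 < r) ∧
    (∀ i < r, moveMask s (adjs.getD i 0) = adjs.getD (moveIndex s i) 0) ∧
    ∀ c ∈ G, inSpan G (moveMask s c) = true

instance (r : ℕ) (adjs G : List ℕ) (gens : List (List (ℕ × ℕ))) :
    Decidable (GensValid r adjs G gens) := by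
  unfold GensValid
  infer_instance

/-- The conditions on the orthogonal basis; `s` is the number of positions. -/
def OrthValid (r s : ℕ) (E G X Y : List ℕ) : Prop :=
  (∀ y ∈ Y, IsGood r E G (y % 2 ^ r)) ∧ (∀ y ∈ Y, y < 2 ^ s) ∧
  (∀ y ∈ Y, bitCount s y % 2 = 1) ∧
  (Y.Pairwise fun y y' => bitCount s (y &&& y') % 2 = 0) ∧
  ∀ x ∈ X, inSpan G (x ^^^ orthCombo s Y x) = true

instance (r s : ℕ) (E G X Y : List ℕ) : Decidable (OrthValid r s E G X Y) := by
  unfold OrthValid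
  infer_instance

/-- The basis and the orthogonal basis have the required properties. -/
def BaseValid (r : ℕ) (E G : List ℕ) (c : FrameCert) : Prop :=
  (∀ x ∈ c.base, IsGood r E G x) ∧ (∀ e ∈ E, inSpan (c.dual ++ (c.base ++ G)) e = true) ∧
  Separates r (c.base ++ G) c.dual G ∧
  if c.even then (∀ x ∈ c.base, bitCount r x % 2 = 0) ∧ c.orth.length = c.base.length + 1 ∧
    OrthValid r (r + 1) E G (2 ^ r :: c.base) c.orth
  else c.orth.length = c.base.length ∧ OrthValid r r E G c.base c.orth

instance (r : ℕ) (E G : List ℕ) (c : FrameCert) : Decidable (BaseValid r E G c) := by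
  unfold BaseValid
  infer_instance

/-- The number of positions of the orthogonal basis. -/
def FrameCert.size (c : FrameCert) (r : ℕ) : ℕ := if c.even then r + 1 else r

/-- The certificate proves the claims on the frame. -/
def FrameCert.Valid (F : Frame) (c : FrameCert) : Prop :=
  (∀ v ∈ F.glue, ∀ x ∈ v, x < 2) ∧
  GlueValid F.roots (wordMasks F.roots) (F.glue.map toMask) ∧
  BaseValid (rankSum F.roots) (wordMasks F.roots) (F.glue.map toMask) c ∧
  GensValid (rankSum F.roots) (adjMasks F.roots) (F.glue.map toMask) c.gens ∧
  (chainSizes c.fine (weights (adjMasks F.roots) 6) (xorSpan (F.glue.map toMask)) (xorSpan c.base)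
    (echelon [] (F.glue.map toMask)) c.gens [0] c.base).prod * F.ratio =
    fastCount (c.orth.map (bitCount (c.size (rankSum F.roots)))) ∧
  -- Together with the previous equation this excludes a zero entry in the chain, i.e. a failed
  -- orbit comparison.
  fastCount (c.orth.map (bitCount (c.size (rankSum F.roots)))) ≠ 0

instance (F : Frame) (c : FrameCert) : Decidable (c.Valid F) := by
  unfold FrameCert.Valid
  infer_instance

/-- The properties of a frame that are claimed. -/
def Frame.Holds (F : Frame) : Prop :=
  F.IsFrame ∧ ∃ h : IsEvenLattice F.form F.lattice, Finite (discO h) ∧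
    (Nat.card (discO h) : ℚ) / Nat.card (discHom h).range = F.ratio ∧
    (F.ratio = 1 → Function.Surjective (discHom h) ∧
      (∀ C : Subgroup (discO h), Nat.card (DoubleCoset.Quotient (C : Set (discO h))
        ((discHom h).range : Set (discO h))) = 1) ∧ UniqueHEmbedding F.form F.lattice)

lemma testBit_toMask {v : List ℕ} (hv : ∀ x ∈ v, x < 2) (i : ℕ) :
    v.getD i 0 = if (toMask v).testBit i then 1 else 0 := by
  induction v generalizing i with
  | nil => simp [toMask]
  | cons b v ih =>
    have hb := hv b List.mem_cons_self
    have ih' := ih fun x hx => hv x (List.mem_cons_of_mem _ hx)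
    cases i with
    | zero =>
      rw [List.getD_cons_zero, toMask, Nat.testBit_zero, Nat.add_mul_mod_self_left]
      interval_cases b <;> simp
    | succ i =>
      rw [List.getD_cons_succ, toMask, Nat.testBit_add_one, ih']
      congr 3
      omega

lemma lattice_eq (F : Frame) (h : ∀ v ∈ F.glue, ∀ x ∈ v, x < 2) :
    F.lattice = maskLattice (flatEquiv F.roots) (F.glue.map toMask) := by
  have hv : ∀ v ∈ F.glue, F.glueVector v = halfVec (flatEquiv F.roots) (toMask v) := by
    intro v hv
    funext p
    change (v.getD (flatEquiv F.roots p) 0 : ℚ) / 2 = _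
    rw [testBit_toMask (h v hv), halfVec]
    split_ifs <;> simp
  rw [Frame.lattice, maskLattice]
  congr 2
  ext x
  constructor
  · rintro ⟨v, hvF, rfl⟩
    exact ⟨_, List.mem_map_of_mem hvF, hv v hvF⟩
  · rintro ⟨_, hg, rfl⟩
    obtain ⟨v, hvF, rfl⟩ := List.mem_map.1 hg
    exact ⟨v, hvF, (hv v hvF).symm⟩

/-- The certificate gives |O(q_K)| through the orthogonal basis and the order of the image through
the stabilizer chain. The equation between them is the ratio. -/
theorem FrameCert.Valid.holds {F : Frame} {c : FrameCert} (hc : c.Valid F) : F.Holds := by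
  obtain ⟨hF, ⟨hL, hG1, hG2, hG3, hG4, hG5⟩, ⟨hX, hE, hsep, hY⟩, hgens, hprod, hne⟩ := hc
  have hL' : ∀ t ∈ F.roots, t.IsTwoElementary := fun t ht =>
    RootType.isTwoElementary_of_isListed (hL t ht)
  set G := F.glue.map toMask with hGdef
  set L := F.roots with hLdef
  have H : MaskCode (cartanSum L) (flatEquiv L) (wordMasks L) G := maskCode_of_glue hL'
    (fun g hg => mem_xorSpan_of_inSpan (hG1 g hg)) hG2 hG3 hG4 hG5
  have A := adjCode fun t ht => (hL' t ht).toIsCorrect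
  have h := H.isEvenLattice
  have := H.finite_discGroup
  have : Finite (DiscGroup (negForm (cartanSum L)) (maskLattice (flatEquiv L) G) ≃ₗ[ℤ]
      DiscGroup (negForm (cartanSum L)) (maskLattice (flatEquiv L) G)) := DFunLike.finite _
  -- All words of the dual root lattice lie in the span of the separating words, the base and the
  -- glue. Orthogonality to the glue removes the separating words.
  have hspan : ∀ w, MaskCode.Good (rankSum L) (wordMasks L) G w → w ∈ xorSpan (c.base ++ G) :=
    fun w hw => mem_of_separates hsep
      (xorSpan_le (xorSpan_closed _) (fun e he => mem_xorSpan_of_inSpan (hE e he)) w hw.1) hw.2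
  have hX' : ∀ x ∈ c.base, MaskCode.Good (rankSum L) (wordMasks L) G x := fun x hx => (hX x hx).good
  have hcount : Nat.card (discO h) = fastCount (c.orth.map (bitCount (c.size (rankSum L)))) ∧
      Nat.card (DiscGroup (negForm (cartanSum L)) (maskLattice (flatEquiv L) G)) =
        2 ^ c.base.length := by
    rw [fastCount_eq, List.map_map]
    rcases Bool.eq_false_or_eq_true c.even with he | he
    · rw [if_pos he] at hY
      obtain ⟨hXe, hlen, hY1, -, hY2, hY3, hY4⟩ := hY
      obtain ⟨h1, h2⟩ := H.card_discO_even h hspan hX' hXe (fun y hy => (hY1 y hy).good) hY2 hY3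
        fun x hx => mem_xorSpan_of_inSpan (hY4 x hx)
      rw [FrameCert.size, if_pos he]
      refine ⟨h1, ?_⟩
      rw [hlen, pow_succ] at h2
      exact Nat.eq_of_mul_eq_mul_right two_pos h2
    · rw [if_neg (by rw [he]; exact Bool.false_ne_true)] at hY
      obtain ⟨hlen, hY1, hY0, hY2, hY3, hY4⟩ := hY
      obtain ⟨h1, h2⟩ := H.card_discO_odd h hspan hX' (fun y hy => by
        have := (hY1 y hy).good
        rwa [Nat.mod_eq_of_lt (hY0 y hy)] at this) hY2 hY3
        fun x hx => mem_xorSpan_of_inSpan (hY4 x hx)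
      rw [FrameCert.size, if_neg (by rw [he]; exact Bool.false_ne_true)]
      exact ⟨h1, by rw [h2, hlen]⟩
  have hrange := H.card_range A h hspan hX' hcount.2 (gens := c.gens)
    (fun s hs => ⟨(hgens s hs).1, (hgens s hs).2.1, fun g hg =>
      mem_xorSpan_of_inSpan ((hgens s hs).2.2 g hg)⟩) c.fine 6
    (fun h0 => hne (by rw [← hprod, h0, zero_mul]))
  have hfin : Finite (discO h) := inferInstance
  have hcons := consequences_of_card h (ratio := F.ratio) (by rw [hrange, hcount.1, hprod])
  rw [Frame.Holds, Frame.IsFrame, lattice_eq F hF]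
  refine ⟨⟨H.neg, H.rootSublattice_eq, ?_⟩, h, hfin, hcons⟩
  have := H.card_quotient
  rwa [hGdef, List.length_map] at this

end Certificate

/-! ### Fundamental weights and discriminant groups of general root lattices -/

section Weights

variable {ι : Type*} [Fintype ι] [DecidableEq ι] {r : ℕ}

/-- The vector with coordinates `M p j / N`. -/
def weightVec (e : ι ≃ Fin r) (M : ℕ → ℕ → ℤ) (N : ℕ) (j : ℕ) : ι → ℚ := fun p => M (e p) j / N

/-- A combination of the vectors `weightVec`. -/
def weightSum (e : ι ≃ Fin r) (M : ℕ → ℕ → ℤ) (N : ℕ) (l : List (ℕ × ℕ)) : ι → ℚ :=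
  (l.map fun a => a.1 • weightVec e M N a.2).sum

/-- The coordinates of `weightSum`, multiplied by `N`. -/
def coordSum (M : ℕ → ℕ → ℤ) (i : ℕ) (l : List (ℕ × ℕ)) : ℤ :=
  (l.map fun a => a.1 * M i a.2).sum

/-- The products of the vectors `weightSum`, multiplied by `-N`. -/
def pairSum (M : ℕ → ℕ → ℤ) (l l' : List (ℕ × ℕ)) : ℤ :=
  (l.map fun a => a.1 * coordSum M a.2 l').sum

/-- The matrix `M` is `N` times the inverse of `C`. -/
structure InvCode (C : Matrix ι ι ℤ) (e : ι ≃ Fin r) (M : ℕ → ℕ → ℤ) (N : ℕ) : Prop where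
  pos : 0 < N
  symm : ∀ p q : ι, M (e p) (e q) = M (e q) (e p)
  mul : ∀ p q, ∑ k, M (e p) (e k) * C k q = if p = q then (N : ℤ) else 0

variable {C : Matrix ι ι ℤ} {e : ι ≃ Fin r} {M : ℕ → ℕ → ℤ} {N : ℕ}

omit [Fintype ι] [DecidableEq ι] in
lemma weightSum_cons (a : ℕ × ℕ) (l : List (ℕ × ℕ)) :
    weightSum e M N (a :: l) = a.1 • weightVec e M N a.2 + weightSum e M N l := by
  simp [weightSum]

omit [Fintype ι] [DecidableEq ι] in
lemma weightSum_apply (l : List (ℕ × ℕ)) (p : ι) :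
    weightSum e M N l p = coordSum M (e p) l / N := by
  induction l with
  | nil => simp [weightSum, coordSum]
  | cons a l ih =>
    rw [weightSum_cons, Pi.add_apply, ih, coordSum, coordSum, List.map_cons, List.sum_cons,
      Pi.smul_apply, weightVec]
    push_cast
    rw [nsmul_eq_mul]
    ring

namespace InvCode

variable (I : InvCode C e M N)
include I

/-- The vectors are columns of the inverse Gram matrix, so up to sign they form the basis dual to
the simple roots, i.e. the fundamental weights. -/
lemma form_weightVec (q : ι) (x : ι → ℚ) : negForm C (weightVec e M N (e q)) x = -x q := by
  have hN : (N : ℚ) ≠ 0 := by exact_mod_cast I.pos.ne'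
  have key : ∀ k, ∑ p, weightVec e M N (e q) p * C p k * x k = if q = k then x k else 0 := fun k => by
    have h1 : ∑ p, weightVec e M N (e q) p * C p k * x k =
        ((∑ p, M (e q) (e p) * C p k : ℤ) : ℚ) / N * x k := by
      push_cast
      rw [Finset.sum_div, Finset.sum_mul]
      refine Finset.sum_congr rfl fun p _ => ?_
      rw [weightVec, I.symm p q]
      ring
    rw [h1, I.mul]
    split_ifs
    · push_cast
      rw [div_self hN, one_mul]
    · simp
  rw [negForm_apply, Finset.sum_comm, Finset.sum_congr rfl fun k _ => key k]
  simp

lemma weightVec_mem {j : ℕ} (hj : j < r) :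
    weightVec e M N j ∈ dualLattice (negForm C) (intLattice ι) := by
  intro y hy
  obtain ⟨q, hq⟩ := e.surjective ⟨j, hj⟩
  obtain ⟨n, hn⟩ := mem_intLattice.1 hy q
  have := I.form_weightVec q y
  rw [hq, hn] at this
  exact Submodule.mem_one.2 ⟨-n, by rw [this]; simp⟩

lemma weightSum_mem {l : List (ℕ × ℕ)} (hl : ∀ a ∈ l, a.2 < r) :
    weightSum e M N l ∈ dualLattice (negForm C) (intLattice ι) := by
  refine list_sum_mem fun v hv => ?_
  obtain ⟨a, ha, rfl⟩ := List.mem_map.1 hv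
  exact Submodule.smul_of_tower_mem _ a.1 (I.weightVec_mem (hl a ha))

lemma form_weightSum {l : List (ℕ × ℕ)} (hl : ∀ a ∈ l, a.2 < r) (l' : List (ℕ × ℕ)) :
    negForm C (weightSum e M N l) (weightSum e M N l') = -(pairSum M l l' : ℚ) / N := by
  induction l with
  | nil => simp [weightSum, pairSum]
  | cons a l ih =>
    obtain ⟨q, hq⟩ := e.surjective ⟨a.2, hl a List.mem_cons_self⟩
    have h1 := I.form_weightVec q (weightSum e M N l')
    rw [hq, weightSum_apply, hq] at h1
    rw [weightSum_cons, map_add, LinearMap.add_apply, ih fun b hb => hl b (List.mem_cons_of_mem _ hb),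
      map_nsmul, LinearMap.smul_apply, h1, pairSum, pairSum, List.map_cons, List.sum_cons]
    push_cast
    rw [nsmul_eq_mul]
    ring

variable (C e M N) in
/-- The classes of the vectors of the dual lattice in the discriminant group. -/
noncomputable def weightClass (l : List (ℕ × ℕ)) : DiscGroup (negForm C) (intLattice ι) :=
  open Classical in
  if h : weightSum e M N l ∈ dualLattice (negForm C) (intLattice ι) then
    Submodule.Quotient.mk ⟨_, h⟩ else 0

omit I in
lemma weightClass_eq {l : List (ℕ × ℕ)}
    (h : weightSum e M N l ∈ dualLattice (negForm C) (intLattice ι)) :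
    weightClass C e M N l = Submodule.Quotient.mk ⟨_, h⟩ := dif_pos h

lemma weightClass_append {l l' : List (ℕ × ℕ)} (hl : ∀ a ∈ l, a.2 < r) (hl' : ∀ a ∈ l', a.2 < r) :
    weightClass C e M N (l ++ l') = weightClass C e M N l + weightClass C e M N l' := by
  rw [weightClass_eq (I.weightSum_mem hl), weightClass_eq (I.weightSum_mem hl'),
    weightClass_eq (I.weightSum_mem (l := l ++ l') fun a ha =>
      (List.mem_append.1 ha).elim (hl a) (hl' a)), ← Submodule.Quotient.mk_add]
  congr 1
  refine Subtype.ext ?_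
  change weightSum e M N (l ++ l') = weightSum e M N l + weightSum e M N l'
  simp [weightSum]

lemma weightClass_single (n : ℕ) {j : ℕ} (hj : j < r) :
    weightClass C e M N [(n, j)] = n • weightClass C e M N [(1, j)] := by
  have h : ∀ n : ℕ, ∀ a ∈ [(n, j)], a.2 < r := by simpa using hj
  rw [weightClass_eq (I.weightSum_mem (h n)), weightClass_eq (I.weightSum_mem (h 1)),
    ← Submodule.Quotient.mk_smul]
  congr 1
  refine Subtype.ext ?_
  change weightSum e M N [(n, j)] = n • weightSum e M N [(1, j)]
  simp [weightSum]

lemma discForm_weightClass (h : IsEvenLattice (negForm C) (intLattice ι)) {l : List (ℕ × ℕ)}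
    (hl : ∀ a ∈ l, a.2 < r) :
    discForm h (weightClass C e M N l) = ((-(pairSum M l l : ℚ) / N : ℚ) : AddCircle (2 : ℚ)) := by
  rw [weightClass_eq (I.weightSum_mem hl), discForm_mk, I.form_weightSum hl]

/-- The combinations `l` and `l'` differ by a vector with integral coordinates. -/
def Congruent (M : ℕ → ℕ → ℤ) (N r : ℕ) (l l' : List (ℕ × ℕ)) : Prop :=
  ∀ i < r, (coordSum M i l - coordSum M i l') % N = 0

instance (M : ℕ → ℕ → ℤ) (N r : ℕ) (l l' : List (ℕ × ℕ)) : Decidable (Congruent M N r l l') := by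
  unfold Congruent
  infer_instance

lemma weightClass_congr {l l' : List (ℕ × ℕ)} (hl : ∀ a ∈ l, a.2 < r) (hl' : ∀ a ∈ l', a.2 < r)
    (h : Congruent M N r l l') : weightClass C e M N l = weightClass C e M N l' := by
  rw [weightClass_eq (I.weightSum_mem hl), weightClass_eq (I.weightSum_mem hl')]
  refine (Submodule.Quotient.eq _).2 (mem_intLattice.2 fun p => ?_)
  change ∃ n : ℤ, weightSum e M N l p - weightSum e M N l' p = n
  obtain ⟨n, hn⟩ := Int.dvd_of_emod_eq_zero (h (e p) (e p).2)
  refine ⟨n, ?_⟩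
  have hN : (N : ℚ) ≠ 0 := by exact_mod_cast I.pos.ne'
  rw [weightSum_apply, weightSum_apply, ← sub_div, div_eq_iff hN, mul_comm]
  exact_mod_cast hn

/-- The combinations of the given weights with coefficients below the given bounds. -/
def box : List (ℕ × ℕ) → List (List (ℕ × ℕ))
  | [] => [[]]
  | a :: P => (List.range a.2).flatMap fun n => (box P).map fun l => (n, a.1) :: l

omit I in
lemma lt_of_mem_box {P : List (ℕ × ℕ)} (hP : ∀ a ∈ P, a.1 < r) {l : List (ℕ × ℕ)}
    (hl : l ∈ box P) : ∀ a ∈ l, a.2 < r := by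
  induction P generalizing l with
  | nil =>
    rw [box, List.mem_singleton] at hl
    simp [hl]
  | cons b P ih =>
    obtain ⟨n, -, hl⟩ := List.mem_flatMap.1 hl
    obtain ⟨l', hl', rfl⟩ := List.mem_map.1 hl
    exact List.forall_mem_cons.2 ⟨hP b List.mem_cons_self,
      ih (fun a ha => hP a (List.mem_cons_of_mem _ ha)) hl'⟩

/-- Coefficients of the generators are reduced modulo their listed orders. -/
lemma exists_box {P : List (ℕ × ℕ)} (hP : ∀ a ∈ P, a.1 < r ∧ 0 < a.2)
    (hord : ∀ a ∈ P, a.2 • weightClass C e M N [(1, a.1)] = 0)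
    {z : DiscGroup (negForm C) (intLattice ι)}
    (hz : z ∈ Submodule.span ℤ {z | ∃ a ∈ P, z = weightClass C e M N [(1, a.1)]}) :
    ∃ l ∈ box P, weightClass C e M N l = z := by
  induction P generalizing z with
  | nil =>
    have h0 : z = 0 := by simpa using hz
    have hnil : ∀ a ∈ ([] : List (ℕ × ℕ)), a.2 < r := by simp
    have := I.weightClass_append hnil hnil
    rw [List.append_nil] at this
    exact ⟨[], List.mem_singleton_self _, by rw [h0]; exact left_eq_add.1 this⟩
  | cons a P ih =>
    have hset : {z | ∃ b ∈ a :: P, z = weightClass C e M N [(1, b.1)]} =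
        insert (weightClass C e M N [(1, a.1)]) {z | ∃ b ∈ P, z = weightClass C e M N [(1, b.1)]} := by
      ext z
      simp
    rw [hset, Submodule.mem_span_insert] at hz
    obtain ⟨n, w, hw, rfl⟩ := hz
    obtain ⟨l, hl, rfl⟩ := ih (fun b hb => hP b (List.mem_cons_of_mem _ hb))
      (fun b hb => hord b (List.mem_cons_of_mem _ hb)) hw
    obtain ⟨ha, hpos⟩ := hP a List.mem_cons_self
    have hm : (0 : ℤ) < a.2 := by exact_mod_cast hpos
    obtain ⟨k, hk⟩ := Int.eq_ofNat_of_zero_le (Int.emod_nonneg n hm.ne')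
    have hka : k < a.2 := by
      have := Int.emod_lt_of_pos n hm
      omega
    refine ⟨(k, a.1) :: l, List.mem_flatMap.2 ⟨k, List.mem_range.2 hka, List.mem_map_of_mem hl⟩, ?_⟩
    rw [← List.singleton_append, I.weightClass_append (by simpa using ha)
      (lt_of_mem_box (fun b hb => (hP b (List.mem_cons_of_mem _ hb)).1) hl), I.weightClass_single k ha]
    congr 1
    have hn : n = (a.2 : ℤ) * (n / a.2) + k := by rw [← hk]; exact (Int.mul_ediv_add_emod n a.2).symm
    rw [hn, add_smul, mul_comm, mul_smul, natCast_zsmul, natCast_zsmul,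
      hord a List.mem_cons_self, smul_zero, zero_add]

/-- The fundamental weights generate the dual lattice, and each is congruent to a combination of the
weights in P. -/
lemma span_weightClass (hC : C.IsSymm) {P : List (ℕ × ℕ)} (hP : ∀ a ∈ P, a.1 < r)
    (hcov : ∀ j < r, ∃ l ∈ box P, Congruent M N r [(1, j)] l) :
    Submodule.span ℤ {z | ∃ a ∈ P, z = weightClass C e M N [(1, a.1)]} = ⊤ := by
  set T := Submodule.span ℤ {z | ∃ a ∈ P, z = weightClass C e M N [(1, a.1)]} with hT
  have hlist : ∀ l : List (ℕ × ℕ), (∀ a ∈ l, a.2 < r ∧ weightClass C e M N [(1, a.2)] ∈ T) →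
      weightClass C e M N l ∈ T := by
    intro l hl
    induction l with
    | nil =>
      have hnil : ∀ a ∈ ([] : List (ℕ × ℕ)), a.2 < r := by simp
      have := I.weightClass_append hnil hnil
      rw [List.append_nil] at this
      rw [left_eq_add.1 this]
      exact T.zero_mem
    | cons a l ih =>
      have ha := hl a List.mem_cons_self
      have hl' := fun b hb => hl b (List.mem_cons_of_mem _ hb)
      rw [← List.singleton_append, I.weightClass_append (by simpa using ha.1) fun b hb => (hl' b hb).1,
        I.weightClass_single a.1 ha.1]
      exact T.add_mem (T.smul_of_tower_mem _ ha.2) (ih hl')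
  have hbox : ∀ P' : List (ℕ × ℕ), P' ⊆ P → ∀ l ∈ box P', ∀ a ∈ l, ∃ b ∈ P, a.2 = b.1 := by
    intro P'
    induction P' with
    | nil =>
      intro _ l hl
      rw [box, List.mem_singleton] at hl
      simp [hl]
    | cons b P' ih =>
      intro hsub l hl
      obtain ⟨n, -, hl⟩ := List.mem_flatMap.1 hl
      obtain ⟨l', hl', rfl⟩ := List.mem_map.1 hl
      exact List.forall_mem_cons.2 ⟨⟨b, hsub List.mem_cons_self, rfl⟩,
        ih (fun a ha => hsub (List.mem_cons_of_mem _ ha)) l' hl'⟩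
  have hcl : ∀ j < r, weightClass C e M N [(1, j)] ∈ T := by
    intro j hj
    obtain ⟨l, hl, h⟩ := hcov j hj
    rw [I.weightClass_congr (by simpa using hj) (lt_of_mem_box hP hl) h]
    refine hlist l fun a ha => ?_
    obtain ⟨b, hb, hab⟩ := hbox P (List.Subset.refl _) l hl a ha
    rw [hab]
    exact ⟨hP b hb, Submodule.subset_span ⟨b, hb, rfl⟩⟩
  rw [eq_top_iff]
  intro z _
  induction z using Submodule.Quotient.induction_on with
  | H y =>
    have hz : ∀ q, ∃ n : ℤ, negForm C (Pi.single q 1) y = n := fun q => by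
      rw [negForm_symm hC]
      exact exists_int_of_mem_dual y.2 (single_mem_intLattice q)
    choose n hn using hz
    -- Expansion in the dual basis: the coefficients are the negatives of the products of y with the
    -- simple roots.
    have hy : y = ∑ q, (-n q) • (⟨weightVec e M N (e q), I.weightVec_mem (e q).2⟩ :
        dualLattice (negForm C) (intLattice ι)) := by
      refine Subtype.ext (funext fun p => ?_)
      rw [AddSubmonoidClass.coe_finsetSum, Finset.sum_apply]
      have h1 : (y : ι → ℚ) p = -negForm C (weightVec e M N (e p)) y := by
        rw [I.form_weightVec, neg_neg]
      have h2 : weightVec e M N (e p) = ∑ q, weightVec e M N (e p) q • (Pi.single q 1 : ι → ℚ) := by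
        ext k
        simp [Finset.sum_apply, Pi.single_apply]
      rw [h1, h2, map_sum, LinearMap.sum_apply, ← Finset.sum_neg_distrib]
      refine Finset.sum_congr rfl fun q _ => ?_
      rw [map_smul, LinearMap.smul_apply, hn]
      change _ = (-n q) • weightVec e M N (e q) p
      rw [weightVec, weightVec, I.symm q p, zsmul_eq_mul, smul_eq_mul]
      push_cast
      ring
    rw [hy]
    change (Submodule.mkQ _) _ ∈ T
    rw [map_sum]
    refine T.sum_mem fun q _ => ?_
    rw [map_zsmul]
    refine T.smul_mem _ ?_
    have := hcl (e q) (e q).2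
    rw [weightClass_eq (I.weightSum_mem (by simp))] at this
    convert this using 1
    rw [Submodule.mkQ_apply]
    congr 1
    exact Subtype.ext (by simp [weightSum])

omit I in
-- An isometry that permutes the simple roots permutes the dual basis in the same way, by
-- nondegeneracy.
lemma map_weightVec (hneg : ∀ x : ι → ℚ, x ≠ 0 → negForm C x x < 0)
    (I : InvCode C e M N) {g : latticeO (negForm C) (intLattice ι)} {σ : Equiv.Perm ι}
    (hg : ∀ p, (g : (ι → ℚ) ≃ₗ[ℚ] (ι → ℚ)) (Pi.single p 1) = Pi.single (σ p) 1) (q : ι) :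
    (g : (ι → ℚ) ≃ₗ[ℚ] (ι → ℚ)) (weightVec e M N (e q)) = weightVec e M N (e (σ q)) := by
  rw [← sub_eq_zero]
  refine (nondegenerate_of_neg hneg).1 _ fun y => ?_
  obtain ⟨x, rfl⟩ := (g : (ι → ℚ) ≃ₗ[ℚ] (ι → ℚ)).surjective y
  rw [map_sub, LinearMap.sub_apply, g.2.1, I.form_weightVec, I.form_weightVec,
    apply_of_map_single hg, sub_self]

omit [Fintype ι] [DecidableEq ι] I in
lemma coordSum_append (i : ℕ) (l l' : List (ℕ × ℕ)) :
    coordSum M i (l ++ l') = coordSum M i l + coordSum M i l' := by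
  simp [coordSum]

lemma pairSum_comm (hC : C.IsSymm) {l l' : List (ℕ × ℕ)} (hl : ∀ a ∈ l, a.2 < r)
    (hl' : ∀ a ∈ l', a.2 < r) : pairSum M l l' = pairSum M l' l := by
  have hN : (N : ℚ) ≠ 0 := by exact_mod_cast I.pos.ne'
  have h1 := I.form_weightSum hl l'
  rw [negForm_symm hC, I.form_weightSum hl' l, div_left_inj' hN, neg_inj] at h1
  exact_mod_cast h1.symm

lemma pairSum_append (hC : C.IsSymm) {l l' : List (ℕ × ℕ)} (hl : ∀ a ∈ l, a.2 < r)
    (hl' : ∀ a ∈ l', a.2 < r) :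
    pairSum M (l ++ l') (l ++ l') = pairSum M l l + pairSum M l' l' + 2 * pairSum M l l' := by
  have h : ∀ a b c, pairSum M (a ++ b) c = pairSum M a c + pairSum M b c := fun a b c => by
    simp [pairSum]
  have h' : ∀ a b c, pairSum M a (b ++ c) = pairSum M a b + pairSum M a c := fun a b c => by
    simp only [pairSum, coordSum_append, mul_add, List.sum_map_add]
  rw [h, h', h', I.pairSum_comm hC hl' hl]
  ring

/-- The scaled products are N times the real ones, so equality modulo 2 becomes congruence modulo
2N. -/
lemma emod_of_discForm_eq (h : IsEvenLattice (negForm C) (intLattice ι)) {l l' : List (ℕ × ℕ)}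
    (hl : ∀ a ∈ l, a.2 < r) (hl' : ∀ a ∈ l', a.2 < r)
    (heq : discForm h (weightClass C e M N l) = discForm h (weightClass C e M N l')) :
    (pairSum M l l - pairSum M l' l') % (2 * N) = 0 := by
  have hN : (N : ℚ) ≠ 0 := by exact_mod_cast I.pos.ne'
  rw [I.discForm_weightClass h hl, I.discForm_weightClass h hl', ← sub_eq_zero,
    ← AddCircle.coe_sub] at heq
  obtain ⟨n, hn⟩ := (AddCircle.coe_eq_zero_iff (2 : ℚ)).1 heq
  rw [← sub_div, eq_div_iff hN, zsmul_eq_mul] at hn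
  have : pairSum M l l - pairSum M l' l' = 2 * N * (-n) := by
    have : ((pairSum M l l - pairSum M l' l' : ℤ) : ℚ) = ((2 * N * (-n) : ℤ) : ℚ) := by
      push_cast
      linarith
    exact_mod_cast this
  rw [this]
  exact Int.mul_emod_right _ _

/-- Each way to map the weights `ps` to combinations in `bx`, compatible with the products and with
the images `done` that have been chosen, is realized by one of the permutations `syms`. -/
def Extends (M : ℕ → ℕ → ℤ) (N r : ℕ) (bx : List (List (ℕ × ℕ))) (syms : List (List (ℕ × ℕ))) :
    List ℕ → List (ℕ × List (ℕ × ℕ)) → Prop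
  | [], done => ∃ s ∈ syms, ∀ a ∈ done, Congruent M N r [(1, moveIndex s a.1)] a.2
  | p :: ps, done => ∀ l ∈ bx, (pairSum M l l - M p p) % (2 * N) = 0 →
      (∀ a ∈ done, (pairSum M l a.2 - M p a.1) % N = 0) → Extends M N r bx syms ps ((p, l) :: done)

instance decidableExtends (M : ℕ → ℕ → ℤ) (N r : ℕ) (bx : List (List (ℕ × ℕ)))
    (syms : List (List (ℕ × ℕ))) : ∀ ps done, Decidable (Extends M N r bx syms ps done)
  | [], done => inferInstanceAs (Decidable (∃ s ∈ syms, ∀ a ∈ done,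
      Congruent M N r [(1, moveIndex s a.1)] a.2))
  | p :: ps, done =>
    have : ∀ l, Decidable (Extends M N r bx syms ps ((p, l) :: done)) := fun l =>
      decidableExtends M N r bx syms ps ((p, l) :: done)
    inferInstanceAs (Decidable (∀ l ∈ bx, (pairSum M l l - M p p) % (2 * N) = 0 →
      (∀ a ∈ done, (pairSum M l a.2 - M p a.1) % N = 0) →
        Extends M N r bx syms ps ((p, l) :: done)))

/-- Follow the branch of the search tree given by the images of the generators under α. The isometry
preserves the form, so these images satisfy the congruences of each node and the branch is not cut
off. The symmetry found at its end agrees with α on the generators. -/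
lemma exists_of_extends (h : IsEvenLattice (negForm C) (intLattice ι)) (hC : C.IsSymm)
    {bx syms : List (List (ℕ × ℕ))} (hbx : ∀ l ∈ bx, ∀ a ∈ l, a.2 < r)
    (hall : ∀ z, ∃ l ∈ bx, weightClass C e M N l = z) (hsyms : ∀ s ∈ syms, ∀ p ∈ s, p.1 < r ∧ p.2 < r)
    (α : discO h) {ps : List ℕ} {done : List (ℕ × List (ℕ × ℕ))} (hps : ∀ p ∈ ps, p < r)
    (hdone : ∀ a ∈ done, a.1 < r ∧ (∀ b ∈ a.2, b.2 < r) ∧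
      α.1 (weightClass C e M N [(1, a.1)]) = weightClass C e M N a.2)
    (hext : Extends M N r bx syms ps done) : ∃ s ∈ syms, ∀ p, (p ∈ ps ∨ ∃ a ∈ done, p = a.1) →
      α.1 (weightClass C e M N [(1, p)]) = weightClass C e M N [(1, moveIndex s p)] := by
  induction ps generalizing done with
  | nil =>
    obtain ⟨s, hs, hsa⟩ := hext
    refine ⟨s, hs, fun p hp => ?_⟩
    rcases hp with hp | ⟨a, ha, rfl⟩
    · simp at hp
    · obtain ⟨h1, h2, h3⟩ := hdone a ha
      rw [h3]
      exact (I.weightClass_congr (by simpa using moveIndex_lt (hsyms s hs) h1) h2 (hsa a ha)).symm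
  | cons p ps ih =>
    obtain ⟨l, hl, hlα⟩ := hall (α.1 (weightClass C e M N [(1, p)]))
    have hp := hps p List.mem_cons_self
    have hsingle : ∀ p < r, ∀ a ∈ [((1 : ℕ), p)], a.2 < r := by simp
    have hsum : ∀ p q, pairSum M [(1, p)] [(1, q)] = M p q := by simp [pairSum, coordSum]
    have hnorm := I.emod_of_discForm_eq h (hbx l hl) (hsingle p hp)
      (by rw [hlα]; exact α.2 _)
    have hpair : ∀ a ∈ done, (pairSum M l a.2 - M p a.1) % N = 0 := by
      intro a ha
      obtain ⟨h1, h2, h3⟩ := hdone a ha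
      have hn2 := I.emod_of_discForm_eq h h2 (hsingle _ h1) (by rw [← h3]; exact α.2 _)
      have hcat : ∀ {l l' : List (ℕ × ℕ)}, (∀ a ∈ l, a.2 < r) → (∀ a ∈ l', a.2 < r) →
          ∀ a ∈ l ++ l', a.2 < r := fun hl hl' a ha => (List.mem_append.1 ha).elim (hl a) (hl' a)
      -- Polarization: preserving the norm of the sum, modulo 2N, gives the product modulo N.
      have hn3 := I.emod_of_discForm_eq h (hcat (hbx l hl) h2) (hcat (hsingle p hp) (hsingle _ h1)) (by
        rw [I.weightClass_append (hbx l hl) h2, I.weightClass_append (hsingle p hp) (hsingle _ h1),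
          hlα, ← h3, ← map_add]
        exact α.2 _)
      rw [I.pairSum_append hC (hbx l hl) h2, I.pairSum_append hC (hsingle p hp) (hsingle _ h1)] at hn3
      rw [hsum p a.1] at hn3
      obtain ⟨x, hx⟩ := Int.dvd_of_emod_eq_zero hnorm
      obtain ⟨y, hy⟩ := Int.dvd_of_emod_eq_zero hn2
      obtain ⟨z, hz⟩ := Int.dvd_of_emod_eq_zero hn3
      have : pairSum M l a.2 - M p a.1 = N * (z - x - y) := by linarith
      rw [this]
      exact Int.mul_emod_right _ _
    rw [hsum] at hnorm
    have hdone' : ∀ a ∈ (p, l) :: done, a.1 < r ∧ (∀ b ∈ a.2, b.2 < r) ∧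
        α.1 (weightClass C e M N [(1, a.1)]) = weightClass C e M N a.2 := by
      intro a ha
      rcases List.mem_cons.1 ha with rfl | ha
      · exact ⟨hp, hbx l hl, hlα.symm⟩
      · exact hdone a ha
    obtain ⟨s, hs, hsp⟩ := ih (fun q hq => hps q (List.mem_cons_of_mem _ hq)) hdone'
      (hext l hl hnorm hpair)
    refine ⟨s, hs, fun q hq => hsp q ?_⟩
    rcases hq with hq | ⟨a, ha, rfl⟩
    · rcases List.mem_cons.1 hq with rfl | hq
      · exact Or.inr ⟨_, List.mem_cons_self, rfl⟩
      · exact Or.inl hq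
    · exact Or.inr ⟨a, List.mem_cons_of_mem _ ha, rfl⟩

lemma weightClass_nil : weightClass C e M N [] = 0 := by
  have hnil : ∀ a ∈ ([] : List (ℕ × ℕ)), a.2 < r := by simp
  have := I.weightClass_append hnil hnil
  rw [List.append_nil] at this
  exact left_eq_add.1 this

lemma exists_mem_box (hC : C.IsSymm) {P : List (ℕ × ℕ)} (hP : ∀ a ∈ P, a.1 < r ∧ 0 < a.2)
    (hord : ∀ a ∈ P, Congruent M N r [(a.2, a.1)] [])
    (hcov : ∀ j < r, ∃ l ∈ box P, Congruent M N r [(1, j)] l)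
    (z : DiscGroup (negForm C) (intLattice ι)) : ∃ l ∈ box P, weightClass C e M N l = z := by
  have hP1 : ∀ a ∈ P, a.1 < r := fun a ha => (hP a ha).1
  refine I.exists_box hP (fun a ha => ?_) (I.span_weightClass hC hP1 hcov ▸ Submodule.mem_top)
  rw [← I.weightClass_single a.2 (hP1 a ha), I.weightClass_congr (by simpa using hP1 a ha)
    (by simp) (hord a ha), I.weightClass_nil]

lemma finite_discGroup (hC : C.IsSymm) {P : List (ℕ × ℕ)} (hP : ∀ a ∈ P, a.1 < r ∧ 0 < a.2)
    (hord : ∀ a ∈ P, Congruent M N r [(a.2, a.1)] [])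
    (hcov : ∀ j < r, ∃ l ∈ box P, Congruent M N r [(1, j)] l) :
    Finite (DiscGroup (negForm C) (intLattice ι)) := by
  have : Finite {l // l ∈ box P} := List.finite_toSet (box P)
  refine Finite.of_surjective (fun l : {l // l ∈ box P} => weightClass C e M N l.1) fun z => ?_
  obtain ⟨l, hl, h⟩ := I.exists_mem_box hC hP hord hcov z
  exact ⟨⟨l, hl⟩, h⟩

/-- If every isometry of the discriminant group is realized on generators by a permutation of the
simple roots, then the isometries of the root lattice induce all of them. -/
theorem surjective_of_extends (h : IsEvenLattice (negForm C) (intLattice ι)) (hC : C.IsSymm)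
    (hneg : ∀ x : ι → ℚ, x ≠ 0 → negForm C x x < 0) {adjs : List ℕ} (A : AdjCode C e adjs)
    {P : List (ℕ × ℕ)} (hP : ∀ a ∈ P, a.1 < r ∧ 0 < a.2)
    (hord : ∀ a ∈ P, Congruent M N r [(a.2, a.1)] [])
    (hcov : ∀ j < r, ∃ l ∈ box P, Congruent M N r [(1, j)] l) {syms : List (List (ℕ × ℕ))}
    (hsyms : ∀ s ∈ syms, IsSymmetry r adjs [] s)
    (hext : Extends M N r (box P) syms (P.map Prod.fst) []) : Function.Surjective (discHom h) := by
  intro α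
  have hP1 : ∀ a ∈ P, a.1 < r := fun a ha => (hP a ha).1
  have hspan := I.span_weightClass hC hP1 hcov
  obtain ⟨s, hs, hsP⟩ := I.exists_of_extends h hC (fun l hl => lt_of_mem_box hP1 hl)
    (I.exists_mem_box hC hP hord hcov) (fun s hs => (hsyms s hs).1) α
    (by simpa using fun p m hp => hP1 (p, m) hp) (by simp) hext
  obtain ⟨σ, hσ, -⟩ := exists_perm_of_moveIndex e (hsyms s hs).1
  obtain ⟨g, hg⟩ := exists_isometry_intLattice (A.comp_of_moveMask hσ (hsyms s hs).2.1)
  -- Two automorphisms of D(K) that agree on the generating weights are equal.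
  refine ⟨g, Subtype.ext (LinearEquiv.toLinearMap_injective (LinearMap.ext_on hspan ?_))⟩
  rintro _ ⟨a, ha, rfl⟩
  change discEquiv g _ = α.1 _
  rw [hsP a.1 (Or.inl (List.mem_map_of_mem ha))]
  obtain ⟨q, hq⟩ := e.surjective ⟨a.1, hP1 a ha⟩
  have hq' : (e q : ℕ) = a.1 := by rw [hq]
  rw [← hq', ← hσ, weightClass_eq (I.weightSum_mem (by simp)),
    weightClass_eq (I.weightSum_mem (l := [(1, (e (σ q) : ℕ))]) (by simp)), discEquiv_mk]
  congr 1
  refine Subtype.ext ?_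
  rw [coe_dualEquiv]
  simpa [weightSum] using map_weightVec hneg I hg q

end InvCode
end Weights

/-! ### Certificates for root lattices without glue -/

section WeightCertificate

open InvCode

/-- The root lattices for which weights are used. -/
def RootType.isSmall : RootType → Bool
  | .A n => memNat n [1, 2, 3, 4, 5, 6, 7]
  | .D n => memNat n [4, 5, 7]
  | .E6 => true
  | .E7 => false
  | .E8 => true

set_option maxRecDepth 100000 in
lemma RootType.isCorrect_A {n : ℕ} (h : n ∈ [1, 2, 3, 4, 5, 6, 7]) : (A n).IsCorrect := by
  fin_cases h <;> (constructor; all_goals decide +kernel)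

set_option maxRecDepth 100000 in
lemma RootType.isCorrect_D {n : ℕ} (h : n ∈ [4, 5, 7]) : (D n).IsCorrect := by
  fin_cases h <;> (constructor; all_goals decide +kernel)

set_option maxRecDepth 100000 in
lemma RootType.isCorrect_of_isSmall {t : RootType} (h : t.isSmall = true) : t.IsCorrect := by
  cases t with
  | A n => exact isCorrect_A (memNat_iff.1 h)
  | D n => exact isCorrect_D (memNat_iff.1 h)
  | E6 =>
    constructor
    all_goals decide +kernel
  | E7 => exact absurd h (by decide)
  | E8 => exact (isTwoElementary_of_isListed rfl).toIsCorrect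

/-- The entries of the inverse of the Cartan matrix of `L`, multiplied by `N`. -/
def weightMatrix (L : List RootType) (N : ℕ) (i j : ℕ) : ℤ :=
  (((blocks L 0).flatMap fun p => (List.range p.1.rank).map fun i => List.replicate p.2 (0 : ℤ) ++
    (List.range p.1.rank).map fun j => p.1.inv i j * ((N : ℤ) / p.1.den)).getD i []).getD j 0

/-- The entries of the Cartan matrix in terms of adjacency masks. -/
def gramEntry (adjs : List ℕ) (i j : ℕ) : ℤ :=
  if i = j then 2 else if (adjs.getD i 0).testBit j then -1 else 0

/-- The matrix `M` is `N` times the inverse of the Cartan matrix. -/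
def InverseValid (M : ℕ → ℕ → ℤ) (N r : ℕ) (adjs : List ℕ) : Prop :=
  0 < N ∧ ∀ i < r, ∀ j < r, M i j = M j i ∧
    ((List.range r).map fun k => M i k * gramEntry adjs k j).sum = if i = j then (N : ℤ) else 0

instance (M : ℕ → ℕ → ℤ) (N r : ℕ) (adjs : List ℕ) : Decidable (InverseValid M N r adjs) := by
  unfold InverseValid
  infer_instance

/-- Translates the identity checked on positions into one on simple roots, since the Gram matrix is
determined by adjacency. -/
lemma InverseValid.invCode {M : ℕ → ℕ → ℤ} {N : ℕ} {L : List RootType}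
    (h : InverseValid M N (rankSum L) (adjMasks L))
    (A : AdjCode (cartanSum L) (flatEquiv L) (adjMasks L)) :
    InvCode (cartanSum L) (flatEquiv L) M N where
  pos := h.1
  symm p q := (h.2 _ (flatEquiv L p).2 _ (flatEquiv L q).2).1
  mul p q := by
    have h1 := (h.2 _ (flatEquiv L p).2 _ (flatEquiv L q).2).2
    have h2 : ∀ k, cartanSum L k q = gramEntry (adjMasks L) (flatEquiv L k) (flatEquiv L q) := by
      intro k
      rw [gramEntry]
      by_cases hk : k = q
      · rw [hk, A.diag, if_pos rfl]
      · rw [A.off_diag k q hk, if_neg fun hkq => hk ((flatEquiv L).injective (Fin.ext hkq))]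
    have h3 : ((flatEquiv L p : ℕ) = flatEquiv L q) ↔ p = q := by
      rw [← Fin.ext_iff, (flatEquiv L).injective.eq_iff]
    simp only [h2]
    rw [(flatEquiv L).sum_comp fun k : Fin (rankSum L) =>
      M (flatEquiv L p) k * gramEntry (adjMasks L) k (flatEquiv L q)]
    simp only [h3] at h1
    rw [← h1, ← List.sum_ofFn]
    congr 1
    exact List.ext_getElem (by simp) fun i _ _ => by simp

/-- A multiple of the exponent of the discriminant group, weights that generate it with their
orders, and symmetries of the Dynkin diagram. -/
structure WeightCert where
  exponent : ℕ
  weights : List (ℕ × ℕ)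
  symmetries : List (List (ℕ × ℕ))

/-- The conditions on generators `P` of the discriminant group and symmetries. -/
def WeightsValid (M : ℕ → ℕ → ℤ) (N r : ℕ) (P : List (ℕ × ℕ)) (syms : List (List (ℕ × ℕ))) :
    Prop :=
  (∀ a ∈ P, a.1 < r ∧ 0 < a.2) ∧ (∀ a ∈ P, Congruent M N r [(a.2, a.1)] []) ∧
  (∀ j < r, ∃ l ∈ box P, Congruent M N r [(1, j)] l) ∧
  Extends M N r (box P) syms (P.map Prod.fst) []

instance (M : ℕ → ℕ → ℤ) (N r : ℕ) (P : List (ℕ × ℕ)) (syms : List (List (ℕ × ℕ))) :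
    Decidable (WeightsValid M N r P syms) := by
  unfold WeightsValid
  infer_instance

/-- The certificate proves the claims on the frame. -/
def WeightCert.Valid (F : Frame) (c : WeightCert) : Prop :=
  F.glue = [] ∧ F.ratio = 1 ∧ (∀ t ∈ F.roots, t.isSmall = true) ∧
  InverseValid (weightMatrix F.roots c.exponent) c.exponent (rankSum F.roots) (adjMasks F.roots) ∧
  GensValid (rankSum F.roots) (adjMasks F.roots) [] c.symmetries ∧
  WeightsValid (weightMatrix F.roots c.exponent) c.exponent (rankSum F.roots) c.weights c.symmetries

instance (F : Frame) (c : WeightCert) : Decidable (c.Valid F) := by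
  unfold WeightCert.Valid
  infer_instance

section RootLattice

variable {ι : Type*} [Fintype ι] [DecidableEq ι] {C : Matrix ι ι ℤ}

lemma isEvenLattice_intLattice (hC : C.IsSymm) (hneg : ∀ x : ι → ℚ, x ≠ 0 → negForm C x x < 0)
    (hdiag : ∀ p, C p p = 2) : IsEvenLattice (negForm C) (intLattice ι) := by
  refine isEvenLattice_of_span hC hneg le_rfl (Set.finite_range _) rfl ?_ ?_
  · rintro _ ⟨p, rfl⟩ _ ⟨q, rfl⟩
    exact ⟨-C p q, by rw [negForm_single_single]; push_cast; rfl⟩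
  · rintro _ ⟨p, rfl⟩
    exact ⟨-1, by rw [negForm_single_single, hdiag]; norm_num⟩

lemma rootSublattice_intLattice (hdiag : ∀ p, C p p = 2) :
    rootSublattice (negForm C) (intLattice ι) = intLattice ι := by
  refine le_antisymm (Submodule.span_le.2 fun x hx => hx.1) (Submodule.span_le.2 ?_)
  rintro _ ⟨p, rfl⟩
  refine Submodule.subset_span ⟨single_mem_intLattice p, ?_⟩
  rw [negForm_single_single, hdiag]
  norm_num

end RootLattice

/-- Surjectivity is proved directly, so |O(q_K)| need not be computed. The quotient by the root
lattice is trivial, as there is no glue. -/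
theorem WeightCert.Valid.holds {F : Frame} {c : WeightCert} (hc : c.Valid F) : F.Holds := by
  obtain ⟨hG, hratio, hL, hinv, hsyms, hP, hord, hcov, hext⟩ := hc
  have hL' : ∀ t ∈ F.roots, t.IsCorrect := fun t ht => RootType.isCorrect_of_isSmall (hL t ht)
  have A := adjCode hL'
  have I := hinv.invCode A
  have hC : (cartanSum F.roots).IsSymm :=
    blockDiagonal_isSymm fun i => (hL' _ (F.roots.get_mem i)).isSymm
  have hneg : ∀ x : Nodes F.roots → ℚ, x ≠ 0 → negForm (cartanSum F.roots) x x < 0 :=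
    negForm_blockDiagonal_neg fun i => (hL' _ (F.roots.get_mem i)).neg
  have h := isEvenLattice_intLattice hC hneg A.diag
  have := I.finite_discGroup hC hP hord hcov
  have : Finite (DiscGroup (negForm (cartanSum F.roots)) (intLattice (Nodes F.roots)) ≃ₗ[ℤ]
      DiscGroup (negForm (cartanSum F.roots)) (intLattice (Nodes F.roots))) := DFunLike.finite _
  have hs := I.surjective_of_extends h hC hneg A hP hord hcov
    (fun s hs => ⟨(hsyms s hs).1, (hsyms s hs).2.1, by simp⟩) hext
  have hcons := consequences_of_card h (ratio := F.ratio) (by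
    rw [hratio, mul_one, MonoidHom.range_eq_top.2 hs]
    exact Nat.card_congr Subgroup.topEquiv.toEquiv)
  have hlat : F.lattice = intLattice (Nodes F.roots) := by
    rw [Frame.lattice, hG]
    simp only [List.not_mem_nil, false_and, exists_false, Set.ofPred_false, Submodule.span_empty,
      sup_bot_eq]
    rfl
  have hfin : Finite (discO h) := inferInstance
  rw [Frame.Holds, Frame.IsFrame, hlat, hG]
  refine ⟨⟨hneg, rootSublattice_intLattice A.diag, ?_⟩, h, hfin, hcons⟩
  have : Subsingleton (↥(intLattice (Nodes F.roots)) ⧸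
      F.rootLattice.submoduleOf (intLattice (Nodes F.roots))) :=
    Submodule.Quotient.subsingleton_iff.2 (eq_top_iff.2 fun x _ => x.2)
  have : IsEmpty (Fin ([] : List (List ℕ)).length) := inferInstanceAs (IsEmpty (Fin 0))
  exact ⟨⟨⟨fun _ => 0, fun _ => 0, fun _ => Subsingleton.elim _ _, fun _ => Subsingleton.elim _ _⟩,
    fun _ _ => Subsingleton.elim _ _⟩⟩

end WeightCertificate

/-! ### Verification of the certificates and conclusion -/

/-- One of the two kinds of certificates proves the claims on the frame. -/
def CertValid (F : Frame) : FrameCert ⊕ WeightCert → Prop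
  | .inl c => c.Valid F
  | .inr c => c.Valid F

instance (F : Frame) : DecidablePred (CertValid F)
  | .inl c => inferInstanceAs (Decidable (c.Valid F))
  | .inr c => inferInstanceAs (Decidable (c.Valid F))

instance decidableForallCertValid :
    ∀ Fs cs, Decidable (List.Forall₂ CertValid Fs cs)
  | [], [] => isTrue .nil
  | [], _ :: _ => isFalse fun h => by cases h
  | _ :: _, [] => isFalse fun h => by cases h
  | F :: Fs, c :: cs =>
    have := decidableForallCertValid Fs cs
    decidable_of_iff (CertValid F c ∧ List.Forall₂ CertValid Fs cs) List.forall₂_cons.symm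

lemma holds_of_certs {Fs : List Frame} {cs : List (FrameCert ⊕ WeightCert)}
    (h : List.Forall₂ CertValid Fs cs) : ∀ F ∈ Fs, F.Holds := by
  induction h with
  | nil => simp
  | @cons F c Fs cs hc _ ih =>
    refine List.forall_mem_cons.2 ⟨?_, ih⟩
    cases c with
    | inl c => exact FrameCert.Valid.holds hc
    | inr c => exact WeightCert.Valid.holds hc

/-- Certificates for `framesFiniteSmall`. -/
def certsFiniteSmall : List (FrameCert ⊕ WeightCert) := [
  .inl ⟨[1], [], [1], [], false, false⟩,
  .inl ⟨[1, 2], [[(0, 1)]], [1, 2], [], false, false⟩,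
  .inr ⟨3, [(0, 3)], [[], [(0, 1)]]⟩,
  .inl ⟨[1, 2, 4], [[(1, 2)], [(0, 1)]], [1, 2, 4], [], false, false⟩,
  .inr ⟨4, [(0, 4)], [[], [(0, 2)]]⟩,
  .inr ⟨6, [(0, 2), (1, 3)], [[], [(1, 2)]]⟩,
  .inl ⟨[5, 9], [[(0, 2)], [(2, 3)]], [21, 25, 28], [], true, false⟩,
  .inl ⟨[1, 2, 4, 8], [[(2, 3)], [(1, 2)], [(0, 1)]], [1, 2, 4, 8], [], false, false⟩,
  .inr ⟨5, [(0, 5)], [[], [(0, 3), (1, 2)]]⟩,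
  .inr ⟨4, [(0, 2), (1, 4)], [[], [(1, 3)]]⟩,
  .inr ⟨3, [(0, 3), (2, 3)], [[], [(2, 3)], [(0, 1)], [(0, 1), (2, 3)], [(0, 2), (1, 3)], [(0, 2),
    (1, 3), (0, 1)], [(0, 3), (1, 2), (1, 0)], [(0, 3), (1, 2)]]⟩,
  .inr ⟨6, [(0, 2), (1, 2), (2, 3)], [[], [(2, 3)], [(0, 1)], [(0, 1), (2, 3)]]⟩,
  .inl ⟨[1, 10, 18], [[(1, 3)], [(3, 4)]], [11, 19, 25], [], false, false⟩,
  .inl ⟨[1, 2, 4, 8, 16], [[(3, 4)], [(2, 3)], [(1, 2)], [(0, 1)]], [1, 2, 4, 8, 16], [], false,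
    false⟩,
  .inr ⟨4, [(4, 4)], [[], [(3, 4)]]⟩,
  .inr ⟨6, [(0, 6)], [[], [(0, 4), (1, 3)]]⟩,
  .inr ⟨10, [(0, 2), (1, 5)], [[], [(1, 4), (2, 3)]]⟩,
  .inr ⟨12, [(0, 3), (2, 4)], [[], [(2, 4)], [(0, 1)], [(0, 1), (2, 4)]]⟩,
  .inr ⟨4, [(0, 2), (1, 2), (2, 4)], [[], [(2, 4)], [(0, 1)], [(0, 1), (2, 4)]]⟩,
  .inr ⟨6, [(0, 2), (1, 3), (3, 3)], [[], [(3, 4)], [(1, 2)], [(1, 2), (3, 4)], [(1, 3), (2, 4)],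
    [(1, 3), (2, 4), (1, 2)], [(1, 4), (2, 3), (2, 1)], [(1, 4), (2, 3)]]⟩,
  .inl ⟨[48, 21], [[(4, 5)]], [21, 37], [], false, false⟩,
  .inl ⟨[1, 2, 20, 36], [[(2, 4)], [(4, 5)], [(0, 1)]], [1, 22, 38, 50], [], false, false⟩,
  .inl ⟨[1, 2, 4, 8, 16, 32], [[(4, 5)], [(3, 4)], [(2, 3)], [(1, 2)], [(0, 1)]], [1, 2, 4, 8, 16,
    32], [], false, false⟩,
  .inr ⟨3, [(0, 3)], [[], [(0, 5), (2, 4)]]⟩,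
  .inr ⟨4, [(0, 2), (5, 4)], [[], [(4, 5)]]⟩,
  .inr ⟨6, [(0, 3), (4, 2), (5, 2)], [[], [(4, 5)], [(2, 4)], [(2, 4), (2, 5)], [(2, 5), (4, 2)],
    [(2, 5)], [(0, 1)], [(0, 1), (4, 5)], [(0, 1), (2, 4)], [(0, 1), (2, 4), (2, 5)], [(0, 1), (2,
    5), (4, 2)], [(0, 1), (2, 5)]]⟩,
  .inr ⟨7, [(0, 7)], [[], [(0, 5), (1, 4), (2, 3)]]⟩,
  .inr ⟨6, [(0, 2), (1, 6)], [[], [(1, 5), (2, 4)]]⟩,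
  .inr ⟨15, [(0, 3), (2, 5)], [[], [(2, 5), (3, 4)], [(0, 1)], [(0, 1), (2, 5), (3, 4)]]⟩,
  .inr ⟨4, [(0, 4), (3, 4)], [[], [(3, 5)], [(0, 2)], [(0, 2), (3, 5)], [(0, 3), (1, 4), (2, 5)],
    [(0, 3), (1, 4), (2, 5), (0, 2)], [(0, 5), (1, 4), (2, 3), (2, 0)], [(0, 5), (1, 4), (2, 3)]]⟩,
  .inr ⟨3, [(0, 3), (2, 3), (4, 3)], [[], [(4, 5)], [(2, 3)], [(2, 3), (4, 5)], [(0, 1)], [(0, 1),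
    (4, 5)], [(0, 1), (2, 3)], [(0, 1), (2, 3), (4, 5)], [(2, 4), (3, 5)], [(2, 4), (3, 5), (2,
    3)], [(2, 5), (3, 4), (3, 2)], [(2, 5), (3, 4)], [(0, 1), (2, 4), (3, 5)], [(0, 1), (2, 4),
    (3, 5), (2, 3)], [(0, 1), (2, 5), (3, 4), (3, 2)], [(0, 1), (2, 5), (3, 4)], [(0, 2), (1, 3)],
    [(0, 2), (1, 3), (4, 5)], [(0, 2), (1, 3), (0, 1)], [(0, 2), (1, 3), (0, 1), (4, 5)], [(0, 3),
    (1, 2), (1, 0)], [(0, 3), (1, 2), (1, 0), (4, 5)], [(0, 3), (1, 2)], [(0, 3), (1, 2), (4, 5)],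
    [(0, 2), (1, 3), (0, 4), (1, 5)], [(0, 2), (1, 3), (0, 4), (1, 5), (0, 1)], [(0, 2), (1, 3),
    (0, 5), (1, 4), (1, 0)], [(0, 2), (1, 3), (0, 5), (1, 4)], [(0, 3), (1, 2), (1, 4), (0, 5),
    (1, 0)], [(0, 3), (1, 2), (1, 4), (0, 5)], [(0, 3), (1, 2), (1, 5), (0, 4)], [(0, 3), (1, 2),
    (1, 5), (0, 4), (0, 1)], [(0, 4), (1, 5), (2, 0), (3, 1)], [(0, 4), (1, 5), (2, 0), (3, 1),
    (2, 3)], [(0, 4), (1, 5), (2, 1), (3, 0), (3, 2)], [(0, 4), (1, 5), (2, 1), (3, 0)], [(0, 5),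
    (1, 4), (2, 0), (3, 1), (3, 2)], [(0, 5), (1, 4), (2, 0), (3, 1)], [(0, 5), (1, 4), (2, 1),
    (3, 0)], [(0, 5), (1, 4), (2, 1), (3, 0), (2, 3)], [(0, 4), (1, 5)], [(0, 4), (1, 5), (0, 1)],
    [(0, 4), (1, 5), (2, 3)], [(0, 4), (1, 5), (2, 3), (0, 1)], [(0, 5), (1, 4), (1, 0)], [(0, 5),
    (1, 4)], [(0, 5), (1, 4), (2, 3), (1, 0)], [(0, 5), (1, 4), (2, 3)]]⟩,
  .inl ⟨[82], [], [82], [], false, false⟩,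
  .inl ⟨[1, 96, 42], [[(5, 6)]], [1, 42, 74], [], false, false⟩,
  .inl ⟨[1, 2, 4, 40, 72], [[(3, 5)], [(5, 6)], [(1, 2)], [(0, 1)]], [1, 2, 44, 76, 100], [],
    false, false⟩,
  .inl ⟨[1, 2, 4, 8, 16, 32, 64], [[(5, 6)], [(4, 5)], [(3, 4)], [(2, 3)], [(1, 2)], [(0, 1)]],
    [1, 2, 4, 8, 16, 32, 64], [], false, false⟩,
  .inr ⟨6, [(0, 2), (1, 3)], [[], [(1, 6), (3, 5)]]⟩,
  .inr ⟨4, [(6, 4)], [[], [(5, 6)]]⟩,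
  .inr ⟨12, [(0, 3), (6, 4)], [[], [(5, 6)], [(0, 1)], [(0, 1), (5, 6)]]⟩,
  .inr ⟨4, [(0, 4), (5, 2), (6, 2)], [[], [(5, 6)], [(3, 5)], [(3, 5), (3, 6)], [(3, 6), (5, 3)],
    [(3, 6)], [(0, 2)], [(0, 2), (5, 6)], [(0, 2), (3, 5)], [(0, 2), (3, 5), (3, 6)], [(0, 2), (3,
    6), (5, 3)], [(0, 2), (3, 6)]]⟩,
  .inr ⟨8, [(0, 8)], [[], [(0, 6), (1, 5), (2, 4)]]⟩,
  .inl ⟨[], [], [256], [], true, false⟩,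
  .inl ⟨[192, 85], [[(6, 7)]], [448, 341, 405], [], true, false⟩,
  .inl ⟨[1, 164], [], [1, 164], [], false, false⟩,
  .inl ⟨[5, 9, 80, 144], [[(4, 6)], [(6, 7)], [(0, 2)], [(0, 4), (1, 5), (2, 6), (3, 7)]], [261,
    265, 348, 412, 460], [], true, false⟩,
  .inl ⟨[1, 2, 192, 84], [[(6, 7)], [(0, 1)]], [1, 2, 84, 148], [], false, false⟩,
  .inl ⟨[40, 18, 17, 48, 65, 63], [[(2, 7)], [(2, 6)], [(3, 5)], [(0, 2)], [(1, 4)], [(0, 1)],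
    [(0, 3)]], [259, 261, 265, 273, 289, 321, 382], [1], true, false⟩,
  .inl ⟨[1, 2, 4, 8, 80, 144], [[(4, 6)], [(6, 7)], [(2, 3)], [(1, 2)], [(0, 1)]], [1, 2, 4, 88,
    152, 200], [], false, false⟩,
  .inl ⟨[1, 2, 4, 8, 16, 32, 64, 128], [[(6, 7)], [(5, 6)], [(4, 5)], [(3, 4)], [(2, 3)], [(1,
    2)], [(0, 1)]], [1, 2, 4, 8, 16, 32, 64, 128], [], false, false⟩,
  .inr ⟨3, [(0, 3), (2, 3)], [[], [(2, 7), (4, 6)], [(0, 1)], [(0, 1), (2, 7), (4, 6)]]⟩]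

set_option maxRecDepth 100000 in
set_option maxHeartbeats 4000000 in
lemma holds_of_mem_framesFiniteSmall : ∀ F ∈ framesFiniteSmall, F.Holds :=
  holds_of_certs (cs := certsFiniteSmall) (by decide +kernel)

/-- Certificates for `framesFiniteLarge`. -/
def certsFiniteLarge : List (FrameCert ⊕ WeightCert) := [
  .inl ⟨[1], [], [1], [], false, false⟩,
  .inl ⟨[1, 2, 328], [[(0, 1)]], [1, 2, 328], [], false, false⟩,
  .inl ⟨[1, 384, 170], [[(7, 8)]], [385, 171, 299], [], false, false⟩,
  .inl ⟨[1, 2, 4, 384, 168], [[(7, 8)], [(1, 2)], [(0, 1)]], [1, 2, 4, 168, 296], [], false,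
    false⟩,
  .inl ⟨[1, 10, 18, 160, 288], [[(5, 7)], [(7, 8)], [(1, 3)], [(1, 5), (2, 6), (3, 7), (4, 8)]],
    [11, 19, 185, 313, 409], [], false, false⟩,
  .inl ⟨[1, 2, 4, 8, 16, 160, 288], [[(5, 7)], [(7, 8)], [(3, 4)], [(2, 3)], [(1, 2)], [(0, 1)]],
    [1, 2, 4, 8, 176, 304, 400], [], false, false⟩,
  .inl ⟨[256, 48, 9, 36, 80, 65, 95], [[(1, 7)], [(0, 3)], [(1, 6)], [(1, 2)], [(4, 5)], [(0, 1)],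
    [(0, 4)]], [259, 261, 265, 273, 289, 321, 382], [1], false, false⟩,
  .inl ⟨[1, 2], [[(0, 1)]], [1, 2], [], false, false⟩,
  .inl ⟨[768, 341], [[(8, 9)]], [341, 597], [], false, false⟩,
  .inl ⟨[1, 2, 4, 656], [[(1, 2)], [(0, 1)]], [1, 2, 4, 656], [], false, false⟩,
  .inl ⟨[1, 2, 768, 340], [[(8, 9)], [(0, 1)]], [1, 770, 342, 598], [], false, false⟩,
  .inl ⟨[5, 9, 768, 336], [[(8, 9)], [(0, 2)], [(2, 3)]], [336, 597, 601, 604], [], false, false⟩,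
  .inl ⟨[1, 2, 4, 8, 768, 336], [[(8, 9)], [(2, 3)], [(1, 2)], [(0, 1)]], [1, 2, 4, 8, 336, 592],
    [], false, false⟩,
  .inl ⟨[1, 2, 20, 36, 320, 576], [[(6, 8)], [(8, 9)], [(2, 4)], [(2, 6), (3, 7), (4, 8), (5, 9)],
    [(0, 1)]], [1, 22, 38, 370, 626, 818], [], false, false⟩,
  .inl ⟨[63, 577, 578, 580, 584, 592], [[(4, 5)], [(3, 4)], [(2, 3)], [(1, 2)], [(0, 1)], [(6,
    8)]], [577, 578, 580, 584, 592, 608], [1], false, false⟩,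
  .inr ⟨6, [(0, 3)], [[], [(0, 1)]]⟩,
  .inl ⟨[1, 2, 4], [[(1, 2)], [(0, 1)]], [1, 2, 4], [], false, false⟩,
  .inl ⟨[5, 9, 1312], [[(0, 2)], [(2, 3)]], [1317, 1321, 1324], [], false, false⟩,
  .inl ⟨[1, 1536, 682], [[(9, 10)]], [1, 682, 1194], [], false, false⟩,
  .inl ⟨[1, 2, 4, 8, 1312], [[(2, 3)], [(1, 2)], [(0, 1)]], [1, 2, 4, 8, 1312], [], false, false⟩,
  .inl ⟨[1, 2, 4, 1536, 680], [[(9, 10)], [(1, 2)], [(0, 1)]], [1, 2, 1540, 684, 1196], [], false,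
    false⟩,
  .inl ⟨[1, 10, 18, 1536, 672], [[(9, 10)], [(1, 3)], [(3, 4)]], [1, 672, 1194, 1202, 1208], [],
    false, false⟩,
  .inl ⟨[672, 15, 23, 27, 29], [[(0, 1)], [(0, 2)], [(0, 3)], [(0, 4)]], [675, 677, 681, 689,
    702], [1], false, false⟩,
  .inr ⟨4, [(0, 4)], [[], [(0, 2)]]⟩,
  .inl ⟨[5, 9], [[(0, 2)], [(2, 3)]], [4101, 4105, 4108], [], true, false⟩,
  .inl ⟨[3072, 1365], [[(10, 11)]], [7168, 5461, 6485], [], true, false⟩,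
  .inl ⟨[5, 9, 3072, 1360], [[(10, 11)], [(0, 2)], [(2, 3)]], [4101, 4105, 7180, 5468, 6492], [],
    true, false⟩,
  .inl ⟨[15, 23, 27, 29], [[(0, 1)], [(0, 2)], [(0, 3)], [(0, 4)]], [4099, 4101, 4105, 4113,
    4126], [1], true, false⟩,
  .inl ⟨[1, 2, 4, 8], [[(2, 3)], [(1, 2)], [(0, 1)]], [1, 2, 4, 8], [], false, false⟩,
  .inl ⟨[1, 10, 18, 2624], [[(1, 3)], [(3, 4)]], [1, 2634, 2642, 2648], [], false, false⟩,
  .inl ⟨[1, 2, 3072, 1364], [[(10, 11)], [(0, 1)]], [1, 2, 1364, 2388], [], false, false⟩,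
  .inl ⟨[48, 3072, 21, 1344], [[(10, 11)], [(4, 5)], [(0, 6), (1, 7), (2, 8), (3, 9), (4, 10), (5,
    11)]], [21, 37, 1344, 2368], [], false, false⟩,
  .inl ⟨[3, 5, 2398, 15], [[(0, 1)], [(2, 3)], [(0, 2)]], [2385, 2386, 2388, 2392], [1], false,
    false⟩,
  .inl ⟨[1, 10, 18], [[(1, 3)], [(3, 4)]], [11, 19, 25], [], false, false⟩,
  .inl ⟨[48, 21, 5248], [[(4, 5)]], [21, 37, 5248], [], false, false⟩,
  .inl ⟨[1, 6144, 2730], [[(11, 12)]], [6145, 2731, 4779], [], false, false⟩,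
  .inl ⟨[3, 5, 2728], [[(0, 1)], [(0, 2)]], [2731, 2733, 2734], [1], false, false⟩,
  .inl ⟨[48, 21], [[(4, 5)]], [21, 37], [], false, false⟩,
  .inl ⟨[82, 10496], [[(0, 7), (1, 8), (2, 9), (3, 10), (4, 11), (5, 12), (6, 13)]], [82, 10496],
    [], false, false⟩,
  .inl ⟨[12288, 5461], [[(12, 13)]], [5461, 9557], [], false, false⟩,
  .inl ⟨[9558, 3], [[(0, 1)]], [9557, 9558], [1], false, false⟩,
  .inl ⟨[82], [], [82], [], false, false⟩,
  .inl ⟨[10922], [], [10922], [1], false, false⟩,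
  .inl ⟨[], [], [65536], [], true, false⟩,
  .inl ⟨[], [], [65536], [38229], true, false⟩,
  .inl ⟨[1], [], [1], [], false, false⟩,
  .inl ⟨[341], [], [341], [597], false, false⟩,
  .inl ⟨[1], [], [1], [76458], false, false⟩]

set_option maxRecDepth 100000 in
set_option maxHeartbeats 4000000 in
lemma holds_of_mem_framesFiniteLarge : ∀ F ∈ framesFiniteLarge, F.Holds :=
  holds_of_certs (cs := certsFiniteLarge) (by decide +kernel)

/-- Certificates for `framesInfiniteOne`. -/
def certsInfiniteOne : List (FrameCert ⊕ WeightCert) := [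
  .inl ⟨[1, 2, 4, 8, 16, 32, 64, 128, 256], [[(7, 8)], [(6, 7)], [(5, 6)], [(4, 5)], [(3, 4)],
    [(2, 3)], [(1, 2)], [(0, 1)]], [1, 2, 4, 8, 16, 32, 64, 128, 256], [], false, false⟩,
  .inl ⟨[1, 2, 4, 8, 16, 32, 320, 576], [[(6, 8)], [(8, 9)], [(4, 5)], [(3, 4)], [(2, 3)], [(1,
    2)], [(0, 1)]], [1, 2, 4, 8, 16, 352, 608, 800], [], false, false⟩,
  .inl ⟨[512, 256, 3, 34, 95, 6, 65, 9], [[(3, 4)], [(3, 6)], [(2, 3)], [(2, 7)], [(2, 5)], [(0,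
    1)], [(0, 2)], [(8, 9)]], [256, 515, 517, 521, 529, 545, 577, 638], [1], false, false⟩,
  .inl ⟨[1, 2, 4, 8, 16, 32, 64, 128, 256, 512], [[(8, 9)], [(7, 8)], [(6, 7)], [(5, 6)], [(4,
    5)], [(3, 4)], [(2, 3)], [(1, 2)], [(0, 1)]], [1, 2, 4, 8, 16, 32, 64, 128, 256, 512], [],
    false, false⟩,
  .inl ⟨[1, 2, 4, 8, 16, 1536, 672], [[(9, 10)], [(3, 4)], [(2, 3)], [(1, 2)], [(0, 1)]], [1, 2,
    4, 8, 16, 672, 1184], [], false, false⟩,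
  .inl ⟨[1, 2, 4, 40, 72, 640, 1152], [[(7, 9)], [(9, 10)], [(3, 5)], [(3, 7), (4, 8), (5, 9), (6,
    10)], [(1, 2)], [(0, 1)]], [1, 2, 44, 76, 740, 1252, 1636], [], false, false⟩,
  .inl ⟨[64, 63, 1153, 1154, 1156, 1160, 1168], [[(4, 5)], [(3, 4)], [(2, 3)], [(1, 2)], [(0, 1)],
    [(7, 9)]], [64, 1153, 1154, 1156, 1160, 1168, 1184], [1], false, false⟩,
  .inl ⟨[1, 2, 4, 8, 16, 32, 64, 640, 1152], [[(7, 9)], [(9, 10)], [(5, 6)], [(4, 5)], [(3, 4)],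
    [(2, 3)], [(1, 2)], [(0, 1)]], [1, 2, 4, 8, 16, 32, 704, 1216, 1600], [], false, false⟩,
  .inl ⟨[1024, 256, 512, 5, 123, 10, 12, 68, 33], [[(4, 5)], [(4, 6)], [(1, 3)], [(1, 4)], [(1,
    7)], [(0, 2)], [(0, 1)], [(8, 9)], [(8, 10)]], [256, 512, 1027, 1029, 1033, 1041, 1057, 1089,
    1150], [1], false, false⟩,
  .inl ⟨[5, 9, 80, 144, 1280, 2304], [[(8, 10)], [(10, 11)], [(4, 6)], [(4, 8), (5, 9), (6, 10),
    (7, 11)], [(0, 2)], [(0, 4), (1, 5), (2, 6), (3, 7)]], [4101, 4105, 4188, 4252, 5580, 6604,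
    7372], [], true, false⟩,
  .inl ⟨[63, 1345, 1346, 1348, 1352, 1360], [[(4, 5)], [(3, 4)], [(2, 3)], [(1, 2)], [(0, 1)],
    [(10, 11)]], [4099, 4101, 4105, 4113, 4129, 5441, 5502], [1], true, false⟩,
  .inl ⟨[1, 2, 20, 36, 3072, 1344], [[(10, 11)], [(2, 4)], [(4, 5)], [(0, 1)]], [1, 2, 1344, 2388,
    2404, 2416], [], false, false⟩,
  .inl ⟨[1, 2, 4, 8, 3072, 1360], [[(10, 11)], [(2, 3)], [(1, 2)], [(0, 1)]], [1, 2, 4, 3080,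
    1368, 2392], [], false, false⟩,
  .inl ⟨[1, 2, 4, 8, 16, 2624], [[(3, 4)], [(2, 3)], [(1, 2)], [(0, 1)]], [1, 2, 4, 8, 16, 2624],
    [], false, false⟩,
  .inl ⟨[32, 1344, 15, 23, 27, 29], [[(0, 1)], [(0, 2)], [(0, 3)], [(0, 4)]], [32, 1347, 1349,
    1353, 1361, 1374], [1], false, false⟩,
  .inl ⟨[3, 5, 80, 95, 145, 2305], [[(8, 10)], [(4, 6)], [(4, 8), (5, 9), (6, 10), (7, 11)], [(0,
    1)], [(2, 3)], [(0, 2)]], [145, 146, 148, 2312, 199, 2391], [1], false, false⟩,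
  .inl ⟨[1, 2, 4, 8, 80, 144, 1280, 2304], [[(8, 10)], [(10, 11)], [(4, 6)], [(4, 8), (5, 9), (6,
    10), (7, 11)], [(2, 3)], [(1, 2)], [(0, 1)]], [1, 2, 4, 88, 152, 1480, 2504, 3272], [], false,
    false⟩,
  .inl ⟨[1, 2, 4, 8, 16, 32, 3072, 1344], [[(10, 11)], [(4, 5)], [(3, 4)], [(2, 3)], [(1, 2)],
    [(0, 1)]], [1, 2, 4, 8, 16, 32, 1344, 2368], [], false, false⟩,
  .inl ⟨[192, 63, 64, 2305, 2306, 2308, 2312, 2320], [[(4, 5)], [(3, 4)], [(2, 3)], [(1, 2)], [(0,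
    1)], [(8, 10)], [(6, 7)]], [64, 128, 2305, 2306, 2308, 2312, 2320, 2336], [1], false, false⟩,
  .inl ⟨[15, 3, 5, 48, 80, 768, 1280, 273], [[(8, 9)], [(10, 11)], [(8, 10)], [(4, 5)], [(6, 7)],
    [(4, 8), (5, 11), (6, 9), (7, 10)], [(0, 1)], [(2, 3)], [(0, 5), (1, 4), (2, 7), (3, 6)]],
    [273, 274, 276, 552, 584, 1047, 1816, 631], [1, 16], false, false⟩,
  .inl ⟨[1, 2, 4, 8, 16], [[(3, 4)], [(2, 3)], [(1, 2)], [(0, 1)]], [1, 2, 4, 8, 16], [], false,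
    false⟩,
  .inl ⟨[1, 2, 20, 36, 5248], [[(2, 4)], [(4, 5)], [(0, 1)]], [1, 2, 5268, 5284, 5296], [], false,
    false⟩,
  .inl ⟨[1, 10, 18, 6144, 2720], [[(11, 12)], [(1, 3)], [(3, 4)]], [11, 19, 6169, 2745, 4793], [],
    false, false⟩,
  .inl ⟨[1, 96, 6144, 42, 2688], [[(11, 12)], [(5, 6)], [(1, 7), (2, 8), (3, 9), (4, 10), (5, 11),
    (6, 12)]], [1, 42, 74, 2688, 4736], [], false, false⟩,
  .inl ⟨[32, 15, 23, 27, 29], [[(0, 1)], [(0, 2)], [(0, 3)], [(0, 4)]], [35, 37, 41, 49, 62], [1],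
    false, false⟩,
  .inl ⟨[16, 3, 5, 4782, 15], [[(0, 1)], [(2, 3)], [(0, 2)]], [16, 4769, 4770, 4772, 4776], [1],
    false, false⟩,
  .inl ⟨[3, 5, 40, 73, 2688], [[(3, 5)], [(0, 1)], [(0, 2)]], [73, 74, 76, 2688, 103], [1], false,
    false⟩,
  .inl ⟨[1, 2, 4, 8, 16, 32, 5248], [[(4, 5)], [(3, 4)], [(2, 3)], [(1, 2)], [(0, 1)]], [1, 2, 4,
    8, 16, 32, 5248], [], false, false⟩,
  .inl ⟨[1, 2, 4, 8, 16, 6144, 2720], [[(11, 12)], [(3, 4)], [(2, 3)], [(1, 2)], [(0, 1)]], [1, 2,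
    4, 8, 6160, 2736, 4784], [], false, false⟩,
  .inl ⟨[1, 2, 4, 40, 72, 6144, 2688], [[(11, 12)], [(3, 5)], [(5, 6)], [(1, 2)], [(0, 1)]], [1,
    2, 4, 2688, 4776, 4808, 4832], [], false, false⟩,
  .inl ⟨[1, 10, 18, 160, 288, 2560, 4608], [[(9, 11)], [(11, 12)], [(5, 7)], [(5, 9), (6, 10), (7,
    11), (8, 12)], [(1, 3)], [(1, 5), (2, 6), (3, 7), (4, 8)]], [11, 19, 185, 313, 2969, 5017,
    6553], [], false, false⟩,
  .inl ⟨[96, 2688, 32, 15, 23, 27, 29], [[(0, 1)], [(0, 2)], [(0, 3)], [(0, 4)], [(5, 6)]], [32,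
    64, 2691, 2693, 2697, 2705, 2718], [1], false, false⟩,
  .inl ⟨[64, 63, 2689, 2690, 2692, 2696, 2704], [[(4, 5)], [(3, 4)], [(2, 3)], [(1, 2)], [(0, 1)],
    [(11, 12)]], [67, 69, 73, 81, 97, 2753, 2814], [1], false, false⟩,
  .inl ⟨[16, 3, 5, 160, 175, 289, 4609], [[(9, 11)], [(5, 7)], [(5, 9), (6, 10), (7, 11), (8,
    12)], [(0, 1)], [(2, 3)], [(0, 2)]], [16, 289, 290, 292, 4616, 391, 4775], [1], false, false⟩,
  .inl ⟨[3, 5, 24, 40, 192, 73, 505], [[(6, 7)], [(6, 8)], [(3, 4)], [(3, 7), (4, 8), (5, 6), (9,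
    12)], [(0, 1)], [(0, 4), (1, 3), (2, 5), (11, 12)]], [73, 74, 76, 87, 103, 191, 319], [1, 8],
    false, false⟩,
  .inl ⟨[1, 2, 20, 36], [[(2, 4)], [(4, 5)], [(0, 1)]], [1, 22, 38, 50], [], false, false⟩,
  .inl ⟨[1, 96, 42, 10496], [[(5, 6)]], [1, 42, 74, 10496], [], false, false⟩,
  .inl ⟨[1, 2, 12288, 5460], [[(12, 13)], [(0, 1)]], [1, 12290, 5462, 9558], [], false, false⟩,
  .inl ⟨[5, 9, 12288, 5456], [[(12, 13)], [(0, 2)], [(2, 3)]], [5456, 9557, 9561, 9564], [],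
    false, false⟩,
  .inl ⟨[48, 12288, 21, 5440], [[(12, 13)], [(4, 5)]], [21, 12325, 5477, 9573], [], false, false⟩,
  .inl ⟨[3, 5, 40, 73], [[(3, 5)], [(0, 1)], [(0, 2)]], [73, 74, 76, 103], [1], false, false⟩,
  .inl ⟨[8, 3, 5, 5456], [[(0, 1)], [(0, 2)]], [8, 5459, 5461, 5462], [1], false, false⟩,
  .inl ⟨[20, 37, 9558, 23], [[(2, 4)], [(0, 1)]], [37, 49, 9538, 9557], [1], false, false⟩,
  .inl ⟨[3, 84, 193, 5376], [[(0, 1)], [(2, 8), (3, 9), (4, 10), (5, 11), (6, 12), (7, 13)]], [84,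
    5379, 5525, 5526], [1], false, false⟩]

set_option maxRecDepth 100000 in
set_option maxHeartbeats 4000000 in
lemma holds_of_mem_framesInfiniteOne : ∀ F ∈ framesInfiniteOne, F.Holds :=
  holds_of_certs (cs := certsInfiniteOne) (by decide +kernel)

/-- Certificates for `framesInfiniteTwo`. -/
def certsInfiniteTwo : List (FrameCert ⊕ WeightCert) := [
  .inl ⟨[1, 2, 4, 8, 16, 32], [[(4, 5)], [(3, 4)], [(2, 3)], [(1, 2)], [(0, 1)]], [1, 2, 4, 8, 16,
    32], [], false, false⟩,
  .inl ⟨[1, 2, 4, 40, 72, 10496], [[(3, 5)], [(5, 6)], [(1, 2)], [(0, 1)]], [1, 2, 4, 10536,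
    10568, 10592], [], false, false⟩,
  .inl ⟨[1, 2, 4, 8, 12288, 5456], [[(12, 13)], [(2, 3)], [(1, 2)], [(0, 1)]], [1, 2, 4, 8, 5456,
    9552], [], false, false⟩,
  .inl ⟨[1, 2, 20, 36, 12288, 5440], [[(12, 13)], [(2, 4)], [(4, 5)], [(0, 1)]], [1, 22, 38,
    12338, 5490, 9586], [], false, false⟩,
  .inl ⟨[1, 2, 192, 12288, 84, 5376], [[(12, 13)], [(6, 7)], [(2, 8), (3, 9), (4, 10), (5, 11),
    (6, 12), (7, 13)], [(0, 1)]], [1, 2, 84, 148, 5376, 9472], [], false, false⟩,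
  .inl ⟨[5, 9, 80, 144, 12288, 5376], [[(12, 13)], [(4, 6)], [(6, 7)], [(0, 2)], [(0, 4), (1, 5),
    (2, 6), (3, 7)]], [5376, 9477, 9481, 9564, 9628, 9676], [], false, false⟩,
  .inl ⟨[96, 32, 15, 23, 27, 29], [[(0, 1)], [(0, 2)], [(0, 3)], [(0, 4)], [(5, 6)]], [32, 67, 69,
    73, 81, 94], [1], false, false⟩,
  .inl ⟨[16, 32, 3, 5, 9550, 15], [[(0, 1)], [(2, 3)], [(0, 2)], [(4, 5)]], [16, 32, 9537, 9538,
    9540, 9544], [1], false, false⟩,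
  .inl ⟨[63, 5441, 5442, 5444, 5448, 5456], [[(4, 5)], [(3, 4)], [(2, 3)], [(1, 2)], [(0, 1)],
    [(12, 13)]], [5441, 5442, 5444, 5448, 5456, 5472], [1], false, false⟩,
  .inl ⟨[8, 3, 5, 80, 145, 5376], [[(4, 6)], [(0, 1)], [(0, 2)]], [8, 145, 146, 148, 5376, 199],
    [1], false, false⟩,
  .inl ⟨[80, 15, 5520, 3, 5, 145], [[(0, 1)], [(2, 3)], [(0, 2)], [(4, 6)], [(12, 13)]], [145,
    146, 148, 152, 5520, 5583], [1], false, false⟩,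
  .inl ⟨[20, 320, 343, 37, 577, 9217], [[(10, 12)], [(6, 8)], [(2, 4)], [(0, 1)], [(6, 10), (7,
    11), (8, 12), (9, 13)], [(2, 6), (3, 7), (4, 8), (5, 9)]], [37, 49, 578, 770, 9237, 9538],
    [1], false, false⟩,
  .inl ⟨[3, 5, 24, 40, 73, 198], [[(6, 7)], [(3, 4)], [(3, 5)], [(0, 1)], [(0, 3), (1, 4), (2, 5),
    (12, 13)]], [73, 74, 76, 87, 103, 191], [1, 8], false, false⟩,
  .inl ⟨[3, 12, 21, 324, 577, 637], [[(6, 10), (7, 11), (8, 12), (9, 13)], [(0, 1)], [(2, 3)],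
    [(4, 5)], [(2, 4), (3, 5), (6, 9), (10, 13)], [(0, 2), (1, 3), (8, 9), (12, 13)]], [21, 22,
    328, 327, 796, 815], [1, 4], false, false⟩,
  .inl ⟨[1, 96, 42], [[(5, 6)]], [1, 42, 74], [], false, false⟩,
  .inl ⟨[1, 164, 20992], [[(1, 8), (2, 9), (3, 10), (4, 11), (5, 12), (6, 13), (7, 14)]], [1, 164,
    20992], [], false, false⟩,
  .inl ⟨[192, 20992, 85], [[(6, 7)]], [21184, 21077, 21141], [], false, false⟩,
  .inl ⟨[1, 24576, 10922], [[(13, 14)]], [1, 10922, 19114], [], false, false⟩,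
  .inl ⟨[4, 19114, 3], [[(0, 1)]], [4, 19113, 19114], [1], false, false⟩,
  .inl ⟨[10, 19, 10912], [[(1, 3)]], [19, 25, 10912], [1], false, false⟩,
  .inl ⟨[42, 19146, 75], [], [42, 19073, 19146], [1], false, false⟩,
  .inl ⟨[1, 2, 4, 40, 72], [[(3, 5)], [(5, 6)], [(1, 2)], [(0, 1)]], [1, 2, 44, 76, 100], [],
    false, false⟩,
  .inl ⟨[5, 9, 80, 144, 20992], [[(4, 6)], [(6, 7)], [(0, 2)], [(0, 4), (1, 5), (2, 6), (3, 7)]],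
    [20997, 21001, 21084, 21148, 21196], [], false, false⟩,
  .inl ⟨[1, 2, 4, 24576, 10920], [[(13, 14)], [(1, 2)], [(0, 1)]], [1, 2, 24580, 10924, 19116],
    [], false, false⟩,
  .inl ⟨[1, 10, 18, 24576, 10912], [[(13, 14)], [(1, 3)], [(3, 4)]], [1, 10912, 19114, 19122,
    19128], [], false, false⟩,
  .inl ⟨[1, 96, 24576, 42, 10880], [[(13, 14)], [(5, 6)]], [1, 42, 24650, 10954, 19146], [],
    false, false⟩,
  .inl ⟨[8, 3, 5, 80, 145], [[(4, 6)], [(0, 1)], [(0, 2)]], [8, 145, 146, 148, 199], [1], false,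
    false⟩,
  .inl ⟨[8, 16, 3, 5, 10912], [[(0, 1)], [(0, 2)], [(3, 4)]], [8, 16, 10915, 10917, 10918], [1],
    false, false⟩,
  .inl ⟨[4, 40, 73, 19114, 43], [[(3, 5)], [(0, 1)]], [4, 73, 97, 19074, 19113], [1], false,
    false⟩,
  .inl ⟨[4, 3, 168, 385, 10752], [[(0, 1)], [(3, 9), (4, 10), (5, 11), (6, 12), (7, 13), (8,
    14)]], [4, 168, 10755, 11049, 11050], [1], false, false⟩,
  .inl ⟨[3, 5, 168, 385, 10753], [[(13, 14)], [(0, 1)], [(0, 2)]], [385, 386, 388, 11136, 10927],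
    [1], false, false⟩,
  .inl ⟨[3, 5, 24, 40, 121], [[(3, 4)], [(3, 5)], [(0, 1)], [(0, 4), (1, 5), (2, 3), (13, 14)]],
    [73, 74, 76, 87, 103], [1, 8], false, false⟩,
  .inl ⟨[3, 12, 164, 289, 178], [[(0, 1)], [(2, 3)], [(0, 2), (1, 3), (7, 8), (13, 14)]], [21, 22,
    168, 167, 412], [1, 4], false, false⟩,
  .inl ⟨[42, 73, 642, 1153, 1231], [[(7, 11), (8, 12), (9, 13), (10, 14)], [(0, 2), (3, 5), (7,
    9), (11, 13)], [(0, 1), (3, 11), (4, 12), (5, 14), (6, 13), (9, 10)]], [42, 1153, 1250, 1577,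
    1639], [1, 2], false, true⟩,
  .inl ⟨[192, 85], [[(6, 7)]], [65728, 65621, 65685], [], true, false⟩,
  .inl ⟨[49152, 21845], [[(14, 15)]], [114688, 87381, 103765], [], true, false⟩,
  .inl ⟨[3, 329], [[(0, 1)]], [65539, 65865, 65866], [1], true, false⟩,
  .inl ⟨[5, 38233], [[(0, 2)]], [65541, 103769, 103772], [9], true, false⟩,
  .inl ⟨[85, 38336], [], [65621, 103872, 103829], [149], true, false⟩,
  .inl ⟨[1, 164], [], [1, 164], [], false, false⟩,
  .inl ⟨[385, 170], [], [385, 299], [1], false, false⟩,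
  .inl ⟨[2, 21844], [], [2, 21844], [1], false, false⟩,
  .inl ⟨[21, 21824], [], [21, 21824], [37], false, false⟩,
  .inl ⟨[5, 9, 80, 144], [[(4, 6)], [(6, 7)], [(0, 2)], [(0, 4), (1, 5), (2, 6), (3, 7)]], [65541,
    65545, 65628, 65692, 65740], [], true, false⟩,
  .inl ⟨[5, 9, 49152, 21840], [[(14, 15)], [(0, 2)], [(2, 3)]], [65541, 65545, 114700, 87388,
    103772], [], true, false⟩,
  .inl ⟨[192, 49152, 85, 21760], [[(14, 15)], [(6, 7)], [(0, 8), (1, 9), (2, 10), (3, 11), (4,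
    12), (5, 13), (6, 14), (7, 15)]], [65728, 65621, 114837, 87445, 103829], [], true, false⟩,
  .inl ⟨[5, 80, 153, 38153], [[(0, 2)], [(4, 6)], [(0, 4), (1, 5), (2, 6), (3, 7)]], [65541,
    65689, 65737, 103692, 103769], [9], true, false⟩,
  .inl ⟨[3, 5, 384, 169], [[(7, 8)], [(0, 1)], [(0, 2)]], [65539, 65541, 65705, 65833, 65926],
    [1], true, false⟩,
  .inl ⟨[3, 5, 24, 40], [[(3, 4)], [(3, 5)], [(0, 1)], [(0, 5), (1, 4), (2, 3), (14, 15)]],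
    [65539, 65541, 65566, 65582, 65590], [1, 8], true, false⟩,
  .inl ⟨[3, 12, 340, 593], [[(0, 1)], [(2, 3)], [(0, 3), (1, 2), (8, 9), (14, 15)]], [65539,
    66129, 66310, 66314, 66142], [1, 4], true, false⟩,
  .inl ⟨[85, 153, 1285, 2313], [[(0, 4), (1, 5), (2, 6), (3, 7)], [(0, 2), (4, 6), (8, 10), (12,
    14)], [(2, 3), (4, 12), (5, 13), (6, 15), (7, 14), (10, 11)]], [65621, 67849, 68800, 68037,
    68697], [9, 5], true, true⟩]

set_option maxRecDepth 100000 in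
set_option maxHeartbeats 4000000 in
lemma holds_of_mem_framesInfiniteTwo : ∀ F ∈ framesInfiniteTwo, F.Holds :=
  holds_of_certs (cs := certsInfiniteTwo) (by decide +kernel)

/-- Certificates for `framesInfiniteThree`. -/
def certsInfiniteThree : List (FrameCert ⊕ WeightCert) := [
  .inl ⟨[1, 2, 192, 84], [[(6, 7)], [(0, 1)]], [1, 2, 84, 148], [], false, false⟩,
  .inl ⟨[1, 2, 328, 41984], [[(2, 9), (3, 10), (4, 11), (5, 12), (6, 13), (7, 14), (8, 15)], [(0,
    1)]], [1, 2, 328, 41984], [], false, false⟩,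
  .inl ⟨[1, 384, 41984, 170], [[(7, 8)]], [1, 42368, 42154, 42282], [], false, false⟩,
  .inl ⟨[1, 2, 49152, 21844], [[(14, 15)], [(0, 1)]], [1, 2, 21844, 38228], [], false, false⟩,
  .inl ⟨[48, 49152, 21, 21824], [[(14, 15)], [(4, 5)]], [21, 37, 21824, 38208], [], false, false⟩,
  .inl ⟨[4, 3, 168, 385], [[(0, 1)]], [4, 385, 386, 171], [1], false, false⟩,
  .inl ⟨[10, 160, 19, 289], [[(5, 7)], [(1, 3)], [(1, 5), (2, 6), (3, 7), (4, 8)]], [19, 25, 299,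
    395], [1], false, false⟩,
  .inl ⟨[4, 8, 38226, 3], [[(0, 1)], [(2, 3)]], [4, 8, 38225, 38226], [1], false, false⟩,
  .inl ⟨[2, 20, 37, 21824], [[(2, 4)]], [2, 37, 49, 21824], [1], false, false⟩,
  .inl ⟨[2, 84, 38292, 149], [], [2, 84, 38145, 38292], [1], false, false⟩,
  .inl ⟨[3, 38338, 85, 195], [[(6, 7)], [(0, 1)]], [38145, 38146, 38228, 38292], [1], false,
    false⟩,
  .inl ⟨[5, 336, 21504, 777], [[(0, 2)], [(4, 10), (5, 11), (6, 12), (7, 13), (8, 14), (9, 15)]],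
    [336, 21504, 601, 604], [9], false, false⟩,
  .inl ⟨[3, 13, 593, 774], [[(2, 3), (4, 10), (5, 11), (6, 12), (7, 13), (8, 14), (9, 15)], [(0,
    1)]], [13, 14, 604, 779], [1, 4], false, false⟩,
  .inl ⟨[3, 84, 145, 157], [[(0, 1)], [(2, 3)], [(0, 3), (1, 2), (6, 7), (14, 15)]], [84, 88, 157,
    158], [1, 4], false, false⟩,
  .inl ⟨[22, 37, 577, 340], [[(2, 6), (3, 7), (4, 8), (5, 9)], [(0, 1), (4, 5), (8, 9), (14,
    15)]], [22, 577, 626, 789], [1, 2], false, false⟩,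
  .inl ⟨[1, 2, 328], [[(0, 1)]], [1, 2, 328], [], false, false⟩,
  .inl ⟨[1, 384, 170], [[(7, 8)]], [385, 171, 299], [], false, false⟩,
  .inl ⟨[768, 83968, 341], [[(8, 9)]], [83968, 341, 597], [], false, false⟩,
  .inl ⟨[1, 98304, 43690], [[(15, 16)]], [98305, 43691, 76459], [], false, false⟩,
  .inl ⟨[4, 3, 657], [[(0, 1)]], [7, 661, 662], [1], false, false⟩,
  .inl ⟨[2, 769, 340], [], [2, 769, 597], [1], false, false⟩,
  .inl ⟨[5, 336, 777], [[(0, 2)]], [336, 601, 604], [9], false, false⟩,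
  .inl ⟨[1, 10, 76466], [[(1, 3)]], [11, 76467, 76473], [18], false, false⟩,
  .inl ⟨[1, 42, 43648], [], [1, 42, 43648], [74], false, false⟩,
  .inl ⟨[96, 43, 43648], [[(5, 6)]], [43744, 43691, 43723], [1], false, false⟩,
  .inl ⟨[1, 170, 76672], [], [171, 76673, 76587], [298], false, false⟩,
  .inl ⟨[3, 297, 173], [[(0, 1)]], [388, 173, 174], [1, 168], false, false⟩,
  .inl ⟨[19, 1185, 1560], [[(1, 4), (5, 11), (6, 12), (7, 13), (8, 14), (9, 15), (10, 16)]], [19,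
    1202, 1547], [1, 10], false, false⟩,
  .inl ⟨[1, 2], [[(0, 1)]], [1, 2], [], false, false⟩,
  .inl ⟨[768, 341], [[(8, 9)]], [341, 597], [], false, false⟩,
  .inl ⟨[196608, 87381], [[(16, 17)]], [87381, 152917], [], false, false⟩,
  .inl ⟨[5, 1321], [[(0, 2)]], [1321, 1324], [9], false, false⟩,
  .inl ⟨[1, 682], [], [1, 682], [1194], false, false⟩,
  .inl ⟨[1, 2], [[(0, 1)]], [1, 2], [152916], false, false⟩,
  .inl ⟨[152933, 48], [[(4, 5)]], [152917, 152933], [21], false, false⟩,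
  .inl ⟨[3, 597], [[(0, 1)]], [597, 598], [1, 340], false, false⟩,
  .inl ⟨[1392, 3109], [[(0, 6), (1, 7), (2, 8), (3, 9), (4, 11), (5, 10), (16, 17)]], [1392,
    3109], [21, 1344], false, false⟩]

set_option maxRecDepth 100000 in
set_option maxHeartbeats 4000000 in
lemma holds_of_mem_framesInfiniteThree : ∀ F ∈ framesInfiniteThree, F.Holds :=
  holds_of_certs (cs := certsInfiniteThree) (by decide +kernel)

lemma holds_of_mem_frames {F : Frame} (hF : F ∈ frames) : F.Holds := by
  simp only [frames, List.mem_append] at hF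
  rcases hF with (((hF | hF) | hF) | hF) | hF
  · exact holds_of_mem_framesFiniteSmall F hF
  · exact holds_of_mem_framesFiniteLarge F hF
  · exact holds_of_mem_framesInfiniteOne F hF
  · exact holds_of_mem_framesInfiniteTwo F hF
  · exact holds_of_mem_framesInfiniteThree F hF

end K3Frames

theorem theorem5p1 :
    ∀ F ∈ K3Frames.frames,
      F.IsFrame ∧
      ∃ h : K3Frames.IsEvenLattice F.form F.lattice,
        Finite (K3Frames.discO h) ∧
        (Nat.card (K3Frames.discO h) : ℚ) / Nat.card (K3Frames.discHom h).range = F.ratio ∧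
        (F.ratio = 1 →
          Function.Surjective (K3Frames.discHom h) ∧
          (∀ C : Subgroup (K3Frames.discO h),
            Nat.card (DoubleCoset.Quotient (C : Set (K3Frames.discO h))
              ((K3Frames.discHom h).range : Set (K3Frames.discO h))) = 1) ∧
          K3Frames.UniqueHEmbedding F.form F.lattice) :=
  fun _ hF => K3Frames.holds_of_mem_frames hF
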